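/- **Setting.** A theory is given by a set of half-edge labels with an involution $f\mapsto\bar f$ (internal edges join a half-edge labelled $f$ to one labelled $\bar f$), a finite set of vertex types (multisets of at least three labels), and a finite set $\mathcal R$ of amplitudes needing renormalization, each of which is a vertex type or a propagator $\{f,\bar f\}$. Let $H$ be the free commutative $\mathbb Q$-algebra on isomorphism classes of one-particle irreducible (1PI) Feynman graphs $\Gamma$ of the theory with at least one loop and with residue $\mathbf{res}(\Gamma)$ (the multiset of labels of the external legs) in $\mathcal R$. Its coproduct is the algebra map with $$\Delta(\Gamma)=\sum_{\gamma\subseteq\Gamma}\gamma\otimes\Gamma/\gamma ,$$ the sum over all subgraphs $\gamma$ (including $\emptyset$ and $\Gamma$) that are disjoint unions of 1PI graphs with residues in $\mathcal R$; in $\Gamma/\gamma$ each component of $\gamma$ is contracted to a vertex or, if it has two legs, to a point of a propagator, and a bare vertex or propagator is identified with $1$. Its counit $\varepsilon$ vanishes on graphs. For $r\in\mathcal R$, $k\ge 1$ let $$c_k^r=\sum_{\mathbf{res}(\Gamma)=r,\ |\Gamma|=k}\frac{1}{|\mathrm{Aut}(\Gamma)|}\,\Gamma ,$$ summed over graphs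 with fixed external legs ($|\Gamma|$ is the number of loops, automorphisms fix the legs, and the labelling of the legs is forgotten in $H$), and let $H_{\mathrm{grad}}\subset H$ be the subalgebra generated by all $c_k^r$, graded by loop number. Assume that the theory has an invariant charge with integer exponents $Q(s)$, $s\in\mathcal R$: every 1PI graph with residue $r\in\mathcal R$ and $k\geq 1$ loops contains exactly $kQ(s)+\delta_{r,s}$ vertices of type $s$ for each vertex type $s\in\mathcal R$, and exactly $kQ(s)-\delta_{r,s}$ internal edges of type $s$ for each propagator $s\in\mathcal R$. (For QED, with the electron-photon vertex and the two propagators as $\mathcal R$, $Q(\bar\psi A\psi)=Q(\bar\psi\psi)=2$ and $Q(\tfrac14F^2)=1$.) Assume also that every $r\in\mathcal R$ has a 1PI graph with $k$ loops, for every $k\ge1$. **Theorem 1.** Let $L$ be the $\mathbb Q$-vector space with basis $z_k^s$ ($k\ge1$, $s\in\mathcal R$). The bilinear bracket $$[z_k^s,z_l^t]=-Q(t)\,k\,z_{k+l}^s+Q(s)\,l\,z_{k+l}^t$$ makes $L$ a Lie algebra. The coproduct restricts to $\Delta:H_{\mathrm{grad}}\to H_{\mathrm{grad}}\otimes H_{\mathrm{grad}}$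 and makes $H_{\mathrm{grad}}$ a Hopf algebra, and $L$ is its Milnor–Moore dual: there is a bilinear pairing $\langle\cdot,\cdot\rangle:U(L)\times H_{\mathrm{grad}}\to\mathbb Q$ with $$\langle 1,a\rangle=\varepsilon(a),\quad \langle uv,a\rangle=\langle u\otimes v,\Delta a\rangle,\quad \langle u,1\rangle=\varepsilon_{U(L)}(u),\quad \langle u,ab\rangle=\langle\Delta_{U(L)}u,a\otimes b\rangle ,$$ with $\langle z_k^s,c_j^t\rangle=\delta_{s,t}\delta_{k,j}$, which identifies $U(L)$ with the graded dual of $H_{\mathrm{grad}}$ (the linear functionals that vanish in all sufficiently high degrees). In particular, for all $s,t,r\in\mathcal R$ and $k,l,j\ge1$, $$\langle[z_k^s,z_l^t],c_j^r\rangle=\langle z_k^s\otimes z_l^t-z_l^t\otimes z_k^s,\Delta(c_j^r)\rangle .$$ -/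

import Mathlib

open scoped TensorProduct

noncomputable section

namespace QFT

/-! ### Perturbative theories and Feynman graphs -/

/-- The combinatorial data of a perturbative quantum field theory. `Leg` is the type of half-edge
labels and an edge always joins a half-edge labelled `f` to one labelled `conj f` (for quantum
electrodynamics: the labels are `A`, `ψ`, `ψbar`, with `conj A = A` and `conj ψ = ψbar`).
An amplitude is recorded by the multiset of labels of its external legs; `amplitudes` is the set of
those that need renormalization. Each of them is an interaction vertex of the theory (at least
three legs) or a propagator `{f, conj f}`. -/
structure Theory where
  Leg : Type
  conj : Leg → Leg
  conj_conj : ∀ f, conj (conj f) = f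
  vertexTypes : Finset (Multiset Leg)
  three_le_card : ∀ v ∈ vertexTypes, 3 ≤ Multiset.card v
  amplitudes : Finset (Multiset Leg)
  amplitudes_spec : ∀ r ∈ amplitudes, r ∈ vertexTypes ∨ ∃ f, r = {f, conj f}

/-- Raw graph data on a set `H` of half-edges: labels, the partition of `H` into vertices, and the
relation `edge a b` saying that `a` and `b` are glued to an internal edge. -/
structure HalfEdgeGraph (T : Theory) (H : Type) where
  label : H → T.Leg
  vertex : Setoid H
  edge : H → H → Prop

namespace HalfEdgeGraph

variable {T : Theory} {H H' : Type}

/-- The multiset of labels of a finite set of half-edges. -/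
def labels [Finite H] (G : HalfEdgeGraph T H) (s : Set H) : Multiset T.Leg :=
  (Set.toFinite s).toFinset.val.map G.label

/-- The labels of all half-edges at the vertex that carries `a`. -/
def vertexType [Finite H] (G : HalfEdgeGraph T H) (a : H) : Multiset T.Leg :=
  G.labels {b | G.vertex.r a b}

/-- The residue: the labels of the external legs. -/
def residue [Finite H] (G : HalfEdgeGraph T H) : Multiset T.Leg :=
  G.labels {a | ¬ ∃ b, G.edge a b}

/-- `G` is a graph of the theory: `edge` is a partial matching that respects the labels, and every
vertex is a vertex of the theory. -/
structure IsGraph [Finite H] (G : HalfEdgeGraph T H) : Prop where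
  symm : ∀ a b, G.edge a b → G.edge b a
  irrefl : ∀ a, ¬ G.edge a a
  unique : ∀ a b c, G.edge a b → G.edge a c → b = c
  label_edge : ∀ a b, G.edge a b → G.label b = T.conj (G.label a)
  vertex_mem : ∀ a, G.vertexType a ∈ T.vertexTypes

/-- Connectedness, when the edges at the half-edges in `X` are removed. -/
def ConnectedAvoiding (G : HalfEdgeGraph T H) (X : Set H) : Prop :=
  ∀ a b, Relation.EqvGen (fun x y => G.vertex.r x y ∨ (G.edge x y ∧ x ∉ X ∧ y ∉ X)) a b

/-- One-particle irreducible: nonempty, connected, and still connected after the removal of any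
one internal edge. -/
structure OnePI (G : HalfEdgeGraph T H) : Prop where
  nonempty : Nonempty H
  connected : G.ConnectedAvoiding ∅
  bridgeless : ∀ a b, G.edge a b → G.ConnectedAvoiding {a, b}

/-- The internal edges. -/
def edges (G : HalfEdgeGraph T H) : Set (Sym2 H) :=
  {e | ∃ a b, e = s(a, b) ∧ G.edge a b}

/-- The number of independent loops of a connected graph. -/
def loops (G : HalfEdgeGraph T H) : ℕ :=
  Set.ncard G.edges + 1 - Nat.card (Quotient G.vertex)

/-- The number of vertices of type `s` plus the number of internal edges of type `s`. A given
amplitude `s` is a vertex (at least three legs) or a propagator (two legs), so that only one of the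
two summands can be nonzero. -/
def occurrences [Finite H] (G : HalfEdgeGraph T H) (s : Multiset T.Leg) : ℕ :=
  Set.ncard {v : Quotient G.vertex | ∃ a, Quotient.mk G.vertex a = v ∧ G.vertexType a = s} +
    Set.ncard {e : Sym2 H | ∃ a b, e = s(a, b) ∧ G.edge a b ∧ {G.label a, G.label b} = s}

/-- Isomorphisms of graphs. -/
structure IsIso (G : HalfEdgeGraph T H) (G' : HalfEdgeGraph T H') (e : H ≃ H') : Prop where
  label : ∀ a, G'.label (e a) = G.label a
  vertex : ∀ a b, G'.vertex.r (e a) (e b) ↔ G.vertex.r a b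
  edge : ∀ a b, G'.edge (e a) (e b) ↔ G.edge a b

/-- The order of the automorphism group (external legs may be permuted). -/
def autCard (G : HalfEdgeGraph T H) : ℕ :=
  Nat.card {e : H ≃ H // G.IsIso G e}

/-! ### Subgraphs and contraction

A subgraph is given by the set `S` of the half-edges of its internal edges. -/

/-- The partition of `H` into the connected components of the graph that has all vertices of `G`
but only the edges in `S`. -/
def block (G : HalfEdgeGraph T H) (S : Set H) : Setoid H :=
  Relation.EqvGen.setoid fun a b => G.vertex.r a b ∨ (G.edge a b ∧ a ∈ S ∧ b ∈ S)

/-- The component `B` as a graph: its internal edges are those in `S`, and all other half-edges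
at its vertices are external legs. If `B` has no half-edge in `S`, it is a single vertex. -/
def component (G : HalfEdgeGraph T H) (S : Set H) (B : Quotient (G.block S)) :
    HalfEdgeGraph T {a : H // Quotient.mk (G.block S) a = B} where
  label a := G.label a
  vertex := Setoid.comap Subtype.val G.vertex
  edge a b := G.edge a b ∧ a.1 ∈ S ∧ b.1 ∈ S

/-- `S` is a set of internal edges that is a disjoint union of one-particle irreducible subgraphs
with residues among the amplitudes that need renormalization. The empty set is allowed, and so is
the set of all internal edges. -/
structure Admissible [Finite H] (G : HalfEdgeGraph T H) (S : Set H) : Prop where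
  closed : ∀ a ∈ S, ∃ b ∈ S, G.edge a b
  component : ∀ a ∈ S, (G.component S (Quotient.mk (G.block S) a)).OnePI ∧
    (G.component S (Quotient.mk (G.block S) a)).residue ∈ T.amplitudes

/-- The component of `a` has exactly two external legs: it will be contracted to a point of a
propagator. -/
def TwoLegged [Finite H] (G : HalfEdgeGraph T H) (S : Set H) (a : H) : Prop :=
  Multiset.card (G.component S (Quotient.mk (G.block S) a)).residue = 2

/-- The contraction `G / S`. A component with at least three legs becomes a single vertex. A
component with two legs disappears and the two edges that end in it are joined, so that two
remaining half-edges form an edge when they are linked by a chain of edges of `G` outside `S` and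
of two-legged components. -/
def contract [Finite H] (G : HalfEdgeGraph T H) (S : Set H) :
    HalfEdgeGraph T {a : H // a ∉ S ∧ ¬ G.TwoLegged S a} where
  label a := G.label a
  vertex := Setoid.comap Subtype.val (G.block S)
  edge a b := a ≠ b ∧ Relation.EqvGen
    (fun x y => x ∉ S ∧ y ∉ S ∧
      (G.edge x y ∨ ((G.block S).r x y ∧ G.TwoLegged S x))) a.1 b.1

end HalfEdgeGraph

/-! ### The algebra of graphs and its coproduct -/

/-- The one-particle irreducible graphs with at least one internal edge (equivalently, at least
one loop) whose residue is an amplitude that needs renormalization. -/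
structure FeynmanGraph (T : Theory) where
  size : ℕ
  graph : HalfEdgeGraph T (Fin size)
  isGraph : graph.IsGraph
  onePI : graph.OnePI
  residue_mem : graph.residue ∈ T.amplitudes
  has_edge : ∃ a b, graph.edge a b

/-- Isomorphism of Feynman graphs. -/
instance FeynmanGraph.setoid (T : Theory) : Setoid (FeynmanGraph T) where
  r Γ Γ' := ∃ e, Γ.graph.IsIso Γ'.graph e
  iseqv :=
    { refl := fun _ => ⟨Equiv.refl _, fun _ => rfl, fun _ _ => Iff.rfl, fun _ _ => Iff.rfl⟩
      symm := fun {Γ Γ'} ⟨e, h⟩ => ⟨e.symm,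
        fun a => by rw [← h.label, e.apply_symm_apply],
        fun a b => by rw [← h.vertex, e.apply_symm_apply, e.apply_symm_apply],
        fun a b => by rw [← h.edge, e.apply_symm_apply, e.apply_symm_apply]⟩
      trans := fun ⟨e, h⟩ ⟨e', h'⟩ => ⟨e.trans e',
        fun a => (h'.label (e a)).trans (h.label a),
        fun a b => (h'.vertex (e a) (e b)).trans (h.vertex a b),
        fun a b => (h'.edge (e a) (e b)).trans (h.edge a b)⟩ }

/-- Isomorphism classes of Feynman graphs. -/
abbrev GraphClass (T : Theory) : Type := Quotient (FeynmanGraph.setoid T)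

/-- A representative of an isomorphism class. -/
def GraphClass.rep {T : Theory} (q : GraphClass T) : FeynmanGraph T := Quotient.out q

/-- The commutative algebra over `ℚ` freely generated by the Feynman graphs. -/
abbrev GraphAlgebra (T : Theory) : Type := MvPolynomial (GraphClass T) ℚ

open Classical in
/-- The element of the graph algebra given by a graph: the corresponding generator, and `1` for a
graph without internal edges (a single vertex, or the empty graph, which is what remains of a
bare propagator). -/
def toAlgebra {T : Theory} {H : Type} (G : HalfEdgeGraph T H) : GraphAlgebra T :=
  if h : ∃ Γ : FeynmanGraph T, ∃ e, Γ.graph.IsIso G e then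
    MvPolynomial.X (Quotient.mk _ h.choose) else 1

/-- `Δ(Γ) = ∑ γ ⊗ Γ/γ`, the sum over all subgraphs `γ` that are disjoint unions of one-particle
irreducible graphs needing renormalization; `γ = ∅` contributes `1 ⊗ Γ`, and `γ = Γ` contributes
`Γ ⊗ 1`. -/
def graphCoproduct {T : Theory} (Γ : FeynmanGraph T) : GraphAlgebra T ⊗[ℚ] GraphAlgebra T :=
  ∑ᶠ S : {S : Set (Fin Γ.size) // Γ.graph.Admissible S},
    (∏ᶠ B : Quotient (Γ.graph.block S.1), toAlgebra (Γ.graph.component S.1 B)) ⊗ₜ[ℚ]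
      toAlgebra (Γ.graph.contract S.1)

/-- The coproduct of the graph algebra. -/
def comul (T : Theory) : GraphAlgebra T →ₐ[ℚ] GraphAlgebra T ⊗[ℚ] GraphAlgebra T :=
  MvPolynomial.aeval fun q => graphCoproduct q.rep

/-- The counit of the graph algebra: it vanishes on all graphs. -/
def counit (T : Theory) : GraphAlgebra T →ₐ[ℚ] ℚ :=
  MvPolynomial.aeval fun _ => 0

open Classical in
/-- The number of permutations of the legs of an amplitude that preserve the labels. -/
def legSymmetry {T : Theory} (r : Multiset T.Leg) : ℕ :=
  ∏ f ∈ r.toFinset, Nat.factorial (r.count f)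

/-- `c_k^r`, the sum of all graphs with residue `r` and `k` loops, with fixed external legs, each
weighted by the inverse of the order of the group of automorphisms that fix the legs. A graph `Γ`
without fixed legs has `legSymmetry r` ways of attaching its legs to those of `r`; by
orbit counting they contribute `legSymmetry r / autCard Γ` in total. -/
def graphSum (T : Theory) (r : Multiset T.Leg) (k : ℕ) : GraphAlgebra T :=
  ∑ᶠ q : {q : GraphClass T // q.rep.graph.residue = r ∧ q.rep.graph.loops = k},
    MvPolynomial.C ((legSymmetry r : ℚ) / (q.1.rep.graph.autCard : ℚ)) * MvPolynomial.X q.1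

/-- The index set of the generators: an amplitude and a positive loop number. -/
abbrev GradIndex (T : Theory) : Type := T.amplitudes × ℕ+

/-- The subalgebra generated by all the graph sums `c_k^r`. -/
def gradAlgebra (T : Theory) : Subalgebra ℚ (GraphAlgebra T) :=
  Algebra.adjoin ℚ (Set.range fun p : GradIndex T => graphSum T p.1 p.2)

/-- The generator `c_k^r` as an element of the subalgebra. -/
def gradGen (T : Theory) (p : GradIndex T) : gradAlgebra T :=
  ⟨graphSum T p.1 p.2, Algebra.subset_adjoin ⟨p, rfl⟩⟩

/-- The restriction of the counit. -/
def gradCounit (T : Theory) : gradAlgebra T →ₐ[ℚ] ℚ :=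
  (counit T).comp (gradAlgebra T).val

/-- The elements of the subalgebra that are homogeneous of loop number `n`. -/
def gradDegree (T : Theory) (n : ℕ) : Submodule ℚ (gradAlgebra T) :=
  (MvPolynomial.weightedHomogeneousSubmodule ℚ
    (fun q : GraphClass T => q.rep.graph.loops) n).comap (gradAlgebra T).val.toLinearMap

/-- The theory has the invariant charge with exponents `Q`: per loop, a graph contains `Q s`
vertices (or internal edges) of type `s`, up to the shift by which a graph with residue `s` has one
vertex more (or one edge less). Equivalently, the product of the dressings of all vertices, divided
by those of all internal edges, of a `k`-loop graph with residue `r` is `X^r 𝒬^k` with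
`𝒬 = ∏_{vertices v} (X^v)^{Q v} / ∏_{propagators e} (X^e)^{Q e}`. -/
def HasInvariantCharge (T : Theory) (Q : T.amplitudes → ℤ) : Prop :=
  ∀ (Γ : FeynmanGraph T) (s : T.amplitudes),
    (Γ.graph.residue ≠ s → (Γ.graph.occurrences s : ℤ) = Γ.graph.loops * Q s) ∧
    (Γ.graph.residue = s → s.1 ∈ T.vertexTypes →
      (Γ.graph.occurrences s : ℤ) = Γ.graph.loops * Q s + 1) ∧
    (Γ.graph.residue = s → s.1 ∉ T.vertexTypes →
      (Γ.graph.occurrences s : ℤ) = Γ.graph.loops * Q s - 1)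

/-! ### Hopf algebras, Lie brackets and duality -/

/-- `Δ` and `ε` make the commutative algebra `A` a Hopf algebra. -/
structure IsHopf {A : Type} [CommRing A] [Algebra ℚ A] (Δ : A →ₐ[ℚ] A ⊗[ℚ] A) (ε : A →ₐ[ℚ] ℚ) :
    Prop where
  coassoc : ∀ a, TensorProduct.assoc ℚ A A A
      (TensorProduct.map Δ.toLinearMap LinearMap.id (Δ a)) =
    TensorProduct.map LinearMap.id Δ.toLinearMap (Δ a)
  counit_left : ∀ a, TensorProduct.lid ℚ A
    (TensorProduct.map ε.toLinearMap LinearMap.id (Δ a)) = a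
  counit_right : ∀ a, TensorProduct.rid ℚ A
    (TensorProduct.map LinearMap.id ε.toLinearMap (Δ a)) = a
  antipode : ∃ S : A →ₗ[ℚ] A, ∀ a,
    LinearMap.mul' ℚ A (TensorProduct.map S LinearMap.id (Δ a)) = algebraMap ℚ A (ε a) ∧
    LinearMap.mul' ℚ A (TensorProduct.map LinearMap.id S (Δ a)) = algebraMap ℚ A (ε a)

/-- A bilinear map that is alternating and satisfies the Jacobi identity. -/
structure IsLieBracket {L : Type} [AddCommGroup L] [Module ℚ L] (b : L →ₗ[ℚ] L →ₗ[ℚ] L) :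
    Prop where
  self : ∀ x, b x x = 0
  jacobi : ∀ x y z, b x (b y z) + b y (b z x) + b z (b x y) = 0

theorem IsLieBracket.neg {L : Type} [AddCommGroup L] [Module ℚ L] {b : L →ₗ[ℚ] L →ₗ[ℚ] L}
    (h : IsLieBracket b) (x y : L) : b x y = - b y x := by
  have := h.self (x + y)
  simp only [map_add, LinearMap.add_apply, h.self, zero_add, add_zero] at this
  exact eq_neg_of_add_eq_zero_right this

/-- The Lie ring given by a Lie bracket. -/
@[reducible]
def IsLieBracket.lieRing {L : Type} [AddCommGroup L] [Module ℚ L] {b : L →ₗ[ℚ] L →ₗ[ℚ] L}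
    (h : IsLieBracket b) : LieRing L where
  bracket x y := b x y
  add_lie x y z := by simp
  lie_add x y z := by simp
  lie_self x := h.self x
  leibniz_lie x y z := by
    have := h.jacobi x y z
    rw [h.neg z x, map_neg] at this
    rw [h.neg (b x y) z, ← sub_eq_zero, ← this]
    abel

/-- The Lie algebra given by a Lie bracket. -/
@[reducible]
def IsLieBracket.lieAlgebra {L : Type} [AddCommGroup L] [Module ℚ L] {b : L →ₗ[ℚ] L →ₗ[ℚ] L}
    (h : IsLieBracket b) : letI := h.lieRing; LieAlgebra ℚ L :=
  letI := h.lieRing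
  { (inferInstance : Module ℚ L) with
    lie_smul := fun t x y => (b x).map_smul t y }

/-- `⟨φ ⊗ ψ, w⟩` for linear functionals `φ`, `ψ`. -/
def pairTensor {A : Type} [AddCommGroup A] [Module ℚ A] (φ ψ : A →ₗ[ℚ] ℚ) : A ⊗[ℚ] A →ₗ[ℚ] ℚ :=
  (TensorProduct.lid ℚ ℚ).toLinearMap ∘ₗ TensorProduct.map φ ψ

section Enveloping

variable (L : Type) [LieRing L] [LieAlgebra ℚ L]

attribute [local instance 100] LieRing.ofAssociativeRing

/-- The coproduct of the universal enveloping algebra: elements of `L` are primitive. -/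
def envelopingComul : UniversalEnvelopingAlgebra ℚ L →ₐ[ℚ]
    UniversalEnvelopingAlgebra ℚ L ⊗[ℚ] UniversalEnvelopingAlgebra ℚ L :=
  UniversalEnvelopingAlgebra.lift ℚ
    { toFun := fun x => UniversalEnvelopingAlgebra.ι ℚ x ⊗ₜ[ℚ] 1 +
        1 ⊗ₜ[ℚ] UniversalEnvelopingAlgebra.ι ℚ x
      map_add' := fun x y => by
        simp only [map_add, TensorProduct.add_tmul, TensorProduct.tmul_add]; abel
      map_smul' := fun t x => by
        simp [TensorProduct.smul_tmul', TensorProduct.tmul_smul]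
      map_lie' := fun {x y} => by
        simp only [LieHom.map_lie, LieRing.of_associative_ring_bracket, mul_add, add_mul,
          Algebra.TensorProduct.tmul_mul_tmul, mul_one, one_mul, TensorProduct.sub_tmul,
          TensorProduct.tmul_sub]
        abel }

/-- The counit of the universal enveloping algebra. -/
def envelopingCounit : UniversalEnvelopingAlgebra ℚ L →ₐ[ℚ] ℚ :=
  UniversalEnvelopingAlgebra.lift ℚ 0

end Enveloping

/-- `P` is a pairing of Hopf algebras between the universal enveloping algebra of `L` and `A`, and
it identifies the enveloping algebra with the graded dual of `A`, the space of those functionals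
that vanish in all sufficiently high degrees. -/
structure IsMilnorMooreDuality (L : Type) [LieRing L] [LieAlgebra ℚ L] {A : Type} [CommRing A]
    [Algebra ℚ A] (Δ : A →ₐ[ℚ] A ⊗[ℚ] A) (ε : A →ₐ[ℚ] ℚ) (deg : ℕ → Submodule ℚ A)
    (P : UniversalEnvelopingAlgebra ℚ L →ₗ[ℚ] A →ₗ[ℚ] ℚ) : Prop where
  one_left : ∀ a, P 1 a = ε a
  mul_left : ∀ u v a, P (u * v) a = pairTensor (P u) (P v) (Δ a)
  one_right : ∀ u, P u 1 = envelopingCounit L u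
  mul_right : ∀ u a b, P u (a * b) = pairTensor (P.flip a) (P.flip b) (envelopingComul L u)
  injective : Function.Injective P
  range : ∀ φ : A →ₗ[ℚ] ℚ,
    (∃ u, P u = φ) ↔ ∃ N : ℕ, ∀ n, N ≤ n → ∀ a ∈ deg n, φ a = 0

/-- The vector space with basis `z_k^s`, where `s` is an amplitude and `k` is positive. -/
abbrev GradLie (T : Theory) : Type := GradIndex T →₀ ℚ

/-- The basis vector `z_k^s`. -/
def z {T : Theory} (s : T.amplitudes) (k : ℕ+) : GradLie T := Finsupp.single (s, k) 1

/-- The bilinear bracket with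
`[z_k^s, z_l^t] = - Q(t) k z_{k+l}^s + Q(s) l z_{k+l}^t`. -/
def bracket {T : Theory} (Q : T.amplitudes → ℤ) : GradLie T →ₗ[ℚ] GradLie T →ₗ[ℚ] GradLie T :=
  Finsupp.linearCombination ℚ fun i : GradIndex T =>
    Finsupp.linearCombination ℚ fun j : GradIndex T =>
      -((Q j.1 : ℚ) * (i.2 : ℕ)) • z i.1 (i.2 + j.2) + ((Q i.1 : ℚ) * (j.2 : ℕ)) • z j.1 (i.2 + j.2)

end QFT

end

open scoped TensorProduct
open QFT

/-!
The theorem rests on a closed formula for the coproduct of the graph sums, from which the rest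
follows by algebra. Put `x_s = 1 ± ∑ c_k^s λ^k` (`dressing`, with `+` for vertices and `-` for
propagators) and `q = ∏ x_s ^ (± Q s)` (`charge`). Then

  `Δ x_r(λ) = ∑ᵢ x_r(λ) q(λ)ⁱ λⁱ ⊗ (i-th coefficient of x_r)`,

which is `comul_graphSum`.

*The formula.* A pair of a graph and an admissible subgraph is the same as the graph `K` in which
the components of the subgraph are shrunk to vertices, together with a filling of every vertex of
`K` by a bare vertex or a graph. Graphs are counted with labelled half-edges, where sums weighted by
`1 / |Aut|` become exponential generating functions, so that fillings of distinct vertices multiply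
(`sum_shrink_eq_coeff`, `sum_loopClasses_eq`). Propagator components appear in `K` as vertices with
two half-edges; the contraction `Γ/γ` erases them, and conversely `n` of them can be placed on `E`
edges in `multichoose E n` ways (`sum_profile_eq`). Summing over `n` gives `(1 - ∑ c_k λ^k)⁻¹` for
every internal edge. Hence the remaining graph `Γ'` contributes a product of `x_s` over its vertices
and of `x_s⁻¹` over its edges, and by the hypothesis on the invariant charge this product is
`x_r q ^ |Γ'|`, whatever `Γ'` is (`dressing_prod_eq`).

*The Hopf algebra.* The `c_k^s` are algebraically independent, since each contains a graph that
occurs in no other (`gradEval_injective`), so that `H_grad` represents the functor of families of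
power series with constant coefficient `1` (`IsUniversalFamily`). The formula says that `Δ` is dual
to the operation `(x ⋆ y)_s(λ) = x_s(λ) y_s(λ q_x(λ))` (`seriesMul`) on such families. As the charge
satisfies `q_{x ⋆ y}(λ) = q_x(λ) q_y(λ q_x(λ))`, this is a group law, and coassociativity and the
antipode follow from the Yoneda principle (`IsUniversalFamily.isHopf`).

*The duality.* The functionals `δ_k^s` dual to `c_k^s` are derivations along the counit. On
generators the formula gives the convolution product of two of them, whose commutator is the bracket
(`gradPairing_bracket`). The universal property of the enveloping algebra, applied to the
convolution algebra of functionals, then yields the pairing (`exists_extension`). It is triangular: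
`(id ⊗ δ_k^s) ∘ Δ` is a derivation that agrees with `∂ / ∂c_k^s` to leading order in the augmentation
ideal, so that a product of `n` elements `z_k^s` kills monomials with more than `n` factors and, among
those with exactly `n` factors, only pairs with the corresponding one
(`apply_word_monomial_ne_zero_iff`). With the spanning half of the Poincaré–Birkhoff–Witt theorem
(`span_multisetWord`) this gives injectivity, and with the grading it gives surjectivity onto the
graded dual (`exists_apply_eq`).
-/

open scoped TensorProduct

noncomputable section

namespace QFT

section

/-! ### Isomorphisms of half-edge graphs -/

/-- A map that sends generators of `r` into the equivalence closure of `s` does so for the whole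
equivalence closure of `r`. -/
theorem eqvGen_map {α β : Type*} {r : α → α → Prop} {s : β → β → Prop} (f : α → β)
    (h : ∀ a b, r a b → Relation.EqvGen s (f a) (f b)) {a b : α} (hab : Relation.EqvGen r a b) :
    Relation.EqvGen s (f a) (f b) := by
  induction hab with
  | rel x y hxy => exact h x y hxy
  | refl x => exact .refl _
  | symm x y _ ih => exact ih.symm
  | trans x y z _ _ ih₁ ih₂ => exact ih₁.trans _ _ _ ih₂

namespace HalfEdgeGraph

variable {T : Theory} {H H' H'' : Type}

theorem ext_iff' {G G' : HalfEdgeGraph T H} (hl : ∀ a, G.label a = G'.label a)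
    (hv : ∀ a b, G.vertex.r a b ↔ G'.vertex.r a b) (he : ∀ a b, G.edge a b ↔ G'.edge a b) :
    G = G' := by
  obtain ⟨l, v, e⟩ := G
  obtain ⟨l', v', e'⟩ := G'
  obtain rfl : l = l' := funext hl
  obtain rfl : v = v' := Setoid.ext hv
  obtain rfl : e = e' := by ext a b; exact he a b
  rfl

/-- The graph `G`, carried to another set of half-edges by a bijection. -/
def map (e : H ≃ H') (G : HalfEdgeGraph T H) : HalfEdgeGraph T H' where
  label a := G.label (e.symm a)
  vertex := G.vertex.comap e.symm
  edge a b := G.edge (e.symm a) (e.symm b)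

theorem isIso_map (e : H ≃ H') (G : HalfEdgeGraph T H) : G.IsIso (G.map e) e where
  label a := by simp [map]
  vertex a b := by
    change G.vertex.r (e.symm (e a)) (e.symm (e b)) ↔ _
    simp
  edge a b := by simp [map]

section Iso

variable {G : HalfEdgeGraph T H} {G' : HalfEdgeGraph T H'} {G'' : HalfEdgeGraph T H''}
  {e : H ≃ H'} {e' : H' ≃ H''}

theorem IsIso.refl (G : HalfEdgeGraph T H) : G.IsIso G (Equiv.refl H) :=
  ⟨fun _ => rfl, fun _ _ => Iff.rfl, fun _ _ => Iff.rfl⟩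

theorem IsIso.symm (h : G.IsIso G' e) : G'.IsIso G e.symm where
  label a := by rw [← h.label, e.apply_symm_apply]
  vertex a b := by rw [← h.vertex, e.apply_symm_apply, e.apply_symm_apply]
  edge a b := by rw [← h.edge, e.apply_symm_apply, e.apply_symm_apply]

theorem IsIso.trans (h : G.IsIso G' e) (h' : G'.IsIso G'' e') : G.IsIso G'' (e.trans e') where
  label a := (h'.label (e a)).trans (h.label a)
  vertex a b := (h'.vertex (e a) (e b)).trans (h.vertex a b)
  edge a b := (h'.edge (e a) (e b)).trans (h.edge a b)

theorem IsIso.eq_map (h : G.IsIso G' e) : G' = G.map e := by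
  refine ext_iff' (fun a => ?_) (fun a b => ?_) (fun a b => ?_)
  · exact (h.symm.label a).symm
  · exact (h.symm.vertex a b).symm
  · exact (h.symm.edge a b).symm

theorem labels_eq_map_univ [Finite H] (G : HalfEdgeGraph T H) (s : Set H) [Fintype s] :
    G.labels s = (Finset.univ : Finset s).val.map fun a : s => G.label a := by
  classical
  unfold labels
  have h : (Set.toFinite s).toFinset = (Finset.univ : Finset s).map (Function.Embedding.subtype _) := by
    ext a
    simp
  rw [h, Finset.map_val, Multiset.map_map]
  rfl

theorem labels_congr [Finite H] [Finite H'] {s : Set H} {s' : Set H'} (f : s ≃ s')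
    (h : ∀ a : s, G'.label (f a) = G.label a) : G.labels s = G'.labels s' := by
  classical
  have := Fintype.ofFinite s
  have := Fintype.ofFinite s'
  rw [labels_eq_map_univ, labels_eq_map_univ, ← Finset.map_univ_equiv f, Finset.map_val,
    Multiset.map_map]
  exact Multiset.map_congr rfl fun a _ => (h a).symm

/-- Label multisets agree when the second set is the image of the first under an injective map
that preserves labels. -/
theorem labels_eq_of_image [Finite H] [Finite H'] {s : Set H} {s' : Set H'} (f : H → H')
    (hf : Set.BijOn f s s') (h : ∀ a ∈ s, G'.label (f a) = G.label a) :
    G.labels s = G'.labels s' :=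
  labels_congr (hf.equiv f) fun a => h a a.2

theorem card_labels [Finite H] (G : HalfEdgeGraph T H) (s : Set H) :
    Multiset.card (G.labels s) = s.ncard := by
  unfold labels
  rw [Multiset.card_map, Set.ncard_eq_toFinset_card s (Set.toFinite s)]
  rfl

theorem mem_labels [Finite H] (G : HalfEdgeGraph T H) (s : Set H) (f : T.Leg) :
    f ∈ G.labels s ↔ ∃ a ∈ s, G.label a = f := by
  unfold labels
  simp

theorem label_mem_vertexType [Finite H] (G : HalfEdgeGraph T H) (a : H) :
    G.label a ∈ G.vertexType a :=
  (mem_labels _ _ _).2 ⟨a, G.vertex.refl' a, rfl⟩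

theorem bijOn_of_equiv (e : H ≃ H') {s : Set H} {s' : Set H'} (h : ∀ a, e a ∈ s' ↔ a ∈ s) :
    Set.BijOn e s s' :=
  ⟨fun a ha => (h a).2 ha, e.injective.injOn, fun b hb =>
    ⟨e.symm b, (h _).1 (by simpa using hb), by simp⟩⟩

theorem IsIso.vertexType [Finite H] [Finite H'] (h : G.IsIso G' e) (a : H) :
    G'.vertexType (e a) = G.vertexType a :=
  (labels_eq_of_image e (bijOn_of_equiv e fun b => h.vertex a b) fun b _ => h.label b).symm

theorem IsIso.exists_edge (h : G.IsIso G' e) (a : H) :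
    (∃ b, G'.edge (e a) b) ↔ ∃ b, G.edge a b := by
  constructor
  · rintro ⟨b, hb⟩
    exact ⟨e.symm b, (h.edge _ _).1 (by simpa using hb)⟩
  · rintro ⟨b, hb⟩
    exact ⟨e b, (h.edge _ _).2 hb⟩

theorem IsIso.residue [Finite H] [Finite H'] (h : G.IsIso G' e) : G'.residue = G.residue :=
  (labels_eq_of_image e (bijOn_of_equiv e fun b => not_congr (h.exists_edge b))
    fun b _ => h.label b).symm

theorem IsIso.has_edge (h : G.IsIso G' e) (hG : ∃ a b, G.edge a b) : ∃ a b, G'.edge a b :=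
  let ⟨a, b, hab⟩ := hG
  ⟨e a, e b, (h.edge a b).2 hab⟩

theorem IsIso.connectedAvoiding (h : G.IsIso G' e) {X : Set H} {X' : Set H'}
    (hX : ∀ a, e a ∈ X' → a ∈ X) (hG : G.ConnectedAvoiding X) : G'.ConnectedAvoiding X' := by
  intro a b
  have := eqvGen_map (s := fun x y => G'.vertex.r x y ∨ (G'.edge x y ∧ x ∉ X' ∧ y ∉ X')) e
    (fun x y hxy => .rel _ _ (hxy.imp (h.vertex x y).2 fun hh =>
      ⟨(h.edge x y).2 hh.1, fun hx => hh.2.1 (hX _ hx), fun hx => hh.2.2 (hX _ hx)⟩))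
    (hG (e.symm a) (e.symm b))
  simpa using this

theorem IsIso.onePI (h : G.IsIso G' e) (hG : G.OnePI) : G'.OnePI where
  nonempty := hG.nonempty.map e
  connected := h.connectedAvoiding (fun _ hx => hx.elim) hG.connected
  bridgeless a b hab := h.connectedAvoiding (X := {e.symm a, e.symm b})
    (fun x hx => by
      rcases hx with hx | hx
      · left; simp [← hx]
      · right; simp [← Set.mem_singleton_iff.1 hx])
    (hG.bridgeless _ _ ((h.symm.edge a b).2 hab))

end Iso

/-- `edge` is a partial matching that respects the labels. -/
structure IsMatching (G : HalfEdgeGraph T H) : Prop where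
  symm : ∀ a b, G.edge a b → G.edge b a
  irrefl : ∀ a, ¬ G.edge a a
  unique : ∀ a b c, G.edge a b → G.edge a c → b = c
  label_edge : ∀ a b, G.edge a b → G.label b = T.conj (G.label a)

theorem IsGraph.isMatching [Finite H] {G : HalfEdgeGraph T H} (h : G.IsGraph) : G.IsMatching :=
  ⟨h.symm, h.irrefl, h.unique, h.label_edge⟩

theorem IsMatching.isGraph [Finite H] {G : HalfEdgeGraph T H} (h : G.IsMatching)
    (hv : ∀ a, G.vertexType a ∈ T.vertexTypes) : G.IsGraph :=
  ⟨h.symm, h.irrefl, h.unique, h.label_edge, hv⟩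

section Iso

variable {G : HalfEdgeGraph T H} {G' : HalfEdgeGraph T H'} {e : H ≃ H'}

theorem IsIso.isMatching (h : G.IsIso G' e) (hG : G.IsMatching) : G'.IsMatching where
  symm a b hab := by
    rw [← h.symm.edge] at hab ⊢
    exact hG.symm _ _ hab
  irrefl a ha := hG.irrefl _ ((h.symm.edge a a).2 ha)
  unique a b c hb hc := by
    rw [← h.symm.edge] at hb hc
    exact e.symm.injective (hG.unique _ _ _ hb hc)
  label_edge a b hab := by
    rw [← h.symm.label, ← h.symm.label]
    exact hG.label_edge _ _ ((h.symm.edge a b).2 hab)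

theorem IsIso.isGraph [Finite H] [Finite H'] (h : G.IsIso G' e) (hG : G.IsGraph) : G'.IsGraph :=
  (h.isMatching hG.isMatching).isGraph fun a => by
    have := hG.vertex_mem (e.symm a)
    rwa [← h.vertexType, e.apply_symm_apply] at this

theorem IsIso.edges_eq (h : G.IsIso G' e) : G'.edges = Sym2.map e '' G.edges := by
  ext x
  constructor
  · rintro ⟨a, b, rfl, hab⟩
    exact ⟨s(e.symm a, e.symm b), ⟨_, _, rfl, (h.symm.edge a b).2 hab⟩, by simp⟩
  · rintro ⟨_, ⟨a, b, rfl, hab⟩, rfl⟩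
    exact ⟨e a, e b, by simp, (h.edge a b).2 hab⟩

theorem IsIso.loops (h : G.IsIso G' e) : G'.loops = G.loops := by
  unfold HalfEdgeGraph.loops
  rw [h.edges_eq, Set.ncard_image_of_injective _ (Sym2.map.injective e.injective),
    Nat.card_congr (Quotient.congr e fun a b => (h.vertex a b).symm)]

end Iso

end HalfEdgeGraph

open HalfEdgeGraph

variable {T : Theory} {H H' : Type}

theorem toAlgebra_of_iso {G : HalfEdgeGraph T H} (Γ : FeynmanGraph T) {e : Fin Γ.size ≃ H}
    (h : Γ.graph.IsIso G e) : toAlgebra G = MvPolynomial.X (Quotient.mk _ Γ) := by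
  have hex : ∃ Γ : FeynmanGraph T, ∃ e, Γ.graph.IsIso G e := ⟨Γ, e, h⟩
  unfold toAlgebra
  rw [dif_pos hex]
  obtain ⟨e', h'⟩ := hex.choose_spec
  congr 1
  exact Quotient.sound ⟨e'.trans e.symm, h'.trans h.symm⟩

theorem toAlgebra_of_no_edge {G : HalfEdgeGraph T H} (h : ¬ ∃ a b, G.edge a b) :
    toAlgebra G = 1 := by
  unfold toAlgebra
  rw [dif_neg]
  rintro ⟨Γ, e, he⟩
  exact h (he.has_edge Γ.has_edge)

theorem HalfEdgeGraph.IsIso.toAlgebra {G : HalfEdgeGraph T H} {G' : HalfEdgeGraph T H'} {e : H ≃ H'}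
    (h : G.IsIso G' e) : toAlgebra G' = toAlgebra G := by
  by_cases hex : ∃ Γ : FeynmanGraph T, ∃ e, Γ.graph.IsIso G e
  · obtain ⟨Γ, e, h'⟩ := hex
    rw [toAlgebra_of_iso Γ h', toAlgebra_of_iso Γ (h'.trans h)]
  · have hex' : ¬ ∃ Γ : FeynmanGraph T, ∃ e, Γ.graph.IsIso G' e :=
      fun ⟨Γ, e, h'⟩ => hex ⟨Γ, _, h'.trans h.symm⟩
    unfold QFT.toAlgebra
    rw [dif_neg hex, dif_neg hex']

/-- The conditions on a graph with an arbitrary finite set of half-edges that make it a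
`FeynmanGraph` with residue `r`. -/
structure HalfEdgeGraph.IsFeynman [Finite H] (r : Multiset T.Leg) (G : HalfEdgeGraph T H) :
    Prop where
  isGraph : G.IsGraph
  onePI : G.OnePI
  residue_eq : G.residue = r
  has_edge : ∃ a b, G.edge a b

theorem HalfEdgeGraph.IsIso.isFeynman [Finite H] [Finite H'] {G : HalfEdgeGraph T H}
    {G' : HalfEdgeGraph T H'} {e : H ≃ H'} (h : G.IsIso G' e) {r : Multiset T.Leg}
    (hG : G.IsFeynman r) : G'.IsFeynman r :=
  ⟨h.isGraph hG.isGraph, h.onePI hG.onePI, h.residue.trans hG.residue_eq, h.has_edge hG.has_edge⟩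

theorem FeynmanGraph.isFeynman (Γ : FeynmanGraph T) : Γ.graph.IsFeynman Γ.graph.residue :=
  ⟨Γ.isGraph, Γ.onePI, rfl, Γ.has_edge⟩

/-- The isomorphism class of a graph that satisfies the conditions of a `FeynmanGraph`. -/
theorem HalfEdgeGraph.IsFeynman.exists_iso [Finite H] {G : HalfEdgeGraph T H} {r : Multiset T.Leg}
    (h : G.IsFeynman r) (hr : r ∈ T.amplitudes) :
    ∃ q : GraphClass T, ∃ e, q.rep.graph.IsIso G e := by
  let e : H ≃ Fin (Nat.card H) := Finite.equivFin H
  have hi := isIso_map e G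
  have hF := hi.isFeynman h
  let Γ : FeynmanGraph T := ⟨_, G.map e, hF.isGraph, hF.onePI, hF.residue_eq ▸ hr, hF.has_edge⟩
  obtain ⟨e', h'⟩ := Quotient.exact (Quotient.out_eq (Quotient.mk (FeynmanGraph.setoid T) Γ))
  exact ⟨Quotient.mk _ Γ, e'.trans e.symm, IsIso.trans h' hi.symm⟩

theorem toAlgebra_of_rep_iso {G : HalfEdgeGraph T H} {q : GraphClass T} {e : Fin q.rep.size ≃ H}
    (h : q.rep.graph.IsIso G e) : toAlgebra G = MvPolynomial.X q := by
  rw [toAlgebra_of_iso _ h]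
  congr 1
  exact Quotient.out_eq q

theorem eq_of_rep_iso {G : HalfEdgeGraph T H} {q q' : GraphClass T} {e : Fin q.rep.size ≃ H}
    {e' : Fin q'.rep.size ≃ H}
    (h : q.rep.graph.IsIso G e) (h' : q'.rep.graph.IsIso G e') : q = q' := by
  rw [← Quotient.out_eq q, ← Quotient.out_eq q']
  exact Quotient.sound ⟨e.trans e'.symm, h.trans h'.symm⟩

end

section

namespace HalfEdgeGraph

variable {T : Theory} {H H' : Type}

/-! ### Counting vertices and edges -/

theorem ConnectedAvoiding.mono {G : HalfEdgeGraph T H} {X Y : Set H} (h : X ⊆ Y)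
    (hY : G.ConnectedAvoiding Y) : G.ConnectedAvoiding X := fun a b =>
  (hY a b).mono fun _ _ hxy => hxy.imp_right fun hh =>
    ⟨hh.1, fun hx => hh.2.1 (h hx), fun hx => hh.2.2 (h hx)⟩

/-- Every edge of a matching consists of two half-edges. The predicate `p` selects some edges. -/
theorem IsMatching.two_mul_ncard [Finite H] {G : HalfEdgeGraph T H} (hG : G.IsMatching)
    (p : H → H → Prop) (hp : ∀ a b, p a b → p b a) :
    2 * Set.ncard {e : Sym2 H | ∃ a b, e = s(a, b) ∧ G.edge a b ∧ p a b} =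
      Nat.card {a // ∃ b, G.edge a b ∧ p a b} := by
  classical
  have := Fintype.ofFinite H
  let f : {a // ∃ b, G.edge a b ∧ p a b} →
      {e : Sym2 H | ∃ a b, e = s(a, b) ∧ G.edge a b ∧ p a b} :=
    fun a => ⟨s(a.1, a.2.choose), a.1, a.2.choose, rfl, a.2.choose_spec⟩
  have hf : ∀ e, Nat.card {a // f a = e} = 2 := by
    rintro ⟨_, a, b, rfl, hab, hpab⟩
    have key : ∀ x, f x = ⟨s(a, b), a, b, rfl, hab, hpab⟩ ↔ x.1 = a ∨ x.1 = b := by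
      rintro ⟨x, hx⟩
      simp only [f, Subtype.mk.injEq, Sym2.eq_iff]
      have h1 := hx.choose_spec.1
      constructor
      · rintro (h | h)
        · exact .inl h.1
        · exact .inr h.1
      · rintro (rfl | rfl)
        · exact .inl ⟨rfl, hG.unique _ _ _ h1 hab⟩
        · exact .inr ⟨rfl, hG.unique _ _ _ h1 (hG.symm _ _ hab)⟩
    have hne : a ≠ b := fun h => hG.irrefl a (by rwa [← h] at hab)
    let e : {x // f x = ⟨s(a, b), a, b, rfl, hab, hpab⟩} ≃ ({a, b} : Finset H) :=
      { toFun := fun x => ⟨x.1.1, by simpa using (key x.1).1 x.2⟩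
        invFun := fun y => ⟨⟨y.1, by
            rcases Finset.mem_insert.1 y.2 with h | h
            · rw [h]; exact ⟨b, hab, hpab⟩
            · rw [Finset.mem_singleton.1 h]; exact ⟨a, hG.symm _ _ hab, hp _ _ hpab⟩⟩,
          (key _).2 (by simpa only [Finset.mem_insert, Finset.mem_singleton] using y.2)⟩
        left_inv := fun x => rfl
        right_inv := fun x => rfl }
    rw [Nat.card_congr e, Nat.card_eq_fintype_card, Fintype.card_coe, Finset.card_pair hne]
  rw [Nat.card_congr (Equiv.sigmaFiberEquiv f).symm, Nat.card_sigma, Finset.sum_congr rfl fun e _ => hf e,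
    Finset.sum_const, smul_eq_mul, mul_comm, Finset.card_univ, ← Nat.card_eq_fintype_card,
    Nat.card_coe_set_eq]

theorem IsMatching.two_mul_ncard_edges [Finite H] {G : HalfEdgeGraph T H} (hG : G.IsMatching) :
    2 * Set.ncard G.edges = Nat.card {a // ∃ b, G.edge a b} := by
  simpa [edges] using hG.two_mul_ncard (fun _ _ => True) fun _ _ _ => trivial

/-- A connected graph has at most one vertex more than edges. -/
theorem ConnectedAvoiding.card_vertices_le [Finite H] [Nonempty H] {G : HalfEdgeGraph T H}
    (hG : G.ConnectedAvoiding ∅) : Nat.card (Quotient G.vertex) ≤ Set.ncard G.edges + 1 := by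
  classical
  let K : SimpleGraph (Quotient G.vertex) :=
    SimpleGraph.fromRel fun x y => ∃ a b, Quotient.mk G.vertex a = x ∧ Quotient.mk G.vertex b = y ∧
      G.edge a b
  have hreach : ∀ a b : H, K.Reachable (Quotient.mk G.vertex a) (Quotient.mk G.vertex b) := by
    intro a b
    induction hG a b with
    | rel x y h =>
      rcases h with h | h
      · rw [Quotient.sound (s := G.vertex) h]
      · by_cases hxy : Quotient.mk G.vertex x = Quotient.mk G.vertex y
        · rw [hxy]
        · exact SimpleGraph.Adj.reachable ⟨hxy, .inl ⟨x, y, rfl, rfl, h.1⟩⟩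
    | refl x => exact .refl _
    | symm x y _ ih => exact ih.symm
    | trans x y z _ _ ih₁ ih₂ => exact ih₁.trans ih₂
  have hK : K.Connected :=
    { preconnected := fun x y => by
        induction x using Quotient.inductionOn
        induction y using Quotient.inductionOn
        exact hreach _ _
      nonempty := ‹Nonempty H›.map (Quotient.mk _) }
  refine hK.card_vert_le_card_edgeSet_add_one.trans (Nat.add_le_add_right ?_ 1)
  have hsub : K.edgeSet ⊆ Sym2.map (Quotient.mk G.vertex) '' G.edges := by
    intro e
    induction e using Sym2.inductionOn with
    | hf x y =>
      rintro ⟨_, ⟨a, b, rfl, rfl, h⟩ | ⟨a, b, rfl, rfl, h⟩⟩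
      · exact ⟨s(a, b), ⟨a, b, rfl, h⟩, by simp⟩
      · exact ⟨s(a, b), ⟨a, b, rfl, h⟩, by simp [Sym2.eq_swap]⟩
  rw [Nat.card_coe_set_eq]
  exact (Set.ncard_le_ncard hsub (Set.toFinite _)).trans (Set.ncard_image_le (Set.toFinite _))

theorem ConnectedAvoiding.vertex_of_no_edge {G : HalfEdgeGraph T H} {X : Set H}
    (hG : G.ConnectedAvoiding X) (h : ¬ ∃ a b, G.edge a b) (a b : H) : G.vertex.r a b := by
  have hle : ∀ x y, Relation.EqvGen
      (fun x y => G.vertex.r x y ∨ (G.edge x y ∧ x ∉ X ∧ y ∉ X)) x y → G.vertex.r x y := by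
    intro x y hxy
    induction hxy with
    | rel x y hxy => exact hxy.resolve_right fun hh => h ⟨x, y, hh.1⟩
    | refl x => exact G.vertex.refl' x
    | symm x y _ ih => exact G.vertex.symm' ih
    | trans x y z _ _ ih₁ ih₂ => exact G.vertex.trans' ih₁ ih₂
  exact hle a b (hG a b)

/-! ### Cutting a graph along a subgraph -/

/-- The graph obtained from `G` by shrinking every component of the subgraph `S` to a vertex. In
contrast to `contract`, components with two legs become vertices with two half-edges. -/
def shrink (G : HalfEdgeGraph T H) (S : Set H) : HalfEdgeGraph T {a // a ∉ S} where
  label a := G.label a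
  vertex := (G.block S).comap Subtype.val
  edge a b := G.edge a b

/-- The half-edge sits at a vertex with two half-edges. -/
def Bivalent [Finite H] (G : HalfEdgeGraph T H) (a : H) : Prop :=
  Multiset.card (G.vertexType a) = 2

/-- Two half-edges are linked by a chain of edges and vertices with two half-edges. -/
def Chain [Finite H] (G : HalfEdgeGraph T H) : H → H → Prop :=
  Relation.EqvGen fun x y => G.edge x y ∨ (G.vertex.r x y ∧ G.Bivalent x)

/-- The graph obtained by erasing all vertices with two half-edges. -/
def smooth [Finite H] (G : HalfEdgeGraph T H) : HalfEdgeGraph T {a // ¬ G.Bivalent a} where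
  label a := G.label a
  vertex := G.vertex.comap Subtype.val
  edge a b := a ≠ b ∧ G.Chain a.1 b.1

/-- The conditions satisfied by a one-particle irreducible graph with residue `r` after the
components of a proper subgraph are shrunk: vertices may have two half-edges. -/
structure IsShrunk [Finite H] (r : Multiset T.Leg) (G : HalfEdgeGraph T H) : Prop where
  isMatching : G.IsMatching
  onePI : G.OnePI
  residue_eq : G.residue = r
  has_edge : ∃ a b, G.edge a b
  type_mem : ∀ a, G.vertexType a ∈ T.vertexTypes ∨ G.vertexType a ∈ T.amplitudes

/-- A graph on `J` that may replace a vertex with half-edges `D`, labelled by `ℓ`: a single vertex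
of the theory, or a one-particle irreducible graph that needs renormalization. -/
structure IsFilling {J : Type} [Finite J] (D : Set J) (ℓ : D → T.Leg) (γ : HalfEdgeGraph T J) :
    Prop where
  isGraph : γ.IsGraph
  onePI : γ.OnePI
  exists_edge_iff : ∀ a, (∃ b, γ.edge a b) ↔ a ∉ D
  label_eq : ∀ a : D, γ.label a = ℓ a
  residue_mem : (∃ a, a ∉ D) → γ.residue ∈ T.amplitudes

/-- The graph `G` is composed of the graphs `γ v`, on the fibres of `σ`, whose internal half-edges
form the set `S`, and of the edges of the graph `K` outside `S`. The vertices of `K` are the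
elements of `V`. -/
structure IsGluing {V : Type} (G : HalfEdgeGraph T H) (S : Set H)
    (K : HalfEdgeGraph T {a // a ∉ S}) (σ : H → V) (γ : ∀ v, HalfEdgeGraph T {a // σ a = v}) :
    Prop where
  label : ∀ v a, (γ v).label a = G.label a.1
  vertex : ∀ v a b, (γ v).vertex.r a b ↔ G.vertex.r a.1 b.1
  edge : ∀ v a b, (γ v).edge a b ↔ G.edge a.1 b.1 ∧ a.1 ∈ S ∧ b.1 ∈ S
  site_vertex : ∀ a b, G.vertex.r a b → σ a = σ b
  site_edge : ∀ a b, G.edge a b → a ∈ S → b ∈ S → σ a = σ b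
  edge_mem : ∀ a b, G.edge a b → (a ∈ S ↔ b ∈ S)
  outer_label : ∀ a, K.label a = G.label a.1
  outer_vertex : ∀ a b, K.vertex.r a b ↔ σ a.1 = σ b.1
  outer_edge : ∀ a b, K.edge a b ↔ G.edge a.1 b.1
  surj : ∀ v, ∃ a, a ∉ S ∧ σ a = v

namespace IsGluing

variable {V : Type} {G : HalfEdgeGraph T H} {S : Set H}
  {K : HalfEdgeGraph T {a // a ∉ S}} {σ : H → V} {γ : ∀ v, HalfEdgeGraph T {a // σ a = v}}

theorem site_of_block (h : G.IsGluing S K σ γ) {a b : H} (hab : (G.block S).r a b) :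
    σ a = σ b := by
  induction hab with
  | rel x y hxy => exact hxy.elim (h.site_vertex _ _) fun hh => h.site_edge _ _ hh.1 hh.2.1 hh.2.2
  | refl x => rfl
  | symm x y _ ih => exact ih.symm
  | trans x y z _ _ ih₁ ih₂ => exact ih₁.trans ih₂

theorem block_iff (h : G.IsGluing S K σ γ) (hγ : ∀ v, (γ v).ConnectedAvoiding ∅) {a b : H} :
    (G.block S).r a b ↔ σ a = σ b := by
  refine ⟨h.site_of_block, fun hab => ?_⟩
  exact eqvGen_map (r := fun x y => (γ (σ b)).vertex.r x y ∨
    ((γ (σ b)).edge x y ∧ x ∉ (∅ : Set _) ∧ y ∉ (∅ : Set _))) Subtype.val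
    (fun x y hxy => .rel _ _ (hxy.imp (h.vertex _ x y).1 fun hh => (h.edge _ x y).1 hh.1))
    (hγ (σ b) ⟨a, hab⟩ ⟨b, rfl⟩)

theorem vertexType [Finite H] (h : G.IsGluing S K σ γ) (v : V) (a : {a // σ a = v}) :
    (γ v).vertexType a = G.vertexType a.1 := by
  refine labels_eq_of_image Subtype.val ⟨fun b hb => (h.vertex v a b).1 hb,
    Subtype.val_injective.injOn, fun b hb => ?_⟩ fun b _ => (h.label v b).symm
  have hb' : σ b = v := (h.site_vertex _ _ hb).symm.trans a.2
  exact ⟨⟨b, hb'⟩, (h.vertex v a ⟨b, hb'⟩).2 hb, rfl⟩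

theorem isIso_component (h : G.IsGluing S K σ γ) (B : Quotient (G.block S)) (v : V)
    (hB : ∀ a, Quotient.mk (G.block S) a = B ↔ σ a = v) :
    (γ v).IsIso (G.component S B) (Equiv.subtypeEquivRight fun a => (hB a).symm) where
  label a := (h.label v a).symm
  vertex a b := (h.vertex v a b).symm
  edge a b := (h.edge v a b).symm

theorem connectedAvoiding (h : G.IsGluing S K σ γ) {X : Set H}
    (hγ : ∀ v, (γ v).ConnectedAvoiding {a | a.1 ∈ X ∧ a.1 ∈ S})
    (hK : K.ConnectedAvoiding {a | a.1 ∈ X}) : G.ConnectedAvoiding X := by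
  have hblock : ∀ a b, σ a = σ b →
      Relation.EqvGen (fun x y => G.vertex.r x y ∨ (G.edge x y ∧ x ∉ X ∧ y ∉ X)) a b := by
    intro a b hab
    refine eqvGen_map Subtype.val (fun x y hxy => .rel _ _ ?_) (hγ (σ b) ⟨a, hab⟩ ⟨b, rfl⟩)
    refine hxy.imp (h.vertex _ x y).1 fun hh => ?_
    obtain ⟨h1, h2, h3⟩ := (h.edge _ x y).1 hh.1
    exact ⟨h1, fun hx => hh.2.1 ⟨hx, h2⟩, fun hx => hh.2.2 ⟨hx, h3⟩⟩
  intro a b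
  obtain ⟨a', ha', haa⟩ := h.surj (σ a)
  obtain ⟨b', hb', hbb⟩ := h.surj (σ b)
  refine (hblock a a' haa.symm).trans _ _ _ (.trans _ _ _ ?_ (hblock b' b hbb))
  refine eqvGen_map Subtype.val (fun x y hxy => ?_) (hK ⟨a', ha'⟩ ⟨b', hb'⟩)
  rcases hxy with hxy | hxy
  · exact hblock _ _ ((h.outer_vertex x y).1 hxy)
  · exact .rel _ _ (.inr ⟨(h.outer_edge x y).1 hxy.1, hxy.2⟩)

theorem outer_connectedAvoiding (h : G.IsGluing S K σ γ) {X : Set H}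
    (hG : G.ConnectedAvoiding X) : K.ConnectedAvoiding {a | a.1 ∈ X} := by
  choose ρ hρS hρ using h.surj
  have hρ' : ∀ x : {a // a ∉ S}, K.vertex.r x ⟨ρ (σ x), hρS _⟩ := fun x =>
    (h.outer_vertex _ _).2 (hρ _).symm
  intro a b
  refine (Relation.EqvGen.rel _ _ (.inl (hρ' a))).trans _ _ _ (.trans _ _ _ ?_
    (Relation.EqvGen.rel _ _ (.inl (hρ' b))).symm)
  refine eqvGen_map (fun x => (⟨ρ (σ x), hρS _⟩ : {a // a ∉ S})) (fun x y hxy => ?_) (hG a b)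
  rcases hxy with hxy | ⟨hxy, hx, hy⟩
  · rw [h.site_vertex _ _ hxy]
    exact .refl _
  · by_cases hxS : x ∈ S
    · rw [h.site_edge _ _ hxy hxS ((h.edge_mem _ _ hxy).1 hxS)]
      exact .refl _
    · have hyS : y ∉ S := fun hy => hxS ((h.edge_mem _ _ hxy).2 hy)
      refine (Relation.EqvGen.rel _ _ (.inl (hρ' ⟨x, hxS⟩))).symm.trans _ _ _ (.trans _ _ _
        (.rel _ ⟨y, hyS⟩ (.inr ⟨(h.outer_edge _ _).2 hxy, hx, hy⟩))
        (Relation.EqvGen.rel _ _ (.inl (hρ' ⟨y, hyS⟩))))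

theorem onePI (h : G.IsGluing S K σ γ) (hγ : ∀ v, (γ v).OnePI) (hK : K.OnePI) : G.OnePI where
  nonempty := hK.nonempty.map Subtype.val
  connected := h.connectedAvoiding
    (fun v => (hγ v).connected.mono fun x hx => hx.1.elim) (hK.connected.mono fun x hx => hx.elim)
  bridgeless a b hab := by
    by_cases haS : a ∈ S
    · have hbS := (h.edge_mem _ _ hab).1 haS
      refine h.connectedAvoiding (fun v => ?_) (hK.connected.mono ?_)
      · by_cases hv : σ a = v
        · subst hv
          have hb := (h.site_edge _ _ hab haS hbS).symm
          refine ((hγ _).bridgeless ⟨a, rfl⟩ ⟨b, hb⟩ ((h.edge _ _ _).2 ⟨hab, haS, hbS⟩)).mono ?_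
          rintro x ⟨hx | hx, -⟩
          · exact .inl (Subtype.ext hx)
          · exact .inr (Subtype.ext hx)
        · refine (hγ v).connected.mono ?_
          rintro x ⟨hx | hx, -⟩
          · exact (hv (hx ▸ x.2)).elim
          · exact (hv ((h.site_edge _ _ hab haS hbS).trans (hx ▸ x.2))).elim
      · rintro x (hx | hx)
        · exact (x.2 (hx ▸ haS)).elim
        · exact (x.2 (hx ▸ hbS)).elim
    · have hbS : b ∉ S := fun hb => haS ((h.edge_mem _ _ hab).2 hb)
      refine h.connectedAvoiding (fun v => (hγ v).connected.mono ?_)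
        ((hK.bridgeless ⟨a, haS⟩ ⟨b, hbS⟩ ((h.outer_edge _ _).2 hab)).mono ?_)
      · rintro x ⟨hx | hx, hxS⟩
        · exact (haS (hx ▸ hxS)).elim
        · exact (hbS (hx ▸ hxS)).elim
      · rintro x (hx | hx)
        · exact .inl (Subtype.ext hx)
        · exact .inr (Subtype.ext hx)

theorem outer_onePI (h : G.IsGluing S K σ γ) (hG : G.OnePI) : K.OnePI where
  nonempty := by
    obtain ⟨a⟩ := hG.nonempty
    obtain ⟨b, hb, -⟩ := h.surj (σ a)
    exact ⟨⟨b, hb⟩⟩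
  connected := (h.outer_connectedAvoiding hG.connected).mono fun x hx => hx.elim
  bridgeless a b hab := (h.outer_connectedAvoiding
    (hG.bridgeless _ _ ((h.outer_edge _ _).1 hab))).mono (by
      rintro x (rfl | hx)
      · exact .inl rfl
      · rw [Set.mem_singleton_iff.1 hx]; exact .inr rfl)

theorem outer_isMatching (h : G.IsGluing S K σ γ) (hG : G.IsMatching) : K.IsMatching where
  symm a b hab := by
    rw [h.outer_edge] at hab ⊢
    exact hG.symm _ _ hab
  irrefl a ha := hG.irrefl _ ((h.outer_edge _ _).1 ha)
  unique a b c hb hc := by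
    rw [h.outer_edge] at hb hc
    exact Subtype.ext (hG.unique _ _ _ hb hc)
  label_edge a b hab := by
    rw [h.outer_label, h.outer_label]
    exact hG.label_edge _ _ ((h.outer_edge _ _).1 hab)

theorem isMatching (h : G.IsGluing S K σ γ) (hγ : ∀ v, (γ v).IsMatching) (hK : K.IsMatching) :
    G.IsMatching := by
  -- an edge is either an edge of some `γ v` or an edge of `K`
  have key : ∀ a b, G.edge a b → (∃ hb : σ b = σ a, a ∈ S ∧ (γ (σ a)).edge ⟨a, rfl⟩ ⟨b, hb⟩) ∨
      (∃ ha : a ∉ S, ∃ hb : b ∉ S, K.edge ⟨a, ha⟩ ⟨b, hb⟩) := by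
    intro a b hab
    by_cases haS : a ∈ S
    · have hbS := (h.edge_mem _ _ hab).1 haS
      exact .inl ⟨(h.site_edge _ _ hab haS hbS).symm, haS, (h.edge _ _ _).2 ⟨hab, haS, hbS⟩⟩
    · have hbS : b ∉ S := fun hb => haS ((h.edge_mem _ _ hab).2 hb)
      exact .inr ⟨haS, hbS, (h.outer_edge _ _).2 hab⟩
  refine ⟨fun a b hab => ?_, fun a ha => ?_, fun a b c hb hc => ?_, fun a b hab => ?_⟩
  · rcases key a b hab with ⟨hb, -, hh⟩ | ⟨ha, hb, hh⟩
    · exact ((h.edge _ _ _).1 ((hγ _).symm _ _ hh)).1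
    · exact (h.outer_edge _ _).1 (hK.symm _ _ hh)
  · rcases key a a ha with ⟨hb, -, hh⟩ | ⟨ha, hb, hh⟩
    · exact (hγ _).irrefl _ hh
    · exact hK.irrefl _ hh
  · rcases key a b hb with ⟨hb, haS, hh⟩ | ⟨ha, hb, hh⟩
    · rcases key a c hc with ⟨hc, -, hh'⟩ | ⟨ha', -, -⟩
      · exact congrArg Subtype.val ((hγ _).unique _ _ _ hh hh')
      · exact (ha' haS).elim
    · rcases key a c hc with ⟨hc, haS, hh'⟩ | ⟨ha', hc, hh'⟩
      · exact (ha haS).elim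
      · exact congrArg Subtype.val (hK.unique _ _ _ hh hh')
  · rcases key a b hab with ⟨hb, -, hh⟩ | ⟨ha, hb, hh⟩
    · have := (hγ _).label_edge _ _ hh
      rwa [h.label, h.label] at this
    · have := hK.label_edge _ _ hh
      rwa [h.outer_label, h.outer_label] at this

theorem isGraph [Finite H] (h : G.IsGluing S K σ γ) (hγ : ∀ v, (γ v).IsGraph)
    (hK : K.IsMatching) : G.IsGraph :=
  (h.isMatching (fun v => (hγ v).isMatching) hK).isGraph fun a => by
    have := (hγ (σ a)).vertex_mem ⟨a, rfl⟩
    rwa [h.vertexType] at this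

theorem outer_exists_edge (h : G.IsGluing S K σ γ) (a : {a // a ∉ S}) :
    (∃ b, K.edge a b) ↔ ∃ b, G.edge a.1 b :=
  ⟨fun ⟨b, hb⟩ => ⟨b.1, (h.outer_edge _ _).1 hb⟩, fun ⟨b, hb⟩ =>
    ⟨⟨b, fun hbS => a.2 ((h.edge_mem _ _ hb).2 hbS)⟩, (h.outer_edge _ _).2 hb⟩⟩

theorem outer_residue [Finite H] (h : G.IsGluing S K σ γ) (hS : ∀ a ∈ S, ∃ b, G.edge a b) :
    K.residue = G.residue := by
  refine labels_eq_of_image Subtype.val ⟨fun a ha => ?_, Subtype.val_injective.injOn,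
    fun a ha => ?_⟩ fun a _ => (h.outer_label a).symm
  · exact fun hh => ha ((h.outer_exists_edge a).2 hh)
  · exact ⟨⟨a, fun haS => ha (hS a haS)⟩, fun hh => ha ((h.outer_exists_edge _).1 hh), rfl⟩

/-- The vertex of `K` that belongs to `v` has the same half-edges as the legs of `γ v`. -/
theorem outer_vertexType [Finite H] (h : G.IsGluing S K σ γ)
    (hS : ∀ v a, (∃ b, (γ v).edge a b) ↔ a.1 ∈ S) (a : {a // a ∉ S}) :
    K.vertexType a = (γ (σ a.1)).residue := by
  let f : {b | K.vertex.r a b} ≃ {b : {b // σ b = σ a.1} | ¬ ∃ c, (γ (σ a.1)).edge b c} :=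
    { toFun := fun b => ⟨⟨b.1.1, ((h.outer_vertex _ _).1 b.2).symm⟩,
        fun hh => b.1.2 ((hS _ _).1 hh)⟩
      invFun := fun b => ⟨⟨b.1.1, fun hb => b.2 ((hS _ _).2 hb)⟩,
        (h.outer_vertex _ _).2 b.1.2.symm⟩
      left_inv := fun _ => rfl
      right_inv := fun _ => rfl }
  exact labels_congr f fun b => (h.label _ _).trans (h.outer_label _).symm

theorem admissible [Finite H] (h : G.IsGluing S K σ γ) (hγ : ∀ v, (γ v).OnePI)
    (hS : ∀ v a, (∃ b, (γ v).edge a b) ↔ a.1 ∈ S)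
    (hr : ∀ v, (∃ a : {a // σ a = v}, a.1 ∈ S) → (γ v).residue ∈ T.amplitudes) :
    G.Admissible S where
  closed a ha := by
    obtain ⟨b, hb⟩ := (hS (σ a) ⟨a, rfl⟩).2 ha
    have := (h.edge _ _ _).1 hb
    exact ⟨b.1, this.2.2, this.1⟩
  component a ha := by
    have hi := h.isIso_component (Quotient.mk (G.block S) a) (σ a) fun b =>
      ⟨fun hh => h.site_of_block (Quotient.exact hh),
        fun hh => Quotient.sound ((h.block_iff fun v => (hγ v).connected).2 hh)⟩
    exact ⟨hi.onePI (hγ _), hi.residue ▸ hr _ ⟨⟨a, rfl⟩, ha⟩⟩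

/-- The loop number is additive. -/
theorem loops [Finite H] [Fintype V] (h : G.IsGluing S K σ γ) (hG : G.IsMatching)
    (hγm : ∀ v, (γ v).IsMatching) (hγ : ∀ v, (γ v).OnePI) (hK : K.OnePI)
    (hS : ∀ v a, (∃ b, (γ v).edge a b) ↔ a.1 ∈ S) :
    G.loops = K.loops + ∑ v, (γ v).loops := by
  classical
  have := Fintype.ofFinite H
  have := hK.nonempty
  have hE : 2 * G.edges.ncard = 2 * K.edges.ncard + ∑ v, 2 * (γ v).edges.ncard := by
    rw [hG.two_mul_ncard_edges, (h.outer_isMatching hG).two_mul_ncard_edges]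
    simp_rw [fun v => (hγm v).two_mul_ncard_edges]
    rw [← Nat.card_sigma, ← Nat.card_sum]
    refine Nat.card_congr (Equiv.symm ?_)
    exact
      { toFun := Sum.elim (fun a => ⟨a.1.1, (h.outer_exists_edge _).1 a.2⟩)
          (fun a => ⟨a.2.1.1, by
            obtain ⟨b, hb⟩ := a.2.2
            exact ⟨b.1, ((h.edge _ _ _).1 hb).1⟩⟩)
        invFun := fun a => if ha : a.1 ∈ S then .inr ⟨σ a.1, ⟨a.1, rfl⟩, (hS _ _).2 ha⟩
          else .inl ⟨⟨a.1, ha⟩, (h.outer_exists_edge _).2 a.2⟩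
        left_inv := by
          rintro (⟨⟨a, ha⟩, ha'⟩ | ⟨v, ⟨a, rfl⟩, ha⟩)
          · simp [ha]
          · have : a ∈ S := (hS _ _).1 ha
            simp [this]
        right_inv := by
          rintro ⟨a, ha⟩
          by_cases haS : a ∈ S <;> simp [haS] }
  have hV : Nat.card (Quotient G.vertex) = ∑ v, Nat.card (Quotient (γ v).vertex) := by
    rw [← Nat.card_sigma]
    refine Nat.card_congr (Equiv.symm (Equiv.ofBijective (fun x : Σ v, Quotient (γ v).vertex =>
      Quotient.map' (s₂ := G.vertex) Subtype.val (fun a b hab => (h.vertex x.1 a b).1 hab) x.2)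
      ⟨?_, ?_⟩))
    · rintro ⟨v, x⟩ ⟨w, y⟩ hxy
      induction x using Quotient.inductionOn with | _ a => ?_
      induction y using Quotient.inductionOn with | _ b => ?_
      have hab : G.vertex.r a.1 b.1 := Quotient.exact hxy
      obtain ⟨a, rfl⟩ := a
      obtain ⟨b, rfl⟩ := b
      have hs := h.site_vertex _ _ hab
      have key : ∀ (w : V) (hw : σ b = w) , σ a = w →
          (⟨σ a, Quotient.mk _ ⟨a, rfl⟩⟩ : Σ v, Quotient (γ v).vertex) =
            ⟨w, Quotient.mk _ ⟨b, hw⟩⟩ := by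
        rintro w hw rfl
        congr 1
        exact Quotient.sound ((h.vertex _ _ _).2 hab)
      exact key _ rfl hs
    · intro x
      induction x using Quotient.inductionOn with | _ a => ?_
      exact ⟨⟨σ a, Quotient.mk _ ⟨a, rfl⟩⟩, rfl⟩
  have hKV : Nat.card (Quotient K.vertex) = Fintype.card V := by
    rw [← Nat.card_eq_fintype_card]
    refine Nat.card_congr (Equiv.ofBijective (Quotient.lift (fun a : {a // a ∉ S} => σ a.1)
      fun a b hab => (h.outer_vertex a b).1 hab) ⟨?_, fun v => ?_⟩)
    · intro x y hxy
      induction x using Quotient.inductionOn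
      induction y using Quotient.inductionOn
      exact Quotient.sound ((h.outer_vertex _ _).2 hxy)
    · obtain ⟨a, ha, hav⟩ := h.surj v
      exact ⟨Quotient.mk _ ⟨a, ha⟩, hav⟩
  have hle := hK.connected.card_vertices_le
  have hle' : ∀ v, Nat.card (Quotient (γ v).vertex) ≤ (γ v).edges.ncard + 1 := fun v => by
    have := (hγ v).nonempty
    exact (hγ v).connected.card_vertices_le
  have hsum : ∑ v, (γ v).loops + ∑ v, Nat.card (Quotient (γ v).vertex) =
      ∑ v, (γ v).edges.ncard + Fintype.card V := by
    rw [← Finset.sum_add_distrib, Fintype.card, Finset.card_eq_sum_ones, ← Finset.sum_add_distrib]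
    exact Finset.sum_congr rfl fun v _ => Nat.sub_add_cancel (hle' v)
  rw [← Finset.mul_sum] at hE
  have h1 : G.loops = G.edges.ncard + 1 - Nat.card (Quotient G.vertex) := rfl
  have h2 : K.loops = K.edges.ncard + 1 - Nat.card (Quotient K.vertex) := rfl
  omega

theorem twoLegged_iff [Finite H] (h : G.IsGluing S K σ γ) (hγ : ∀ v, (γ v).ConnectedAvoiding ∅)
    (hS : ∀ v a, (∃ b, (γ v).edge a b) ↔ a.1 ∈ S) (a : {a // a ∉ S}) :
    G.TwoLegged S a.1 ↔ K.Bivalent a := by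
  have hi := h.isIso_component (Quotient.mk (G.block S) a.1) (σ a.1) fun b =>
    ⟨fun hh => h.site_of_block (Quotient.exact hh), fun hh => Quotient.sound ((h.block_iff hγ).2 hh)⟩
  unfold TwoLegged Bivalent
  rw [hi.residue, h.outer_vertexType hS]

/-- The contraction of a subgraph is obtained in two steps: first shrink its components to
vertices, then erase the vertices with two half-edges. -/
theorem smooth_iso_contract [Finite H] (h : G.IsGluing S K σ γ)
    (hγ : ∀ v, (γ v).ConnectedAvoiding ∅)
    (hS : ∀ v a, (∃ b, (γ v).edge a b) ↔ a.1 ∈ S) :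
    ∃ e, K.smooth.IsIso (G.contract S) e := by
  have htl := h.twoLegged_iff hγ hS
  let e : {a : {a // a ∉ S} // ¬ K.Bivalent a} ≃ {a : H // a ∉ S ∧ ¬ G.TwoLegged S a} :=
    { toFun := fun a => ⟨a.1.1, a.1.2, fun hh => a.2 ((htl a.1).1 hh)⟩
      invFun := fun a => ⟨⟨a.1, a.2.1⟩, fun hh => a.2.2 ((htl _).2 hh)⟩
      left_inv := fun _ => rfl
      right_inv := fun _ => rfl }
  refine ⟨e, fun a => (h.outer_label a.1).symm, fun a b => ?_, fun a b => ?_⟩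
  · exact (h.block_iff hγ).trans (h.outer_vertex a.1 b.1).symm
  · refine and_congr (not_congr e.injective.eq_iff) ⟨fun hab => ?_, fun hab => ?_⟩
    · have key : ∀ x y : H, Relation.EqvGen (fun x y => x ∉ S ∧ y ∉ S ∧
          (G.edge x y ∨ ((G.block S).r x y ∧ G.TwoLegged S x))) x y →
          x = y ∨ ∃ hx hy, K.Chain ⟨x, hx⟩ ⟨y, hy⟩ := by
        intro x y hxy
        induction hxy with
        | rel x y hxy =>
          obtain ⟨hx, hy, hh⟩ := hxy
          refine .inr ⟨hx, hy, .rel _ _ (hh.imp (h.outer_edge ⟨x, hx⟩ ⟨y, hy⟩).2 fun hh => ?_)⟩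
          exact ⟨(h.outer_vertex _ _).2 (h.site_of_block hh.1), (htl ⟨x, hx⟩).1 hh.2⟩
        | refl x => exact .inl rfl
        | symm x y _ ih =>
          rcases ih with rfl | ⟨hx, hy, hh⟩
          · exact .inl rfl
          · exact .inr ⟨hy, hx, hh.symm⟩
        | trans x y z _ _ ih₁ ih₂ =>
          rcases ih₁ with rfl | ⟨hx, hy, hh⟩
          · exact ih₂
          · rcases ih₂ with rfl | ⟨hy', hz, hh'⟩
            · exact .inr ⟨hx, hy, hh⟩
            · exact .inr ⟨hx, hz, hh.trans _ _ _ hh'⟩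
      rcases key _ _ hab with hh | ⟨hx, hy, hh⟩
      · have : a.1 = b.1 := Subtype.ext hh
        rw [this]
        exact .refl _
      · exact hh
    · refine eqvGen_map (a := a.1) (b := b.1) Subtype.val
        (fun x y hxy => .rel _ _ ⟨x.2, y.2, ?_⟩) hab
      exact hxy.imp (h.outer_edge x y).1 fun hh =>
        ⟨(h.block_iff hγ).2 ((h.outer_vertex _ _).1 hh.1), (htl x).2 hh.2⟩

end IsGluing

end HalfEdgeGraph

end

section

/-! ### Finiteness -/

/-- The labels that occur in the vertices and amplitudes of the theory. -/
def Theory.labelSet (T : Theory) : Set T.Leg :=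
  {f | ∃ v, (v ∈ T.vertexTypes ∨ v ∈ T.amplitudes) ∧ f ∈ v}

theorem Theory.finite_labelSet (T : Theory) : T.labelSet.Finite := by
  classical
  refine Set.Finite.subset
    ((T.vertexTypes ∪ T.amplitudes).biUnion fun v => v.toFinset).finite_toSet ?_
  rintro f ⟨v, hv, hf⟩
  simp only [Finset.coe_biUnion, Set.mem_iUnion]
  exact ⟨v, by simpa using hv, by simpa using hf⟩

theorem Theory.two_le_card (T : Theory) {r : Multiset T.Leg} (hr : r ∈ T.amplitudes) :
    2 ≤ Multiset.card r := by
  rcases T.amplitudes_spec r hr with h | ⟨f, rfl⟩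
  · exact (T.three_le_card r h).trans' (by norm_num)
  · simp

namespace HalfEdgeGraph

variable {T : Theory} {H H' : Type}

/-- There are finitely many graphs on a finite set of half-edges with labels in a finite set. -/
theorem finite_of_label_mem [Finite H] (p : HalfEdgeGraph T H → Prop)
    (hp : ∀ G, p G → ∀ a, G.label a ∈ T.labelSet) : Finite {G // p G} := by
  have := T.finite_labelSet.to_subtype
  refine Finite.of_injective (β := (H → T.labelSet) × (H → H → Prop) × (H → H → Prop))
    (fun G => (fun a => ⟨G.1.label a, hp _ G.2 a⟩, G.1.vertex.r, G.1.edge)) ?_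
  rintro ⟨G, hG⟩ ⟨G', hG'⟩ h
  simp only [Prod.mk.injEq] at h
  refine Subtype.ext (ext_iff' (fun a => ?_) (fun a b => ?_) (fun a b => ?_))
  · exact congrArg Subtype.val (congrFun h.1 a)
  · rw [h.2.1]
  · rw [h.2.2]

theorem IsGraph.label_mem [Finite H] {G : HalfEdgeGraph T H} (h : G.IsGraph) (a : H) :
    G.label a ∈ T.labelSet :=
  ⟨_, .inl (h.vertex_mem a), G.label_mem_vertexType a⟩

theorem IsShrunk.label_mem [Finite H] {r : Multiset T.Leg} {G : HalfEdgeGraph T H}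
    (h : G.IsShrunk r) (a : H) : G.label a ∈ T.labelSet :=
  ⟨_, h.type_mem a, G.label_mem_vertexType a⟩

instance [Finite H] (r : Multiset T.Leg) : Finite {G : HalfEdgeGraph T H // G.IsShrunk r} :=
  finite_of_label_mem _ fun _ h => h.label_mem

instance [Finite H] (r : Multiset T.Leg) : Finite {G : HalfEdgeGraph T H // G.IsFeynman r} :=
  finite_of_label_mem _ fun _ h => h.isGraph.label_mem

instance {J : Type} [Finite J] (D : Set J) (ℓ : D → T.Leg) :
    Finite {γ : HalfEdgeGraph T J // γ.IsFilling D ℓ} :=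
  finite_of_label_mem _ fun _ h => h.isGraph.label_mem

/-! ### Reconstructing a graph from its shrunk graph and the components of the subgraph -/

/-- The graph composed of the graphs `γ v`, on the fibres of `σ`, and of the edges of `K`. -/
def glue {V : Type} (S : Set H) (K : HalfEdgeGraph T {a // a ∉ S}) (σ : H → V)
    (γ : ∀ v, HalfEdgeGraph T {a // σ a = v}) : HalfEdgeGraph T H where
  label a := (γ (σ a)).label ⟨a, rfl⟩
  vertex :=
    { r := fun a b => ∃ v, ∃ (ha : σ a = v) (hb : σ b = v), (γ v).vertex.r ⟨a, ha⟩ ⟨b, hb⟩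
      iseqv :=
        { refl := fun a => ⟨σ a, rfl, rfl, (γ _).vertex.refl' _⟩
          symm := fun ⟨v, ha, hb, h⟩ => ⟨v, hb, ha, (γ v).vertex.symm' h⟩
          trans := by
            rintro a b c ⟨v, ha, hb, h⟩ ⟨w, hb', hc, h'⟩
            obtain rfl : v = w := hb.symm.trans hb'
            exact ⟨v, ha, hc, (γ v).vertex.trans' h h'⟩ } }
  edge a b := (∃ v, ∃ (ha : σ a = v) (hb : σ b = v), (γ v).edge ⟨a, ha⟩ ⟨b, hb⟩) ∨
    ∃ (ha : a ∉ S) (hb : b ∉ S), K.edge ⟨a, ha⟩ ⟨b, hb⟩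

theorem isGluing_glue {V : Type} {S : Set H} {K : HalfEdgeGraph T {a // a ∉ S}} {σ : H → V}
    {γ : ∀ v, HalfEdgeGraph T {a // σ a = v}}
    (hl : ∀ v (a : {a // σ a = v}) (ha : a.1 ∉ S), (γ v).label a = K.label ⟨a.1, ha⟩)
    (hS : ∀ v a b, (γ v).edge a b → a.1 ∈ S ∧ b.1 ∈ S)
    (hK : ∀ a b, K.vertex.r a b ↔ σ a.1 = σ b.1)
    (hs : ∀ v, ∃ a, a ∉ S ∧ σ a = v) : (glue S K σ γ).IsGluing S K σ γ where
  label := by rintro v ⟨a, rfl⟩; rfl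
  vertex v a b := by
    constructor
    · intro h
      exact ⟨v, a.2, b.2, h⟩
    · rintro ⟨w, ha, hb, h⟩
      obtain rfl : v = w := a.2.symm.trans ha
      exact h
  edge v a b := by
    constructor
    · intro h
      exact ⟨.inl ⟨v, a.2, b.2, h⟩, hS _ _ _ h⟩
    · rintro ⟨⟨w, ha, hb, h⟩ | ⟨ha, -, -⟩, haS, -⟩
      · obtain rfl : v = w := a.2.symm.trans ha
        exact h
      · exact (ha haS).elim
  site_vertex := by
    rintro a b ⟨v, ha, hb, -⟩
    exact ha.trans hb.symm
  site_edge := by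
    rintro a b (⟨v, ha, hb, -⟩ | ⟨ha, -, -⟩) haS -
    · exact ha.trans hb.symm
    · exact (ha haS).elim
  edge_mem := by
    rintro a b (⟨v, ha, hb, h⟩ | ⟨ha, hb, -⟩)
    · exact iff_of_true (hS _ _ _ h).1 (hS _ _ _ h).2
    · exact iff_of_false ha hb
  outer_label a := (hl _ ⟨a.1, rfl⟩ a.2).symm
  outer_vertex := hK
  outer_edge a b := by
    constructor
    · intro h
      exact .inr ⟨a.2, b.2, h⟩
    · rintro (⟨v, ha, hb, h⟩ | ⟨_, _, h⟩)
      · exact (a.2 (hS _ _ _ h).1).elim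
      · exact h
  surj := hs

theorem IsGluing.unique {V : Type} {G G' : HalfEdgeGraph T H} {S : Set H}
    {K : HalfEdgeGraph T {a // a ∉ S}} {σ : H → V} {γ : ∀ v, HalfEdgeGraph T {a // σ a = v}}
    (h : G.IsGluing S K σ γ) (h' : G'.IsGluing S K σ γ) : G = G' := by
  have hv : ∀ {G G' : HalfEdgeGraph T H}, G.IsGluing S K σ γ → G'.IsGluing S K σ γ →
      ∀ a b, G.vertex.r a b → G'.vertex.r a b := fun h h' a b hab =>
    (h'.vertex (σ b) ⟨a, h.site_vertex _ _ hab⟩ ⟨b, rfl⟩).1 ((h.vertex _ _ _).2 hab)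
  have he : ∀ {G G' : HalfEdgeGraph T H}, G.IsGluing S K σ γ → G'.IsGluing S K σ γ →
      ∀ a b, G.edge a b → G'.edge a b := by
    intro G G' h h' a b hab
    by_cases haS : a ∈ S
    · have hbS := (h.edge_mem _ _ hab).1 haS
      exact ((h'.edge (σ b) ⟨a, h.site_edge _ _ hab haS hbS⟩ ⟨b, rfl⟩).1
        ((h.edge _ _ _).2 ⟨hab, haS, hbS⟩)).1
    · have hbS : b ∉ S := fun hb => haS ((h.edge_mem _ _ hab).2 hb)
      exact (h'.outer_edge ⟨a, haS⟩ ⟨b, hbS⟩).1 ((h.outer_edge _ _).2 hab)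
  exact ext_iff' (fun a => (h.label _ ⟨a, rfl⟩).symm.trans (h'.label _ _))
    (fun a b => ⟨hv h h' a b, hv h' h a b⟩) (fun a b => ⟨he h h' a b, he h' h a b⟩)

/-- The assignments of all half-edges to vertices of `K` that extend the given one. -/
abbrev Sites (S : Set H) (K : HalfEdgeGraph T {a // a ∉ S}) : Type :=
  {σ : H → Quotient K.vertex // ∀ b (hb : b ∉ S), σ b = Quotient.mk _ ⟨b, hb⟩}

/-- The graphs that may replace the vertex `v` of `K`, on the half-edges that `σ` assigns to it. -/
abbrev Filling [Finite H] (S : Set H) (K : HalfEdgeGraph T {a // a ∉ S})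
    (σ : H → Quotient K.vertex) (v : Quotient K.vertex) : Type :=
  {γ : HalfEdgeGraph T {a // σ a = v} // γ.IsFilling {a : {a // σ a = v} | a.1 ∉ S}
    fun a => K.label ⟨a.1.1, a.2⟩}

theorem block_vertex_or {G : HalfEdgeGraph T H} {S : Set H} {a b : H} (hab : (G.block S).r a b) :
    G.vertex.r a b ∨ ∃ c ∈ S, (G.block S).r a c := by
  induction hab with
  | rel x y hxy => exact hxy.imp_right fun hh => ⟨x, hh.2.1, .refl x⟩
  | refl x => exact .inl (G.vertex.refl' x)
  | symm x y hxy ih =>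
    rcases ih with hh | ⟨c, hc, hh⟩
    · exact .inl (G.vertex.symm' hh)
    · exact .inr ⟨c, hc, hxy.symm.trans _ _ _ hh⟩
  | trans x y z hxy _ ih₁ ih₂ =>
    rcases ih₁ with h₁ | hh
    · rcases ih₂ with h₂ | ⟨c, hc, hh⟩
      · exact .inl (G.vertex.trans' h₁ h₂)
      · exact .inr ⟨c, hc, hxy.trans _ _ _ hh⟩
    · exact .inr hh

section Fillings

variable [Finite H] {S : Set H} {K : HalfEdgeGraph T {a // a ∉ S}} {r : Multiset T.Leg}

theorem IsFilling.exists_edge_iff' {σ : H → Quotient K.vertex} (γ : ∀ v, Filling S K σ v) (v)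
    (a : {a // σ a = v}) : (∃ b, (γ v).1.edge a b) ↔ a.1 ∈ S :=
  ((γ v).2.exists_edge_iff a).trans not_not

theorem isGluing_of_filling (σ : Sites S K) (γ : ∀ v, Filling S K σ.1 v) :
    (glue S K σ.1 fun v => (γ v).1).IsGluing S K σ.1 fun v => (γ v).1 := by
  refine isGluing_glue (fun v a ha => (γ v).2.label_eq ⟨a, ha⟩) (fun v a b hab => ?_)
    (fun a b => ?_) (fun v => ?_)
  · exact ⟨(IsFilling.exists_edge_iff' γ _ _).1 ⟨b, hab⟩,
      (IsFilling.exists_edge_iff' γ _ _).1 ⟨a, (γ v).2.isGraph.symm _ _ hab⟩⟩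
  · rw [σ.2 _ a.2, σ.2 _ b.2, Quotient.eq]
  · induction v using Quotient.inductionOn with | _ a => exact ⟨a.1, a.2, σ.2 _ a.2⟩

/-- What a gluing of fillings into a shrunk graph satisfies. -/
theorem IsGluing.spec {G : HalfEdgeGraph T H} {σ : Sites S K} {γ : ∀ v, Filling S K σ.1 v}
    (h : G.IsGluing S K σ.1 fun v => (γ v).1) (hK : K.IsShrunk r) :
    G.IsFeynman r ∧ G.Admissible S ∧ G.shrink S = K := by
  have hS := IsFilling.exists_edge_iff' γ
  have hadm := h.admissible (fun v => (γ v).2.onePI) hS fun v ⟨a, ha⟩ =>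
    (γ v).2.residue_mem ⟨a, not_not.2 ha⟩
  refine ⟨⟨h.isGraph (fun v => (γ v).2.isGraph) hK.isMatching,
    h.onePI (fun v => (γ v).2.onePI) hK.onePI, ?_, ?_⟩, hadm, ?_⟩
  · rw [← hK.residue_eq]
    exact (h.outer_residue fun a ha => let ⟨b, _, hb⟩ := hadm.closed a ha; ⟨b, hb⟩).symm
  · obtain ⟨a, b, hab⟩ := hK.has_edge
    exact ⟨_, _, (h.outer_edge _ _).1 hab⟩
  · exact ext_iff' (fun a => (h.outer_label a).symm)
      (fun a b => (h.block_iff fun v => (γ v).2.onePI.connected).trans (h.outer_vertex a b).symm)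
      fun a b => (h.outer_edge a b).symm

theorem Admissible.exists_leg {G : HalfEdgeGraph T H} (h : G.Admissible S) (a : H) :
    ∃ b, b ∉ S ∧ (G.block S).r b a := by
  by_cases ha : a ∈ S
  · have h2 := T.two_le_card (h.component a ha).2
    have : (G.component S (Quotient.mk (G.block S) a)).residue ≠ 0 := by
      intro h0
      rw [h0] at h2
      simp at h2
    obtain ⟨f, hf⟩ := Multiset.exists_mem_of_ne_zero this
    obtain ⟨⟨b, hb⟩, hbe, -⟩ := (mem_labels _ _ _).1 hf
    have hba : (G.block S).r b a := Quotient.exact hb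
    refine ⟨b, fun hbS => hbe ?_, hba⟩
    obtain ⟨c, hcS, hbc⟩ := h.closed b hbS
    refine ⟨⟨c, Quotient.sound (?_ : (G.block S).r c a)⟩, hbc, hbS, hcS⟩
    exact ((Relation.EqvGen.rel _ _ (.inr ⟨hbc, hbS, hcS⟩)).symm).trans _ _ _ hba
  · exact ⟨a, ha, .refl a⟩

/-- Every pair of a graph and an admissible subgraph is a gluing. -/
theorem Admissible.exists_gluing {G : HalfEdgeGraph T H} (hG : G.IsGraph) (h : G.Admissible S) :
    ∃ (σ : Sites S (G.shrink S)) (γ : ∀ v, Filling S (G.shrink S) σ.1 v),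
      G.IsGluing S (G.shrink S) σ.1 fun v => (γ v).1 := by
  choose ρ hρS hρ using h.exists_leg
  let σ : H → Quotient (G.shrink S).vertex := fun a => Quotient.mk _ ⟨ρ a, hρS a⟩
  have hσ : ∀ a b, σ a = σ b ↔ (G.block S).r a b := by
    intro a b
    refine Quotient.eq.trans (Iff.trans (Iff.rfl : _ ↔ (G.block S).r (ρ a) (ρ b)) ?_)
    exact ⟨fun hh => (hρ a).symm.trans _ _ _ (hh.trans _ _ _ (hρ b)),
      fun hh => (hρ a).trans _ _ _ (hh.trans _ _ _ (hρ b).symm)⟩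
  have hσ' : ∀ b (hb : b ∉ S), σ b = Quotient.mk _ ⟨b, hb⟩ := fun b hb =>
    Quotient.sound (s := (G.shrink S).vertex) (hρ b : (G.block S).r (ρ b) b)
  let γ : ∀ v, HalfEdgeGraph T {a // σ a = v} := fun v =>
    { label := fun a => G.label a.1
      vertex := G.vertex.comap Subtype.val
      edge := fun a b => G.edge a.1 b.1 ∧ a.1 ∈ S ∧ b.1 ∈ S }
  have hmem : ∀ a b, G.edge a b → a ∈ S → b ∈ S := by
    intro a b hab haS
    obtain ⟨c, hcS, hac⟩ := h.closed a haS
    rwa [hG.unique _ _ _ hab hac]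
  have hgl : G.IsGluing S (G.shrink S) σ γ :=
    { label := fun _ _ => rfl
      vertex := fun _ _ _ => Iff.rfl
      edge := fun _ _ _ => Iff.rfl
      site_vertex := fun a b hab => (hσ a b).2 (.rel _ _ (.inl hab))
      site_edge := fun a b hab ha hb => (hσ a b).2 (.rel _ _ (.inr ⟨hab, ha, hb⟩))
      edge_mem := fun a b hab => ⟨hmem a b hab, hmem b a (hG.symm _ _ hab)⟩
      outer_label := fun _ => rfl
      outer_vertex := fun a b => (hσ a b).symm
      outer_edge := fun _ _ => Iff.rfl
      surj := fun v => by
        induction v using Quotient.inductionOn with | _ a => exact ⟨a.1, a.2, hσ' _ a.2⟩ }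
  have hS : ∀ v a, (∃ b, (γ v).edge a b) ↔ a.1 ∈ S := by
    rintro v ⟨a, rfl⟩
    refine ⟨fun ⟨b, hb⟩ => hb.2.1, fun ha => ?_⟩
    obtain ⟨b, hbS, hab⟩ := h.closed a ha
    exact ⟨⟨b, ((hσ _ _).2 (.rel _ _ (.inr ⟨hab, ha, hbS⟩))).symm⟩, hab, ha, hbS⟩
  have hcomp : ∀ a, (γ (σ a)).IsIso (G.component S (Quotient.mk (G.block S) a)) _ := fun a =>
    hgl.isIso_component _ _ fun b => Quotient.eq.trans (hσ b a).symm
  have hpi : ∀ v, (γ v).OnePI := by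
    intro v
    by_cases hv : ∃ a : {a // σ a = v}, a.1 ∈ S
    · obtain ⟨⟨a, rfl⟩, ha⟩ := hv
      exact (hcomp a).symm.onePI (h.component a ha).1
    · refine ⟨?_, fun a b => ?_, fun a b hab => (hv ⟨a, hab.2.1⟩).elim⟩
      · obtain ⟨a, -, ha⟩ := hgl.surj v
        exact ⟨⟨a, ha⟩⟩
      · refine .rel _ _ (.inl ?_)
        refine (block_vertex_or ((hσ _ _).1 (a.2.trans b.2.symm))).resolve_right ?_
        rintro ⟨c, hc, hac⟩
        exact hv ⟨⟨c, ((hσ _ _).2 hac).symm.trans a.2⟩, hc⟩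
  have hfill : ∀ v, (γ v).IsFilling {a : {a // σ a = v} | a.1 ∉ S}
      fun a => (G.shrink S).label ⟨a.1.1, a.2⟩ := by
    intro v
    refine ⟨⟨?_, ?_, ?_, ?_, ?_⟩, hpi v, fun a => (hS v a).trans not_not.symm, fun _ => rfl, ?_⟩
    · exact fun a b hab => ⟨hG.symm _ _ hab.1, hab.2.2, hab.2.1⟩
    · exact fun a ha => hG.irrefl _ ha.1
    · exact fun a b c hab hac => Subtype.ext (hG.unique _ _ _ hab.1 hac.1)
    · exact fun a b hab => hG.label_edge _ _ hab.1
    · exact fun a => hgl.vertexType v a ▸ hG.vertex_mem a.1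
    · rintro ⟨⟨a, rfl⟩, ha⟩
      have ha : a ∈ S := not_not.1 ha
      exact (hcomp a).residue ▸ (h.component a ha).2
  exact ⟨⟨σ, hσ'⟩, fun v => ⟨γ v, hfill v⟩, hgl⟩

/-- The legs of a filling form a vertex of the theory or an amplitude. -/
theorem IsFilling.residue_mem' {J : Type} [Finite J] {D : Set J} {ℓ : D → T.Leg}
    {γ : HalfEdgeGraph T J} (h : γ.IsFilling D ℓ) :
    γ.residue ∈ T.vertexTypes ∨ γ.residue ∈ T.amplitudes := by
  by_cases hD : ∃ a, a ∉ D
  · exact .inr (h.residue_mem hD)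
  · left
    have hne : ¬ ∃ a b, γ.edge a b := fun ⟨a, hab⟩ => hD ⟨a, (h.exists_edge_iff a).1 hab⟩
    obtain ⟨a⟩ := h.onePI.nonempty
    convert h.isGraph.vertex_mem a using 1
    refine labels_eq_of_image id ⟨fun b _ => h.onePI.connected.vertex_of_no_edge hne a b,
      Function.injective_id.injOn, fun b _ => ⟨b, fun ⟨c, hc⟩ => hne ⟨b, c, hc⟩, rfl⟩⟩
      fun _ _ => rfl

theorem Admissible.isShrunk {G : HalfEdgeGraph T H} (hG : G.IsFeynman r) (h : G.Admissible S)
    (hS : ∃ a b, G.edge a b ∧ a ∉ S) : (G.shrink S).IsShrunk r := by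
  obtain ⟨σ, γ, hgl⟩ := h.exists_gluing hG.isGraph
  have hSS := IsFilling.exists_edge_iff' γ
  refine ⟨hgl.outer_isMatching hG.isGraph.isMatching, hgl.outer_onePI hG.onePI, ?_, ?_, ?_⟩
  · rw [← hG.residue_eq]
    exact hgl.outer_residue fun a ha => let ⟨b, _, hb⟩ := h.closed a ha; ⟨b, hb⟩
  · obtain ⟨a, b, hab, ha⟩ := hS
    exact ⟨⟨a, ha⟩, ⟨b, fun hb => ha ((hgl.edge_mem _ _ hab).2 hb)⟩, hab⟩
  · intro a
    rw [hgl.outer_vertexType hSS]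
    exact (γ _).2.residue_mem'

theorem IsGluing.finprod_component {G : HalfEdgeGraph T H} {σ : Sites S K}
    {γ : ∀ v, Filling S K σ.1 v} (h : G.IsGluing S K σ.1 fun v => (γ v).1)
    [Fintype (Quotient K.vertex)] :
    ∏ᶠ B : Quotient (G.block S), toAlgebra (G.component S B) = ∏ v, toAlgebra (γ v).1 := by
  have hb := fun a b => h.block_iff (a := a) (b := b) fun v => (γ v).2.onePI.connected
  let e : Quotient (G.block S) ≃ Quotient K.vertex :=
    Equiv.ofBijective (Quotient.lift σ.1 fun a b hab => (hb a b).1 hab) (by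
      constructor
      · intro x y hxy
        induction x using Quotient.inductionOn
        induction y using Quotient.inductionOn
        exact Quotient.sound ((hb _ _).2 hxy)
      · intro v
        obtain ⟨a, -, ha⟩ := h.surj v
        exact ⟨Quotient.mk _ a, ha⟩)
  rw [← finprod_eq_prod_of_fintype, ← finprod_comp_equiv e]
  refine finprod_congr fun B => ?_
  refine (h.isIso_component B (e B) fun a => ?_).toAlgebra
  induction B using Quotient.inductionOn with | _ b => exact Quotient.eq.trans (hb a b)

/-- The pairs of a graph and an admissible subgraph `S` with given shrunk graph `K` correspond to
the ways of filling the vertices of `K`. -/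
theorem sum_shrink_eq (hK : K.IsShrunk r) {C : Type} [CommRing C]
    (φ : GraphAlgebra T →+* C) [Fintype (Quotient K.vertex)] [Fintype (Sites S K)]
    [∀ σ v, Fintype (Filling S K σ v)]
    [Fintype {G : HalfEdgeGraph T H // G.IsFeynman r ∧ G.Admissible S ∧ G.shrink S = K}] :
    ∑ G : {G : HalfEdgeGraph T H // G.IsFeynman r ∧ G.Admissible S ∧ G.shrink S = K},
      φ (∏ᶠ B : Quotient (G.1.block S), toAlgebra (G.1.component S B)) =
    ∑ σ : Sites S K, ∏ v, ∑ γ : Filling S K σ.1 v, φ (toAlgebra γ.1) := by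
  classical
  simp_rw [Finset.prod_univ_sum, Fintype.piFinset_univ]
  rw [Finset.sum_sigma']
  symm
  refine Finset.sum_bij (fun x _ => ⟨glue S K x.1.1 fun v => (x.2 v).1,
    (isGluing_of_filling x.1 x.2).spec hK⟩) (fun _ _ => Finset.mem_univ _) ?_ ?_ ?_
  · rintro ⟨σ, γ⟩ - ⟨σ', γ'⟩ - heq
    have hg := isGluing_of_filling σ γ
    have hg' := isGluing_of_filling σ' γ'
    have heq' : (glue S K σ.1 fun v => (γ v).1) = glue S K σ'.1 fun v => (γ' v).1 :=
      congrArg Subtype.val heq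
    rw [← heq'] at hg'
    obtain rfl : σ = σ' := by
      refine Subtype.ext (funext fun a => ?_)
      obtain ⟨b, hb, hba⟩ := hg.surj (σ.1 a)
      rw [← hba, σ.2 b hb, ← σ'.2 b hb]
      exact hg'.site_of_block ((hg.block_iff fun v => (γ v).2.onePI.connected).2 hba)
    congr 1
    funext v
    refine Subtype.ext (ext_iff' (fun a => ?_) (fun a b => ?_) (fun a b => ?_))
    · exact (hg.label v a).trans (hg'.label v a).symm
    · exact (hg.vertex v a b).trans (hg'.vertex v a b).symm
    · exact (hg.edge v a b).trans (hg'.edge v a b).symm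
  · rintro ⟨G, hG, hadm, rfl⟩ -
    obtain ⟨σ, γ, hgl⟩ := hadm.exists_gluing hG.isGraph
    exact ⟨⟨σ, γ⟩, by simp, Subtype.ext ((isGluing_of_filling σ γ).unique hgl)⟩
  · rintro ⟨σ, γ⟩ -
    dsimp only
    rw [(isGluing_of_filling σ γ).finprod_component, map_prod]

end Fillings

end HalfEdgeGraph

end

section

open HalfEdgeGraph

variable {T : Theory} {H H' : Type}

/-! ### Labelled counting -/

theorem HalfEdgeGraph.autCard_pos [Finite H] (G : HalfEdgeGraph T H) : 0 < G.autCard := by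
  have : Nonempty {e : H ≃ H // G.IsIso G e} := ⟨⟨Equiv.refl H, IsIso.refl G⟩⟩
  exact Nat.card_pos

/-- Orbit counting: the relabellings of a graph with a given property. -/
theorem card_map_eq {J : Type} [Finite H] [Finite J] (G : HalfEdgeGraph T H)
    (p : HalfEdgeGraph T J → Prop) :
    Nat.card {e : H ≃ J // p (G.map e)} =
      Nat.card {γ : HalfEdgeGraph T J // p γ ∧ ∃ e, G.IsIso γ e} * G.autCard := by
  classical
  let f : {e : H ≃ J // p (G.map e)} → {γ : HalfEdgeGraph T J // p γ ∧ ∃ e, G.IsIso γ e} :=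
    fun e => ⟨G.map e.1, e.2, e.1, isIso_map _ _⟩
  have hfin : Finite {γ : HalfEdgeGraph T J // p γ ∧ ∃ e, G.IsIso γ e} := by
    refine Finite.of_surjective f fun ⟨γ, hγ, e, he⟩ => ?_
    exact ⟨⟨e, he.eq_map ▸ hγ⟩, Subtype.ext he.eq_map.symm⟩
  have := Fintype.ofFinite {γ : HalfEdgeGraph T J // p γ ∧ ∃ e, G.IsIso γ e}
  have hf : ∀ γ, Nat.card {e // f e = γ} = G.autCard := by
    rintro ⟨γ, hγ, e₀, he₀⟩
    refine Nat.card_congr ?_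
    have hiso : ∀ e : {e // f e = ⟨γ, hγ, e₀, he₀⟩}, G.IsIso γ e.1.1 := fun e => by
      have h : G.map e.1.1 = γ := congrArg Subtype.val e.2
      have h' := isIso_map e.1.1 G
      rwa [h] at h'
    exact
      { toFun := fun e => ⟨e.1.1.trans e₀.symm, (hiso e).trans he₀.symm⟩
        invFun := fun e => ⟨⟨e.1.trans e₀, (e.2.trans he₀).eq_map ▸ hγ⟩,
          Subtype.ext (e.2.trans he₀).eq_map.symm⟩
        left_inv := fun e => by ext; simp
        right_inv := fun e => by ext; simp }
  rw [Nat.card_congr (Equiv.sigmaFiberEquiv f).symm, Nat.card_sigma,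
    Finset.sum_congr rfl fun e _ => hf e, Finset.sum_const, smul_eq_mul, Finset.card_univ,
    ← Nat.card_eq_fintype_card]

/-- A sum over graphs on `J` with property `p` of a function of their isomorphism class, as a sum
over isomorphism classes. -/
theorem sum_class_eq {J : Type} [Finite J] (p : HalfEdgeGraph T J → Prop)
    [Fintype {γ : HalfEdgeGraph T J // p γ}] (cls : {γ : HalfEdgeGraph T J // p γ} → GraphClass T)
    (hcls : ∀ γ, ∃ e, (cls γ).rep.graph.IsIso γ.1 e) (s : Finset (GraphClass T))
    (hs : ∀ γ, cls γ ∈ s) {M : Type} [AddCommGroup M] [Module ℚ M] (F : GraphClass T → M) :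
    ∑ γ, F (cls γ) = ∑ q ∈ s, ((Nat.card {e : Fin q.rep.size ≃ J // p (q.rep.graph.map e)} : ℚ) /
      q.rep.graph.autCard) • F q := by
  classical
  rw [← Finset.sum_fiberwise_of_maps_to (s := Finset.univ) (t := s) (g := cls) fun γ _ => hs γ]
  refine Finset.sum_congr rfl fun q _ => ?_
  rw [Finset.sum_congr rfl fun γ hγ => by rw [(Finset.mem_filter.1 hγ).2], Finset.sum_const,
    card_map_eq]
  have hpos : (q.rep.graph.autCard : ℚ) ≠ 0 := by exact_mod_cast q.rep.graph.autCard_pos.ne'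
  rw [Nat.cast_mul, mul_div_cancel_right₀ _ hpos, Nat.cast_smul_eq_nsmul]
  congr 1
  rw [← Fintype.card_subtype, ← Nat.card_eq_fintype_card]
  refine Nat.card_congr
    { toFun := fun γ => ⟨γ.1.1, γ.1.2, by have h := hcls γ.1; rwa [γ.2] at h⟩
      invFun := fun γ => ⟨⟨γ.1, γ.2.1⟩, ?_⟩
      left_inv := fun _ => rfl
      right_inv := fun _ => rfl }
  obtain ⟨e, he⟩ := γ.2.2
  obtain ⟨e', he'⟩ := hcls ⟨γ.1, γ.2.1⟩
  exact eq_of_rep_iso he' he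

theorem exists_equiv_of_map_eq {α β ι : Type*} [Fintype α] [Fintype β] (f : α → ι) (g : β → ι)
    (h : (Finset.univ : Finset α).val.map f = (Finset.univ : Finset β).val.map g) :
    ∃ e : α ≃ β, ∀ a, g (e a) = f a := by
  classical
  have hc : ∀ x, Nonempty ({a // f a = x} ≃ {b // g b = x}) := by
    intro x
    refine Fintype.card_eq.1 ?_
    have := congrArg (Multiset.count x) h
    rw [Multiset.count_map, Multiset.count_map] at this
    rw [Fintype.card_subtype, Fintype.card_subtype]
    simpa [eq_comm, Finset.card_def, Finset.filter_val] using this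
  refine ⟨(Equiv.sigmaFiberEquiv f).symm.trans
    ((Equiv.sigmaCongrRight fun x => (hc x).some).trans (Equiv.sigmaFiberEquiv g)), fun a => ?_⟩
  exact ((hc (f a)).some ⟨a, rfl⟩).2

/-- The number of bijections that preserve the labels. -/
theorem card_equiv_of_map_eq {α β : Type} [Fintype α] [Fintype β] (f : α → T.Leg) (g : β → T.Leg)
    (h : (Finset.univ : Finset α).val.map f = (Finset.univ : Finset β).val.map g) :
    Nat.card {e : α ≃ β // ∀ a, g (e a) = f a} =
      legSymmetry ((Finset.univ : Finset α).val.map f) := by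
  classical
  obtain ⟨e₀, he₀⟩ := exists_equiv_of_map_eq f g h
  have E : {e : α ≃ β // ∀ a, g (e a) = f a} ≃ {σ : Equiv.Perm α // f ∘ σ = f} :=
    { toFun := fun e => ⟨e.1.trans e₀.symm, funext fun a => by
        have := he₀ (e₀.symm (e.1 a))
        rw [e₀.apply_symm_apply, e.2] at this
        exact this.symm⟩
      invFun := fun σ => ⟨σ.1.trans e₀, fun a => (he₀ _).trans (congrFun σ.2 a)⟩
      left_inv := fun e => by ext; simp
      right_inv := fun e => by ext; simp }
  rw [Nat.card_congr E, Nat.card_eq_fintype_card, DomMulAct.stabilizer_card']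
  unfold legSymmetry
  refine Finset.prod_congr ?_ fun x _ => ?_
  · ext x
    simp
  · rw [Fintype.card_subtype, Multiset.count_map]
    simp [eq_comm, Finset.card_def, Finset.filter_val]

/-- Bijections that match two subsets correspond to pairs of bijections. -/
def equivMatching {α β : Type} (p : α → Prop) (q : β → Prop) [DecidablePred p] [DecidablePred q] :
    {e : α ≃ β // ∀ a, p a ↔ q (e a)} ≃
      ({a // p a} ≃ {b // q b}) × ({a // ¬ p a} ≃ {b // ¬ q b}) where
  toFun e := (e.1.subtypeEquiv e.2, e.1.subtypeEquiv fun a => not_congr (e.2 a))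
  invFun f := ⟨(Equiv.sumCompl p).symm.trans ((Equiv.sumCongr f.1 f.2).trans (Equiv.sumCompl q)),
    fun a => by
      by_cases h : p a
      · simpa [h] using (f.1 ⟨a, h⟩).2
      · simpa [h] using (f.2 ⟨a, h⟩).2⟩
  left_inv e := by
    ext a
    by_cases h : p a <;> simp [h]
  right_inv f := by
    ext a
    · simp [a.2]
    · simp [a.2]

/-- The ways to put a given graph in the place of a vertex. -/
theorem card_isFilling {J : Type} [Finite J] [Finite H] {D : Set J} {ℓ : D → T.Leg}
    {s : Multiset T.Leg} [Fintype D] (hs : (Finset.univ : Finset D).val.map ℓ = s)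
    {G : HalfEdgeGraph T H} (hG : G.IsFeynman s) (hsr : s ∈ T.amplitudes) (m : ℕ)
    (hm : Nat.card {a // a ∉ D} = m) (hsize : Nat.card H = Multiset.card s + m) :
    Nat.card {e : H ≃ J // (G.map e).IsFilling D ℓ} = legSymmetry s * m.factorial := by
  classical
  have := Fintype.ofFinite H
  have := Fintype.ofFinite J
  let p : H → Prop := fun a => ¬ ∃ b, G.edge a b
  have hlab : (Finset.univ : Finset {a // p a}).val.map (fun a => G.label a.1) = s := by
    rw [← hG.residue_eq]
    exact (labels_eq_map_univ G {a | p a}).symm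
  have hcard : Fintype.card {a // ¬ p a} = m := by
    have h1 := Fintype.card_subtype_compl p
    have h2 : Fintype.card {a // p a} = Multiset.card s := by
      rw [← hlab, Multiset.card_map]; rfl
    rw [h1, h2, ← Nat.card_eq_fintype_card, hsize]
    omega
  have hiff : ∀ e : H ≃ J, (G.map e).IsFilling D ℓ ↔
      (∀ a, p a ↔ e a ∈ D) ∧ ∀ (a : H) (ha : e a ∈ D), G.label a = ℓ ⟨e a, ha⟩ := by
    intro e
    have hi := isIso_map e G
    constructor
    · intro h
      refine ⟨fun a => ?_, fun a ha => ?_⟩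
      · rw [← not_iff_not, ← h.exists_edge_iff, hi.exists_edge, not_not]
      · rw [← hi.label]
        exact h.label_eq ⟨e a, ha⟩
    · rintro ⟨h1, h2⟩
      refine ⟨hi.isGraph hG.isGraph, hi.onePI hG.onePI, fun b => ?_, fun b => ?_, fun _ => ?_⟩
      · rw [← e.apply_symm_apply b, hi.exists_edge, ← h1, not_not]
      · have := h2 (e.symm b) (by simp)
        rw [← hi.label] at this
        simpa using this
      · rw [hi.residue, hG.residue_eq]
        exact hsr
  have E : {e : H ≃ J // (G.map e).IsFilling D ℓ} ≃
      {f : ({a // p a} ≃ {b // b ∈ D}) × ({a // ¬ p a} ≃ {b // ¬ b ∈ D}) //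
        ∀ a, ℓ (f.1 a) = G.label a.1} := by
    refine (Equiv.subtypeEquivRight hiff).trans ((Equiv.subtypeSubtypeEquivSubtypeInter
      (fun e : H ≃ J => ∀ a, p a ↔ e a ∈ D) (fun e => ∀ (a : H) (ha : e a ∈ D),
        G.label a = ℓ ⟨e a, ha⟩)).symm.trans ((equivMatching p (· ∈ D)).subtypeEquiv fun e => ?_))
    constructor
    · intro h a
      exact (h a.1 ((e.2 a.1).1 a.2)).symm
    · intro h a ha
      exact (h ⟨a, (e.2 a).2 ha⟩).symm
  have E' : {f : ({a // p a} ≃ {b // b ∈ D}) × ({a // ¬ p a} ≃ {b // ¬ b ∈ D}) //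
        ∀ a, ℓ (f.1 a) = G.label a.1} ≃
      {f : {a // p a} ≃ {b // b ∈ D} // ∀ a, ℓ (f a) = G.label a.1} ×
        ({a // ¬ p a} ≃ {b // ¬ b ∈ D}) :=
    { toFun := fun f => (⟨f.1.1, f.2⟩, f.1.2)
      invFun := fun f => ⟨(f.1.1, f.2), f.1.2⟩
      left_inv := fun _ => rfl
      right_inv := fun _ => rfl }
  have hne : Nonempty ({a // ¬ p a} ≃ {b // ¬ b ∈ D}) :=
    Fintype.card_eq.1 (by rw [hcard, ← hm, Nat.card_eq_fintype_card])
  rw [Nat.card_congr (E.trans E'), Nat.card_prod,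
    card_equiv_of_map_eq (T := T) (fun a : {a // p a} => G.label a.1) ℓ (hlab.trans hs.symm), hlab,
    Nat.card_eq_fintype_card, Fintype.card_equiv hne.some, hcard]

/-- The isomorphism classes of Feynman graphs with residue `s` and `n` half-edges. -/
theorem finite_classes (s : Multiset T.Leg) (n : ℕ) :
    {q : GraphClass T | q.rep.graph.residue = s ∧ q.rep.size = n}.Finite := by
  have : Finite {q : GraphClass T // q.rep.graph.residue = s ∧ q.rep.size = n} := by
    let f : {q : GraphClass T // q.rep.graph.residue = s ∧ q.rep.size = n} →
        {G : HalfEdgeGraph T (Fin n) // G.IsFeynman s} := fun q =>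
      ⟨q.1.rep.graph.map (finCongr q.2.2),
        (isIso_map _ _).isFeynman (by have := q.1.rep.isFeynman; rwa [q.2.1] at this)⟩
    refine Finite.of_injective f fun q q' h => Subtype.ext ?_
    have h' : q.1.rep.graph.map (finCongr q.2.2) = q'.1.rep.graph.map (finCongr q'.2.2) :=
      congrArg Subtype.val h
    have h1 := isIso_map (finCongr q.2.2) q.1.rep.graph
    rw [h'] at h1
    exact eq_of_rep_iso h1 (isIso_map _ _)
  exact Set.finite_coe_iff.1 this

/-- The isomorphism classes of Feynman graphs with residue `s` and `n` half-edges. -/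
def classes (T : Theory) (s : Multiset T.Leg) (n : ℕ) : Finset (GraphClass T) :=
  (finite_classes s n).toFinset

@[simp]
theorem mem_classes {s : Multiset T.Leg} {n : ℕ} {q : GraphClass T} :
    q ∈ classes T s n ↔ q.rep.graph.residue = s ∧ q.rep.size = n := by
  simp [classes]

open Classical in
/-- The exponential generating function, with respect to the number of half-edges that are not
legs, of the graphs that may replace a vertex of type `s`. -/
def fillSeries {C : Type} [CommRing C] [Algebra ℚ C] (φ : GraphAlgebra T →ₐ[ℚ] C)
    (s : Multiset T.Leg) : PowerSeries C :=
  PowerSeries.mk fun m => if m = 0 then (if s ∈ T.vertexTypes then 1 else 0) else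
    if s ∈ T.amplitudes then ∑ q ∈ classes T s (Multiset.card s + m),
      ((legSymmetry s : ℚ) / q.rep.graph.autCard) • φ (MvPolynomial.X q) else 0

theorem HalfEdgeGraph.IsFilling.residue_eq {J : Type} [Finite J] {D : Set J} {ℓ : D → T.Leg}
    {γ : HalfEdgeGraph T J} (h : γ.IsFilling D ℓ) [Fintype D] :
    γ.residue = (Finset.univ : Finset D).val.map ℓ := by
  have hset : {a | ¬ ∃ b, γ.edge a b} = D := by
    ext a
    exact (not_congr (h.exists_edge_iff a)).trans not_not
  unfold residue
  rw [hset, labels_eq_map_univ]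
  exact Multiset.map_congr rfl fun a _ => h.label_eq a

theorem sum_filling {J : Type} [Finite J] {D : Set J} {ℓ : D → T.Leg}
    {s : Multiset T.Leg} [Fintype D] (hs : (Finset.univ : Finset D).val.map ℓ = s)
    {C : Type} [CommRing C] [Algebra ℚ C] (φ : GraphAlgebra T →ₐ[ℚ] C)
    [Fintype {γ : HalfEdgeGraph T J // γ.IsFilling D ℓ}] :
    ∑ γ : {γ : HalfEdgeGraph T J // γ.IsFilling D ℓ}, φ (toAlgebra γ.1) =
      ((Nat.card {a // a ∉ D}).factorial : ℚ) •
        PowerSeries.coeff (Nat.card {a // a ∉ D}) (fillSeries φ s) := by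
  classical
  have := Fintype.ofFinite J
  rw [fillSeries, PowerSeries.coeff_mk]
  by_cases hm : Nat.card {a // a ∉ D} = 0
  · rw [if_pos hm, hm]
    have hD : ∀ a, a ∈ D := fun a => by
      by_contra ha
      have : Nonempty {a // a ∉ D} := ⟨⟨a, ha⟩⟩
      exact Nat.card_pos.ne' hm
    have hne : ∀ γ : {γ : HalfEdgeGraph T J // γ.IsFilling D ℓ}, ¬ ∃ a b, γ.1.edge a b :=
      fun γ ⟨a, hab⟩ => (γ.2.exists_edge_iff a).1 hab (hD a)
    have hsub : Subsingleton {γ : HalfEdgeGraph T J // γ.IsFilling D ℓ} := by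
      refine ⟨fun γ γ' => Subtype.ext (ext_iff' (fun a => ?_) (fun a b => ?_) fun a b => ?_)⟩
      · exact (γ.2.label_eq ⟨a, hD a⟩).trans (γ'.2.label_eq ⟨a, hD a⟩).symm
      · exact iff_of_true (γ.2.onePI.connected.vertex_of_no_edge (hne γ) a b)
          (γ'.2.onePI.connected.vertex_of_no_edge (hne γ') a b)
      · exact iff_of_false (fun h => hne γ ⟨a, b, h⟩) (fun h => hne γ' ⟨a, b, h⟩)
    have hval : ∀ γ : {γ : HalfEdgeGraph T J // γ.IsFilling D ℓ}, φ (toAlgebra γ.1) = 1 := fun γ => by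
      rw [toAlgebra_of_no_edge (hne γ), map_one]
    rw [Finset.sum_congr rfl fun γ _ => hval γ]
    split_ifs with hsv
    · let γ₀ : HalfEdgeGraph T J := ⟨fun a => ℓ ⟨a, hD a⟩, ⊤, fun _ _ => False⟩
      have hJ : Nonempty J := by
        have := T.three_le_card s hsv
        rw [← hs, Multiset.card_map] at this
        have hpos : 0 < Fintype.card D := (by norm_num : 0 < 3).trans_le this
        exact (Fintype.card_pos_iff.1 hpos).map Subtype.val
      have hγ₀ : γ₀.IsFilling D ℓ := by
        refine ⟨⟨fun _ _ h => h, fun _ h => h, fun _ _ _ h => h.elim, fun _ _ h => h.elim,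
          fun a => ?_⟩, ⟨hJ, fun a b => .rel _ _ (.inl trivial), fun _ _ h => h.elim⟩,
          fun a => ?_, fun _ => rfl, fun ⟨a, ha⟩ => (ha (hD a)).elim⟩
        · convert hsv
          rw [← hs]
          have : {b | γ₀.vertex.r a b} = D := by
            ext b
            exact iff_of_true trivial (hD b)
          unfold vertexType
          rw [this, labels_eq_map_univ]
        · simpa [γ₀] using hD a
      have : Unique {γ : HalfEdgeGraph T J // γ.IsFilling D ℓ} :=
        { default := ⟨γ₀, hγ₀⟩, uniq := fun _ => Subsingleton.elim _ _ }
      simp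
    · have : IsEmpty {γ : HalfEdgeGraph T J // γ.IsFilling D ℓ} := by
        refine ⟨fun γ => hsv ?_⟩
        obtain ⟨a⟩ := γ.2.onePI.nonempty
        rw [← hs, ← γ.2.residue_eq]
        convert γ.2.isGraph.vertex_mem a using 1
        exact labels_eq_of_image id ⟨fun b _ => γ.2.onePI.connected.vertex_of_no_edge (hne γ) a b,
          Function.injective_id.injOn, fun b _ => ⟨b, fun ⟨c, hc⟩ => hne γ ⟨b, c, hc⟩, rfl⟩⟩
          fun _ _ => rfl
      simp
  · rw [if_neg hm]
    have hD : ∃ a, a ∉ D := by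
      by_contra! h
      have : IsEmpty {a // a ∉ D} := ⟨fun a => a.2 (h a)⟩
      exact hm (Nat.card_of_isEmpty)
    split_ifs with hsr
    · have hF : ∀ γ : {γ : HalfEdgeGraph T J // γ.IsFilling D ℓ}, γ.1.IsFeynman s := fun γ =>
        ⟨γ.2.isGraph, γ.2.onePI, γ.2.residue_eq.trans hs,
          let ⟨a, ha⟩ := hD; ⟨a, (γ.2.exists_edge_iff a).2 ha⟩⟩
      choose cls e he using fun γ => (hF γ).exists_iso hsr
      have hJ : Nat.card J = Multiset.card s + Nat.card {a // a ∉ D} := by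
        have h1 : Multiset.card s = Fintype.card {a // a ∈ D} := by
          rw [← hs, Multiset.card_map]
          exact (Finset.card_univ (α := D)).trans (Fintype.card_congr (Equiv.refl _))
        rw [h1, ← Nat.card_eq_fintype_card, ← Nat.card_sum]
        exact Nat.card_congr (Equiv.sumCompl _).symm
      have hmem : ∀ γ, cls γ ∈ classes T s (Multiset.card s + Nat.card {a // a ∉ D}) := fun γ => by
        rw [mem_classes, ← hJ, ← (he γ).residue, (hF γ).residue_eq, ← Nat.card_congr (e γ)]
        simp
      have := sum_class_eq _ cls (fun γ => ⟨e γ, he γ⟩) _ hmem fun q => φ (MvPolynomial.X q)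
      rw [Finset.sum_congr rfl fun γ _ => congrArg φ (toAlgebra_of_rep_iso (he γ)), this,
        Finset.smul_sum]
      refine Finset.sum_congr rfl fun q hq => ?_
      rw [mem_classes] at hq
      rw [card_isFilling hs (hq.1 ▸ q.rep.isFeynman) hsr _ rfl (by rw [← hq.2]; simp), smul_smul]
      congr 1
      push_cast
      ring
    · have : IsEmpty {γ : HalfEdgeGraph T J // γ.IsFilling D ℓ} :=
        ⟨fun γ => hsr (hs ▸ γ.2.residue_eq ▸ γ.2.residue_mem hD)⟩
      simp

end

section

open HalfEdgeGraph

/-! ### Products of exponential generating functions -/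

/-- A product of exponential generating functions counts the ways to distribute the elements of a
set. This is the multinomial theorem. -/
theorem sum_fun_prod_coeff {ι V C : Type} [Fintype ι] [DecidableEq ι] [Fintype V] [DecidableEq V]
    [CommRing C] [Algebra ℚ C] (F : V → PowerSeries C) :
    ∑ f : ι → V, ∏ v, ((Fintype.card {a // f a = v}).factorial : ℚ) •
        PowerSeries.coeff (Fintype.card {a // f a = v}) (F v) =
      ((Fintype.card ι).factorial : ℚ) • PowerSeries.coeff (Fintype.card ι) (∏ v, F v) := by
  classical
  let Ψ : MvPolynomial V ℚ →ₗ[ℚ] C := (MvPolynomial.basisMonomials V ℚ).constr ℚ fun k =>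
    ∏ v, ((k v).factorial : ℚ) • PowerSeries.coeff (k v) (F v)
  have hΨ : ∀ k : V →₀ ℕ, Ψ (MvPolynomial.monomial k 1) =
      ∏ v, ((k v).factorial : ℚ) • PowerSeries.coeff (k v) (F v) := fun k => by
    have := (MvPolynomial.basisMonomials V ℚ).constr_basis ℚ (fun k =>
      ∏ v, ((k v).factorial : ℚ) • PowerSeries.coeff (k v) (F v)) k
    rwa [MvPolynomial.coe_basisMonomials] at this
  have hmon : ∀ k : V →₀ ℕ, (MvPolynomial.monomial k 1 : MvPolynomial V ℚ) =
      ∏ v, MvPolynomial.X v ^ k v := fun k => by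
    rw [MvPolynomial.monomial_eq, map_one, one_mul, Finsupp.prod_fintype _ _ (by simp)]
  have h1 : (∑ v, MvPolynomial.X v : MvPolynomial V ℚ) ^ Fintype.card ι =
      ∑ f : ι → V, MvPolynomial.monomial
        (Finsupp.equivFunOnFinite.symm fun v => Fintype.card {a // f a = v}) 1 := by
    have := Finset.prod_univ_sum (fun _ : ι => (Finset.univ : Finset V))
      (fun _ v => (MvPolynomial.X v : MvPolynomial V ℚ))
    rw [Finset.prod_const, Finset.card_univ, Fintype.piFinset_univ] at this
    rw [this]
    refine Finset.sum_congr rfl fun f _ => ?_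
    rw [hmon, ← Finset.prod_fiberwise Finset.univ f]
    refine Finset.prod_congr rfl fun v _ => ?_
    rw [Finset.prod_congr rfl fun a ha => by rw [(Finset.mem_filter.1 ha).2], Finset.prod_const]
    simp [Fintype.card_subtype]
  have h2 := congrArg Ψ (h1.symm.trans
    (Finset.sum_pow_eq_sum_piAntidiag Finset.univ (fun v => (MvPolynomial.X v : MvPolynomial V ℚ))
      (Fintype.card ι)))
  rw [map_sum, map_sum] at h2
  simp_rw [hΨ] at h2
  refine h2.trans ?_
  rw [PowerSeries.coeff_prod, Finset.smul_sum]
  refine Finset.sum_bij' (fun k _ => Finsupp.equivFunOnFinite.symm k) (fun l _ => l) ?_ ?_ ?_ ?_ ?_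
  · intro k hk
    rw [Finset.mem_piAntidiag] at hk
    rw [Finset.mem_finsuppAntidiag]
    exact ⟨hk.1, Finset.subset_univ _⟩
  · intro l hl
    rw [Finset.mem_finsuppAntidiag] at hl
    rw [Finset.mem_piAntidiag]
    exact ⟨hl.1, by simp⟩
  · intro k _
    rfl
  · intro l _
    ext
    rfl
  · intro k hk
    rw [Finset.mem_piAntidiag] at hk
    have hk' := hmon (Finsupp.equivFunOnFinite.symm k)
    simp only [Finsupp.coe_equivFunOnFinite_symm] at hk' ⊢
    rw [← hk', ← nsmul_eq_mul, map_nsmul, hΨ, Finset.prod_smul, ← Nat.cast_smul_eq_nsmul ℚ, smul_smul]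
    congr 1
    have := Nat.multinomial_spec Finset.univ k
    rw [hk.1] at this
    rw [← this]
    push_cast
    simp [mul_comm]

variable {T : Theory} {H : Type}

/-- The type of a vertex. -/
def HalfEdgeGraph.typeOf [Finite H] (G : HalfEdgeGraph T H) (v : Quotient G.vertex) :
    Multiset T.Leg :=
  Quotient.lift G.vertexType (fun a b hab => by
    unfold vertexType
    congr 1
    ext c
    exact ⟨fun h => G.vertex.trans' (G.vertex.symm' hab) h, fun h => G.vertex.trans' hab h⟩) v

/-- The sum over all graphs with given shrunk graph: every vertex is filled independently. -/
theorem sum_shrink_eq_coeff [Finite H] {S : Set H} {K : HalfEdgeGraph T {a // a ∉ S}}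
    {r : Multiset T.Leg} (hK : K.IsShrunk r) {C : Type} [CommRing C] [Algebra ℚ C]
    (φ : GraphAlgebra T →ₐ[ℚ] C) [Fintype (Quotient K.vertex)]
    [Fintype {G : HalfEdgeGraph T H // G.IsFeynman r ∧ G.Admissible S ∧ G.shrink S = K}] :
    ∑ G : {G : HalfEdgeGraph T H // G.IsFeynman r ∧ G.Admissible S ∧ G.shrink S = K},
      φ (∏ᶠ B : Quotient (G.1.block S), toAlgebra (G.1.component S B)) =
    ((Nat.card S).factorial : ℚ) •
      PowerSeries.coeff (Nat.card S) (∏ v, fillSeries φ (K.typeOf v)) := by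
  classical
  have := Fintype.ofFinite H
  have : ∀ σ v, Fintype (Filling S K σ v) := fun _ _ => Fintype.ofFinite _
  have key := sum_shrink_eq hK φ.toRingHom
  simp only [AlgHom.toRingHom_eq_coe, RingHom.coe_coe] at key
  rw [key, Nat.card_eq_fintype_card, ← sum_fun_prod_coeff]
  let E : Sites S K ≃ (S → Quotient K.vertex) :=
    { toFun := fun σ a => σ.1 a.1
      invFun := fun f => ⟨fun a => if h : a ∈ S then f ⟨a, h⟩ else Quotient.mk _ ⟨a, h⟩,
        fun b hb => by simp [hb]⟩
      left_inv := fun σ => by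
        refine Subtype.ext (funext fun a => ?_)
        by_cases h : a ∈ S
        · simp [h]
        · simp [h, σ.2 a h]
      right_inv := fun f => by
        ext a
        simp }
  refine Fintype.sum_equiv E _ _ fun σ => Finset.prod_congr rfl fun v _ => ?_
  have hs : (Finset.univ : Finset {a : {a // σ.1 a = v} | a.1 ∉ S}).val.map
      (fun a => K.label ⟨a.1.1, a.2⟩) = K.typeOf v := by
    induction v using Quotient.inductionOn with | _ b => ?_
    change _ = K.labels {c | K.vertex.r b c}
    rw [labels_eq_map_univ]
    let f : {a : {a // σ.1 a = Quotient.mk _ b} | a.1 ∉ S} ≃ {c | K.vertex.r b c} :=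
      { toFun := fun a => ⟨⟨a.1.1, a.2⟩, by
          have h := a.1.2
          rw [σ.2 _ a.2] at h
          exact K.vertex.symm' (Quotient.exact h)⟩
        invFun := fun c => ⟨⟨c.1.1, by
          rw [σ.2 _ c.1.2]
          exact Quotient.sound (K.vertex.symm' c.2)⟩, c.1.2⟩
        left_inv := fun _ => rfl
        right_inv := fun _ => rfl }
    rw [← Multiset.map_univ_val_equiv f, Multiset.map_map]
    rfl
  rw [sum_filling hs]
  have hcard : Nat.card {a : {a // σ.1 a = v} // a ∉ {a : {a // σ.1 a = v} | a.1 ∉ S}} =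
      Fintype.card {a : S // E σ a = v} := by
    rw [← Nat.card_eq_fintype_card]
    exact Nat.card_congr
      { toFun := fun a => ⟨⟨a.1.1, not_not.1 a.2⟩, a.1.2⟩
        invFun := fun a => ⟨⟨a.1.1, a.2⟩, not_not.2 a.1.2⟩
        left_inv := fun _ => rfl
        right_inv := fun _ => rfl }
  rw [hcard]

end

section

namespace HalfEdgeGraph

variable {T : Theory} {H : Type}

/-! ### Subdividing an edge -/

/-- `G'` is obtained from `G` by placing a vertex with the two half-edges `inr false`, `inr true` on
the edge that consists of `a` and `b`. -/
structure IsSubdivision (G' : HalfEdgeGraph T (H ⊕ Bool)) (G : HalfEdgeGraph T H) (a b : H) :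
    Prop where
  ne : a ≠ b
  label_inl : ∀ u, G'.label (.inl u) = G.label u
  label_false : G'.label (.inr false) = T.conj (G.label a)
  label_true : G'.label (.inr true) = T.conj (G.label b)
  label_ab : G.label b = T.conj (G.label a)
  vertex_inl : ∀ u v, G'.vertex.r (.inl u) (.inl v) ↔ G.vertex.r u v
  vertex_inr : ∀ s t, G'.vertex.r (.inr s) (.inr t)
  not_vertex : ∀ u t, ¬ G'.vertex.r (.inl u) (.inr t)
  edge_iff : ∀ u v, G.edge u v ↔
    G'.edge (.inl u) (.inl v) ∨ (u = a ∧ v = b) ∨ (u = b ∧ v = a)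
  edge_ne : ∀ u v, G'.edge (.inl u) (.inl v) → (u ≠ a ∧ u ≠ b) ∧ (v ≠ a ∧ v ≠ b)
  edge_false : ∀ u, G'.edge (.inl u) (.inr false) ↔ u = a
  edge_false' : ∀ u, G'.edge (.inr false) (.inl u) ↔ u = a
  edge_true : ∀ u, G'.edge (.inl u) (.inr true) ↔ u = b
  edge_true' : ∀ u, G'.edge (.inr true) (.inl u) ↔ u = b
  not_edge : ∀ s t, ¬ G'.edge (.inr s) (.inr t)

theorem labels_range_inr [Finite H] (G : HalfEdgeGraph T (H ⊕ Bool)) :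
    G.labels (Set.range Sum.inr) = {G.label (.inr true), G.label (.inr false)} := by
  classical
  have := Fintype.ofFinite (Set.range (Sum.inr : Bool → H ⊕ Bool))
  rw [labels_eq_map_univ, ← Multiset.map_univ_val_equiv
    (Equiv.ofInjective (Sum.inr : Bool → H ⊕ Bool) Sum.inr_injective), Multiset.map_map]
  rfl

namespace IsSubdivision

variable {G' : HalfEdgeGraph T (H ⊕ Bool)} {G : HalfEdgeGraph T H} {a b : H}

theorem edge_ab (h : IsSubdivision G' G a b) : G.edge a b :=
  (h.edge_iff a b).2 (.inr (.inl ⟨rfl, rfl⟩))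

theorem edge_ba (h : IsSubdivision G' G a b) : G.edge b a :=
  (h.edge_iff b a).2 (.inr (.inr ⟨rfl, rfl⟩))

theorem label_true' (h : IsSubdivision G' G a b) : G'.label (.inr true) = G.label a := by
  rw [h.label_true, h.label_ab, T.conj_conj]

theorem label_false' (h : IsSubdivision G' G a b) : G'.label (.inr false) = G.label b := by
  rw [h.label_false, h.label_ab]

/-- Connectivity passes from `G` to its subdivision. -/
theorem connectedAvoiding (h : IsSubdivision G' G a b) {X : Set H} {X' : Set (H ⊕ Bool)}
    (hG : G.ConnectedAvoiding X)
    (he : ∀ u v, G.edge u v → u ∉ X → v ∉ X → Relation.EqvGen (fun x y => G'.vertex.r x y ∨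
      (G'.edge x y ∧ x ∉ X' ∧ y ∉ X')) (.inl u) (.inl v))
    (hc : ∃ t u, G'.edge (.inr t) (.inl u) ∧ .inr t ∉ X' ∧ .inl u ∉ X') :
    G'.ConnectedAvoiding X' := by
  obtain ⟨t, u, htu, ht, hu⟩ := hc
  have hinl : ∀ v w : H, Relation.EqvGen (fun x y => G'.vertex.r x y ∨
      (G'.edge x y ∧ x ∉ X' ∧ y ∉ X')) (.inl v) (.inl w) := fun v w =>
    eqvGen_map _ (fun x y hxy => hxy.elim (fun hh => .rel _ _ (.inl ((h.vertex_inl x y).2 hh)))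
      fun hh => he x y hh.1 hh.2.1 hh.2.2) (hG v w)
  have hall : ∀ p, Relation.EqvGen (fun x y => G'.vertex.r x y ∨
      (G'.edge x y ∧ x ∉ X' ∧ y ∉ X')) p (.inl u) := by
    rintro (v | s)
    · exact hinl v u
    · exact (Relation.EqvGen.rel _ _ (.inl (h.vertex_inr s t))).trans _ _ _
        (.rel _ _ (.inr ⟨htu, ht, hu⟩))
  exact fun p q => (hall p).trans _ _ _ (hall q).symm

/-- Connectivity passes from a subdivision to `G`. -/
theorem connectedAvoiding' (h : IsSubdivision G' G a b) {X : Set H} {X' : Set (H ⊕ Bool)}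
    (hG : G'.ConnectedAvoiding X') (g : Bool → H)
    (he : ∀ u v, G'.edge (.inl u) (.inl v) → .inl u ∉ X' → .inl v ∉ X' → u ∉ X ∧ v ∉ X)
    (hg : Relation.EqvGen (fun x y => G.vertex.r x y ∨ (G.edge x y ∧ x ∉ X ∧ y ∉ X))
      (g false) (g true))
    (hf : .inl a ∉ X' → .inr false ∉ X' → g false = a)
    (ht : .inl b ∉ X' → .inr true ∉ X' → g true = b) :
    G.ConnectedAvoiding X := by
  intro u v
  refine eqvGen_map (a := .inl u) (b := .inl v) (Sum.elim id g) ?_ (hG (.inl u) (.inl v))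
  rintro (x | s) (y | t) hxy
  · refine .rel _ _ (hxy.imp (h.vertex_inl x y).1 fun hh => ⟨?_, he x y hh.1 hh.2.1 hh.2.2⟩)
    exact (h.edge_iff x y).2 (.inl hh.1)
  · obtain ⟨hh, hx, hy⟩ := hxy.resolve_left (h.not_vertex x t)
    cases t
    · obtain rfl := (h.edge_false x).1 hh
      rw [Sum.elim_inr, hf hx hy]
      exact .refl _
    · obtain rfl := (h.edge_true x).1 hh
      rw [Sum.elim_inr, ht hx hy]
      exact .refl _
  · obtain ⟨hh, hy, hx⟩ := hxy.resolve_left fun hh => h.not_vertex y s (G'.vertex.symm' hh)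
    cases s
    · obtain rfl := (h.edge_false' y).1 hh
      rw [Sum.elim_inr, hf hx hy]
      exact .refl _
    · obtain rfl := (h.edge_true' y).1 hh
      rw [Sum.elim_inr, ht hx hy]
      exact .refl _
  · cases s <;> cases t
    · exact .refl _
    · exact hg
    · exact hg.symm
    · exact .refl _

theorem onePI (h : IsSubdivision G' G a b) (hG : G.OnePI) : G'.OnePI := by
  have hab : ∀ {X' : Set (H ⊕ Bool)}, .inl a ∉ X' → .inl b ∉ X' → .inr false ∉ X' →
      .inr true ∉ X' → Relation.EqvGen (fun x y => G'.vertex.r x y ∨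
      (G'.edge x y ∧ x ∉ X' ∧ y ∉ X')) (.inl a) (.inl b) := fun ha hb hf ht =>
    (Relation.EqvGen.rel _ _ (.inr ⟨(h.edge_false a).2 rfl, ha, hf⟩)).trans _ _ _
      ((Relation.EqvGen.rel _ _ (.inl (h.vertex_inr false true))).trans _ _ _
      (.rel _ _ (.inr ⟨(h.edge_true' b).2 rfl, ht, hb⟩)))
  -- the edge `ab` is cut in `G` whenever one of its two halves is cut in `G'`
  have hcut : ∀ (t : Bool) (c : H), (t = false ∧ c = a ∨ t = true ∧ c = b) →
      G'.ConnectedAvoiding {.inl c, .inr t} := by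
    intro t c htc
    refine h.connectedAvoiding (hG.bridgeless a b h.edge_ab) (fun u v huv hu hv => ?_) ?_
    · simp only [Set.mem_insert_iff, Set.mem_singleton_iff, not_or] at hu hv
      have huv' := ((h.edge_iff u v).1 huv).resolve_right
        (by rintro (⟨h1, -⟩ | ⟨h1, -⟩); exacts [hu.1 h1, hu.2 h1])
      refine .rel _ _ (.inr ⟨huv', ?_, ?_⟩)
      · rcases htc with ⟨rfl, rfl⟩ | ⟨rfl, rfl⟩ <;> simp [hu]
      · rcases htc with ⟨rfl, rfl⟩ | ⟨rfl, rfl⟩ <;> simp [hv]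
    · rcases htc with ⟨rfl, rfl⟩ | ⟨rfl, rfl⟩
      · exact ⟨true, b, (h.edge_true' b).2 rfl, by simp, by simpa using h.ne.symm⟩
      · exact ⟨false, a, (h.edge_false' a).2 rfl, by simp, by simpa using h.ne⟩
  refine ⟨hG.nonempty.map .inl, ?_, ?_⟩
  · refine h.connectedAvoiding hG.connected (fun u v huv _ _ => ?_)
      ⟨false, a, (h.edge_false' a).2 rfl, by simp, by simp⟩
    rcases (h.edge_iff u v).1 huv with hh | ⟨rfl, rfl⟩ | ⟨rfl, rfl⟩
    · exact .rel _ _ (.inr ⟨hh, by simp, by simp⟩)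
    · exact hab (by simp) (by simp) (by simp) (by simp)
    · exact (hab (by simp) (by simp) (by simp) (by simp)).symm
  · rintro (u | s) (v | t) huv
    · obtain ⟨⟨hua, hub⟩, hva, hvb⟩ := h.edge_ne u v huv
      refine h.connectedAvoiding (hG.bridgeless u v ((h.edge_iff u v).2 (.inl huv)))
        (fun x y hxy hx hy => ?_) ⟨false, a, (h.edge_false' a).2 rfl, by simp,
          by simp [hua.symm, hva.symm]⟩
      have hab' := hab (X' := {.inl u, .inl v}) (by simp [hua.symm, hva.symm])
        (by simp [hub.symm, hvb.symm]) (by simp) (by simp)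
      rcases (h.edge_iff x y).1 hxy with hh | ⟨rfl, rfl⟩ | ⟨rfl, rfl⟩
      · exact .rel _ _ (.inr ⟨hh, by simpa using hx, by simpa using hy⟩)
      · exact hab'
      · exact hab'.symm
    · cases t
      · exact hcut _ _ (.inl ⟨rfl, (h.edge_false u).1 huv⟩)
      · exact hcut _ _ (.inr ⟨rfl, (h.edge_true u).1 huv⟩)
    · rw [Set.pair_comm]
      cases s
      · exact hcut _ _ (.inl ⟨rfl, (h.edge_false' v).1 huv⟩)
      · exact hcut _ _ (.inr ⟨rfl, (h.edge_true' v).1 huv⟩)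
    · exact (h.not_edge s t huv).elim

theorem onePI' (h : IsSubdivision G' G a b) (hG : G'.OnePI) : G.OnePI := by
  have hcut : G.ConnectedAvoiding {a, b} := by
    refine h.connectedAvoiding' (hG.bridgeless _ _ ((h.edge_false a).2 rfl)) (fun _ => b)
      (fun u v huv _ _ => ?_) (.refl _) (fun ha => by simp at ha) fun _ _ => rfl
    obtain ⟨⟨hua, hub⟩, hva, hvb⟩ := h.edge_ne u v huv
    simp [hua, hub, hva, hvb]
  refine ⟨⟨a⟩, ?_, fun u v huv => ?_⟩
  · refine h.connectedAvoiding' hG.connected (fun t => if t then b else a) (fun u v _ _ _ => by simp)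
      (.rel _ _ (.inr ⟨h.edge_ab, by simp, by simp⟩)) (fun _ _ => rfl) (fun _ _ => rfl)
  · rcases (h.edge_iff u v).1 huv with hh | ⟨rfl, rfl⟩ | ⟨rfl, rfl⟩
    · obtain ⟨⟨hua, hub⟩, hva, hvb⟩ := h.edge_ne u v hh
      exact h.connectedAvoiding' (hG.bridgeless _ _ hh) (fun t => if t then b else a)
        (fun x y _ hx hy => ⟨by simpa using hx, by simpa using hy⟩)
        (.rel _ _ (.inr ⟨h.edge_ab, by simp [hua.symm, hva.symm], by simp [hub.symm, hvb.symm]⟩))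
        (fun _ _ => rfl) (fun _ _ => rfl)
    · exact hcut
    · rw [Set.pair_comm]
      exact hcut

theorem isMatching (h : IsSubdivision G' G a b) (hG : G.IsMatching) : G'.IsMatching where
  symm := by
    rintro (u | s) (v | t) huv
    · obtain ⟨⟨hua, hub⟩, hva, hvb⟩ := h.edge_ne u v huv
      refine ((h.edge_iff v u).1 (hG.symm _ _ ((h.edge_iff u v).2 (.inl huv)))).resolve_right ?_
      rintro (⟨h1, -⟩ | ⟨h1, -⟩)
      exacts [hva h1, hvb h1]
    · cases t
      · exact (h.edge_false' u).2 ((h.edge_false u).1 huv)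
      · exact (h.edge_true' u).2 ((h.edge_true u).1 huv)
    · cases s
      · exact (h.edge_false v).2 ((h.edge_false' v).1 huv)
      · exact (h.edge_true v).2 ((h.edge_true' v).1 huv)
    · exact (h.not_edge s t huv).elim
  irrefl := by
    rintro (u | s) huu
    · exact hG.irrefl u ((h.edge_iff u u).2 (.inl huu))
    · exact h.not_edge s s huu
  unique := by
    rintro (u | s) (v | t) (w | t') h1 h2
    · rw [hG.unique u v w ((h.edge_iff u v).2 (.inl h1)) ((h.edge_iff u w).2 (.inl h2))]
    · obtain ⟨⟨hua, hub⟩, -⟩ := h.edge_ne u v h1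
      cases t'
      · exact (hua ((h.edge_false u).1 h2)).elim
      · exact (hub ((h.edge_true u).1 h2)).elim
    · obtain ⟨⟨hua, hub⟩, -⟩ := h.edge_ne u w h2
      cases t
      · exact (hua ((h.edge_false u).1 h1)).elim
      · exact (hub ((h.edge_true u).1 h1)).elim
    · cases t <;> cases t'
      · rfl
      · exact (h.ne (((h.edge_false u).1 h1).symm.trans ((h.edge_true u).1 h2))).elim
      · exact (h.ne (((h.edge_false u).1 h2).symm.trans ((h.edge_true u).1 h1))).elim
      · rfl
    · cases s
      · rw [(h.edge_false' v).1 h1, (h.edge_false' w).1 h2]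
      · rw [(h.edge_true' v).1 h1, (h.edge_true' w).1 h2]
    · exact (h.not_edge _ _ h2).elim
    · exact (h.not_edge _ _ h1).elim
    · exact (h.not_edge _ _ h1).elim
  label_edge := by
    rintro (u | s) (v | t) huv
    · rw [h.label_inl, h.label_inl]
      exact hG.label_edge u v ((h.edge_iff u v).2 (.inl huv))
    · cases t
      · rw [(h.edge_false u).1 huv, h.label_inl, h.label_false]
      · rw [(h.edge_true u).1 huv, h.label_inl, h.label_true]
    · cases s
      · rw [(h.edge_false' v).1 huv, h.label_inl, h.label_false, T.conj_conj]
      · rw [(h.edge_true' v).1 huv, h.label_inl, h.label_true, T.conj_conj]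
    · exact (h.not_edge s t huv).elim

theorem isMatching' (h : IsSubdivision G' G a b) (hG : G'.IsMatching) : G.IsMatching where
  symm u v huv := by
    rcases (h.edge_iff u v).1 huv with hh | ⟨rfl, rfl⟩ | ⟨rfl, rfl⟩
    · exact (h.edge_iff v u).2 (.inl (hG.symm _ _ hh))
    · exact h.edge_ba
    · exact h.edge_ab
  irrefl u huu := by
    rcases (h.edge_iff u u).1 huu with hh | ⟨h1, h2⟩ | ⟨h1, h2⟩
    · exact hG.irrefl _ hh
    · exact h.ne (h1.symm.trans h2)
    · exact h.ne (h2.symm.trans h1)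
  unique u v w h1 h2 := by
    rcases (h.edge_iff u v).1 h1 with hh | ⟨rfl, rfl⟩ | ⟨rfl, rfl⟩
    · rcases (h.edge_iff u w).1 h2 with hh' | ⟨rfl, rfl⟩ | ⟨rfl, rfl⟩
      · exact Sum.inl_injective (hG.unique _ _ _ hh hh')
      · exact ((h.edge_ne _ _ hh).1.1 rfl).elim
      · exact ((h.edge_ne _ _ hh).1.2 rfl).elim
    · rcases (h.edge_iff u w).1 h2 with hh' | ⟨-, rfl⟩ | ⟨h3, -⟩
      · exact ((h.edge_ne _ _ hh').1.1 rfl).elim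
      · rfl
      · exact (h.ne h3).elim
    · rcases (h.edge_iff u w).1 h2 with hh' | ⟨h3, -⟩ | ⟨-, rfl⟩
      · exact ((h.edge_ne _ _ hh').1.2 rfl).elim
      · exact (h.ne h3.symm).elim
      · rfl
  label_edge u v huv := by
    rcases (h.edge_iff u v).1 huv with hh | ⟨rfl, rfl⟩ | ⟨rfl, rfl⟩
    · rw [← h.label_inl, ← h.label_inl]
      exact hG.label_edge _ _ hh
    · exact h.label_ab
    · rw [h.label_ab, T.conj_conj]

theorem exists_edge (h : IsSubdivision G' G a b) (u : H) :
    (∃ p, G'.edge (.inl u) p) ↔ ∃ v, G.edge u v := by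
  constructor
  · rintro ⟨v | t, hh⟩
    · exact ⟨v, (h.edge_iff u v).2 (.inl hh)⟩
    · cases t
      · rw [(h.edge_false u).1 hh]
        exact ⟨b, h.edge_ab⟩
      · rw [(h.edge_true u).1 hh]
        exact ⟨a, h.edge_ba⟩
  · rintro ⟨v, hh⟩
    rcases (h.edge_iff u v).1 hh with hh | ⟨rfl, rfl⟩ | ⟨rfl, rfl⟩
    · exact ⟨.inl v, hh⟩
    · exact ⟨.inr false, (h.edge_false _).2 rfl⟩
    · exact ⟨.inr true, (h.edge_true _).2 rfl⟩

theorem exists_edge_inr (h : IsSubdivision G' G a b) (t : Bool) : ∃ p, G'.edge (.inr t) p := by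
  cases t
  · exact ⟨.inl a, (h.edge_false' a).2 rfl⟩
  · exact ⟨.inl b, (h.edge_true' b).2 rfl⟩

/-- The vertices of a subdivision. -/
def vertexEquiv (h : IsSubdivision G' G a b) :
    Quotient G.vertex ⊕ Unit ≃ Quotient G'.vertex where
  toFun := Sum.elim (Quotient.map' Sum.inl fun u v huv => (h.vertex_inl u v).2 huv)
    fun _ => Quotient.mk _ (.inr false)
  invFun := Quotient.lift (Sum.elim (fun u => .inl (Quotient.mk _ u)) fun _ => .inr ()) (by
    rintro (u | s) (v | t) huv
    · exact congrArg Sum.inl (Quotient.sound ((h.vertex_inl u v).1 huv))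
    · exact (h.not_vertex u t huv).elim
    · exact (h.not_vertex v s (G'.vertex.symm' huv)).elim
    · rfl)
  left_inv := by
    rintro (x | x)
    · induction x using Quotient.inductionOn
      rfl
    · rfl
  right_inv x := by
    induction x using Quotient.inductionOn with | _ p => ?_
    rcases p with u | t
    · rfl
    · exact Quotient.sound (h.vertex_inr false t)

variable [Finite H]

theorem residue (h : IsSubdivision G' G a b) : G'.residue = G.residue := by
  refine (labels_eq_of_image .inl ⟨fun u hu => ?_, Sum.inl_injective.injOn, ?_⟩
    fun u _ => h.label_inl u).symm
  · exact fun hh => hu ((h.exists_edge u).1 hh)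
  · rintro (u | t) hu
    · exact ⟨u, fun hh => hu ((h.exists_edge u).2 hh), rfl⟩
    · exact (hu (h.exists_edge_inr t)).elim

theorem vertexType_inl (h : IsSubdivision G' G a b) (u : H) :
    G'.vertexType (.inl u) = G.vertexType u := by
  refine (labels_eq_of_image .inl ⟨fun v hv => (h.vertex_inl u v).2 hv,
    Sum.inl_injective.injOn, ?_⟩ fun u _ => h.label_inl u).symm
  rintro (v | t) hv
  · exact ⟨v, (h.vertex_inl u v).1 hv, rfl⟩
  · exact (h.not_vertex u t hv).elim

theorem vertexType_inr (h : IsSubdivision G' G a b) (t : Bool) :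
    G'.vertexType (.inr t) = {G.label a, G.label b} := by
  have hset : {p | G'.vertex.r (.inr t) p} = Set.range Sum.inr := by
    ext p
    rcases p with u | s
    · exact iff_of_false (fun hh => h.not_vertex u t (G'.vertex.symm' hh)) (by simp)
    · exact iff_of_true (h.vertex_inr t s) ⟨s, rfl⟩
  unfold vertexType
  rw [hset, labels_range_inr, h.label_true', h.label_false']

theorem bivalent_inl (h : IsSubdivision G' G a b) (u : H) :
    G'.Bivalent (.inl u) ↔ G.Bivalent u := by
  unfold Bivalent
  rw [h.vertexType_inl]

theorem bivalent_inr (h : IsSubdivision G' G a b) (t : Bool) : G'.Bivalent (.inr t) := by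
  unfold Bivalent
  rw [h.vertexType_inr]
  simp

theorem isShrunk (h : IsSubdivision G' G a b) {r : Multiset T.Leg} (hG : G.IsShrunk r)
    (hab : ({G.label a, G.label b} : Multiset T.Leg) ∈ T.amplitudes) : G'.IsShrunk r := by
  refine ⟨h.isMatching hG.isMatching, h.onePI hG.onePI, h.residue.trans hG.residue_eq,
    ⟨_, _, (h.edge_false a).2 rfl⟩, ?_⟩
  rintro (u | t)
  · rw [h.vertexType_inl]
    exact hG.type_mem u
  · rw [h.vertexType_inr]
    exact .inr hab

theorem isShrunk' (h : IsSubdivision G' G a b) {r : Multiset T.Leg} (hG : G'.IsShrunk r) :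
    G.IsShrunk r := by
  refine ⟨h.isMatching' hG.isMatching, h.onePI' hG.onePI, h.residue.symm.trans hG.residue_eq,
    ⟨_, _, h.edge_ab⟩, fun u => ?_⟩
  rw [← h.vertexType_inl]
  exact hG.type_mem _

/-- Erasing the vertices with two half-edges gives the same result for `G` and a subdivision. -/
theorem smooth_iso (h : IsSubdivision G' G a b) : ∃ e, G.smooth.IsIso G'.smooth e := by
  let e : {u // ¬ G.Bivalent u} ≃ {p // ¬ G'.Bivalent p} :=
    { toFun := fun u => ⟨.inl u.1, fun hh => u.2 ((h.bivalent_inl _).1 hh)⟩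
      invFun := fun p => ⟨p.1.elim id (fun _ => a), by
        obtain ⟨u | t, hp⟩ := p
        · exact fun hh => hp ((h.bivalent_inl _).2 hh)
        · exact (hp (h.bivalent_inr t)).elim⟩
      left_inv := fun _ => rfl
      right_inv := by
        rintro ⟨u | t, hp⟩
        · rfl
        · exact (hp (h.bivalent_inr t)).elim }
  refine ⟨e, fun u => h.label_inl u.1, fun u v => h.vertex_inl u.1 v.1, fun u v => ?_⟩
  refine and_congr (not_congr e.injective.eq_iff) ⟨fun huv => ?_, fun huv => ?_⟩
  · have hrel : ∀ p q, (G'.edge p q ∨ (G'.vertex.r p q ∧ G'.Bivalent p)) →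
        G.Chain (p.elim id fun t => if t then b else a) (q.elim id fun t => if t then b else a) := by
      rintro (x | s) (y | t) hxy
      · exact .rel _ _ (hxy.imp (fun hh => (h.edge_iff x y).2 (.inl hh)) fun hh =>
          ⟨(h.vertex_inl x y).1 hh.1, (h.bivalent_inl x).1 hh.2⟩)
      · have hh := hxy.resolve_right fun hh => h.not_vertex x t hh.1
        cases t
        · rw [(h.edge_false x).1 hh]
          exact .refl _
        · rw [(h.edge_true x).1 hh]
          exact .refl _
      · have hh := hxy.resolve_right fun hh => h.not_vertex y s (G'.vertex.symm' hh.1)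
        cases s
        · rw [(h.edge_false' y).1 hh]
          exact .refl _
        · rw [(h.edge_true' y).1 hh]
          exact .refl _
      · cases s <;> cases t
        · exact .refl _
        · exact .rel _ _ (.inl h.edge_ab)
        · exact .rel _ _ (.inl h.edge_ba)
        · exact .refl _
    exact eqvGen_map (a := (e u).1) (b := (e v).1) (fun p => p.elim id fun t => if t then b else a)
      hrel huv
  · have hab : G'.Chain (.inl a) (.inl b) :=
      (Relation.EqvGen.rel _ _ (.inl ((h.edge_false a).2 rfl))).trans _ _ _
      ((Relation.EqvGen.rel _ _ (.inr ⟨h.vertex_inr false true, h.bivalent_inr _⟩)).trans _ _ _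
      (.rel _ _ (.inl ((h.edge_true' b).2 rfl))))
    refine eqvGen_map (a := u.1) (b := v.1) Sum.inl (fun x y hxy => ?_) huv
    rcases hxy with hxy | hxy
    · rcases (h.edge_iff x y).1 hxy with hh | ⟨rfl, rfl⟩ | ⟨rfl, rfl⟩
      · exact .rel _ _ (.inl hh)
      · exact hab
      · exact hab.symm
    · exact .rel _ _ (.inr ⟨(h.vertex_inl x y).2 hxy.1, (h.bivalent_inl x).2 hxy.2⟩)

theorem loops (h : IsSubdivision G' G a b) (hG : G.IsMatching) : G'.loops = G.loops := by
  have hV : Nat.card (Quotient G'.vertex) = Nat.card (Quotient G.vertex) + 1 := by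
    rw [← Nat.card_congr h.vertexEquiv, Nat.card_sum]
    simp
  have hE := hG.two_mul_ncard_edges
  have hE' := (h.isMatching hG).two_mul_ncard_edges
  have e : {p // ∃ q, G'.edge p q} ≃ {u // ∃ v, G.edge u v} ⊕ Bool :=
    (Equiv.subtypeSum).trans (Equiv.sumCongr (Equiv.subtypeEquivRight h.exists_edge)
      (Equiv.subtypeUnivEquiv h.exists_edge_inr))
  rw [Nat.card_congr e, Nat.card_sum, ← hE] at hE'
  have hB : Nat.card Bool = 2 := by simp
  unfold HalfEdgeGraph.loops
  omega

theorem prod_typeOf (h : IsSubdivision G' G a b) {C : Type} [CommMonoid C]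
    [Fintype (Quotient G.vertex)] [Fintype (Quotient G'.vertex)] (g : Multiset T.Leg → C) :
    ∏ v, g (G'.typeOf v) = (∏ v, g (G.typeOf v)) * g {G.label a, G.label b} := by
  rw [← Equiv.prod_comp h.vertexEquiv, Fintype.prod_sum_type]
  congr 1
  · refine Finset.prod_congr rfl fun v _ => ?_
    induction v using Quotient.inductionOn with | _ u => exact congrArg g (h.vertexType_inl u)
  · rw [Fintype.prod_unique]
    exact congrArg g (h.vertexType_inr false)

end IsSubdivision

end HalfEdgeGraph

end

section

namespace HalfEdgeGraph

variable {T : Theory} {H : Type}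

/-! ### Counting subdivisions -/

theorem pair_mem_amplitudes {x y : T.Leg} (h : ({x, y} : Multiset T.Leg) ∈ T.amplitudes) :
    y = T.conj x := by
  rcases T.amplitudes_spec _ h with h | ⟨f, hf⟩
  · have := T.three_le_card _ h
    simp at this
  · have hx : x ∈ ({f, T.conj f} : Multiset T.Leg) := hf ▸ by simp
    simp only [Multiset.insert_eq_cons, Multiset.mem_cons, Multiset.mem_singleton] at hx
    rcases hx with rfl | rfl
    · simpa using hf
    · rw [T.conj_conj]
      have : ({f, T.conj f} : Multiset T.Leg) = {T.conj f, f} := Multiset.cons_swap _ _ 0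
      rw [this] at hf
      simpa using hf

theorem exists_isSubdivision {G : HalfEdgeGraph T H} (hG : G.IsMatching) {a b : H}
    (hab : G.edge a b) : ∃ G', IsSubdivision G' G a b := by
  have hne : a ≠ b := fun h => hG.irrefl a (by rwa [← h] at hab)
  have hba := hG.symm _ _ hab
  let vr : H ⊕ Bool → H ⊕ Bool → Prop := fun p q =>
    match p, q with
    | .inl u, .inl v => G.vertex.r u v
    | .inr _, .inr _ => True
    | _, _ => False
  let er : H ⊕ Bool → H ⊕ Bool → Prop := fun p q =>
    match p, q with
    | .inl u, .inl v => G.edge u v ∧ (u ≠ a ∧ u ≠ b) ∧ (v ≠ a ∧ v ≠ b)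
    | .inl u, .inr t => u = if t then b else a
    | .inr t, .inl u => u = if t then b else a
    | .inr _, .inr _ => False
  let G' : HalfEdgeGraph T (H ⊕ Bool) :=
    { label := Sum.elim G.label fun t => T.conj (G.label (if t then b else a))
      vertex :=
        { r := vr
          iseqv :=
            { refl := by rintro (u | t); exacts [G.vertex.refl' u, trivial]
              symm := by
                rintro (u | s) (v | t) h
                exacts [G.vertex.symm' h, h.elim, h.elim, trivial]
              trans := by
                rintro (u | s) (v | t) (w | t') h h'
                exacts [G.vertex.trans' h h', h'.elim, h.elim, h.elim, h.elim, h.elim, h'.elim,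
                  trivial] } }
      edge := er }
  refine ⟨G', hne, fun _ => rfl, rfl, rfl, hG.label_edge _ _ hab, fun _ _ => Iff.rfl,
    fun _ _ => trivial, fun _ _ h => h, fun u v => ⟨fun huv => ?_, ?_⟩, fun u v h => h.2,
    fun _ => Iff.rfl, fun _ => Iff.rfl, fun _ => Iff.rfl, fun _ => Iff.rfl, fun _ _ h => h⟩
  · by_cases hua : u = a
    · subst hua
      exact .inr (.inl ⟨rfl, hG.unique _ _ _ huv hab⟩)
    by_cases hub : u = b
    · subst hub
      exact .inr (.inr ⟨rfl, hG.unique _ _ _ huv hba⟩)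
    refine .inl ⟨huv, ⟨hua, hub⟩, ?_, ?_⟩
    · rintro rfl
      exact hub (hG.unique _ _ _ (hG.symm _ _ huv) hab)
    · rintro rfl
      exact hua (hG.unique _ _ _ (hG.symm _ _ huv) hba)
  · rintro (h | ⟨rfl, rfl⟩ | ⟨rfl, rfl⟩)
    exacts [h.1, hab, hba]

/-- A vertex with two half-edges lies on an edge: its half-edges are joined to the rest of the
graph, since the graph has legs and is one-particle irreducible. -/
theorem IsShrunk.exists_edge_inl [Finite H] {G : HalfEdgeGraph T (H ⊕ Bool)} {r : Multiset T.Leg}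
    (hG : G.IsShrunk r) (hr : r ∈ T.amplitudes)
    (hv : ∀ t p, G.vertex.r (.inr t) p ↔ p ∈ Set.range Sum.inr) (t : Bool) :
    ∃ u, G.edge (.inr t) (.inl u) := by
  by_contra hno
  have hbool : ∀ s : Bool, s = t ∨ s = !t := by
    intro s
    cases s <;> cases t <;> simp
  have hbool' : ∀ s s' s'' : Bool, s ≠ s' → s'' ≠ s → s'' = s' := by decide
  have hclosed : ∀ X : Set (H ⊕ Bool), G.ConnectedAvoiding X →
      (∀ u, G.edge (.inr !t) (.inl u) → .inl u ∈ X) →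
      ∀ p : H ⊕ Bool, p ∈ Set.range (Sum.inr : Bool → H ⊕ Bool) := by
    intro X hX hXt p
    have hmem : ∀ s u, G.edge (.inr s) (.inl u) → .inl u ∈ X := by
      intro s u h
      rcases hbool s with rfl | rfl
      · exact (hno ⟨u, h⟩).elim
      · exact hXt u h
    have hiff : ∀ x y, Relation.EqvGen
        (fun x y => G.vertex.r x y ∨ (G.edge x y ∧ x ∉ X ∧ y ∉ X)) x y →
        (x ∈ Set.range (Sum.inr : Bool → H ⊕ Bool) ↔ y ∈ Set.range Sum.inr) := by
      intro x y hxy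
      induction hxy with
      | rel x y h =>
        rcases x with u | s <;> rcases y with v | t'
        · simp
        · refine iff_of_false (fun hh => ?_) fun _ => ?_
          · simp at hh
          · rcases h with h | h
            · have := (hv t' _).1 (G.vertex.symm' h)
              simp at this
            · exact h.2.1 (hmem _ _ (hG.isMatching.symm _ _ h.1))
        · refine iff_of_false (fun _ => ?_) fun hh => ?_
          · rcases h with h | h
            · have := (hv s _).1 h
              simp at this
            · exact h.2.2 (hmem _ _ h.1)
          · simp at hh
        · simp
      | refl x => exact Iff.rfl
      | symm x y _ ih => exact ih.symm
      | trans x y z _ _ ih₁ ih₂ => exact ih₁.trans ih₂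
    exact (hiff _ _ (hX (.inr t) p)).1 ⟨t, rfl⟩
  by_cases ht' : ∃ u, G.edge (.inr !t) (.inl u)
  · obtain ⟨u, hu⟩ := ht'
    have := hclosed _ (hG.onePI.bridgeless _ _ hu)
      (fun v hv => .inr (by rw [hG.isMatching.unique _ _ _ hv hu]; rfl)) (.inl u)
    simp at this
  · have hall := hclosed _ hG.onePI.connected fun u hu => (ht' ⟨u, hu⟩).elim
    have hedge : ∀ p, ∃ q, G.edge p q := by
      obtain ⟨p, q, hpq⟩ := hG.has_edge
      obtain ⟨s, rfl⟩ := hall p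
      obtain ⟨s', rfl⟩ := hall q
      have hne : s ≠ s' := by
        rintro rfl
        exact hG.isMatching.irrefl _ hpq
      intro p
      obtain ⟨s'', rfl⟩ := hall p
      by_cases h : s'' = s
      · exact ⟨_, h ▸ hpq⟩
      · have : s'' = s' := hbool' s s' s'' hne h
        exact ⟨_, this ▸ hG.isMatching.symm _ _ hpq⟩
    have h0 : G.residue = 0 := by
      refine Multiset.eq_zero_of_forall_notMem fun f hf => ?_
      obtain ⟨p, hp, -⟩ := (mem_labels _ _ _).1 hf
      exact hp (hedge p)
    have := T.two_le_card (hG.residue_eq ▸ hr)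
    rw [h0] at this
    simp at this

theorem IsShrunk.exists_isSubdivision [Finite H] {G : HalfEdgeGraph T (H ⊕ Bool)}
    {r : Multiset T.Leg} (hG : G.IsShrunk r) (hr : r ∈ T.amplitudes)
    (hv : ∀ p, G.vertex.r (.inr false) p ↔ p ∈ Set.range Sum.inr)
    (ht : G.vertexType (.inr false) ∈ T.amplitudes) : ∃ K a b, IsSubdivision G K a b := by
  have hv' : ∀ t p, G.vertex.r (.inr t) p ↔ p ∈ Set.range Sum.inr := by
    intro t p
    have h1 := (hv (.inr t)).2 ⟨t, rfl⟩
    rw [← hv]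
    exact ⟨fun h => G.vertex.trans' h1 h, fun h => G.vertex.trans' (G.vertex.symm' h1) h⟩
  have hM := hG.isMatching
  obtain ⟨a, ha⟩ := hG.exists_edge_inl hr hv' false
  obtain ⟨b, hb⟩ := hG.exists_edge_inl hr hv' true
  have ha' := hM.symm _ _ ha
  have hb' := hM.symm _ _ hb
  have hlab : G.label (.inr false) = T.conj (G.label (.inr true)) := by
    refine pair_mem_amplitudes ?_
    convert ht using 1
    rw [← labels_range_inr]
    unfold vertexType
    congr 1
    ext p
    exact (hv p).symm
  have hla := hM.label_edge _ _ ha'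
  have hlb := hM.label_edge _ _ hb
  have hne : a ≠ b := by
    rintro rfl
    have := hM.unique _ _ _ ha' hb'
    simp at this
  let K : HalfEdgeGraph T H :=
    { label := fun u => G.label (.inl u)
      vertex := G.vertex.comap .inl
      edge := fun u v => G.edge (.inl u) (.inl v) ∨ (u = a ∧ v = b) ∨ (u = b ∧ v = a) }
  refine ⟨K, a, b, hne, fun _ => rfl, hla, hM.label_edge _ _ hb', ?_, fun _ _ => Iff.rfl,
    fun s t => (hv' s _).2 ⟨t, rfl⟩, fun u t h => ?_, fun _ _ => Iff.rfl, fun u v h => ?_,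
    fun u => ⟨fun h => ?_, fun h => h ▸ ha'⟩, fun u => ⟨fun h => ?_, fun h => h ▸ ha⟩,
    fun u => ⟨fun h => ?_, fun h => h ▸ hb'⟩, fun u => ⟨fun h => ?_, fun h => h ▸ hb⟩,
    fun s t h => ?_⟩
  · change G.label (.inl b) = T.conj (G.label (.inl a))
    rw [hlb, ← hlab, hla]
  · have := (hv' t _).1 (G.vertex.symm' h)
    simp at this
  · have h' := hM.symm _ _ h
    refine ⟨⟨?_, ?_⟩, ?_, ?_⟩
    · rintro rfl; simpa using hM.unique _ _ _ h ha'
    · rintro rfl; simpa using hM.unique _ _ _ h hb'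
    · rintro rfl; simpa using hM.unique _ _ _ h' ha'
    · rintro rfl; simpa using hM.unique _ _ _ h' hb'
  · exact Sum.inl_injective (hM.unique _ _ _ (hM.symm _ _ h) ha)
  · exact Sum.inl_injective (hM.unique _ _ _ h ha)
  · exact Sum.inl_injective (hM.unique _ _ _ (hM.symm _ _ h) hb)
  · exact Sum.inl_injective (hM.unique _ _ _ h hb)
  · cases s
    · simpa using hM.unique _ _ _ h ha
    · simpa using hM.unique _ _ _ h hb

theorem IsSubdivision.unique {G' G'' : HalfEdgeGraph T (H ⊕ Bool)} {G : HalfEdgeGraph T H} {a b : H}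
    (h : IsSubdivision G' G a b) (h' : IsSubdivision G'' G a b) : G' = G'' := by
  refine ext_iff' ?_ ?_ ?_
  · rintro (u | t)
    · rw [h.label_inl, h'.label_inl]
    · cases t
      · rw [h.label_false, h'.label_false]
      · rw [h.label_true, h'.label_true]
  · rintro (u | s) (v | t)
    · rw [h.vertex_inl, h'.vertex_inl]
    · exact iff_of_false (h.not_vertex u t) (h'.not_vertex u t)
    · exact iff_of_false (fun hh => h.not_vertex v s (G'.vertex.symm' hh))
        (fun hh => h'.not_vertex v s (G''.vertex.symm' hh))
    · exact iff_of_true (h.vertex_inr s t) (h'.vertex_inr s t)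
  · have key : ∀ {G' G'' : HalfEdgeGraph T (H ⊕ Bool)}, IsSubdivision G' G a b →
        IsSubdivision G'' G a b → ∀ u v, G'.edge (.inl u) (.inl v) → G''.edge (.inl u) (.inl v) := by
      intro G' G'' h h' u v huv
      refine ((h'.edge_iff u v).1 ((h.edge_iff u v).2 (.inl huv))).resolve_right ?_
      obtain ⟨⟨h1, h2⟩, -⟩ := h.edge_ne u v huv
      rintro (⟨h3, -⟩ | ⟨h3, -⟩)
      exacts [h1 h3, h2 h3]
    rintro (u | s) (v | t)
    · exact ⟨key h h' u v, key h' h u v⟩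
    · cases t
      · rw [h.edge_false, h'.edge_false]
      · rw [h.edge_true, h'.edge_true]
    · cases s
      · rw [h.edge_false', h'.edge_false']
      · rw [h.edge_true', h'.edge_true']
    · exact iff_of_false (h.not_edge s t) (h'.not_edge s t)

theorem IsSubdivision.unique' {G' : HalfEdgeGraph T (H ⊕ Bool)} {G K : HalfEdgeGraph T H}
    {a b c d : H} (h : IsSubdivision G' G a b) (h' : IsSubdivision G' K c d) :
    G = K ∧ a = c ∧ b = d := by
  have hac : a = c := (h'.edge_false a).1 ((h.edge_false a).2 rfl)
  have hbd : b = d := (h'.edge_true b).1 ((h.edge_true b).2 rfl)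
  refine ⟨ext_iff' (fun u => ?_) (fun u v => ?_) (fun u v => ?_), hac, hbd⟩
  · rw [← h.label_inl, ← h'.label_inl]
  · rw [← h.vertex_inl, ← h'.vertex_inl]
  · rw [h.edge_iff, h'.edge_iff, hac, hbd]

/-- The number of vertices of a given type. -/
def vertexCount [Finite H] (G : HalfEdgeGraph T H) (s : Multiset T.Leg) : ℕ :=
  Nat.card {v // G.typeOf v = s}

/-- The number of internal edges of a given type. -/
def edgeCount (G : HalfEdgeGraph T H) (s : Multiset T.Leg) : ℕ :=
  Set.ncard {e : Sym2 H | ∃ a b, e = s(a, b) ∧ G.edge a b ∧ {G.label a, G.label b} = s}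

theorem occurrences_eq [Finite H] (G : HalfEdgeGraph T H) (s : Multiset T.Leg) :
    G.occurrences s = G.vertexCount s + G.edgeCount s := by
  have : {v : Quotient G.vertex | ∃ a, Quotient.mk G.vertex a = v ∧ G.vertexType a = s} =
      {v | G.typeOf v = s} := by
    ext v
    induction v using Quotient.inductionOn with | _ a => ?_
    constructor
    · rintro ⟨b, hb, hs⟩
      rw [← hb]
      exact hs
    · exact fun h => ⟨a, rfl, h⟩
  unfold occurrences vertexCount edgeCount
  rw [this]
  rfl

theorem IsMatching.two_mul_edgeCount [Finite H] {G : HalfEdgeGraph T H} (hG : G.IsMatching)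
    (s : Multiset T.Leg) :
    2 * G.edgeCount s = Nat.card {a // ∃ b, G.edge a b ∧ {G.label a, G.label b} = s} :=
  hG.two_mul_ncard _ fun a b h => by
    rw [← h]
    exact Multiset.cons_swap _ _ 0

theorem IsIso.typeOf_comp {H' : Type} [Finite H] [Finite H'] {G : HalfEdgeGraph T H}
    {G' : HalfEdgeGraph T H'} {e : H ≃ H'} (h : G.IsIso G' e) :
    ∃ f : Quotient G.vertex ≃ Quotient G'.vertex, ∀ v, G'.typeOf (f v) = G.typeOf v := by
  refine ⟨Quotient.congr e fun a b => (h.vertex a b).symm, fun v => ?_⟩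
  induction v using Quotient.inductionOn with | _ a => exact h.vertexType a

theorem IsIso.vertexCount {H' : Type} [Finite H] [Finite H'] {G : HalfEdgeGraph T H}
    {G' : HalfEdgeGraph T H'} {e : H ≃ H'} (h : G.IsIso G' e) (s : Multiset T.Leg) :
    G'.vertexCount s = G.vertexCount s := by
  obtain ⟨f, hf⟩ := h.typeOf_comp
  exact (Nat.card_congr (f.subtypeEquiv fun v => by rw [hf])).symm

theorem IsIso.edgeCount {H' : Type} [Finite H] [Finite H'] {G : HalfEdgeGraph T H}
    {G' : HalfEdgeGraph T H'} {e : H ≃ H'} (h : G.IsIso G' e) (hG : G.IsMatching)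
    (s : Multiset T.Leg) : G'.edgeCount s = G.edgeCount s := by
  have h1 := hG.two_mul_edgeCount s
  have h2 := (h.isMatching hG).two_mul_edgeCount s
  have : Nat.card {a // ∃ b, G.edge a b ∧ {G.label a, G.label b} = s} =
      Nat.card {a // ∃ b, G'.edge a b ∧ {G'.label a, G'.label b} = s} := by
    refine Nat.card_congr (e.subtypeEquiv fun a => ⟨?_, ?_⟩)
    · rintro ⟨b, hb, hs⟩
      exact ⟨e b, (h.edge _ _).2 hb, by rw [h.label, h.label, hs]⟩
    · rintro ⟨b, hb, hs⟩
      obtain ⟨b, rfl⟩ := e.surjective b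
      exact ⟨b, (h.edge _ _).1 hb, by rw [← h.label, ← h.label, hs]⟩
  omega

/-- The half-edges at the vertices of type `s`. -/
theorem card_vertexType_eq [Finite H] (G : HalfEdgeGraph T H) (s : Multiset T.Leg) :
    Nat.card {a // G.vertexType a = s} = Multiset.card s * G.vertexCount s := by
  classical
  have := Fintype.ofFinite (Quotient G.vertex)
  let f : {a // G.vertexType a = s} → {v // G.typeOf v = s} := fun a => ⟨Quotient.mk _ a.1, a.2⟩
  have hf : ∀ v, Nat.card {a // f a = v} = Multiset.card s := by
    rintro ⟨v, hv⟩
    induction v using Quotient.inductionOn with | _ a => ?_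
    have hv : G.vertexType a = s := hv
    have hc : Multiset.card s = Nat.card {b | G.vertex.r a b} := by
      rw [← hv, vertexType, card_labels, ← Nat.card_coe_set_eq]
    rw [hc]
    have hmk : ∀ b : {a // G.vertexType a = s}, f b = ⟨Quotient.mk _ a, hv⟩ ↔ G.vertex.r a b.1 :=
      fun b => by
        rw [Subtype.ext_iff]
        exact Quotient.eq.trans ⟨fun h => G.vertex.symm' h, fun h => G.vertex.symm' h⟩
    exact Nat.card_congr
      { toFun := fun b => ⟨b.1.1, (hmk b.1).1 b.2⟩
        invFun := fun b => ⟨⟨b.1, by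
          rw [← hv]
          exact congrArg G.typeOf (Quotient.sound (G.vertex.symm' b.2))⟩, (hmk _).2 b.2⟩
        left_inv := fun _ => rfl
        right_inv := fun _ => rfl }
  rw [Nat.card_congr (Equiv.sigmaFiberEquiv f).symm, Nat.card_sigma,
    Finset.sum_congr rfl fun e _ => hf e, Finset.sum_const, smul_eq_mul, mul_comm, Finset.card_univ,
    ← Nat.card_eq_fintype_card]
  rfl

namespace IsSubdivision

variable [Finite H] {G' : HalfEdgeGraph T (H ⊕ Bool)} {G : HalfEdgeGraph T H} {a b : H}

open Classical in
theorem vertexCount (h : IsSubdivision G' G a b) (s : Multiset T.Leg) :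
    G'.vertexCount s = G.vertexCount s + if s = {G.label a, G.label b} then 1 else 0 := by
  have e : {v // G.typeOf v = s} ⊕ {_u : Unit // ({G.label a, G.label b} : Multiset T.Leg) = s} ≃
      {v // G'.typeOf v = s} :=
    Equiv.subtypeSum.symm.trans (h.vertexEquiv.subtypeEquiv (p := fun x => Sum.elim
      (fun v => G.typeOf v = s) (fun _ => ({G.label a, G.label b} : Multiset T.Leg) = s) x) (by
      rintro (v | u)
      · induction v using Quotient.inductionOn with | _ u => ?_
        exact iff_of_eq (congrArg (· = s) (h.vertexType_inl u).symm)
      · exact iff_of_eq (congrArg (· = s) (h.vertexType_inr false).symm)))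
  unfold HalfEdgeGraph.vertexCount
  rw [← Nat.card_congr e, Nat.card_sum]
  congr 1
  split_ifs with hs
  · rw [hs]
    simp
  · have : IsEmpty {_u : Unit // ({G.label a, G.label b} : Multiset T.Leg) = s} :=
      ⟨fun x => hs x.2.symm⟩
    simp

open Classical in
theorem edgeCount (h : IsSubdivision G' G a b) (hG : G.IsMatching) (s : Multiset T.Leg) :
    G'.edgeCount s = G.edgeCount s + if s = {G.label a, G.label b} then 1 else 0 := by
  have h1 := hG.two_mul_edgeCount s
  have h2 := (h.isMatching hG).two_mul_edgeCount s
  have hswap : ({G.label b, G.label a} : Multiset T.Leg) = {G.label a, G.label b} :=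
    Multiset.cons_swap _ _ 0
  have e : {p // ∃ q, G'.edge p q ∧ {G'.label p, G'.label q} = s} ≃
      {u // ∃ v, G.edge u v ∧ {G.label u, G.label v} = s} ⊕
        {_t : Bool // ({G.label a, G.label b} : Multiset T.Leg) = s} := by
    refine Equiv.subtypeSum.trans (Equiv.sumCongr (Equiv.subtypeEquivRight fun u => ?_)
      (Equiv.subtypeEquivRight fun t => ?_))
    · constructor
      · rintro ⟨v | t, hh, rfl⟩
        · exact ⟨v, (h.edge_iff u v).2 (.inl hh), by rw [h.label_inl, h.label_inl]⟩
        · cases t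
          · obtain rfl := (h.edge_false u).1 hh
            exact ⟨b, h.edge_ab, by rw [h.label_inl, h.label_false']⟩
          · obtain rfl := (h.edge_true u).1 hh
            exact ⟨a, h.edge_ba, by rw [h.label_inl, h.label_true']⟩
      · rintro ⟨v, hh, rfl⟩
        rcases (h.edge_iff u v).1 hh with hh | ⟨rfl, rfl⟩ | ⟨rfl, rfl⟩
        · exact ⟨.inl v, hh, by rw [h.label_inl, h.label_inl]⟩
        · exact ⟨.inr false, (h.edge_false _).2 rfl, by rw [h.label_inl, h.label_false']⟩
        · exact ⟨.inr true, (h.edge_true _).2 rfl, by rw [h.label_inl, h.label_true']⟩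
    · cases t
      · constructor
        · rintro ⟨v | t, hh, rfl⟩
          · rw [(h.edge_false' v).1 hh, h.label_inl, h.label_false', hswap]
          · exact (h.not_edge _ _ hh).elim
        · rintro rfl
          exact ⟨.inl a, (h.edge_false' a).2 rfl, by rw [h.label_inl, h.label_false', hswap]⟩
      · constructor
        · rintro ⟨v | t, hh, rfl⟩
          · rw [(h.edge_true' v).1 hh, h.label_inl, h.label_true']
          · exact (h.not_edge _ _ hh).elim
        · rintro rfl
          exact ⟨.inl b, (h.edge_true' b).2 rfl, by rw [h.label_inl, h.label_true']⟩
  rw [Nat.card_congr e, Nat.card_sum, ← h1] at h2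
  split_ifs with hs
  · have : Nat.card {_t : Bool // ({G.label a, G.label b} : Multiset T.Leg) = s} = 2 := by
      rw [Nat.card_congr (Equiv.subtypeUnivEquiv fun _ => hs.symm)]
      simp
    omega
  · have : IsEmpty {_t : Bool // ({G.label a, G.label b} : Multiset T.Leg) = s} :=
      ⟨fun x => hs x.2.symm⟩
    rw [Nat.card_of_isEmpty] at h2
    omega

end IsSubdivision

end HalfEdgeGraph

end

section

open HalfEdgeGraph

variable {T : Theory} {H : Type}

theorem finite_isShrunk [Finite H] (r : Multiset T.Leg) :
    {G : HalfEdgeGraph T H | G.IsShrunk r}.Finite :=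
  Set.finite_coe_iff.1 (inferInstance : Finite {G : HalfEdgeGraph T H // G.IsShrunk r})

/-- The shrunk graphs with residue `r` and a given set of half-edges. -/
def shrunkGraphs (T : Theory) (r : Multiset T.Leg) (H : Type) [Finite H] :
    Finset (HalfEdgeGraph T H) :=
  (finite_isShrunk r).toFinset

@[simp]
theorem mem_shrunkGraphs [Finite H] {r : Multiset T.Leg} {G : HalfEdgeGraph T H} :
    G ∈ shrunkGraphs T r H ↔ G.IsShrunk r :=
  Set.Finite.mem_toFinset _

theorem HalfEdgeGraph.IsIso.isShrunk {H' : Type} [Finite H] [Finite H'] {G : HalfEdgeGraph T H}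
    {G' : HalfEdgeGraph T H'} {e : H ≃ H'} (h : G.IsIso G' e) {r : Multiset T.Leg}
    (hG : G.IsShrunk r) : G'.IsShrunk r :=
  ⟨h.isMatching hG.isMatching, h.onePI hG.onePI, h.residue.trans hG.residue_eq,
    h.has_edge hG.has_edge, fun a => by
      have := hG.type_mem (e.symm a)
      rwa [← h.vertexType, e.apply_symm_apply] at this⟩

/-- The amplitudes with two legs. -/
abbrev Propagator (T : Theory) : Type := {s : T.amplitudes // Multiset.card s.1 = 2}

/-- The numbers of vertices with two half-edges, for each type. -/
def HalfEdgeGraph.HasProfile [Finite H] (G : HalfEdgeGraph T H) (n : Propagator T → ℕ) : Prop :=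
  ∀ s, G.vertexCount s.1.1 = n s

/-- A function of graphs that is invariant under isomorphisms and subdivisions. -/
structure IsSubdivisionInvariant (r : Multiset T.Leg) {M : Type}
    (Y : ∀ (H : Type) [Finite H], HalfEdgeGraph T H → M) : Prop where
  iso : ∀ {H H' : Type} [Finite H] [Finite H'] {G : HalfEdgeGraph T H} {G' : HalfEdgeGraph T H'}
    {e : H ≃ H'}, G.IsIso G' e → G.IsShrunk r → Y H' G' = Y H G
  sub : ∀ {H : Type} [Finite H] {G' : HalfEdgeGraph T (H ⊕ Bool)} {G : HalfEdgeGraph T H} {a b : H},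
    IsSubdivision G' G a b → G.IsShrunk r → Y (H ⊕ Bool) G' = Y H G

/-- A sum over graphs is invariant under relabelling of the half-edges. -/
theorem sum_map_eq {r : Multiset T.Leg} {M : Type} [AddCommGroup M]
    {Y : ∀ (H : Type) [Finite H], HalfEdgeGraph T H → M} {J : Type} [Finite H] [Finite J] (e : J ≃ H)
    (hY : ∀ {G : HalfEdgeGraph T J} {G' : HalfEdgeGraph T H} {e : J ≃ H}, G.IsIso G' e →
      G.IsShrunk r → Y H G' = Y J G)
    (p : HalfEdgeGraph T J → Prop) (q : HalfEdgeGraph T H → Prop) [DecidablePred p]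
    [DecidablePred q]
    (hpq : ∀ {G : HalfEdgeGraph T J} {G' : HalfEdgeGraph T H}, G.IsIso G' e → (p G ↔ q G')) :
    ∑ G ∈ (shrunkGraphs T r J).filter p, Y J G = ∑ G ∈ (shrunkGraphs T r H).filter q, Y H G := by
  refine Finset.sum_bij' (fun G _ => G.map e) (fun G _ => G.map e.symm) ?_ ?_ ?_ ?_ ?_
  · intro G hG
    rw [Finset.mem_filter, mem_shrunkGraphs] at hG ⊢
    exact ⟨(isIso_map e G).isShrunk hG.1, (hpq (isIso_map e G)).1 hG.2⟩
  · intro G hG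
    rw [Finset.mem_filter, mem_shrunkGraphs] at hG ⊢
    exact ⟨(isIso_map e.symm G).isShrunk hG.1, (hpq (isIso_map e.symm G).symm).2 hG.2⟩
  · intro G _
    exact (isIso_map e G).symm.eq_map.symm
  · intro G _
    exact (isIso_map e.symm G).symm.eq_map.symm
  · intro G hG
    rw [Finset.mem_filter, mem_shrunkGraphs] at hG
    exact (hY (isIso_map e G) hG.1).symm

/-- The two additional half-edges form a vertex of type `s`. -/
def HalfEdgeGraph.IsMarked [Finite H] (G : HalfEdgeGraph T (H ⊕ Bool)) (s : Multiset T.Leg) :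
    Prop :=
  (∀ p, G.vertex.r (.inr false) p ↔ p ∈ Set.range Sum.inr) ∧ G.vertexType (.inr false) = s

section

variable {r : Multiset T.Leg} {M : Type} [AddCommGroup M] [Module ℚ M]
  {Y : ∀ (H : Type) [Finite H], HalfEdgeGraph T H → M}

open Classical in
/-- Graphs with a marked vertex that has two half-edges correspond to graphs with a marked oriented
edge. -/
theorem sum_marked_eq [Finite H] (hr : r ∈ T.amplitudes) (hY : IsSubdivisionInvariant r Y)
    (n : Propagator T → ℕ) (s : Propagator T) :
    ∑ G ∈ (shrunkGraphs T r (H ⊕ Bool)).filter (fun G => G.HasProfile (n + Pi.single s 1) ∧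
        G.IsMarked s.1.1), Y (H ⊕ Bool) G =
      ∑ G ∈ (shrunkGraphs T r H).filter fun G => G.HasProfile n,
        ((2 * G.edgeCount s.1.1 : ℕ) : ℚ) • Y H G := by
  have := Fintype.ofFinite H
  have hR : ∀ G ∈ (shrunkGraphs T r H).filter fun G => G.HasProfile n,
      ((2 * G.edgeCount s.1.1 : ℕ) : ℚ) • Y H G =
        ∑ _a ∈ Finset.univ.filter fun a => ∃ b, G.edge a b ∧ {G.label a, G.label b} = s.1.1,
          Y H G := by
    intro G hG
    rw [Finset.mem_filter, mem_shrunkGraphs] at hG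
    rw [Finset.sum_const, hG.1.isMatching.two_mul_edgeCount, Nat.cast_smul_eq_nsmul,
      Nat.card_eq_fintype_card, Fintype.card_subtype]
  have hprof : ∀ {G' : HalfEdgeGraph T (H ⊕ Bool)} {G : HalfEdgeGraph T H} {a b : H},
      IsSubdivision G' G a b → ({G.label a, G.label b} : Multiset T.Leg) = s.1.1 →
      (G'.HasProfile (n + Pi.single s 1) ↔ G.HasProfile n) := by
    intro G' G a b h hab
    refine forall_congr' fun t => ?_
    rw [h.vertexCount, hab, Pi.add_apply, Pi.single_apply]
    by_cases hts : t = s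
    · subst hts; simp
    · rw [if_neg hts, if_neg fun hh => hts (Subtype.ext (Subtype.ext hh))]
      simp
  rw [Finset.sum_congr rfl hR, Finset.sum_sigma']
  symm
  have hex : ∀ x ∈ ((shrunkGraphs T r H).filter fun G => G.HasProfile n).sigma
      (fun G => Finset.univ.filter fun a => ∃ b, G.edge a b ∧ {G.label a, G.label b} = s.1.1),
      ∃ G' b, IsSubdivision G' x.1 x.2 b ∧ {x.1.label x.2, x.1.label b} = s.1.1 := by
    rintro ⟨G, a⟩ hx
    simp only [Finset.mem_sigma, Finset.mem_filter, mem_shrunkGraphs, Finset.mem_univ,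
      true_and] at hx
    obtain ⟨b, hab, hs⟩ := hx.2
    obtain ⟨G', hG'⟩ := exists_isSubdivision hx.1.1.isMatching hab
    exact ⟨G', b, hG', hs⟩
  choose f g hfg using hex
  refine Finset.sum_bij (fun x hx => f x hx) ?_ ?_ ?_ ?_
  · rintro ⟨G, a⟩ hx
    have h := hfg _ hx
    simp only [Finset.mem_sigma, Finset.mem_filter, mem_shrunkGraphs, Finset.mem_univ,
      true_and] at hx
    rw [Finset.mem_filter, mem_shrunkGraphs]
    refine ⟨h.1.isShrunk hx.1.1 (h.2 ▸ s.1.2), (hprof h.1 h.2).2 hx.1.2, ?_, ?_⟩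
    · rintro (u | t)
      · exact iff_of_false (fun hh => h.1.not_vertex u false (HalfEdgeGraph.vertex _ |>.symm' hh))
          (by simp)
      · exact iff_of_true (h.1.vertex_inr _ _) ⟨t, rfl⟩
    · rw [h.1.vertexType_inr, h.2]
  · rintro ⟨G, a⟩ hx ⟨K, c⟩ hy heq
    have h := (hfg _ hx).1
    have h' := (hfg _ hy).1
    rw [← heq] at h'
    obtain ⟨rfl, rfl, -⟩ := h.unique' h'
    rfl
  · intro G' hG'
    rw [Finset.mem_filter, mem_shrunkGraphs] at hG'
    obtain ⟨hG', hp, hv, ht⟩ := hG'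
    obtain ⟨K, a, b, h⟩ := hG'.exists_isSubdivision hr hv (ht ▸ s.1.2)
    have hs : ({K.label a, K.label b} : Multiset T.Leg) = s.1.1 := by
      rw [← ht, h.vertexType_inr]
    have hx : (⟨K, a⟩ : Σ _ : HalfEdgeGraph T H, H) ∈
        ((shrunkGraphs T r H).filter fun G => G.HasProfile n).sigma
        (fun G => Finset.univ.filter fun a => ∃ b, G.edge a b ∧ {G.label a, G.label b} = s.1.1) := by
      simp only [Finset.mem_sigma, Finset.mem_filter, mem_shrunkGraphs, Finset.mem_univ, true_and]
      exact ⟨⟨h.isShrunk' hG', (hprof h hs).1 hp⟩, b, h.edge_ab, hs⟩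
    refine ⟨_, hx, ?_⟩
    have h' := (hfg _ hx).1
    have hgb : g ⟨K, a⟩ hx = b := (h.isMatching' hG'.isMatching).unique _ _ _ h'.edge_ab h.edge_ab
    rw [hgb] at h'
    exact h'.unique h
  · rintro ⟨G, a⟩ hx
    have h := hfg _ hx
    simp only [Finset.mem_sigma, Finset.mem_filter, mem_shrunkGraphs] at hx
    exact (hY.sub h.1 hx.1.1).symm

theorem exists_equiv_sum_bool {J : Type} [Finite H] [Finite J] (h : Nat.card J = Nat.card H + 2)
    {x y : J} (hxy : x ≠ y) : ∃ e : J ≃ H ⊕ Bool, e x = .inr false ∧ e y = .inr true := by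
  classical
  have hc : Nat.card J = Nat.card (H ⊕ Bool) := by rw [Nat.card_sum, h]; simp
  let e₀ : J ≃ H ⊕ Bool := (Finite.card_eq.1 hc).some
  let e₁ := e₀.trans (Equiv.swap (e₀ x) (.inr false))
  have h1 : e₁ x = .inr false := by simp [e₁]
  refine ⟨e₁.trans (Equiv.swap (e₁ y) (.inr true)), ?_, by simp⟩
  rw [Equiv.trans_apply, h1]
  refine Equiv.swap_apply_of_ne_of_ne (fun hh => hxy (e₁.injective (h1.trans hh))) (by simp)

theorem HalfEdgeGraph.IsIso.hasProfile {H' : Type} [Finite H] [Finite H'] {G : HalfEdgeGraph T H}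
    {G' : HalfEdgeGraph T H'} {e : H ≃ H'} (h : G.IsIso G' e) {n : Propagator T → ℕ}
    (hG : G.HasProfile n) : G'.HasProfile n := fun s => (h.vertexCount _).trans (hG s)

open Classical in
/-- Removing one vertex with two half-edges. -/
theorem sum_profile_succ {J : Type} [Finite H] [Finite J] (hJ : Nat.card J = Nat.card H + 2)
    (hr : r ∈ T.amplitudes) (hY : IsSubdivisionInvariant r Y)
    (n : Propagator T → ℕ) (s : Propagator T) :
    ((n s + 1 : ℕ) : ℚ) •
        ∑ G ∈ (shrunkGraphs T r J).filter (fun G => G.HasProfile (n + Pi.single s 1)), Y J G =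
      ((Nat.card J * (Nat.card J - 1) : ℕ) : ℚ) •
        ∑ G ∈ (shrunkGraphs T r H).filter (fun G => G.HasProfile n),
          (G.edgeCount s.1.1 : ℚ) • Y H G := by
  have := Fintype.ofFinite J
  let p : HalfEdgeGraph T J → J × J → Prop := fun G x =>
    (∀ c, G.vertex.r x.1 c ↔ c = x.1 ∨ c = x.2) ∧ G.vertexType x.1 = s.1.1
  have h1 : ∀ G ∈ (shrunkGraphs T r J).filter (fun G => G.HasProfile (n + Pi.single s 1)),
      ((2 * (n s + 1) : ℕ) : ℚ) • Y J G =
        ∑ x ∈ (Finset.univ : Finset J).offDiag, if p G x then Y J G else 0 := by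
    intro G hG
    rw [Finset.mem_filter, mem_shrunkGraphs] at hG
    have hcard : 2 * (n s + 1) = Nat.card {a // G.vertexType a = s.1.1} := by
      rw [card_vertexType_eq, s.2, hG.2 s]
      simp
    rw [← Finset.sum_filter, Finset.sum_const, Nat.cast_smul_eq_nsmul]
    congr 1
    rw [hcard, Nat.card_eq_fintype_card, Fintype.card_subtype]
    symm
    refine Finset.card_bij (fun x _ => x.1) ?_ ?_ ?_
    · intro x hx
      simp only [Finset.mem_filter, Finset.mem_univ, true_and]
      exact (Finset.mem_filter.1 hx).2.2
    · rintro ⟨x, y⟩ hx ⟨x', y'⟩ hx' (rfl : x = x')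
      simp only [Finset.mem_filter, Finset.mem_offDiag, Finset.mem_univ, true_and, p] at hx hx'
      have := (hx'.2.1 y).1 ((hx.2.1 y).2 (.inr rfl))
      rw [this.resolve_left fun h => hx.1 h.symm]
    · intro x hx
      simp only [Finset.mem_filter, Finset.mem_univ, true_and] at hx
      have h2 : Set.ncard {c | G.vertex.r x c} = 2 := by
        rw [← card_labels G]
        exact (congrArg Multiset.card hx).trans s.2
      obtain ⟨u, v, huv, hset⟩ := Set.ncard_eq_two.1 h2
      have hmem : ∀ c, G.vertex.r x c ↔ c = u ∨ c = v := fun c => by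
        have : c ∈ {c | G.vertex.r x c} ↔ c ∈ ({u, v} : Set J) := by rw [hset]
        simpa using this
      rcases (hmem x).1 (G.vertex.refl' x) with rfl | rfl
      · refine ⟨(x, v), ?_, rfl⟩
        simp only [Finset.mem_filter, Finset.mem_offDiag, Finset.mem_univ, true_and, p]
        exact ⟨huv, hmem, hx⟩
      · refine ⟨(x, u), ?_, rfl⟩
        simp only [Finset.mem_filter, Finset.mem_offDiag, Finset.mem_univ, true_and, p]
        exact ⟨huv.symm, fun c => (hmem c).trans or_comm, hx⟩
  have h2 : ∀ x ∈ (Finset.univ : Finset J).offDiag,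
      ∑ G ∈ (shrunkGraphs T r J).filter (fun G => G.HasProfile (n + Pi.single s 1)),
        (if p G x then Y J G else 0) =
      ∑ G ∈ (shrunkGraphs T r H).filter fun G => G.HasProfile n,
        ((2 * G.edgeCount s.1.1 : ℕ) : ℚ) • Y H G := by
    rintro ⟨x, y⟩ hxy
    obtain ⟨e, hex, hey⟩ := exists_equiv_sum_bool hJ (Finset.mem_offDiag.1 hxy).2.2
    rw [← sum_marked_eq hr hY, ← Finset.sum_filter, Finset.filter_filter]
    refine sum_map_eq e hY.iso
      (fun G => G.HasProfile (n + Pi.single s 1) ∧ p G (x, y))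
      (fun G => G.HasProfile (n + Pi.single s 1) ∧ G.IsMarked s.1.1)
      fun {G G'} hi => and_congr ⟨hi.hasProfile, hi.symm.hasProfile⟩ (and_congr ?_ ?_)
    · rw [← hex]
      refine ⟨fun h c => ?_, fun h c => ?_⟩
      · obtain ⟨c, rfl⟩ := e.surjective c
        rw [hi.vertex, h]
        constructor
        · rintro (rfl | rfl)
          exacts [⟨_, hex.symm⟩, ⟨_, hey.symm⟩]
        · rintro ⟨t, ht⟩
          cases t
          · exact .inl (e.injective (ht.symm.trans hex.symm))
          · exact .inr (e.injective (ht.symm.trans hey.symm))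
      · rw [← hi.vertex, h]
        constructor
        · rintro ⟨t, ht⟩
          cases t
          · exact .inl (e.injective (ht.symm.trans hex.symm))
          · exact .inr (e.injective (ht.symm.trans hey.symm))
        · rintro (rfl | rfl)
          exacts [⟨_, hex.symm⟩, ⟨_, hey.symm⟩]
    · rw [← hex, hi.vertexType]
  have h3 := Finset.sum_congr rfl h1
  rw [Finset.sum_comm, Finset.sum_congr rfl h2, ← Finset.smul_sum, Finset.sum_const,
    Finset.offDiag_card] at h3
  have hk : (Finset.univ : Finset J).card * (Finset.univ : Finset J).card -
      (Finset.univ : Finset J).card =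
      Nat.card J * (Nat.card J - 1) := by
    rw [Finset.card_univ, ← Nat.card_eq_fintype_card, Nat.mul_sub, mul_one]
  rw [hk, ← Nat.cast_smul_eq_nsmul ℚ] at h3
  have h4 : ∑ G ∈ (shrunkGraphs T r H).filter (fun G => G.HasProfile n),
      ((2 * G.edgeCount s.1.1 : ℕ) : ℚ) • Y H G = (2 : ℚ) •
      ∑ G ∈ (shrunkGraphs T r H).filter (fun G => G.HasProfile n),
        (G.edgeCount s.1.1 : ℚ) • Y H G := by
    rw [Finset.smul_sum]
    exact Finset.sum_congr rfl fun G _ => by rw [smul_smul]; push_cast; rfl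
  rw [h4] at h3
  have h5 := congrArg (fun m : M => (2⁻¹ : ℚ) • m) h3
  simp only [smul_smul] at h5
  convert h5 using 2
  · push_cast; ring
  · push_cast; ring

end

/-- `vertexCount` and `edgeCount` change by the same amount under subdivision. -/
theorem HalfEdgeGraph.IsSubdivision.edgeCount_sub [Finite H] {G' : HalfEdgeGraph T (H ⊕ Bool)}
    {G : HalfEdgeGraph T H} {a b : H} (h : IsSubdivision G' G a b) (hG : G.IsMatching)
    (s : Multiset T.Leg) : (G'.edgeCount s : ℚ) - G'.vertexCount s =
      G.edgeCount s - G.vertexCount s := by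
  rw [h.vertexCount, h.edgeCount hG]
  push_cast
  ring

theorem Nat.succ_mul_multichoose (E n : ℕ) :
    (n + 1) * Nat.multichoose E (n + 1) = (E + n) * Nat.multichoose E n := by
  rcases E with _ | E
  · rcases n with _ | n <;> simp [Nat.multichoose_zero_succ]
  · have h1 := Nat.multichoose_eq (E + 1) (n + 1)
    have h2 := Nat.multichoose_eq (E + 1) n
    have e1 : E + 1 + (n + 1) - 1 = (E + n) + 1 := by omega
    have e2 : E + 1 + n - 1 = E + n := by omega
    rw [h1, h2, e1, e2, mul_comm, ← Nat.add_one_mul_choose_eq]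
    ring

open Classical in
/-- All vertices with two half-edges are removed: they can be placed on `E` edges in
`multichoose E n` ways. -/
theorem sum_profile_eq {r : Multiset T.Leg} {M : Type} [AddCommGroup M] [Module ℚ M]
    (hr : r ∈ T.amplitudes) (l : ℕ) (m : ℕ) :
    ∀ (Y : ∀ (H : Type) [Finite H], HalfEdgeGraph T H → M), IsSubdivisionInvariant r Y →
    ∀ (n : Propagator T → ℕ), ∑ s, n s = m →
    ((1 : ℚ) / (l + 2 * m).factorial) •
        ∑ G ∈ (shrunkGraphs T r (Fin (l + 2 * m))).filter (fun G => G.HasProfile n), Y _ G =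
      ((1 : ℚ) / l.factorial) •
        ∑ G ∈ (shrunkGraphs T r (Fin l)).filter (fun G => G.HasProfile 0),
          ((∏ s, Nat.multichoose (G.edgeCount s.1.1) (n s) : ℕ) : ℚ) • Y _ G := by
  induction m with
  | zero =>
    intro Y hY n hn
    have hn0 : n = 0 := by
      funext s
      exact (Finset.sum_eq_zero_iff.1 hn) s (Finset.mem_univ s)
    subst hn0
    simp [Nat.multichoose_zero_right]
  | succ m ih =>
    intro Y hY n hn
    obtain ⟨s, hs⟩ : ∃ s, n s ≠ 0 := by
      by_contra! h
      simp [h] at hn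
    let n' : Propagator T → ℕ := Function.update n s (n s - 1)
    have hns : n s = n' s + 1 := by simp only [n', Function.update_self]; omega
    have hnn : n = n' + Pi.single s 1 := by
      funext t
      by_cases ht : t = s
      · subst ht; simpa using hns
      · simp [n', ht]
    have hn' : ∑ t, n' t = m := by
      have : ∑ t, n t = ∑ t, n' t + 1 := by
        rw [hnn]
        simp [Finset.sum_add_distrib]
      omega
    let Y' : ∀ (H : Type) [Finite H], HalfEdgeGraph T H → M := fun H _ G =>
      ((G.edgeCount s.1.1 : ℚ) - G.vertexCount s.1.1 + n' s) • Y H G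
    have hY' : IsSubdivisionInvariant r Y' :=
      { iso := fun {H H' _ _ G G' e} h hG => by
          simp only [Y']
          rw [hY.iso h hG, h.vertexCount, h.edgeCount hG.isMatching]
        sub := fun {H _ G' G a b} h hG => by
          simp only [Y']
          rw [hY.sub h hG, h.edgeCount_sub hG.isMatching] }
    have key := sum_profile_succ (J := Fin (l + 2 * (m + 1))) (H := Fin (l + 2 * m))
      (by simp; ring) hr hY n' s
    rw [← hnn] at key
    have hE : ∑ G ∈ (shrunkGraphs T r (Fin (l + 2 * m))).filter (fun G => G.HasProfile n'),
        (G.edgeCount s.1.1 : ℚ) • Y _ G =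
        ∑ G ∈ (shrunkGraphs T r (Fin (l + 2 * m))).filter (fun G => G.HasProfile n'), Y' _ G := by
      refine Finset.sum_congr rfl fun G hG => ?_
      rw [Finset.mem_filter] at hG
      simp only [Y']
      rw [hG.2 s]
      congr 1
      ring
    have hih := ih Y' hY' n' hn'
    rw [hE] at key
    have hfact : ((l + 2 * (m + 1)).factorial : ℚ) =
        (Nat.card (Fin (l + 2 * (m + 1))) * (Nat.card (Fin (l + 2 * (m + 1))) - 1) : ℕ) *
          (l + 2 * m).factorial := by
      have : l + 2 * (m + 1) = (l + 2 * m + 1) + 1 := by ring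
      rw [Nat.card_eq_fintype_card, Fintype.card_fin, this, Nat.factorial_succ, Nat.factorial_succ]
      rw [Nat.add_sub_cancel]
      push_cast
      ring
    have hc0 : ((Nat.card (Fin (l + 2 * (m + 1))) * (Nat.card (Fin (l + 2 * (m + 1))) - 1) : ℕ) : ℚ)
        ≠ 0 := by
      rw [Nat.card_eq_fintype_card, Fintype.card_fin]
      have : 0 < (l + 2 * (m + 1)) * (l + 2 * (m + 1) - 1) := Nat.mul_pos (by omega) (by omega)
      exact_mod_cast this.ne'
    set c : ℚ := ((Nat.card (Fin (l + 2 * (m + 1))) *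
      (Nat.card (Fin (l + 2 * (m + 1))) - 1) : ℕ) : ℚ) with hc
    have hm0 : ((l + 2 * m).factorial : ℚ) ≠ 0 := by exact_mod_cast (Nat.factorial_pos _).ne'
    have hk0 : ((n' s + 1 : ℕ) : ℚ) ≠ 0 := by exact_mod_cast (n' s).succ_ne_zero
    have h1 : ((n' s + 1 : ℕ) : ℚ) • (((1 : ℚ) / (l + 2 * (m + 1)).factorial) •
        ∑ G ∈ (shrunkGraphs T r (Fin (l + 2 * (m + 1)))).filter (fun G => G.HasProfile n), Y _ G) =
        ((1 : ℚ) / (l + 2 * m).factorial) •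
        ∑ G ∈ (shrunkGraphs T r (Fin (l + 2 * m))).filter (fun G => G.HasProfile n'), Y' _ G := by
      rw [smul_comm, key, smul_smul, hfact]
      congr 1
      field_simp
    rw [hih] at h1
    have h2 := congrArg (fun x : M => ((n' s + 1 : ℕ) : ℚ)⁻¹ • x) h1
    simp only [smul_smul] at h2
    rw [← mul_assoc, inv_mul_cancel₀ hk0, one_mul] at h2
    rw [h2, mul_comm, ← smul_smul, Finset.smul_sum]
    congr 1
    refine Finset.sum_congr rfl fun G hG => ?_
    rw [Finset.mem_filter] at hG
    have hv0 : G.vertexCount s.1.1 = 0 := hG.2 s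
    simp only [Y', smul_smul]
    congr 1
    rw [hv0]
    have hsplit : ∀ k : Propagator T → ℕ, ∏ t, Nat.multichoose (G.edgeCount t.1.1) (k t) =
        Nat.multichoose (G.edgeCount s.1.1) (k s) *
          ∏ t ∈ Finset.univ.erase s, Nat.multichoose (G.edgeCount t.1.1) (k t) := fun k =>
      (Finset.mul_prod_erase _ _ (Finset.mem_univ s)).symm
    have herase : ∏ t ∈ Finset.univ.erase s, Nat.multichoose (G.edgeCount t.1.1) (n t) =
        ∏ t ∈ Finset.univ.erase s, Nat.multichoose (G.edgeCount t.1.1) (n' t) :=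
      Finset.prod_congr rfl fun t ht => by simp [n', Finset.ne_of_mem_erase ht]
    rw [hsplit n, hsplit n', herase, hns]
    have hmc := Nat.succ_mul_multichoose (G.edgeCount s.1.1) (n' s)
    have hmc' : ((n' s + 1 : ℕ) : ℚ) * (Nat.multichoose (G.edgeCount s.1.1) (n' s + 1) : ℕ) =
        (G.edgeCount s.1.1 + n' s) * (Nat.multichoose (G.edgeCount s.1.1) (n' s) : ℕ) := by
      exact_mod_cast hmc
    push_cast at hmc' hk0 ⊢
    field_simp
    linear_combination (-(∏ t ∈ Finset.univ.erase s,
      (Nat.multichoose (G.edgeCount t.1.1) (n' t) : ℚ))) * hmc'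

end

section

namespace HalfEdgeGraph

variable {T : Theory} {H H' : Type}

/-! ### Loop numbers and sizes -/

/-- A one-particle irreducible graph with an internal edge has a loop: it is still connected
without that edge. -/
theorem OnePI.loops_pos [Finite H] {G : HalfEdgeGraph T H} (hG : G.OnePI)
    (he : ∃ a b, G.edge a b) : 0 < G.loops := by
  obtain ⟨a, b, hab⟩ := he
  have := hG.nonempty
  let G₀ : HalfEdgeGraph T H :=
    { label := G.label
      vertex := G.vertex
      edge := fun x y => G.edge x y ∧ x ∉ ({a, b} : Set H) ∧ y ∉ ({a, b} : Set H) }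
  have h₀ : G₀.ConnectedAvoiding ∅ := fun x y =>
    (hG.bridgeless a b hab x y).mono fun u v huv => huv.imp_right fun h => ⟨h, by simp, by simp⟩
  have h1 := h₀.card_vertices_le
  have h2 : G₀.edges.ncard < G.edges.ncard := by
    refine Set.ncard_lt_ncard ⟨?_, fun hh => ?_⟩ (Set.toFinite _)
    · rintro _ ⟨x, y, rfl, hxy⟩
      exact ⟨x, y, rfl, hxy.1⟩
    · obtain ⟨x, y, hxy, hh⟩ := hh ⟨a, b, rfl, hab⟩
      rcases Sym2.eq_iff.1 hxy with h | h
      · exact hh.2.1 (by simp [h.1])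
      · exact hh.2.1 (by simp [h.2])
  have h3 : Nat.card (Quotient G₀.vertex) = Nat.card (Quotient G.vertex) := rfl
  unfold loops
  omega

theorem loops_eq_zero [Finite H] [Nonempty H] {G : HalfEdgeGraph T H}
    (he : ¬ ∃ a b, G.edge a b) : G.loops = 0 := by
  have h1 : G.edges = ∅ := by
    rw [Set.eq_empty_iff_forall_notMem]
    rintro _ ⟨a, b, -, hab⟩
    exact he ⟨a, b, hab⟩
  have : Nonempty (Quotient G.vertex) := ‹Nonempty H›.map (Quotient.mk _)
  have h2 : 0 < Nat.card (Quotient G.vertex) := Nat.card_pos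
  rw [loops, h1, Set.ncard_empty]
  omega

theorem card_eq_legs_add [Finite H] {G : HalfEdgeGraph T H} (hG : G.IsMatching) :
    Nat.card H = Multiset.card G.residue + 2 * G.edges.ncard := by
  classical
  have := Fintype.ofFinite H
  rw [hG.two_mul_ncard_edges, residue, card_labels, ← Nat.card_coe_set_eq, add_comm]
  simp only [Nat.card_eq_fintype_card, Set.coe_ofPred]
  rw [Fintype.card_subtype_compl]
  have := Fintype.card_subtype_le (fun a => ∃ b, G.edge a b)
  omega

theorem three_mul_card_vertices_le [Finite H] {G : HalfEdgeGraph T H} (hG : G.IsGraph) :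
    3 * Nat.card (Quotient G.vertex) ≤ Nat.card H := by
  classical
  have := Fintype.ofFinite (Quotient G.vertex)
  rw [Nat.card_congr (Equiv.sigmaFiberEquiv (Quotient.mk G.vertex)).symm, Nat.card_sigma,
    Nat.card_eq_fintype_card, ← smul_eq_mul, smul_eq_mul, mul_comm, ← smul_eq_mul,
    ← Finset.card_univ, ← Finset.sum_const]
  refine Finset.sum_le_sum fun v _ => ?_
  induction v using Quotient.inductionOn with | _ a => ?_
  have h := T.three_le_card _ (hG.vertex_mem a)
  rw [vertexType, card_labels, ← Nat.card_coe_set_eq] at h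
  refine h.trans_eq (Nat.card_congr (Equiv.subtypeEquivRight fun b => ?_))
  exact ⟨fun hb => (Quotient.sound hb).symm, fun hb => Quotient.exact hb.symm⟩

/-- The size of a graph is bounded in terms of its loop number, since its vertices have at least
three half-edges. -/
theorem IsGraph.card_le [Finite H] {G : HalfEdgeGraph T H} (hG : G.IsGraph) :
    Nat.card H ≤ 6 * G.loops + 3 * Multiset.card G.residue := by
  have h1 := card_eq_legs_add hG.isMatching
  have h2 := three_mul_card_vertices_le hG
  unfold loops
  omega

/-! ### Isomorphisms and subgraphs -/

variable {G : HalfEdgeGraph T H} {G' : HalfEdgeGraph T H'} {e : H ≃ H'} {S : Set H} {S' : Set H'}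

theorem IsIso.block (h : G.IsIso G' e) (hS : ∀ a, e a ∈ S' ↔ a ∈ S) (a b : H) :
    (G'.block S').r (e a) (e b) ↔ (G.block S).r a b := by
  constructor
  · intro hab
    have := eqvGen_map (s := fun a b => G.vertex.r a b ∨ (G.edge a b ∧ a ∈ S ∧ b ∈ S)) e.symm
      (fun x y hxy => .rel _ _ ?_) hab
    · rwa [e.symm_apply_apply, e.symm_apply_apply] at this
    · rw [h.symm.vertex, h.symm.edge, ← hS, ← hS]
      simpa using hxy
  · exact fun hab => eqvGen_map e (fun x y hxy => .rel _ _ (by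
      rwa [h.vertex, h.edge, hS, hS])) hab

theorem IsIso.component (h : G.IsIso G' e) (hS : ∀ a, e a ∈ S' ↔ a ∈ S)
    {B : Quotient (G.block S)} {B' : Quotient (G'.block S')}
    (hB : ∀ a, Quotient.mk (G.block S) a = B ↔ Quotient.mk (G'.block S') (e a) = B') :
    (G.component S B).IsIso (G'.component S' B') (e.subtypeEquiv hB) where
  label a := h.label a.1
  vertex a b := h.vertex a.1 b.1
  edge a b := and_congr (h.edge a.1 b.1) (and_congr (hS a.1) (hS b.1))

theorem IsIso.mk_block_iff (h : G.IsIso G' e) (hS : ∀ a, e a ∈ S' ↔ a ∈ S) (b a : H) :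
    Quotient.mk (G.block S) a = Quotient.mk (G.block S) b ↔
      Quotient.mk (G'.block S') (e a) = Quotient.mk (G'.block S') (e b) :=
  Quotient.eq.trans ((h.block hS a b).symm.trans Quotient.eq.symm)

theorem IsIso.admissible [Finite H] [Finite H'] (h : G.IsIso G' e) (hS : ∀ a, e a ∈ S' ↔ a ∈ S)
    (hG : G.Admissible S) : G'.Admissible S' where
  closed a ha := by
    obtain ⟨a, rfl⟩ := e.surjective a
    obtain ⟨b, hb, hab⟩ := hG.closed a ((hS a).1 ha)
    exact ⟨e b, (hS b).2 hb, (h.edge a b).2 hab⟩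
  component a ha := by
    obtain ⟨a, rfl⟩ := e.surjective a
    obtain ⟨h1, h2⟩ := hG.component a ((hS a).1 ha)
    have hi := h.component hS (h.mk_block_iff hS a)
    exact ⟨hi.onePI h1, hi.residue ▸ h2⟩

theorem IsIso.twoLegged [Finite H] [Finite H'] (h : G.IsIso G' e) (hS : ∀ a, e a ∈ S' ↔ a ∈ S)
    (a : H) : G'.TwoLegged S' (e a) ↔ G.TwoLegged S a := by
  unfold TwoLegged
  rw [(h.component hS (h.mk_block_iff hS a)).residue]

theorem IsIso.contract [Finite H] [Finite H'] (h : G.IsIso G' e) (hS : ∀ a, e a ∈ S' ↔ a ∈ S) :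
    (G.contract S).IsIso (G'.contract S') (e.subtypeEquiv fun a =>
      and_congr (not_congr (hS a).symm) (not_congr (h.twoLegged hS a).symm)) where
  label a := h.label a.1
  vertex a b := h.block hS a.1 b.1
  edge a b := by
    refine and_congr (not_congr (Equiv.injective _).eq_iff) ⟨fun hab => ?_, fun hab => ?_⟩
    · have := eqvGen_map (s := fun x y => x ∉ S ∧ y ∉ S ∧
        (G.edge x y ∨ ((G.block S).r x y ∧ G.TwoLegged S x))) e.symm (fun x y hxy => .rel _ _ ?_) hab
      · simpa using this
      · rw [← hS, ← hS, ← h.edge, ← h.block hS, ← h.twoLegged hS]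
        simpa using hxy
    · refine eqvGen_map (a := a.1) (b := b.1) e (fun x y hxy => .rel _ _ ?_) hab
      rwa [hS, hS, h.edge, h.block hS, h.twoLegged hS]

end HalfEdgeGraph

open HalfEdgeGraph

variable {T : Theory} {H H' : Type}

/-- The term of a subgraph in the coproduct. -/
def coproductTerm [Finite H] (G : HalfEdgeGraph T H) (S : Set H) :
    GraphAlgebra T ⊗[ℚ] GraphAlgebra T :=
  (∏ᶠ B : Quotient (G.block S), toAlgebra (G.component S B)) ⊗ₜ[ℚ] toAlgebra (G.contract S)

theorem HalfEdgeGraph.IsIso.coproductTerm [Finite H] [Finite H'] {G : HalfEdgeGraph T H}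
    {G' : HalfEdgeGraph T H'} {e : H ≃ H'} (h : G.IsIso G' e) {S : Set H} {S' : Set H'}
    (hS : ∀ a, e a ∈ S' ↔ a ∈ S) : coproductTerm G' S' = coproductTerm G S := by
  unfold QFT.coproductTerm
  rw [(h.contract hS).toAlgebra]
  congr 1
  symm
  refine finprod_eq_of_bijective (Quotient.congr e fun a b => (h.block hS a b).symm)
    (Equiv.bijective _) fun B => ?_
  induction B using Quotient.inductionOn with | _ b => ?_
  exact ((h.component hS (h.mk_block_iff hS b)).toAlgebra).symm

open Classical in
/-- The coproduct of a graph on an arbitrary set of half-edges. -/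
def coproductSum [Fintype H] (G : HalfEdgeGraph T H) : GraphAlgebra T ⊗[ℚ] GraphAlgebra T :=
  ∑ S : Finset H, if G.Admissible S then coproductTerm G S else 0

theorem HalfEdgeGraph.IsIso.coproductSum [Fintype H] [Fintype H'] {G : HalfEdgeGraph T H}
    {G' : HalfEdgeGraph T H'} {e : H ≃ H'} (h : G.IsIso G' e) :
    coproductSum G' = coproductSum G := by
  classical
  symm
  refine Fintype.sum_equiv (Equiv.finsetCongr e) _ _ fun S => ?_
  have hS : ∀ a, e a ∈ ((Equiv.finsetCongr e S : Finset H') : Set H') ↔ a ∈ (S : Set H) := by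
    intro a
    simp [Equiv.finsetCongr_apply]
  have hS' : ∀ a, e.symm a ∈ (S : Set H) ↔ a ∈ ((Equiv.finsetCongr e S : Finset H') : Set H') := by
    intro a
    rw [← hS, e.apply_symm_apply]
  rw [h.coproductTerm hS]
  exact if_congr (Iff.intro (h.admissible hS) (h.symm.admissible hS')) rfl rfl

theorem graphCoproduct_eq (Γ : FeynmanGraph T) : graphCoproduct Γ = coproductSum Γ.graph := by
  classical
  unfold graphCoproduct coproductSum
  rw [finsum_eq_sum_of_fintype, ← Finset.sum_filter]
  symm
  refine Finset.sum_bij (fun S hS => ⟨S, (Finset.mem_filter.1 hS).2⟩)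
    (fun _ _ => Finset.mem_univ _) (fun S _ S' _ h => ?_) (fun S _ => ?_) fun _ _ => rfl
  · exact Finset.coe_injective (congrArg Subtype.val h)
  · refine ⟨(Set.toFinite S.1).toFinset, ?_, Subtype.ext (Set.Finite.coe_toFinset _)⟩
    rw [Finset.mem_filter, Set.Finite.coe_toFinset]
    exact ⟨Finset.mem_univ _, S.2⟩

end

section

open HalfEdgeGraph

variable {T : Theory} {H : Type}

/-! ### The coproduct as a sum over shrunk graphs -/

theorem finite_isFeynman [Finite H] (r : Multiset T.Leg) :
    {G : HalfEdgeGraph T H | G.IsFeynman r}.Finite :=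
  Set.finite_coe_iff.1 (inferInstance : Finite {G : HalfEdgeGraph T H // G.IsFeynman r})

/-- The Feynman graphs with residue `r` and a given set of half-edges. -/
def feynmanGraphs (T : Theory) (r : Multiset T.Leg) (H : Type) [Finite H] :
    Finset (HalfEdgeGraph T H) :=
  (finite_isFeynman r).toFinset

@[simp]
theorem mem_feynmanGraphs [Finite H] {r : Multiset T.Leg} {G : HalfEdgeGraph T H} :
    G ∈ feynmanGraphs T r H ↔ G.IsFeynman r :=
  Set.Finite.mem_toFinset _

section Full

variable [Finite H] {r : Multiset T.Leg} {G : HalfEdgeGraph T H} {S : Set H}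

theorem HalfEdgeGraph.IsFeynman.block_of_full (hG : G.IsFeynman r) (hS : ∀ a b, G.edge a b → a ∈ S)
    (a b : H) : (G.block S).r a b :=
  (hG.onePI.connected a b).mono fun x y hxy => hxy.imp_right fun h =>
    ⟨h.1, hS x y h.1, hS y x (hG.isGraph.symm _ _ h.1)⟩

theorem HalfEdgeGraph.IsFeynman.isIso_component (hG : G.IsFeynman r)
    (hS : ∀ a b, G.edge a b → a ∈ S) (B : Quotient (G.block S)) :
    ∃ e, G.IsIso (G.component S B) e := by
  have hB : ∀ a, Quotient.mk (G.block S) a = B := fun a => by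
    induction B using Quotient.inductionOn with | _ b => ?_
    exact Quotient.sound (hG.block_of_full hS a b)
  refine ⟨(Equiv.subtypeUnivEquiv hB).symm, fun _ => rfl, fun _ _ => Iff.rfl, fun a b => ?_⟩
  exact ⟨fun h => h.1, fun h => ⟨h, hS a b h, hS b a (hG.isGraph.symm _ _ h)⟩⟩

/-- All internal edges together are a subgraph, which contributes `Γ ⊗ 1` to the coproduct. -/
theorem HalfEdgeGraph.IsFeynman.admissible_full (hG : G.IsFeynman r) (hr : r ∈ T.amplitudes)
    (hS : ∀ a, a ∈ S ↔ ∃ b, G.edge a b) : G.Admissible S where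
  closed a ha := by
    obtain ⟨b, hab⟩ := (hS a).1 ha
    exact ⟨b, (hS b).2 ⟨a, hG.isGraph.symm _ _ hab⟩, hab⟩
  component a _ := by
    obtain ⟨e, he⟩ := hG.isIso_component (fun a b h => (hS a).2 ⟨b, h⟩) (Quotient.mk (G.block S) a)
    exact ⟨he.onePI hG.onePI, by rwa [he.residue, hG.residue_eq]⟩

theorem HalfEdgeGraph.IsFeynman.coproductTerm_full (hG : G.IsFeynman r)
    (hS : ∀ a b, G.edge a b → a ∈ S) : coproductTerm G S = toAlgebra G ⊗ₜ 1 := by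
  unfold coproductTerm
  congr 1
  · obtain ⟨a⟩ := hG.onePI.nonempty
    rw [finprod_eq_single _ (Quotient.mk (G.block S) a)]
    · obtain ⟨e, he⟩ := hG.isIso_component hS (Quotient.mk (G.block S) a)
      exact he.toAlgebra
    · intro B hB
      induction B using Quotient.inductionOn with | _ b => ?_
      exact (hB (Quotient.sound (hG.block_of_full hS b a))).elim
  · refine toAlgebra_of_no_edge ?_
    rintro ⟨a, b, hne, hab⟩
    have key : ∀ x y, Relation.EqvGen (fun x y => x ∉ S ∧ y ∉ S ∧
        (G.edge x y ∨ ((G.block S).r x y ∧ G.TwoLegged S x))) x y →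
        x = y ∨ (G.TwoLegged S x ∧ G.TwoLegged S y) := by
      intro x y hxy
      induction hxy with
      | rel x y h =>
        obtain ⟨h1, -, h | h⟩ := h
        · exact (h1 (hS x y h)).elim
        · refine .inr ⟨h.2, ?_⟩
          have hc : ∀ B B' : Quotient (G.block S), B = B' →
              Multiset.card (G.component S B).residue = 2 →
              Multiset.card (G.component S B').residue = 2 := by
            rintro B _ rfl hB
            exact hB
          exact hc _ _ (Quotient.sound h.1) h.2
      | refl x => exact .inl rfl
      | symm x y _ ih => exact ih.imp Eq.symm And.symm
      | trans x y z _ _ ih₁ ih₂ =>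
        rcases ih₁ with rfl | h1
        · exact ih₂
        · rcases ih₂ with rfl | h2
          · exact .inr h1
          · exact .inr ⟨h1.1, h2.2⟩
    rcases key _ _ hab with h | h
    · exact hne (Subtype.ext h)
    · exact a.2.2 h.1

end Full

/-- The homomorphism that records the loop number of a graph `γ` as the exponent of a variable. -/
def loopHom (T : Theory) : GraphAlgebra T →ₐ[ℚ] PowerSeries (GraphAlgebra T) :=
  MvPolynomial.aeval fun q => PowerSeries.monomial q.rep.graph.loops (MvPolynomial.X q)

theorem loopHom_X (q : GraphClass T) : loopHom T (MvPolynomial.X q) =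
    PowerSeries.monomial q.rep.graph.loops (MvPolynomial.X q) :=
  MvPolynomial.aeval_X _ _

theorem HalfEdgeGraph.IsFeynman.loopHom [Finite H] {r : Multiset T.Leg} {G : HalfEdgeGraph T H}
    (hG : G.IsFeynman r) (hr : r ∈ T.amplitudes) :
    loopHom T (toAlgebra G) = PowerSeries.monomial G.loops (toAlgebra G) := by
  obtain ⟨q, e, h⟩ := hG.exists_iso hr
  rw [toAlgebra_of_rep_iso h, loopHom_X, h.loops]

theorem HalfEdgeGraph.IsFilling.loopHom {J : Type} [Finite J] {D : Set J} {ℓ : D → T.Leg}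
    {γ : HalfEdgeGraph T J} (h : γ.IsFilling D ℓ) :
    loopHom T (toAlgebra γ) = PowerSeries.monomial γ.loops (toAlgebra γ) := by
  by_cases he : ∃ a b, γ.edge a b
  · obtain ⟨a, b, hab⟩ := he
    exact IsFeynman.loopHom ⟨h.isGraph, h.onePI, rfl, a, b, hab⟩
      (h.residue_mem ⟨a, (h.exists_edge_iff a).1 ⟨b, hab⟩⟩)
  · have := h.onePI.nonempty
    rw [toAlgebra_of_no_edge he, loops_eq_zero he, map_one, PowerSeries.monomial_zero_eq_C_apply,
      map_one]

theorem HalfEdgeGraph.Admissible.loopHom [Finite H] {S : Set H} {G : HalfEdgeGraph T H}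
    (h : G.Admissible S) {r : Multiset T.Leg} (hG : G.IsFeynman r)
    (hK : (G.shrink S).IsShrunk r) : (G.shrink S).loops ≤ G.loops ∧
    loopHom T (∏ᶠ B : Quotient (G.block S), toAlgebra (G.component S B)) =
      PowerSeries.monomial (G.loops - (G.shrink S).loops)
        (∏ᶠ B : Quotient (G.block S), toAlgebra (G.component S B)) := by
  have := Fintype.ofFinite (Quotient (G.shrink S).vertex)
  obtain ⟨σ, γ, hg⟩ := h.exists_gluing hG.isGraph
  have hl := hg.loops hG.isGraph.isMatching (fun v => (γ v).2.isGraph.isMatching)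
    (fun v => (γ v).2.onePI) hK.onePI (IsFilling.exists_edge_iff' γ)
  refine ⟨by omega, ?_⟩
  rw [hg.finprod_component, map_prod, Finset.prod_congr rfl fun v _ => (γ v).2.loopHom,
    PowerSeries.prod_monomial, hl, Nat.add_sub_cancel_left]

/-- The product of a function of the vertex types over the vertices of a graph. -/
def HalfEdgeGraph.vertexProd [Finite H] (G : HalfEdgeGraph T H) {C : Type} [CommMonoid C]
    (g : Multiset T.Leg → C) : C :=
  ∏ᶠ v, g (G.typeOf v)

theorem HalfEdgeGraph.IsIso.vertexProd {H' : Type} [Finite H] [Finite H'] {G : HalfEdgeGraph T H}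
    {G' : HalfEdgeGraph T H'} {e : H ≃ H'} (h : G.IsIso G' e) {C : Type} [CommMonoid C]
    (g : Multiset T.Leg → C) : G'.vertexProd g = G.vertexProd g := by
  obtain ⟨f, hf⟩ := h.typeOf_comp
  exact (finprod_eq_of_bijective f f.bijective fun v => by rw [hf]).symm

/-- The contribution to the `k`-loop part of the coproduct of the graphs that become `K` when a
subgraph with `m` half-edges is shrunk. -/
def outerTerm [Finite H] (k m : ℕ) (K : HalfEdgeGraph T H) : GraphAlgebra T ⊗[ℚ] GraphAlgebra T :=
  if K.loops ≤ k then
    PowerSeries.coeff (k - K.loops) (PowerSeries.coeff m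
      (K.vertexProd (fillSeries (loopHom T)))) ⊗ₜ toAlgebra K.smooth
  else 0

open Classical in
theorem sum_shrink_coproductTerm [Fintype H] {r : Multiset T.Leg} (S : Finset H) (k : ℕ)
    {K : HalfEdgeGraph T {a // a ∉ (S : Set H)}} (hK : K.IsShrunk r) :
    ∑ G ∈ (feynmanGraphs T r H).filter fun G => G.loops = k ∧ G.Admissible S ∧ G.shrink S = K,
      coproductTerm G S = (S.card.factorial : ℚ) • outerTerm k S.card K := by
  have := Fintype.ofFinite (Quotient K.vertex)
  have : Finite {G : HalfEdgeGraph T H // G.IsFeynman r ∧ G.Admissible S ∧ G.shrink S = K} :=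
    (finite_isFeynman r).subset fun G hG => hG.1
  have := Fintype.ofFinite {G : HalfEdgeGraph T H // G.IsFeynman r ∧ G.Admissible S ∧ G.shrink S = K}
  have key := sum_shrink_eq_coeff hK (loopHom T)
  have hcard : Nat.card (S : Set H) = S.card := by simp
  rw [hcard] at key
  have hs : ∀ G, G ∈ (feynmanGraphs T r H).filter (fun G => G.Admissible S ∧ G.shrink S = K) ↔
      G.IsFeynman r ∧ G.Admissible S ∧ G.shrink S = K := fun G => by
    rw [Finset.mem_filter, mem_feynmanGraphs]
  rw [← Finset.sum_subtype _ hs fun G => loopHom T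
    (∏ᶠ B : Quotient (G.block S), toAlgebra (G.component S B))] at key
  have hf : (feynmanGraphs T r H).filter (fun G => G.loops = k ∧ G.Admissible S ∧ G.shrink S = K) =
      ((feynmanGraphs T r H).filter fun G => G.Admissible S ∧ G.shrink S = K).filter
        fun G => G.loops = k := by
    rw [Finset.filter_filter]
    exact Finset.filter_congr fun G _ => and_comm
  have hterm : ∀ G ∈ (feynmanGraphs T r H).filter fun G => G.Admissible S ∧ G.shrink S = K,
      K.loops ≤ G.loops ∧ coproductTerm G S =
        (∏ᶠ B : Quotient (G.block S), toAlgebra (G.component S B)) ⊗ₜ toAlgebra K.smooth ∧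
      loopHom T (∏ᶠ B : Quotient (G.block S), toAlgebra (G.component S B)) =
        PowerSeries.monomial (G.loops - K.loops)
          (∏ᶠ B : Quotient (G.block S), toAlgebra (G.component S B)) := by
    intro G hG
    obtain ⟨hF, hadm, rfl⟩ := (hs G).1 hG
    obtain ⟨h1, h2⟩ := hadm.loopHom hF hK
    refine ⟨h1, ?_, h2⟩
    obtain ⟨σ, γ, hg⟩ := hadm.exists_gluing hF.isGraph
    obtain ⟨e, he⟩ := hg.smooth_iso_contract (fun v => (γ v).2.onePI.connected)
      (IsFilling.exists_edge_iff' γ)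
    rw [coproductTerm, he.toAlgebra]
  rw [hf, Finset.sum_filter]
  unfold outerTerm
  split_ifs with hk
  · have key' := congrArg (PowerSeries.coeff (k - K.loops)) key
    rw [map_sum, PowerSeries.coeff_smul] at key'
    rw [vertexProd, finprod_eq_prod_of_fintype, TensorProduct.smul_tmul', ← key',
      TensorProduct.sum_tmul]
    refine Finset.sum_congr rfl fun G hG => ?_
    obtain ⟨h1, h2, h3⟩ := hterm G hG
    rw [h3, PowerSeries.coeff_monomial, h2]
    have : k - K.loops = G.loops - K.loops ↔ G.loops = k := by omega
    simp only [this]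
    split_ifs
    · rfl
    · rw [TensorProduct.zero_tmul]
  · rw [smul_zero]
    refine Finset.sum_eq_zero fun G hG => if_neg fun h => hk ?_
    exact h ▸ (hterm G hG).1

/-- The coproduct without the term `Γ ⊗ 1` as a sum over the sets of half-edges of the subgraph and
the shrunk graphs. -/
theorem sum_coproductSum_sub [Fintype H] {r : Multiset T.Leg} (hr : r ∈ T.amplitudes) (k : ℕ) :
    ∑ G ∈ (feynmanGraphs T r H).filter fun G => G.loops = k,
      (coproductSum G - toAlgebra G ⊗ₜ 1) =
    ∑ S : Finset H, ∑ K ∈ shrunkGraphs T r {a // a ∉ (S : Set H)},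
      (S.card.factorial : ℚ) • outerTerm k S.card K := by
  classical
  have h1 : ∀ G ∈ (feynmanGraphs T r H).filter fun G => G.loops = k,
      coproductSum G - toAlgebra G ⊗ₜ 1 = ∑ S : Finset H,
        if G.Admissible S ∧ ∃ a b, G.edge a b ∧ a ∉ (S : Set H) then coproductTerm G S else 0 := by
    intro G hG
    rw [Finset.mem_filter, mem_feynmanGraphs] at hG
    have hF : ∀ a, a ∈ ((Finset.univ.filter fun a => ∃ b, G.edge a b : Finset H) : Set H) ↔
        ∃ b, G.edge a b := by simp
    rw [sub_eq_iff_eq_add, coproductSum,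
      ← hG.1.coproductTerm_full fun a b hab => (hF a).2 ⟨b, hab⟩,
      ← Finset.sum_erase_add _ _ (Finset.mem_univ (Finset.univ.filter fun a => ∃ b, G.edge a b)),
      if_pos (hG.1.admissible_full hr hF),
      ← Finset.sum_erase_add (a := Finset.univ.filter fun a => ∃ b, G.edge a b) _
        (fun S : Finset H => if G.Admissible S ∧ ∃ a b, G.edge a b ∧ a ∉ (S : Set H)
          then coproductTerm G S else 0) (Finset.mem_univ _), if_neg, add_zero]
    · congr 1
      refine Finset.sum_congr rfl fun S hS => ?_
      refine if_congr ⟨fun h => ⟨h, ?_⟩, fun h => h.1⟩ rfl rfl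
      by_contra! hh
      refine Finset.ne_of_mem_erase hS (Finset.ext fun a => ?_)
      rw [Finset.mem_filter]
      refine ⟨fun ha => ⟨Finset.mem_univ _, ?_⟩, fun ⟨_, b, hab⟩ => hh a b hab⟩
      obtain ⟨b, -, hab⟩ := h.closed a ha
      exact ⟨b, hab⟩
    · rintro ⟨-, a, b, hab, ha⟩
      exact ha ((hF a).2 ⟨b, hab⟩)
  rw [Finset.sum_congr rfl h1, Finset.sum_comm]
  refine Finset.sum_congr rfl fun S _ => ?_
  rw [← Finset.sum_filter, Finset.filter_filter,
    ← Finset.sum_fiberwise_of_maps_to (g := fun G => G.shrink (S : Set H))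
      (t := shrunkGraphs T r {a // a ∉ (S : Set H)})]
  · refine Finset.sum_congr rfl fun K hK => ?_
    rw [mem_shrunkGraphs] at hK
    rw [← sum_shrink_coproductTerm S k hK, Finset.filter_filter]
    refine Finset.sum_congr (Finset.filter_congr fun G _ => ?_) fun _ _ => rfl
    constructor
    · rintro ⟨⟨h1, h2, -⟩, h3⟩
      exact ⟨h1, h2, h3⟩
    · rintro ⟨h1, h2, rfl⟩
      refine ⟨⟨h1, h2, ?_⟩, rfl⟩
      obtain ⟨a, b, hab⟩ := hK.has_edge
      exact ⟨a, b, hab, a.2⟩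
  · intro G hG
    rw [Finset.mem_filter, mem_feynmanGraphs] at hG
    rw [mem_shrunkGraphs]
    exact hG.2.2.1.isShrunk hG.1 hG.2.2.2

end

section

open HalfEdgeGraph

variable {T : Theory} {H : Type}

/-! ### Generating series of graphs -/

theorem finite_loopClasses (s : Multiset T.Leg) (k : ℕ) :
    {q : GraphClass T | q.rep.graph.residue = s ∧ q.rep.graph.loops = k}.Finite := by
  refine Set.Finite.subset (Set.Finite.biUnion (Set.finite_Iic (6 * k + 3 * Multiset.card s))
    fun n _ => finite_classes s n) fun q hq => ?_
  have h := q.rep.isGraph.card_le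
  rw [Nat.card_eq_fintype_card, Fintype.card_fin, hq.1, hq.2] at h
  exact Set.mem_biUnion (Set.mem_Iic.2 h) ⟨hq.1, rfl⟩

/-- The isomorphism classes of Feynman graphs with residue `s` and `k` loops. -/
def loopClasses (T : Theory) (s : Multiset T.Leg) (k : ℕ) : Finset (GraphClass T) :=
  (finite_loopClasses s k).toFinset

@[simp]
theorem mem_loopClasses {s : Multiset T.Leg} {k : ℕ} {q : GraphClass T} :
    q ∈ loopClasses T s k ↔ q.rep.graph.residue = s ∧ q.rep.graph.loops = k := by
  simp [loopClasses]

theorem graphSum_eq (s : Multiset T.Leg) (k : ℕ) : graphSum T s k =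
    ∑ q ∈ loopClasses T s k, ((legSymmetry s : ℚ) / q.rep.graph.autCard) • MvPolynomial.X q := by
  have : Finite {q : GraphClass T // q.rep.graph.residue = s ∧ q.rep.graph.loops = k} :=
    finite_loopClasses s k
  have := Fintype.ofFinite {q : GraphClass T // q.rep.graph.residue = s ∧ q.rep.graph.loops = k}
  rw [graphSum, finsum_eq_sum_of_fintype, Finset.sum_subtype _ fun q => mem_loopClasses]
  exact Finset.sum_congr rfl fun q _ => (MvPolynomial.smul_eq_C_mul _ _).symm

theorem FeynmanGraph.loops_pos (Γ : FeynmanGraph T) : 0 < Γ.graph.loops :=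
  Γ.onePI.loops_pos Γ.has_edge

theorem loopClasses_zero (s : Multiset T.Leg) : loopClasses T s 0 = ∅ := by
  ext q
  simp only [mem_loopClasses, Finset.notMem_empty, iff_false, not_and]
  exact fun _ => q.rep.loops_pos.ne'

theorem FeynmanGraph.card_residue_lt (Γ : FeynmanGraph T) :
    Multiset.card Γ.graph.residue < Γ.size := by
  have h := card_eq_legs_add Γ.isGraph.isMatching
  rw [Nat.card_eq_fintype_card, Fintype.card_fin] at h
  obtain ⟨a, b, hab⟩ := Γ.has_edge
  have : 0 < Γ.graph.edges.ncard := (Set.ncard_pos).2 ⟨s(a, b), a, b, rfl, hab⟩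
  omega

/-- Power series in `λ` whose coefficients are polynomials in `t`, as power series in `t`. -/
def swapSeries (A : Type) [CommRing A] :
    PowerSeries (Polynomial A) →+* PowerSeries (PowerSeries A) where
  toFun f := PowerSeries.mk fun m => PowerSeries.mk fun i => (PowerSeries.coeff i f).coeff m
  map_one' := by
    ext m i
    simp only [PowerSeries.coeff_mk, PowerSeries.coeff_one]
    split_ifs <;> simp_all [PowerSeries.coeff_one, Polynomial.coeff_one]
  map_zero' := by ext; simp
  map_add' f g := by ext; simp
  map_mul' f g := by
    ext m i
    simp only [PowerSeries.coeff_mk, PowerSeries.coeff_mul, Polynomial.finsetSum_coeff,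
      Polynomial.coeff_mul, map_sum]
    exact Finset.sum_comm

theorem coeff_coeff_swapSeries {A : Type} [CommRing A] (f : PowerSeries (Polynomial A)) (m i : ℕ) :
    PowerSeries.coeff i (PowerSeries.coeff m (swapSeries A f)) =
      (PowerSeries.coeff i f).coeff m := by
  simp [swapSeries]

/-- The value at `t = 1`. -/
def evalSeries (A : Type) [CommRing A] : PowerSeries (Polynomial A) →+* PowerSeries A :=
  PowerSeries.map (Polynomial.evalRingHom 1)

theorem coeff_evalSeries {A : Type} [CommRing A] (f : PowerSeries (Polynomial A)) (i : ℕ) :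
    PowerSeries.coeff i (evalSeries A f) = (PowerSeries.coeff i f).eval 1 := by
  simp [evalSeries]

open Classical in
/-- The generating series of the graphs that may replace a vertex of type `s`, with respect to the
loop number and the number of half-edges that are not legs. -/
def fillPoly (s : Multiset T.Leg) : PowerSeries (Polynomial (GraphAlgebra T)) :=
  PowerSeries.C (if s ∈ T.vertexTypes then 1 else 0) +
    PowerSeries.mk fun i => ∑ q ∈ loopClasses T s i, Polynomial.monomial
      (q.rep.size - Multiset.card s)
      (((legSymmetry s : ℚ) / q.rep.graph.autCard) • MvPolynomial.X q)

theorem swapSeries_fillPoly (s : Multiset T.Leg) :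
    swapSeries _ (fillPoly s) = fillSeries (loopHom T) s := by
  classical
  ext m i : 2
  rw [coeff_coeff_swapSeries, fillPoly, fillSeries, map_add, PowerSeries.coeff_mk,
    PowerSeries.coeff_mk, PowerSeries.coeff_C, Polynomial.coeff_add, Polynomial.finsetSum_coeff]
  simp only [Polynomial.coeff_monomial]
  by_cases hm : m = 0
  · subst hm
    rw [Finset.sum_eq_zero, add_zero, if_pos rfl]
    · by_cases hs : s ∈ T.vertexTypes <;> by_cases hi : i = 0 <;>
        simp [hs, hi, PowerSeries.coeff_one]
    · intro q hq
      rw [mem_loopClasses] at hq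
      have := q.rep.card_residue_lt
      rw [hq.1] at this
      exact if_neg (by omega)
  · rw [if_neg hm]
    have h0 : (if i = 0 then (if s ∈ T.vertexTypes then 1 else 0 : Polynomial (GraphAlgebra T))
        else 0).coeff m = 0 := by
      split_ifs <;> simp [Polynomial.coeff_one, hm]
    rw [h0, zero_add, ← Finset.sum_filter]
    by_cases hs : s ∈ T.amplitudes
    · rw [if_pos hs, map_sum]
      simp only [PowerSeries.coeff_smul, loopHom_X, PowerSeries.coeff_monomial, smul_ite, smul_zero]
      rw [← Finset.sum_filter]
      refine Finset.sum_congr (Finset.ext fun q => ?_) fun _ _ => rfl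
      simp only [Finset.mem_filter, mem_loopClasses, mem_classes]
      constructor
      · rintro ⟨⟨h1, h2⟩, h3⟩
        exact ⟨⟨h1, by omega⟩, h2.symm⟩
      · rintro ⟨⟨h1, h2⟩, h3⟩
        exact ⟨⟨h1, h3.symm⟩, by omega⟩
    · rw [if_neg hs, map_zero]
      refine Finset.sum_eq_zero fun q hq => ?_
      rw [Finset.mem_filter, mem_loopClasses] at hq
      exact (hs (hq.1.1 ▸ q.rep.residue_mem)).elim

open Classical in
/-- The series `[s is a vertex] + ∑ c_k^s λ^k`. -/
def ampSeries (s : Multiset T.Leg) : PowerSeries (GraphAlgebra T) :=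
  PowerSeries.C (if s ∈ T.vertexTypes then 1 else 0) + PowerSeries.mk fun k => graphSum T s k

theorem evalSeries_fillPoly (s : Multiset T.Leg) :
    evalSeries _ (fillPoly s) = ampSeries s := by
  classical
  ext i : 1
  rw [coeff_evalSeries, fillPoly, ampSeries, map_add, map_add, PowerSeries.coeff_mk,
    PowerSeries.coeff_mk, PowerSeries.coeff_C, PowerSeries.coeff_C, Polynomial.eval_add,
    Polynomial.eval_finsetSum, graphSum_eq]
  congr 1
  · split_ifs <;> simp
  · simp

theorem ampSeries_of_notMem {s : Multiset T.Leg} (hs : s ∈ T.vertexTypes) (hs' : s ∉ T.amplitudes) :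
    ampSeries s = 1 := by
  ext i : 1
  rw [ampSeries, if_pos hs, map_add, PowerSeries.coeff_mk, graphSum_eq, Finset.sum_eq_zero, add_zero,
    map_one]
  intro q hq
  rw [mem_loopClasses] at hq
  exact (hs' (hq.1 ▸ q.rep.residue_mem)).elim

theorem graphSum_zero (s : Multiset T.Leg) : graphSum T s 0 = 0 := by
  rw [graphSum_eq, loopClasses_zero, Finset.sum_empty]

theorem constantCoeff_fillPoly {s : Multiset T.Leg} (hs : s ∉ T.vertexTypes) :
    PowerSeries.constantCoeff (fillPoly s) = 0 := by
  rw [← PowerSeries.coeff_zero_eq_constantCoeff_apply, fillPoly, if_neg hs, map_zero, zero_add,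
    PowerSeries.coeff_mk, loopClasses_zero, Finset.sum_empty]

theorem Propagator.notMem (s : Propagator T) : s.1.1 ∉ T.vertexTypes := fun h => by
  have := T.three_le_card _ h
  rw [s.2] at this
  omega

/-! ### Removing the vertices with two half-edges -/

theorem HalfEdgeGraph.IsIso.smooth {H' : Type} [Finite H] [Finite H'] {G : HalfEdgeGraph T H}
    {G' : HalfEdgeGraph T H'} {e : H ≃ H'} (h : G.IsIso G' e) :
    ∃ e, G.smooth.IsIso G'.smooth e := by
  have hb : ∀ a, G'.Bivalent (e a) ↔ G.Bivalent a := fun a => by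
    rw [Bivalent, Bivalent, h.vertexType]
  refine ⟨e.subtypeEquiv fun a => not_congr (hb a).symm, fun a => h.label a.1,
    fun a b => h.vertex a.1 b.1, fun a b => ?_⟩
  refine and_congr (not_congr (Equiv.injective _).eq_iff) ⟨fun hab => ?_, fun hab => ?_⟩
  · have := eqvGen_map (s := fun x y => G.edge x y ∨ (G.vertex.r x y ∧ G.Bivalent x)) e.symm
      (fun x y hxy => .rel _ _ ?_) hab
    · simp only [Equiv.subtypeEquiv_apply, e.symm_apply_apply] at this
      exact this
    · rw [← h.edge, ← h.vertex, ← hb]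
      simpa using hxy
  · refine eqvGen_map (a := a.1) (b := b.1) e (fun x y hxy => .rel _ _ ?_) hab
    rwa [h.edge, h.vertex, hb]

/-- A graph without vertices that have two half-edges is not changed by `smooth`. -/
theorem HalfEdgeGraph.IsMatching.toAlgebra_smooth [Finite H] {G : HalfEdgeGraph T H}
    (hG : G.IsMatching) (h : ∀ a, ¬ G.Bivalent a) : toAlgebra G.smooth = toAlgebra G := by
  refine IsIso.toAlgebra (e := (Equiv.subtypeUnivEquiv h).symm)
    ⟨fun _ => rfl, fun _ _ => Iff.rfl, fun a b => ⟨fun hab => ?_, fun hab => ⟨?_, ?_⟩⟩⟩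
  · have key : ∀ x y, G.Chain x y → x = y ∨ G.edge x y := by
      intro x y hxy
      induction hxy with
      | rel x y hxy => exact .inr (hxy.resolve_right fun hh => h x hh.2)
      | refl x => exact .inl rfl
      | symm x y _ ih => exact ih.imp Eq.symm (hG.symm _ _)
      | trans x y z _ _ ih₁ ih₂ =>
        rcases ih₁ with rfl | h1
        · exact ih₂
        · rcases ih₂ with rfl | h2
          · exact .inr h1
          · exact .inl (hG.unique _ _ _ (hG.symm _ _ h1) h2)
    exact (key _ _ hab.2).resolve_left fun hh => hab.1 (Subtype.ext hh)
  · rintro hh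
    have : a = b := congrArg Subtype.val hh
    exact hG.irrefl a (by rwa [← this] at hab)
  · exact .rel _ _ (.inl hab)

theorem HalfEdgeGraph.IsSubdivision.vertexProd [Finite H] {G' : HalfEdgeGraph T (H ⊕ Bool)}
    {G : HalfEdgeGraph T H} {a b : H} (h : IsSubdivision G' G a b) {C : Type} [CommMonoid C]
    {g : Multiset T.Leg → C} (hg : ∀ s, Multiset.card s = 2 → g s = 1) :
    G'.vertexProd g = G.vertexProd g := by
  have := Fintype.ofFinite (Quotient G.vertex)
  have := Fintype.ofFinite (Quotient G'.vertex)
  rw [HalfEdgeGraph.vertexProd, HalfEdgeGraph.vertexProd, finprod_eq_prod_of_fintype,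
    finprod_eq_prod_of_fintype, h.prod_typeOf, hg _ (by simp), mul_one]

/-- The contribution of a shrunk graph in which a vertex has the weight `g` and the vertices with
two half-edges have the total weight `f`. -/
def weightedTerm (k m : ℕ) (g : Multiset T.Leg → PowerSeries (Polynomial (GraphAlgebra T)))
    (f : PowerSeries (Polynomial (GraphAlgebra T))) (H : Type) [Finite H] (K : HalfEdgeGraph T H) :
    GraphAlgebra T ⊗[ℚ] GraphAlgebra T :=
  if K.loops ≤ k then
    (PowerSeries.coeff (k - K.loops) (K.vertexProd g * f)).coeff m ⊗ₜ toAlgebra K.smooth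
  else 0

theorem weightedTerm_iso {H' : Type} [Finite H] [Finite H'] {G : HalfEdgeGraph T H}
    {G' : HalfEdgeGraph T H'} {e : H ≃ H'} (h : G.IsIso G' e) (k m : ℕ)
    (g : Multiset T.Leg → PowerSeries (Polynomial (GraphAlgebra T)))
    (f : PowerSeries (Polynomial (GraphAlgebra T))) :
    weightedTerm k m g f H' G' = weightedTerm k m g f H G := by
  obtain ⟨e', he'⟩ := h.smooth
  rw [weightedTerm, weightedTerm, h.loops, h.vertexProd, he'.toAlgebra]

theorem isSubdivisionInvariant_weightedTerm (r : Multiset T.Leg) (k m : ℕ)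
    {g : Multiset T.Leg → PowerSeries (Polynomial (GraphAlgebra T))}
    (hg : ∀ s, Multiset.card s = 2 → g s = 1)
    (f : PowerSeries (Polynomial (GraphAlgebra T))) :
    IsSubdivisionInvariant r (weightedTerm k m g f) where
  iso h _ := weightedTerm_iso h k m g f
  sub {H _ G' G a b} h hG := by
    obtain ⟨e', he'⟩ := h.smooth_iso
    rw [weightedTerm, weightedTerm, h.loops hG.isMatching, h.vertexProd hg, he'.toAlgebra]

theorem outerTerm_eq [Finite H] (k m : ℕ) (K : HalfEdgeGraph T H) :
    outerTerm k m K = weightedTerm k m fillPoly 1 H K := by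
  have hs : K.vertexProd (fillSeries (loopHom T)) = swapSeries _ (K.vertexProd fillPoly) := by
    have := Fintype.ofFinite (Quotient K.vertex)
    rw [vertexProd, vertexProd, finprod_eq_prod_of_fintype, finprod_eq_prod_of_fintype, map_prod]
    exact Finset.prod_congr rfl fun v _ => (swapSeries_fillPoly _).symm
  rw [outerTerm, weightedTerm, hs, coeff_coeff_swapSeries, mul_one]

/-- The subgraph and the shrunk graph are smaller than the whole graph. -/
theorem outerTerm_eq_zero [Finite H] {r : Multiset T.Leg} {K : HalfEdgeGraph T H}
    (hK : K.IsShrunk r) {k m : ℕ} (hm : 6 * k + 3 * Multiset.card r < Nat.card H + m) :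
    outerTerm k m K = 0 := by
  classical
  have := Fintype.ofFinite H
  let S : Finset (H ⊕ Fin m) := Finset.univ.map ⟨Sum.inr, Sum.inr_injective⟩
  have hS : S.card = m := by simp [S]
  have hmem : ∀ a : H ⊕ Fin m, a ∈ (S : Set (H ⊕ Fin m)) ↔ ∃ b, Sum.inr b = a := by
    intro a
    simp [S]
  let e : H ≃ {a // a ∉ (S : Set (H ⊕ Fin m))} :=
    Equiv.ofBijective (fun a => ⟨.inl a, by rw [hmem]; rintro ⟨b, hb⟩; cases hb⟩)
      ⟨fun a b hab => Sum.inl_injective (congrArg Subtype.val hab), by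
        rintro ⟨a | a, ha⟩
        · exact ⟨a, rfl⟩
        · exact (ha ((hmem _).2 ⟨a, rfl⟩)).elim⟩
  have key := sum_shrink_coproductTerm S k ((isIso_map e K).isShrunk hK)
  rw [hS, Finset.sum_eq_zero, outerTerm_eq, weightedTerm_iso (isIso_map e K), ← outerTerm_eq] at key
  · rcases smul_eq_zero.1 key.symm with h | h
    · exact (Nat.factorial_ne_zero m (by exact_mod_cast h)).elim
    · exact h
  · intro G hG
    rw [Finset.mem_filter, mem_feynmanGraphs] at hG
    have h := hG.1.isGraph.card_le
    rw [hG.1.residue_eq, hG.2.1, Nat.card_sum, Nat.card_eq_fintype_card (α := Fin m),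
      Fintype.card_fin] at h
    omega

end

section

open HalfEdgeGraph

variable {T : Theory} {r : Multiset T.Leg}

/-! ### From labelled graphs to isomorphism classes -/

/-- A sum over the graphs on `n` half-edges, divided by `n!`, is a sum over the isomorphism classes,
weighted by the inverse order of the automorphism group. -/
theorem sum_feynmanGraphs_eq (hr : r ∈ T.amplitudes) (n : ℕ) {M : Type} [AddCommGroup M] [Module ℚ M]
    (F : GraphClass T → M) (F' : HalfEdgeGraph T (Fin n) → M)
    (hF : ∀ (q : GraphClass T) (G : HalfEdgeGraph T (Fin n)) e, q.rep.graph.IsIso G e →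
      F' G = F q) :
    ((1 : ℚ) / n.factorial) • ∑ G ∈ feynmanGraphs T r (Fin n), F' G =
      ∑ q ∈ classes T r n, ((1 : ℚ) / q.rep.graph.autCard) • F q := by
  have := Fintype.ofFinite {G : HalfEdgeGraph T (Fin n) // G.IsFeynman r}
  let cls : {G : HalfEdgeGraph T (Fin n) // G.IsFeynman r} → GraphClass T := fun G =>
    (G.2.exists_iso hr).choose
  have hcls : ∀ G, ∃ e, (cls G).rep.graph.IsIso G.1 e := fun G => (G.2.exists_iso hr).choose_spec
  have hsum := sum_class_eq _ cls hcls (classes T r n) (fun G => by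
    obtain ⟨e, he⟩ := hcls G
    rw [mem_classes]
    exact ⟨he.residue.symm.trans G.2.residue_eq, by simpa using Fintype.card_congr e⟩) F
  rw [Finset.sum_subtype _ fun G => mem_feynmanGraphs,
    Finset.sum_congr rfl fun G _ => (hcls G).elim fun e he => hF (cls G) G.1 e he, hsum,
    Finset.smul_sum]
  refine Finset.sum_congr rfl fun q hq => ?_
  rw [mem_classes] at hq
  have hcard : Nat.card {e : Fin q.rep.size ≃ Fin n // (q.rep.graph.map e).IsFeynman r} =
      n.factorial := by
    have h1 : Nat.card {e : Fin q.rep.size ≃ Fin n // (q.rep.graph.map e).IsFeynman r} =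
        Nat.card (Fin q.rep.size ≃ Fin n) :=
      Nat.card_congr (Equiv.subtypeUnivEquiv fun e =>
        (isIso_map e _).isFeynman (hq.1 ▸ q.rep.isFeynman))
    rw [h1, Nat.card_eq_fintype_card, Fintype.card_equiv (finCongr hq.2), Fintype.card_fin, hq.2]
  rw [hcard, smul_smul]
  congr 1
  have : (n.factorial : ℚ) ≠ 0 := by exact_mod_cast n.factorial_ne_zero
  field_simp

/-- The shrunk graphs on `j` half-edges together with subgraphs on `m` half-edges. -/
def shrunkSum (T : Theory) (r : Multiset T.Leg) (k m j : ℕ) : GraphAlgebra T ⊗[ℚ] GraphAlgebra T :=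
  ((1 : ℚ) / j.factorial) • ∑ K ∈ shrunkGraphs T r (Fin j), outerTerm k m K

theorem shrunkSum_eq_zero {k m j : ℕ} (h : 6 * k + 3 * Multiset.card r < j + m) :
    shrunkSum T r k m j = 0 := by
  rw [shrunkSum, Finset.sum_eq_zero, smul_zero]
  intro K hK
  rw [mem_shrunkGraphs] at hK
  exact outerTerm_eq_zero hK (by rwa [Nat.card_eq_fintype_card, Fintype.card_fin])

open Classical in
theorem sum_coproductSum_fin (hr : r ∈ T.amplitudes) (k n : ℕ) :
    ((1 : ℚ) / n.factorial) • ∑ G ∈ (feynmanGraphs T r (Fin n)).filter fun G => G.loops = k,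
      (coproductSum G - toAlgebra G ⊗ₜ 1) =
    ∑ p ∈ Finset.HasAntidiagonal.antidiagonal n, shrunkSum T r k p.1 p.2 := by
  have h1 : ∀ S : Finset (Fin n), ∑ K ∈ shrunkGraphs T r {a // a ∉ (S : Set (Fin n))},
      (S.card.factorial : ℚ) • outerTerm k S.card K =
      ((S.card.factorial * (n - S.card).factorial : ℕ) : ℚ) •
        shrunkSum T r k S.card (n - S.card) := by
    intro S
    have hcard : Nat.card {a // a ∉ (S : Set (Fin n))} = Nat.card (Fin (n - S.card)) := by
      simp [Nat.card_eq_fintype_card, Fintype.card_subtype_compl]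
    have h2 := sum_map_eq (r := r) (Y := weightedTerm k S.card fillPoly 1)
      (Finite.card_eq.1 hcard).some
      (fun h _ => weightedTerm_iso h k S.card fillPoly 1) (fun _ => True) (fun _ => True)
      fun _ => Iff.rfl
    simp only [Finset.filter_true, ← outerTerm_eq] at h2
    have h3 : ((n - S.card).factorial : ℚ) ≠ 0 := by exact_mod_cast (n - S.card).factorial_ne_zero
    rw [← Finset.smul_sum, h2, shrunkSum, smul_smul]
    congr 1
    push_cast
    field_simp
  have h2 := Finset.sum_powerset_apply_card (fun m => ((m.factorial * (n - m).factorial : ℕ) : ℚ) •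
    shrunkSum T r k m (n - m)) (x := (Finset.univ : Finset (Fin n)))
  rw [sum_coproductSum_sub hr, Finset.sum_congr rfl fun S _ => h1 S,
    ← Finset.powerset_univ, h2, Finset.card_univ, Fintype.card_fin, Finset.smul_sum,
    Finset.Nat.sum_antidiagonal_eq_sum_range_succ (fun m j => shrunkSum T r k m j)]
  refine Finset.sum_congr rfl fun m hm => ?_
  have hmn : m ≤ n := Nat.lt_succ_iff.1 (Finset.mem_range.1 hm)
  rw [← Nat.cast_smul_eq_nsmul ℚ, smul_smul, smul_smul]
  have h3 : (n.factorial : ℚ) ≠ 0 := by exact_mod_cast n.factorial_ne_zero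
  have h4 : ((n.choose m * m.factorial * (n - m).factorial : ℕ) : ℚ) = n.factorial := by
    rw [Nat.choose_mul_factorial_mul_factorial hmn]
  have h5 : 1 / (n.factorial : ℚ) *
      ((n.choose m : ℚ) * ((m.factorial * (n - m).factorial : ℕ) : ℚ)) = 1 := by
    rw [one_div, inv_mul_eq_one₀ h3, ← h4]
    push_cast
    ring
  convert one_smul ℚ _ using 2
  linear_combination h5

theorem sum_range_antidiagonal {M : Type} [AddCommMonoid M] (a : ℕ → ℕ → M) {B N N' : ℕ}
    (ha : ∀ m j, B < m + j → a m j = 0) (hN : B < N) (hN' : B < N') :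
    ∑ n ∈ Finset.range (B + 1), ∑ p ∈ Finset.HasAntidiagonal.antidiagonal n, a p.1 p.2 =
      ∑ m ∈ Finset.range N, ∑ j ∈ Finset.range N', a m j := by
  rw [← Finset.sum_product', Finset.sum_sigma']
  refine Finset.sum_bij_ne_zero (fun x _ _ => x.2) ?_ ?_ ?_ ?_
  · rintro ⟨n, m, j⟩ h _
    simp only [Finset.mem_sigma, Finset.mem_range, Finset.HasAntidiagonal.mem_antidiagonal] at h
    simp only [Finset.mem_product, Finset.mem_range]
    omega
  · rintro ⟨n, m, j⟩ h _ ⟨n', m', j'⟩ h' _ heq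
    simp only [Finset.mem_sigma, Finset.mem_range, Finset.HasAntidiagonal.mem_antidiagonal] at h h'
    simp only [Prod.mk.injEq] at heq
    obtain ⟨rfl, rfl⟩ := heq
    obtain rfl : n = n' := by omega
    rfl
  · rintro ⟨m, j⟩ _ hne
    refine ⟨⟨m + j, m, j⟩, ?_, hne, rfl⟩
    simp only [Finset.mem_sigma, Finset.mem_range, Finset.HasAntidiagonal.mem_antidiagonal, and_true]
    by_contra hh
    exact hne (ha m j (by omega))
  · rintro ⟨n, m, j⟩ _ _
    rfl

/-- The coproduct of the sum of all graphs with `k` loops as a sum over shrunk graphs. -/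
theorem sum_loopClasses_eq (hr : r ∈ T.amplitudes) (k : ℕ) {N N' : ℕ}
    (hN : 6 * k + 3 * Multiset.card r < N) (hN' : 6 * k + 3 * Multiset.card r < N') :
    ∑ q ∈ loopClasses T r k, ((1 : ℚ) / q.rep.graph.autCard) •
      (graphCoproduct q.rep - MvPolynomial.X q ⊗ₜ 1) =
    ∑ m ∈ Finset.range N, ∑ j ∈ Finset.range N', shrunkSum T r k m j := by
  classical
  rw [← sum_range_antidiagonal (shrunkSum T r k)
    (fun m j h => shrunkSum_eq_zero (by omega)) hN hN']
  have h1 : ∀ n, ∑ p ∈ Finset.HasAntidiagonal.antidiagonal n, shrunkSum T r k p.1 p.2 =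
      ∑ q ∈ (classes T r n).filter fun q => q.rep.graph.loops = k,
        ((1 : ℚ) / q.rep.graph.autCard) • (graphCoproduct q.rep - MvPolynomial.X q ⊗ₜ 1) := by
    intro n
    rw [← sum_coproductSum_fin hr, Finset.sum_filter, sum_feynmanGraphs_eq hr n
      (fun q => if q.rep.graph.loops = k then
        graphCoproduct q.rep - MvPolynomial.X q ⊗ₜ 1 else 0), Finset.sum_filter]
    · refine Finset.sum_congr rfl fun q _ => ?_
      rw [smul_ite, smul_zero]
    · intro q G e h
      rw [h.loops, h.coproductSum, toAlgebra_of_rep_iso h, graphCoproduct_eq]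
  rw [Finset.sum_congr rfl fun n _ => h1 n, Finset.sum_sigma']
  symm
  refine Finset.sum_bij (fun x _ => x.2) ?_ ?_ ?_ fun _ _ => rfl
  · rintro ⟨n, q⟩ h
    simp only [Finset.mem_sigma, Finset.mem_filter, mem_classes] at h
    exact mem_loopClasses.2 ⟨h.2.1.1, h.2.2⟩
  · rintro ⟨n, q⟩ h ⟨n', q'⟩ h' (rfl : q = q')
    simp only [Finset.mem_sigma, Finset.mem_filter, mem_classes] at h h'
    obtain rfl : n = n' := h.2.1.2.symm.trans h'.2.1.2
    rfl
  · intro q hq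
    rw [mem_loopClasses] at hq
    refine ⟨⟨q.rep.size, q⟩, ?_, rfl⟩
    simp only [Finset.mem_sigma, Finset.mem_filter, mem_classes, Finset.mem_range]
    have h := q.rep.isGraph.card_le
    rw [Nat.card_eq_fintype_card, Fintype.card_fin, hq.1, hq.2] at h
    exact ⟨by omega, ⟨hq.1, trivial⟩, hq.2⟩

end

section

open HalfEdgeGraph

variable {T : Theory} {r : Multiset T.Leg} {H : Type}

/-! ### Summation over the vertices with two half-edges -/

/-- A product over the vertices, collected by types. -/
theorem HalfEdgeGraph.vertexProd_eq_prod [Finite H] (G : HalfEdgeGraph T H) {ι : Type} [Fintype ι]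
    {f : ι → Multiset T.Leg} (hf : Function.Injective f) {C : Type} [CommMonoid C]
    {g : Multiset T.Leg → C} (hg : ∀ a, G.vertexType a ∉ Set.range f → g (G.vertexType a) = 1) :
    G.vertexProd g = ∏ i, g (f i) ^ G.vertexCount (f i) := by
  classical
  have := Fintype.ofFinite (Quotient G.vertex)
  have h1 : ∀ v, g (G.typeOf v) = ∏ i, if G.typeOf v = f i then g (f i) else 1 := by
    intro v
    by_cases hv : ∃ i, f i = G.typeOf v
    · obtain ⟨i, hi⟩ := hv
      rw [Finset.prod_eq_single i, if_pos hi.symm, hi]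
      · intro j _ hj
        exact if_neg fun h => hj (hf (h.symm.trans hi.symm))
      · exact fun h => (h (Finset.mem_univ i)).elim
    · rw [Finset.prod_eq_one fun i _ => if_neg fun h => hv ⟨i, h.symm⟩]
      induction v using Quotient.inductionOn with | _ a => ?_
      exact hg a hv
  rw [vertexProd, finprod_eq_prod_of_fintype, Finset.prod_congr rfl fun v _ => h1 v,
    Finset.prod_comm]
  refine Finset.prod_congr rfl fun i _ => ?_
  rw [Finset.prod_ite, Finset.prod_const, Finset.prod_const_one, mul_one, vertexCount,
    Nat.card_eq_fintype_card, Fintype.card_subtype]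

theorem HalfEdgeGraph.vertexProd_mul [Finite H] (G : HalfEdgeGraph T H) {C : Type} [CommMonoid C]
    (g h : Multiset T.Leg → C) :
    G.vertexProd (fun s => g s * h s) = G.vertexProd g * G.vertexProd h := by
  have := Fintype.ofFinite (Quotient G.vertex)
  simp only [vertexProd, finprod_eq_prod_of_fintype, Finset.prod_mul_distrib]

theorem Propagator.injective : Function.Injective fun s : Propagator T => s.1.1 :=
  fun _ _ h => Subtype.ext (Subtype.ext h)

open Classical in
/-- The weight of a vertex that does not have two half-edges. -/
def vertexWeight (s : Multiset T.Leg) : PowerSeries (Polynomial (GraphAlgebra T)) :=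
  if Multiset.card s = 2 then 1 else fillPoly s

/-- The weight of `n s` vertices of each type `s` with two half-edges. -/
def bivalentWeight (n : Propagator T → ℕ) : PowerSeries (Polynomial (GraphAlgebra T)) :=
  ∏ s, fillPoly s.1.1 ^ n s

theorem HalfEdgeGraph.IsShrunk.vertexProd_fillPoly [Finite H] {G : HalfEdgeGraph T H}
    (hG : G.IsShrunk r) :
    G.vertexProd fillPoly = G.vertexProd vertexWeight * bivalentWeight fun s =>
      G.vertexCount s.1.1 := by
  classical
  let h : Multiset T.Leg → PowerSeries (Polynomial (GraphAlgebra T)) := fun s =>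
    if Multiset.card s = 2 then fillPoly s else 1
  have h1 : (fillPoly : Multiset T.Leg → PowerSeries (Polynomial (GraphAlgebra T))) =
      fun s => vertexWeight s * h s := by
    funext s
    simp only [vertexWeight, h]
    split_ifs <;> simp
  have h2 : G.vertexProd h = bivalentWeight fun s => G.vertexCount s.1.1 := by
    rw [vertexProd_eq_prod G Propagator.injective]
    · exact Finset.prod_congr rfl fun s _ => by simp only [h, if_pos s.2]
    · intro a ha
      refine if_neg fun hc => ha ?_
      rcases hG.type_mem a with hv | hv
      · have := T.three_le_card _ hv
        omega
      · exact ⟨⟨⟨_, hv⟩, hc⟩, rfl⟩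
  conv_lhs => rw [h1, vertexProd_mul, h2]

theorem outerTerm_eq_of_hasProfile [Finite H] {G : HalfEdgeGraph T H} (hG : G.IsShrunk r)
    {n : Propagator T → ℕ} (hn : G.HasProfile n) (k m : ℕ) :
    outerTerm k m G = weightedTerm k m vertexWeight (bivalentWeight n) H G := by
  rw [outerTerm_eq, weightedTerm, weightedTerm, hG.vertexProd_fillPoly, mul_one]
  have : (fun s : Propagator T => G.vertexCount s.1.1) = n := funext hn
  rw [this]

theorem X_dvd_fillPoly (s : Propagator T) :
    (PowerSeries.X : PowerSeries (Polynomial (GraphAlgebra T))) ∣ fillPoly s.1.1 :=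
  PowerSeries.X_dvd_iff.2 (constantCoeff_fillPoly s.notMem)

/-- Each vertex with two half-edges carries at least one loop, so that there are at most `k`. -/
theorem weightedTerm_eq_zero [Finite H] (G : HalfEdgeGraph T H) {k : ℕ} (m : ℕ)
    (g : Multiset T.Leg → PowerSeries (Polynomial (GraphAlgebra T)))
    {n : Propagator T → ℕ} {s : Propagator T} (hs : k < n s) :
    weightedTerm k m g (bivalentWeight n) H G = 0 := by
  rw [weightedTerm]
  split_ifs
  · have h0 : fillPoly s.1.1 ^ n s ∣ bivalentWeight n :=
      Finset.dvd_prod_of_mem (fun s : Propagator T => fillPoly s.1.1 ^ n s) (Finset.mem_univ s)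
    have h1 : PowerSeries.X ^ (k + 1) ∣ G.vertexProd g * bivalentWeight n :=
      Dvd.dvd.mul_left (dvd_trans (pow_dvd_pow _ hs)
        (dvd_trans (pow_dvd_pow_of_dvd (X_dvd_fillPoly s) _) h0)) _
    rw [PowerSeries.X_pow_dvd_iff.1 h1 _ (by omega), Polynomial.coeff_zero, TensorProduct.zero_tmul]
  · rfl

open Classical in
theorem sum_outerTerm_eq [Finite H] (k m : ℕ) :
    ∑ G ∈ shrunkGraphs T r H, outerTerm k m G =
      ∑ n ∈ Fintype.piFinset fun _ : Propagator T => Finset.range (k + 1),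
        ∑ G ∈ (shrunkGraphs T r H).filter fun G => G.HasProfile n,
          weightedTerm k m vertexWeight (bivalentWeight n) H G := by
  simp_rw [Finset.sum_filter]
  rw [Finset.sum_comm]
  refine Finset.sum_congr rfl fun G hG => ?_
  rw [mem_shrunkGraphs] at hG
  have hp : G.HasProfile fun s => G.vertexCount s.1.1 := fun _ => rfl
  rw [outerTerm_eq_of_hasProfile hG hp]
  by_cases hn : (fun s : Propagator T => G.vertexCount s.1.1) ∈
      Fintype.piFinset fun _ : Propagator T => Finset.range (k + 1)
  · rw [Finset.sum_eq_single_of_mem _ hn, if_pos hp]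
    exact fun n _ hne => if_neg fun h => hne (funext fun s => (h s).symm)
  · rw [Finset.sum_eq_zero fun n hn' => if_neg fun h => hn ?_]
    · simp only [Fintype.mem_piFinset, Finset.mem_range, not_forall, not_lt] at hn
      obtain ⟨s, hs⟩ := hn
      exact weightedTerm_eq_zero G m _ (s := s) hs
    · rwa [show (fun s : Propagator T => G.vertexCount s.1.1) = n from funext h]

theorem HalfEdgeGraph.HasProfile.two_mul_sum_le [Finite H] {G : HalfEdgeGraph T H}
    {n : Propagator T → ℕ} (h : G.HasProfile n) : 2 * ∑ s, n s ≤ Nat.card H := by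
  classical
  have := Fintype.ofFinite H
  have h1 : ∀ s : Propagator T, 2 * n s = ∑ a : H, if G.vertexType a = s.1.1 then 1 else 0 := by
    intro s
    have h2 := card_vertexType_eq G s.1.1
    rw [s.2, h s, Nat.card_eq_fintype_card, Fintype.card_subtype] at h2
    rw [← h2, Finset.card_filter]
  rw [Finset.mul_sum, Finset.sum_congr rfl fun s _ => h1 s, Finset.sum_comm,
    Nat.card_eq_fintype_card, Fintype.card_eq_sum_ones]
  refine Finset.sum_le_sum fun a _ => ?_
  by_cases ha : ∃ s : Propagator T, G.vertexType a = s.1.1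
  · obtain ⟨s, hs⟩ := ha
    rw [Finset.sum_eq_single_of_mem s (Finset.mem_univ s)]
    · rw [if_pos hs]
    · exact fun t _ ht => if_neg fun h => ht (Propagator.injective (h.symm.trans hs))
  · rw [Finset.sum_eq_zero fun s _ => if_neg fun h => ha ⟨s, h⟩]
    exact Nat.zero_le _

theorem HalfEdgeGraph.IsGraph.not_bivalent [Finite H] {G : HalfEdgeGraph T H} (hG : G.IsGraph)
    (a : H) : ¬ G.Bivalent a := fun h => by
  have := T.three_le_card _ (hG.vertex_mem a)
  rw [Bivalent] at h
  omega

theorem HalfEdgeGraph.vertexCount_eq_zero [Finite H] {G : HalfEdgeGraph T H} {s : Multiset T.Leg} :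
    G.vertexCount s = 0 ↔ ∀ a, G.vertexType a ≠ s := by
  rw [vertexCount, Finite.card_eq_zero_iff, isEmpty_subtype]
  exact ⟨fun h a => h (Quotient.mk _ a), fun h v => by
    induction v using Quotient.inductionOn with | _ a => ?_
    exact h a⟩

open Classical in
/-- The shrunk graphs without vertices that have two half-edges are the Feynman graphs. -/
theorem filter_hasProfile_zero [Finite H] :
    (shrunkGraphs T r H).filter (fun G => G.HasProfile 0) = feynmanGraphs T r H := by
  ext G
  rw [Finset.mem_filter, mem_shrunkGraphs, mem_feynmanGraphs]
  constructor
  · rintro ⟨h, h0⟩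
    refine ⟨h.isMatching.isGraph fun a => ?_, h.onePI, h.residue_eq, h.has_edge⟩
    by_contra hv
    have ha := (h.type_mem a).resolve_left hv
    obtain ⟨f, hf⟩ := (T.amplitudes_spec _ ha).resolve_left hv
    exact vertexCount_eq_zero.1 (h0 ⟨⟨_, ha⟩, (congrArg Multiset.card hf).trans (by simp)⟩) a rfl
  · intro h
    refine ⟨⟨h.isGraph.isMatching, h.onePI, h.residue_eq, h.has_edge,
      fun a => .inl (h.isGraph.vertex_mem a)⟩, fun s => ?_⟩
    rw [Pi.zero_apply, vertexCount_eq_zero]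
    exact fun a ha => h.isGraph.not_bivalent a (by rw [Bivalent, ha, s.2])

open Classical in
/-- The sum over the shrunk graphs with a given number of vertices with two half-edges, as a sum
over Feynman graphs. -/
theorem sum_range_profile (hr : r ∈ T.amplitudes) {k N : ℕ} (m : ℕ)
    (hN : 6 * k + 3 * Multiset.card r < N) (n : Propagator T → ℕ) :
    ∑ j ∈ Finset.range N, ((1 : ℚ) / j.factorial) •
        ∑ G ∈ (shrunkGraphs T r (Fin j)).filter fun G => G.HasProfile n,
          weightedTerm k m vertexWeight (bivalentWeight n) _ G =
      ∑ l ∈ Finset.range N, ∑ q ∈ classes T r l, ((1 : ℚ) / q.rep.graph.autCard) •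
        ((∏ s, Nat.multichoose (q.rep.graph.edgeCount s.1.1) (n s) : ℕ) : ℚ) •
          weightedTerm k m vertexWeight (bivalentWeight n) _ q.rep.graph := by
  set f : ℕ → GraphAlgebra T ⊗[ℚ] GraphAlgebra T := fun j => ((1 : ℚ) / j.factorial) •
    ∑ G ∈ (shrunkGraphs T r (Fin j)).filter (fun G => G.HasProfile n),
      weightedTerm k m vertexWeight (bivalentWeight n) _ G with hf
  have hbig : ∀ j, N ≤ j → f j = 0 := by
    intro j hj
    rw [hf]
    simp only
    rw [Finset.sum_eq_zero, smul_zero]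
    intro G hG
    rw [Finset.mem_filter, mem_shrunkGraphs] at hG
    rw [← outerTerm_eq_of_hasProfile hG.1 hG.2]
    exact outerTerm_eq_zero hG.1 (by rw [Nat.card_eq_fintype_card, Fintype.card_fin]; omega)
  have hsmall : ∀ j, j < 2 * ∑ s, n s → f j = 0 := by
    intro j hj
    rw [hf]
    simp only
    rw [Finset.sum_eq_zero, smul_zero]
    intro G hG
    rw [Finset.mem_filter, mem_shrunkGraphs] at hG
    have := hG.2.two_mul_sum_le
    rw [Nat.card_eq_fintype_card, Fintype.card_fin] at this
    omega
  have h1 : ∑ j ∈ Finset.range N, f j = ∑ l ∈ Finset.range N, f (l + 2 * ∑ s, n s) := by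
    have h2 := Finset.sum_range_add f (2 * ∑ s, n s) N
    have h3 := Finset.sum_range_add f N (2 * ∑ s, n s)
    rw [Finset.sum_eq_zero (s := Finset.range (2 * ∑ s, n s)) fun j hj =>
      hsmall j (Finset.mem_range.1 hj), zero_add] at h2
    rw [Finset.sum_eq_zero (s := Finset.range (2 * ∑ s, n s)) fun j _ =>
      hbig (N + j) (by omega), add_zero, add_comm N] at h3
    rw [← h3, h2]
    exact Finset.sum_congr rfl fun l _ => by rw [add_comm]
  rw [h1]
  refine Finset.sum_congr rfl fun l _ => ?_
  have h2 := sum_profile_eq hr l (∑ s, n s) (weightedTerm k m vertexWeight (bivalentWeight n))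
    (isSubdivisionInvariant_weightedTerm r k m (fun s hs => if_pos hs) _) n rfl
  rw [hf]
  simp only
  rw [h2, filter_hasProfile_zero]
  refine sum_feynmanGraphs_eq hr l (fun q =>
    ((∏ s, Nat.multichoose (q.rep.graph.edgeCount s.1.1) (n s) : ℕ) : ℚ) •
      weightedTerm k m vertexWeight (bivalentWeight n) _ q.rep.graph) _ fun q G e h => ?_
  rw [weightedTerm_iso h]
  simp only [h.edgeCount q.rep.isGraph.isMatching]

theorem sum_classes_eq {M : Type} [AddCommMonoid M] {k N : ℕ}
    (hN : 6 * k + 3 * Multiset.card r < N) (F : GraphClass T → M)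
    (hF : ∀ q, k < q.rep.graph.loops → F q = 0) :
    ∑ l ∈ Finset.range N, ∑ q ∈ classes T r l, F q =
      ∑ i ∈ Finset.range (k + 1), ∑ q ∈ loopClasses T r i, F q := by
  rw [Finset.sum_sigma', Finset.sum_sigma']
  refine Finset.sum_bij_ne_zero (fun x _ _ => ⟨x.2.rep.graph.loops, x.2⟩) ?_ ?_ ?_ ?_
  · rintro ⟨l, q⟩ h hne
    simp only [Finset.mem_sigma, Finset.mem_range, mem_classes] at h
    simp only [Finset.mem_sigma, Finset.mem_range, mem_loopClasses, and_true]
    refine ⟨?_, h.2.1⟩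
    by_contra hh
    exact hne (hF q (by omega))
  · rintro ⟨l, q⟩ h _ ⟨l', q'⟩ h' _ heq
    simp only [Finset.mem_sigma, mem_classes] at h h'
    obtain rfl : q = q' := by
      injection heq
    obtain rfl : l = l' := h.2.2.symm.trans h'.2.2
    rfl
  · rintro ⟨i, q⟩ h hne
    simp only [Finset.mem_sigma, Finset.mem_range, mem_loopClasses] at h
    refine ⟨⟨q.rep.size, q⟩, ?_, hne, ?_⟩
    · simp only [Finset.mem_sigma, mem_classes, Finset.mem_range]
      have h1 := q.rep.isGraph.card_le
      rw [Nat.card_eq_fintype_card, Fintype.card_fin, h.2.1, h.2.2] at h1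
      exact ⟨by omega, h.2.1, trivial⟩
    · simp only [h.2.2]
  · rintro ⟨l, q⟩ _ _
    rfl

open Classical in
/-- The coproduct as a sum over the graphs that remain after the contraction. -/
theorem sum_loopClasses_eq_sum (hr : r ∈ T.amplitudes) (k : ℕ) :
    ∑ q ∈ loopClasses T r k, ((1 : ℚ) / q.rep.graph.autCard) •
      (graphCoproduct q.rep - MvPolynomial.X q ⊗ₜ 1) =
    ∑ i ∈ Finset.range (k + 1), ∑ q ∈ loopClasses T r i, ((1 : ℚ) / q.rep.graph.autCard) •
      PowerSeries.coeff (k - q.rep.graph.loops) (evalSeries _ (q.rep.graph.vertexProd vertexWeight *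
        ∑ n ∈ Fintype.piFinset fun _ : Propagator T => Finset.range (k + 1),
          (∏ s, Nat.multichoose (q.rep.graph.edgeCount s.1.1) (n s)) • bivalentWeight n)) ⊗ₜ
        MvPolynomial.X q := by
  let p : GraphClass T → Polynomial (GraphAlgebra T) := fun q =>
    PowerSeries.coeff (k - q.rep.graph.loops) (q.rep.graph.vertexProd vertexWeight *
        ∑ n ∈ Fintype.piFinset fun _ : Propagator T => Finset.range (k + 1),
          (∏ s, Nat.multichoose (q.rep.graph.edgeCount s.1.1) (n s)) • bivalentWeight n)
  let N := 6 * k + 3 * Multiset.card r + 1 +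
    ∑ i ∈ Finset.range (k + 1), ∑ q ∈ loopClasses T r i, (p q).natDegree
  have hN : 6 * k + 3 * Multiset.card r < N := by omega
  have hp : ∀ i ∈ Finset.range (k + 1), ∀ q ∈ loopClasses T r i, (p q).natDegree < N := by
    intro i hi q hq
    have h1 := Finset.single_le_sum (f := fun i => ∑ q ∈ loopClasses T r i, (p q).natDegree)
      (fun _ _ => Nat.zero_le _) hi
    have h2 := Finset.single_le_sum (f := fun q => (p q).natDegree) (fun _ _ => Nat.zero_le _) hq
    exact Nat.lt_of_le_of_lt (h2.trans h1) (by omega)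
  have hW : ∀ (m : ℕ) (n : Propagator T → ℕ) (q : GraphClass T), q.rep.graph.loops ≤ k →
      weightedTerm k m vertexWeight (bivalentWeight n) _ q.rep.graph =
        (PowerSeries.coeff (k - q.rep.graph.loops)
          (q.rep.graph.vertexProd vertexWeight * bivalentWeight n)).coeff m ⊗ₜ
            MvPolynomial.X q := by
    intro m n q hq
    rw [weightedTerm, if_pos hq,
      q.rep.isGraph.isMatching.toAlgebra_smooth q.rep.isGraph.not_bivalent,
      toAlgebra_of_rep_iso (IsIso.refl _)]
  have h1 : ∀ m, ∑ j ∈ Finset.range N, shrunkSum T r k m j =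
      ∑ i ∈ Finset.range (k + 1), ∑ q ∈ loopClasses T r i, ((1 : ℚ) / q.rep.graph.autCard) •
        ((p q).coeff m ⊗ₜ[ℚ] MvPolynomial.X q) := by
    intro m
    simp only [shrunkSum, sum_outerTerm_eq, Finset.smul_sum (s := Fintype.piFinset _)]
    rw [Finset.sum_comm, Finset.sum_congr rfl fun n _ => sum_range_profile hr m hN n,
      Finset.sum_congr rfl fun n _ => sum_classes_eq hN _ ?_, Finset.sum_comm]
    · refine Finset.sum_congr rfl fun i hi => ?_
      rw [Finset.sum_comm]
      refine Finset.sum_congr rfl fun q hq => ?_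
      have hq' : q.rep.graph.loops ≤ k := by
        rw [(mem_loopClasses.1 hq).2]
        exact Nat.lt_succ_iff.1 (Finset.mem_range.1 hi)
      rw [← Finset.smul_sum]
      simp only [p]
      rw [Finset.mul_sum, map_sum, Polynomial.finsetSum_coeff,
        TensorProduct.sum_tmul]
      congr 1
      refine Finset.sum_congr rfl fun n _ => ?_
      rw [hW m n q hq', mul_smul_comm, map_nsmul, Polynomial.coeff_smul, Nat.cast_smul_eq_nsmul,
        TensorProduct.smul_tmul']
    · intro q hq
      rw [weightedTerm, if_neg (by omega), smul_zero, smul_zero]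
  rw [sum_loopClasses_eq hr k hN hN, Finset.sum_congr rfl fun m _ => h1 m, Finset.sum_comm]
  refine Finset.sum_congr rfl fun i hi => ?_
  rw [Finset.sum_comm]
  refine Finset.sum_congr rfl fun q hq => ?_
  rw [← Finset.smul_sum, ← TensorProduct.sum_tmul, coeff_evalSeries,
    Polynomial.eval_eq_sum_range' (hp i hi q hq)]
  simp only [one_pow, mul_one]

end

section

open HalfEdgeGraph

variable {T : Theory}

/-! ### The coproduct of the graph sums -/

/-- The truncated series `∑ multichoose E n w ^ n` is inverse to `(1 - w) ^ E` up to terms of high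
order. -/
theorem exists_mul_sum_multichoose {R : Type*} [CommRing R] (w : R) (k E : ℕ) :
    ∃ d, (1 - w) ^ E * ∑ n ∈ Finset.range (k + 1), (Nat.multichoose E n : R) * w ^ n =
      1 + w ^ (k + 1) * d := by
  induction E with
  | zero =>
    refine ⟨0, ?_⟩
    rw [Finset.sum_range_succ', Finset.sum_eq_zero fun n _ => ?_]
    · simp
    · simp
  | succ E ih =>
    obtain ⟨d, hd⟩ := ih
    have h1 : ∀ k, (1 - w) * ∑ n ∈ Finset.range (k + 1), (Nat.multichoose (E + 1) n : R) * w ^ n =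
        ∑ n ∈ Finset.range (k + 1), (Nat.multichoose E n : R) * w ^ n -
          w ^ (k + 1) * Nat.multichoose (E + 1) k := by
      intro k
      induction k with
      | zero => simp
      | succ k ih =>
        rw [Finset.sum_range_succ, mul_add, ih, Finset.sum_range_succ _ (k + 1),
          Nat.multichoose_succ_succ]
        push_cast
        ring
    refine ⟨d - (1 - w) ^ E * Nat.multichoose (E + 1) k, ?_⟩
    rw [pow_succ, mul_assoc, h1, mul_sub, hd]
    ring

open Classical in
/-- The sign with which the graphs of an amplitude are counted: `1` for a vertex, `-1` for a
propagator. -/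
def sign (s : T.amplitudes) : ℤ := if s.1 ∈ T.vertexTypes then 1 else -1

theorem sign_mul_self (s : T.amplitudes) : sign s * sign s = 1 := by
  unfold sign
  split_ifs <;> rfl

/-- The dressing `1 ± ∑ c_k^s λ^k` of an amplitude. -/
def dressingSeries (s : T.amplitudes) : PowerSeries (GraphAlgebra T) :=
  1 + (sign s : GraphAlgebra T) • PowerSeries.mk fun k => graphSum T s k

theorem coeff_dressingSeries (s : T.amplitudes) (k : ℕ) :
    PowerSeries.coeff k (dressingSeries s) =
      if k = 0 then 1 else (sign s : GraphAlgebra T) * graphSum T s k := by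
  rw [dressingSeries, map_add, PowerSeries.coeff_smul, PowerSeries.coeff_mk, PowerSeries.coeff_one]
  split_ifs with h
  · rw [h, graphSum_zero, smul_zero, add_zero]
  · rw [zero_add, smul_eq_mul]

theorem isUnit_dressingSeries (s : T.amplitudes) : IsUnit (dressingSeries s) := by
  rw [PowerSeries.isUnit_iff_constantCoeff, ← PowerSeries.coeff_zero_eq_constantCoeff_apply,
    coeff_dressingSeries, if_pos rfl]
  exact isUnit_one

/-- The dressing as a unit of the ring of power series. -/
def dressing (s : T.amplitudes) : (PowerSeries (GraphAlgebra T))ˣ := (isUnit_dressingSeries s).unit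

theorem dressing_of_mem {s : T.amplitudes} (hs : s.1 ∈ T.vertexTypes) :
    (dressing s : PowerSeries (GraphAlgebra T)) = ampSeries s.1 := by
  rw [dressing, IsUnit.unit_spec, dressingSeries, ampSeries, sign, if_pos hs, if_pos hs]
  simp

theorem dressing_of_notMem {s : T.amplitudes} (hs : s.1 ∉ T.vertexTypes) :
    (dressing s : PowerSeries (GraphAlgebra T)) = 1 - ampSeries s.1 := by
  rw [dressing, IsUnit.unit_spec, dressingSeries, ampSeries, sign, if_neg hs, if_neg hs]
  simp [sub_eq_add_neg]

/-- The invariant charge. -/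
def charge (Q : T.amplitudes → ℤ) : (PowerSeries (GraphAlgebra T))ˣ :=
  ∏ s, dressing s ^ (sign s * Q s)

theorem X_dvd_ampSeries {s : Multiset T.Leg} (hs : s ∉ T.vertexTypes) :
    (PowerSeries.X : PowerSeries (GraphAlgebra T)) ∣ ampSeries s := by
  rw [PowerSeries.X_dvd_iff, ← PowerSeries.coeff_zero_eq_constantCoeff_apply, ampSeries, if_neg hs,
    map_zero, zero_add, PowerSeries.coeff_mk, graphSum_zero]

theorem HalfEdgeGraph.IsGraph.vertexCount_eq_zero {H : Type} [Finite H] {G : HalfEdgeGraph T H}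
    (hG : G.IsGraph) {s : Multiset T.Leg} (hs : s ∉ T.vertexTypes) : G.vertexCount s = 0 :=
  HalfEdgeGraph.vertexCount_eq_zero.2 fun a h => hs (h ▸ hG.vertex_mem a)

theorem HalfEdgeGraph.edgeCount_eq_zero {H : Type} (G : HalfEdgeGraph T H)
    {s : Multiset T.Leg} (hs : s ∈ T.vertexTypes) : G.edgeCount s = 0 := by
  rw [edgeCount]
  convert Set.ncard_empty (Sym2 H)
  rw [Set.eq_empty_iff_forall_notMem]
  rintro _ ⟨a, b, -, -, h⟩
  have := T.three_le_card _ hs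
  rw [← h] at this
  simp at this

theorem Propagator.iff_notMem (s : T.amplitudes) :
    Multiset.card s.1 = 2 ↔ s.1 ∉ T.vertexTypes := by
  refine ⟨fun h => Propagator.notMem ⟨s, h⟩, fun h => ?_⟩
  obtain ⟨f, hf⟩ := (T.amplitudes_spec _ s.2).resolve_left h
  rw [hf]
  simp

/-- The number of vertices and edges, with the exponents of their dressings. -/
theorem dressing_prod_eq {Q : T.amplitudes → ℤ} (hQ : HasInvariantCharge T Q) (Γ : FeynmanGraph T)
    {r : T.amplitudes} (hr : Γ.graph.residue = r) :
    (dressing r * charge Q ^ Γ.graph.loops) *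
      ∏ s : Propagator T, dressing s.1 ^ Γ.graph.edgeCount s.1.1 =
      ∏ s : T.amplitudes, dressing s ^ Γ.graph.vertexCount s := by
  classical
  have h1 : dressing r = ∏ s : T.amplitudes, dressing s ^ (if s = r then (1 : ℤ) else 0) := by
    rw [Finset.prod_eq_single r]
    · simp
    · intro s _ hs
      simp [hs]
    · simp
  have h2 : ∏ s : Propagator T, dressing s.1 ^ Γ.graph.edgeCount s.1.1 =
      ∏ s : T.amplitudes, dressing s ^ Γ.graph.edgeCount s := by
    rw [← Finset.prod_subtype (Finset.univ.filter fun s : T.amplitudes => Multiset.card s.1 = 2)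
      (by simp) fun s => dressing s ^ Γ.graph.edgeCount s, Finset.prod_filter]
    refine Finset.prod_congr rfl fun s _ => ?_
    split_ifs with h
    · rfl
    · rw [edgeCount_eq_zero _ (not_not.1 (mt (Propagator.iff_notMem s).2 h)), pow_zero]
  rw [h1, h2, charge, ← Finset.prod_pow, ← Finset.prod_mul_distrib, ← Finset.prod_mul_distrib]
  refine Finset.prod_congr rfl fun s _ => ?_
  rw [← zpow_natCast, ← zpow_natCast, ← zpow_natCast, ← zpow_mul, ← zpow_add, ← zpow_add]
  congr 1
  have hocc := occurrences_eq Γ.graph s.1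
  obtain ⟨h3, h4, h5⟩ := hQ Γ s
  by_cases hv : s.1 ∈ T.vertexTypes
  · have he := edgeCount_eq_zero Γ.graph hv
    rw [he, add_zero] at hocc
    rw [← hocc, he, sign, if_pos hv]
    by_cases hs : s = r
    · rw [h4 (hs ▸ hr) hv, if_pos hs]
      push_cast
      ring
    · rw [h3 fun h => hs (Subtype.ext (h.symm.trans hr)), if_neg hs]
      push_cast
      ring
  · have he := Γ.isGraph.vertexCount_eq_zero hv
    rw [he, zero_add] at hocc
    rw [← hocc, he, sign, if_neg hv]
    by_cases hs : s = r
    · rw [h5 (hs ▸ hr) hv, if_pos hs]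
      push_cast
      ring
    · rw [h3 fun h => hs (Subtype.ext (h.symm.trans hr)), if_neg hs]
      push_cast
      ring

theorem evalSeries_bivalentWeight (n : Propagator T → ℕ) :
    evalSeries _ (bivalentWeight n) = ∏ s : Propagator T, ampSeries s.1.1 ^ n s := by
  rw [bivalentWeight, map_prod]
  exact Finset.prod_congr rfl fun s _ => by rw [map_pow, evalSeries_fillPoly]

theorem evalSeries_vertexProd (Γ : FeynmanGraph T) :
    evalSeries _ (Γ.graph.vertexProd vertexWeight) =
      ((∏ s : T.amplitudes, dressing s ^ Γ.graph.vertexCount s :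
        (PowerSeries (GraphAlgebra T))ˣ) : PowerSeries (GraphAlgebra T)) := by
  have := Fintype.ofFinite (Quotient Γ.graph.vertex)
  have h1 : evalSeries _ (Γ.graph.vertexProd vertexWeight) = Γ.graph.vertexProd ampSeries := by
    rw [vertexProd, vertexProd, finprod_eq_prod_of_fintype, finprod_eq_prod_of_fintype, map_prod]
    refine Finset.prod_congr rfl fun v _ => ?_
    induction v using Quotient.inductionOn with | _ a => ?_
    have ha : ¬ Multiset.card (Γ.graph.typeOf (Quotient.mk _ a)) = 2 := Γ.isGraph.not_bivalent a
    rw [vertexWeight, if_neg ha, evalSeries_fillPoly]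
  rw [h1, vertexProd_eq_prod Γ.graph (ι := T.amplitudes) Subtype.val_injective, Units.coe_prod]
  · refine Finset.prod_congr rfl fun s _ => ?_
    rw [Units.val_pow_eq_pow_val]
    by_cases hs : s.1 ∈ T.vertexTypes
    · rw [dressing_of_mem hs]
    · rw [Γ.isGraph.vertexCount_eq_zero hs, pow_zero, pow_zero]
  · intro a ha
    exact ampSeries_of_notMem (Γ.isGraph.vertex_mem a) fun h => ha ⟨⟨_, h⟩, rfl⟩

open Classical in
theorem coeff_evalSeries_eq {Q : T.amplitudes → ℤ} (hQ : HasInvariantCharge T Q)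
    (Γ : FeynmanGraph T) {r : T.amplitudes} (hr : Γ.graph.residue = r) {k j : ℕ} (hj : j ≤ k) :
    PowerSeries.coeff j (evalSeries _ (Γ.graph.vertexProd vertexWeight *
        ∑ n ∈ Fintype.piFinset fun _ : Propagator T => Finset.range (k + 1),
          (∏ s, Nat.multichoose (Γ.graph.edgeCount s.1.1) (n s)) • bivalentWeight n)) =
      PowerSeries.coeff j (dressing r * charge Q ^ Γ.graph.loops :
        (PowerSeries (GraphAlgebra T))ˣ).val := by
  have h1 : evalSeries (GraphAlgebra T)
      (∑ n ∈ Fintype.piFinset fun _ : Propagator T => Finset.range (k + 1),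
        (∏ s, Nat.multichoose (Γ.graph.edgeCount s.1.1) (n s)) • bivalentWeight n) =
      ∏ s : Propagator T, ∑ n ∈ Finset.range (k + 1),
        (Nat.multichoose (Γ.graph.edgeCount s.1.1) n : PowerSeries (GraphAlgebra T)) *
          ampSeries s.1.1 ^ n := by
    rw [Finset.prod_univ_sum, map_sum]
    refine Finset.sum_congr rfl fun n _ => ?_
    rw [map_nsmul, evalSeries_bivalentWeight, nsmul_eq_mul, Nat.cast_prod, Finset.prod_mul_distrib]
  have h2 : ∀ s : Propagator T, (PowerSeries.X : PowerSeries (GraphAlgebra T)) ^ (k + 1) ∣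
      (dressing s.1 : PowerSeries (GraphAlgebra T)) ^ Γ.graph.edgeCount s.1.1 *
        ∑ n ∈ Finset.range (k + 1),
          (Nat.multichoose (Γ.graph.edgeCount s.1.1) n : PowerSeries (GraphAlgebra T)) *
            ampSeries s.1.1 ^ n - 1 := by
    intro s
    obtain ⟨d, hd⟩ := exists_mul_sum_multichoose (ampSeries s.1.1) k (Γ.graph.edgeCount s.1.1)
    rw [dressing_of_notMem s.notMem, hd, add_sub_cancel_left]
    exact Dvd.dvd.mul_right (pow_dvd_pow_of_dvd (X_dvd_ampSeries s.notMem) _) d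
  have h3 : (PowerSeries.X : PowerSeries (GraphAlgebra T)) ^ (k + 1) ∣
      (∏ s : Propagator T, (dressing s.1 : PowerSeries (GraphAlgebra T)) ^
        Γ.graph.edgeCount s.1.1) * (∏ s : Propagator T, ∑ n ∈ Finset.range (k + 1),
          (Nat.multichoose (Γ.graph.edgeCount s.1.1) n : PowerSeries (GraphAlgebra T)) *
            ampSeries s.1.1 ^ n) - 1 := by
    rw [← Finset.prod_mul_distrib]
    refine Finset.prod_induction _ (fun x => (PowerSeries.X : PowerSeries (GraphAlgebra T)) ^ (k + 1)
      ∣ x - 1) ?_ (by simp) fun s _ => h2 s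
    intro x y hx hy
    have : x * y - 1 = (x - 1) * y + (y - 1) := by ring
    rw [this]
    exact dvd_add (Dvd.dvd.mul_right hx y) hy
  have h4 := congrArg Units.val (dressing_prod_eq hQ Γ hr)
  rw [Units.val_mul, Units.coe_prod] at h4
  simp only [Units.val_pow_eq_pow_val (dressing _)] at h4
  rw [map_mul, evalSeries_vertexProd, h1, ← h4, ← sub_eq_zero, ← map_sub]
  have hlt : j < k + 1 := by omega
  refine PowerSeries.X_pow_dvd_iff.1 ?_ j hlt
  rw [mul_assoc, ← mul_sub_one]
  exact Dvd.dvd.mul_left h3 _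

/-- The coproduct of the sum of all graphs with `k` loops. -/
theorem comul_graphSum {Q : T.amplitudes → ℤ} (hQ : HasInvariantCharge T Q) (r : T.amplitudes)
    (k : ℕ) : comul T (graphSum T r k) = graphSum T r k ⊗ₜ 1 +
      ∑ i ∈ Finset.range (k + 1), PowerSeries.coeff (k - i)
        (dressing r * charge Q ^ i : (PowerSeries (GraphAlgebra T))ˣ).val ⊗ₜ graphSum T r i := by
  classical
  have key := congrArg (fun x => (legSymmetry r.1 : ℚ) • x) (sum_loopClasses_eq_sum r.2 k)
  simp only [Finset.smul_sum, smul_smul, mul_one_div] at key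
  have h1 : comul T (graphSum T r k) - graphSum T r k ⊗ₜ 1 =
      ∑ q ∈ loopClasses T r k, ((legSymmetry r.1 : ℚ) / q.rep.graph.autCard) •
        (graphCoproduct q.rep - MvPolynomial.X q ⊗ₜ 1) := by
    rw [graphSum_eq, map_sum, TensorProduct.sum_tmul, ← Finset.sum_sub_distrib]
    refine Finset.sum_congr rfl fun q _ => ?_
    rw [map_smul, comul, MvPolynomial.aeval_X, smul_sub, TensorProduct.smul_tmul']
  rw [← sub_eq_iff_eq_add', h1, key]
  refine Finset.sum_congr rfl fun i hi => ?_
  rw [graphSum_eq r.1 i, TensorProduct.tmul_sum]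
  refine Finset.sum_congr rfl fun q hq => ?_
  rw [mem_loopClasses] at hq
  rw [coeff_evalSeries_eq hQ q.rep hq.1 (Nat.sub_le _ _), hq.2, TensorProduct.tmul_smul]

end

section

/-! ### A group law on families of power series -/

section Composition

variable {B B' : Type} [CommRing B] [CommRing B']

/-- The composition of power series, as a homomorphism of groups of units. -/
def unitSubst (a : PowerSeries B) (ha : PowerSeries.constantCoeff a = 0) :
    (PowerSeries B)ˣ →* (PowerSeries B)ˣ :=
  Units.map (PowerSeries.substAlgHom (R := B)
    (PowerSeries.HasSubst.of_constantCoeff_zero' ha)).toRingHom.toMonoidHom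

theorem val_unitSubst (a : PowerSeries B) (ha : PowerSeries.constantCoeff a = 0)
    (u : (PowerSeries B)ˣ) :
    (unitSubst a ha u : PowerSeries B) = PowerSeries.subst a u.val :=
  congrFun (PowerSeries.coe_substAlgHom (PowerSeries.HasSubst.of_constantCoeff_zero' ha)) u.val

theorem constantCoeff_subst_eq (a f : PowerSeries B) (ha : PowerSeries.constantCoeff a = 0) :
    PowerSeries.constantCoeff (PowerSeries.subst a f : PowerSeries B) =
      PowerSeries.constantCoeff f := by
  have hs := PowerSeries.HasSubst.of_constantCoeff_zero' ha
  have h1 : f = PowerSeries.C (PowerSeries.constantCoeff f) +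
      (f - PowerSeries.C (PowerSeries.constantCoeff f)) := by ring
  have h2 : PowerSeries.constantCoeff
      (PowerSeries.subst a (f - PowerSeries.C (PowerSeries.constantCoeff f)) : PowerSeries B) = 0 :=
    PowerSeries.constantCoeff_subst_eq_zero ha _ (by simp)
  conv_lhs => rw [h1]
  rw [PowerSeries.subst_add hs, map_add, h2, add_zero]
  have h3 : (PowerSeries.subst a (PowerSeries.C (PowerSeries.constantCoeff f)) : PowerSeries B) =
      PowerSeries.C (PowerSeries.constantCoeff f) := PowerSeries.subst_C _
  rw [h3, PowerSeries.constantCoeff_C]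

theorem constantCoeff_subst_zero {a b : PowerSeries B} (ha : PowerSeries.constantCoeff a = 0)
    (hb : PowerSeries.constantCoeff b = 0) :
    PowerSeries.constantCoeff (PowerSeries.subst a b : PowerSeries B) = 0 :=
  (constantCoeff_subst_eq a b ha).trans hb

theorem unitSubst_unitSubst {a b : PowerSeries B} (ha : PowerSeries.constantCoeff a = 0)
    (hb : PowerSeries.constantCoeff b = 0) (u : (PowerSeries B)ˣ) :
    unitSubst a ha (unitSubst b hb u) =
      unitSubst (PowerSeries.subst a b) (constantCoeff_subst_zero ha hb) u := by
  ext1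
  rw [val_unitSubst, val_unitSubst, val_unitSubst]
  exact PowerSeries.subst_comp_subst_apply (PowerSeries.HasSubst.of_constantCoeff_zero' hb)
    (PowerSeries.HasSubst.of_constantCoeff_zero' ha) u.val

theorem unitSubst_of_eq_X {a : PowerSeries B} (ha : PowerSeries.constantCoeff a = 0)
    (h : a = PowerSeries.X) (u : (PowerSeries B)ˣ) : unitSubst a ha u = u := by
  ext1
  rw [val_unitSubst, h]
  exact PowerSeries.X_subst u.val

/-- A ring homomorphism, applied to the coefficients of an invertible power series. -/
def unitMap (f : B →+* B') : (PowerSeries B)ˣ →* (PowerSeries B')ˣ :=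
  Units.map (PowerSeries.map f).toMonoidHom

theorem val_unitMap (f : B →+* B') (u : (PowerSeries B)ˣ) :
    (unitMap f u : PowerSeries B') = PowerSeries.map f u.val := rfl

theorem unitMap_comp {B'' : Type} [CommRing B''] (g : B' →+* B'') (f : B →+* B')
    (u : (PowerSeries B)ˣ) : unitMap (g.comp f) u = unitMap g (unitMap f u) := by
  ext1
  simp [val_unitMap, PowerSeries.map_comp]

theorem constantCoeff_map_eq (f : B →+* B') (a : PowerSeries B) :
    PowerSeries.constantCoeff (PowerSeries.map f a) = f (PowerSeries.constantCoeff a) := by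
  rw [← PowerSeries.coeff_zero_eq_constantCoeff_apply, PowerSeries.coeff_map,
    PowerSeries.coeff_zero_eq_constantCoeff_apply]

theorem unitMap_unitSubst (f : B →+* B') {a : PowerSeries B}
    (ha : PowerSeries.constantCoeff a = 0) (u : (PowerSeries B)ˣ) :
    unitMap f (unitSubst a ha u) =
      unitSubst (PowerSeries.map f a) (by rw [constantCoeff_map_eq, ha, map_zero]) (unitMap f u) := by
  ext1
  rw [val_unitMap, val_unitSubst, val_unitSubst, val_unitMap]
  exact PowerSeries.map_subst (PowerSeries.HasSubst.of_constantCoeff_zero' ha) u.val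

end Composition

section GroupLaw

variable {R : Type} [Fintype R] (n : R → ℤ) {B B' : Type} [CommRing B] [CommRing B']

/-- The charge of a family of power series. -/
def seriesCharge (x : R → (PowerSeries B)ˣ) : (PowerSeries B)ˣ := ∏ s, x s ^ n s

/-- The variable, multiplied by the charge. -/
def seriesArg (x : R → (PowerSeries B)ˣ) : PowerSeries B := PowerSeries.X * (seriesCharge n x).val

theorem constantCoeff_seriesArg (x : R → (PowerSeries B)ˣ) :
    PowerSeries.constantCoeff (seriesArg n x) = 0 := by
  simp [seriesArg]

/-- The group law `(x ⋆ y)(λ) = x(λ) y(λ q(λ))`, where `q` is the charge of `x`. -/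
def seriesMul (x y : R → (PowerSeries B)ˣ) (s : R) : (PowerSeries B)ˣ :=
  x s * unitSubst (seriesArg n x) (constantCoeff_seriesArg n x) (y s)

theorem map_seriesCharge {C : Type} [CommRing C] (f : (PowerSeries B)ˣ →* (PowerSeries C)ˣ)
    (x : R → (PowerSeries B)ˣ) : f (seriesCharge n x) = seriesCharge n fun s => f (x s) := by
  rw [seriesCharge, map_prod]
  exact Finset.prod_congr rfl fun s _ => map_zpow _ _ _

theorem seriesCharge_seriesMul (x y : R → (PowerSeries B)ˣ) :
    seriesCharge n (seriesMul n x y) = seriesCharge n x *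
      unitSubst (seriesArg n x) (constantCoeff_seriesArg n x) (seriesCharge n y) := by
  rw [map_seriesCharge, seriesCharge, seriesCharge, seriesCharge, ← Finset.prod_mul_distrib]
  exact Finset.prod_congr rfl fun s _ => mul_zpow _ _ _

theorem subst_seriesArg {a : PowerSeries B} (ha : PowerSeries.constantCoeff a = 0)
    (x : R → (PowerSeries B)ˣ) : PowerSeries.subst a (seriesArg n x) =
      a * (unitSubst a ha (seriesCharge n x)).val := by
  have hs := PowerSeries.HasSubst.of_constantCoeff_zero' ha
  rw [seriesArg, PowerSeries.subst_mul hs, PowerSeries.subst_X hs, val_unitSubst]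

theorem seriesArg_seriesMul (x y : R → (PowerSeries B)ˣ) :
    seriesArg n (seriesMul n x y) = PowerSeries.subst (seriesArg n x) (seriesArg n y) := by
  rw [subst_seriesArg n (constantCoeff_seriesArg n x), seriesArg, seriesCharge_seriesMul,
    Units.val_mul, ← mul_assoc]
  rfl

theorem unitSubst_congr {a b : PowerSeries B} (ha : PowerSeries.constantCoeff a = 0) (h : a = b)
    (u : (PowerSeries B)ˣ) : unitSubst a ha u = unitSubst b (h ▸ ha) u := by
  subst h
  rfl

theorem seriesMul_assoc (x y w : R → (PowerSeries B)ˣ) :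
    seriesMul n (seriesMul n x y) w = seriesMul n x (seriesMul n y w) := by
  funext s
  simp only [seriesMul, map_mul]
  rw [mul_assoc, unitSubst_unitSubst, unitSubst_congr _ (seriesArg_seriesMul n x y)]

theorem seriesArg_one : seriesArg n (1 : R → (PowerSeries B)ˣ) = PowerSeries.X := by
  simp [seriesArg, seriesCharge]

theorem one_seriesMul (x : R → (PowerSeries B)ˣ) : seriesMul n 1 x = x := by
  funext s
  rw [seriesMul, unitSubst_of_eq_X _ (seriesArg_one n), Pi.one_apply, one_mul]

theorem seriesMul_one (x : R → (PowerSeries B)ˣ) : seriesMul n x 1 = x := by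
  funext s
  rw [seriesMul, Pi.one_apply, map_one, mul_one]

theorem unitMap_seriesMul (f : B →+* B') (x y : R → (PowerSeries B)ˣ) (s : R) :
    unitMap f (seriesMul n x y s) =
      seriesMul n (fun s => unitMap f (x s)) (fun s => unitMap f (y s)) s := by
  rw [seriesMul, map_mul, unitMap_unitSubst, seriesMul]
  congr 1
  refine unitSubst_congr _ ?_ _
  rw [seriesArg, seriesArg, map_mul, PowerSeries.map_X, ← val_unitMap, map_seriesCharge]

theorem isUnit_coeff_one_seriesArg (x : R → (PowerSeries B)ˣ) :
    IsUnit (PowerSeries.coeff 1 (seriesArg n x)) := by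
  have h : PowerSeries.coeff 1 (seriesArg n x) =
      PowerSeries.constantCoeff (seriesCharge n x).val := by
    rw [seriesArg, ← PowerSeries.coeff_zero_eq_constantCoeff_apply]
    exact PowerSeries.coeff_succ_X_mul 0 _
  rw [h]
  exact (seriesCharge n x).isUnit.map _

/-- The compositional inverse of `λ q(λ)`. -/
def seriesArgInv (x : R → (PowerSeries B)ˣ) : PowerSeries B :=
  PowerSeries.substInvOfIsUnit (seriesArg n x) (isUnit_coeff_one_seriesArg n x)

theorem constantCoeff_seriesArgInv (x : R → (PowerSeries B)ˣ) :
    PowerSeries.constantCoeff (seriesArgInv n x) = 0 :=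
  PowerSeries.constantCoeff_substInvOfIsUnit _ _

/-- The inverse for the group law. -/
def seriesInv (x : R → (PowerSeries B)ˣ) (s : R) : (PowerSeries B)ˣ :=
  (unitSubst (seriesArgInv n x) (constantCoeff_seriesArgInv n x) (x s))⁻¹

theorem seriesArg_seriesInv (x : R → (PowerSeries B)ˣ) :
    seriesArg n (seriesInv n x) = seriesArgInv n x := by
  have h1 : PowerSeries.subst (seriesArgInv n x) (seriesArg n x) = PowerSeries.X :=
    PowerSeries.subst_substInvOfIsUnit_right _ (constantCoeff_seriesArg n x) _
  rw [subst_seriesArg n (constantCoeff_seriesArgInv n x)] at h1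
  have h2 : seriesCharge n (seriesInv n x) = (unitSubst (seriesArgInv n x)
      (constantCoeff_seriesArgInv n x) (seriesCharge n x))⁻¹ := by
    rw [map_seriesCharge, seriesCharge, seriesCharge, ← Finset.prod_inv_distrib]
    exact Finset.prod_congr rfl fun s _ => inv_zpow _ _
  rw [seriesArg, h2, ← h1, mul_assoc, Units.mul_inv, mul_one]

theorem seriesInv_seriesMul (x : R → (PowerSeries B)ˣ) : seriesMul n (seriesInv n x) x = 1 := by
  funext s
  rw [seriesMul, unitSubst_congr _ (seriesArg_seriesInv n x), seriesInv, inv_mul_cancel,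
    Pi.one_apply]

theorem seriesMul_seriesInv (x : R → (PowerSeries B)ˣ) : seriesMul n x (seriesInv n x) = 1 := by
  funext s
  rw [seriesMul, seriesInv, map_inv, unitSubst_unitSubst, unitSubst_of_eq_X, mul_inv_cancel,
    Pi.one_apply]
  exact PowerSeries.subst_substInvOfIsUnit_left _ (constantCoeff_seriesArg n x) _

theorem constantCoeff_seriesInv {x : R → (PowerSeries B)ˣ}
    (hx : ∀ s, PowerSeries.constantCoeff (x s).val = 1) (s : R) :
    PowerSeries.constantCoeff (seriesInv n x s).val = 1 := by
  have h1 : PowerSeries.constantCoeff ((seriesInv n x s)⁻¹).val = 1 := by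
    rw [seriesInv, inv_inv, val_unitSubst, constantCoeff_subst_eq _ _
      (constantCoeff_seriesArgInv n x), hx]
  have h2 : PowerSeries.constantCoeff ((seriesInv n x s).val * ((seriesInv n x s)⁻¹).val) = 1 := by
    rw [Units.mul_inv, map_one]
  rwa [map_mul, h1, mul_one] at h2

theorem constantCoeff_seriesMul {x y : R → (PowerSeries B)ˣ}
    (hx : ∀ s, PowerSeries.constantCoeff (x s).val = 1)
    (hy : ∀ s, PowerSeries.constantCoeff (y s).val = 1) (s : R) :
    PowerSeries.constantCoeff (seriesMul n x y s).val = 1 := by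
  rw [seriesMul, Units.val_mul, map_mul, val_unitSubst,
    constantCoeff_subst_eq _ _ (constantCoeff_seriesArg n x), hx, hy, mul_one]

/-- The coefficients of the product. -/
theorem coeff_seriesMul (x y : R → (PowerSeries B)ˣ) (s : R) (k : ℕ) :
    PowerSeries.coeff k (seriesMul n x y s).val = ∑ i ∈ Finset.range (k + 1),
      PowerSeries.coeff (k - i) (x s * seriesCharge n x ^ i : (PowerSeries B)ˣ).val *
        PowerSeries.coeff i (y s).val := by
  have hs := PowerSeries.HasSubst.of_constantCoeff_zero' (constantCoeff_seriesArg n x)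
  let F : PowerSeries B →ₐ[B] PowerSeries B := PowerSeries.substAlgHom hs
  have hFX : F PowerSeries.X = seriesArg n x := PowerSeries.substAlgHom_X hs
  have hF : ∀ p : Polynomial B, F (p : PowerSeries B) = Polynomial.aeval (seriesArg n x) p :=
    PowerSeries.substAlgHom_coe hs
  obtain ⟨g, hg⟩ : PowerSeries.X ^ (k + 1) ∣
      (y s).val - (PowerSeries.trunc (k + 1) (y s).val : PowerSeries B) := by
    rw [PowerSeries.X_pow_dvd_iff]
    intro m hm
    rw [map_sub, Polynomial.coeff_coe, PowerSeries.coeff_trunc, if_pos hm, sub_self]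
  have h1 : (seriesMul n x y s).val = (x s).val * F (y s).val := rfl
  have h2 : F (y s).val = PowerSeries.X ^ (k + 1) * ((seriesCharge n x).val ^ (k + 1) * F g) +
      ∑ i ∈ Finset.range (k + 1), PowerSeries.coeff i (y s).val • (seriesArg n x) ^ i := by
    have h3 : (y s).val = PowerSeries.X ^ (k + 1) * g +
        (PowerSeries.trunc (k + 1) (y s).val : PowerSeries B) := by rw [← hg, sub_add_cancel]
    refine (congrArg F h3).trans ?_
    rw [map_add, map_mul, map_pow, hFX, hF,
      Polynomial.aeval_eq_sum_range' (PowerSeries.natDegree_trunc_lt (y s).val k)]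
    congr 1
    · rw [seriesArg]
      ring
    · refine Finset.sum_congr rfl fun i hi => ?_
      rw [PowerSeries.coeff_trunc, if_pos (Finset.mem_range.1 hi)]
  rw [h1, h2, mul_add, map_add, mul_left_comm, PowerSeries.coeff_X_pow_mul', if_neg (by omega),
    zero_add, Finset.mul_sum, map_sum]
  refine Finset.sum_congr rfl fun i hi => ?_
  have hik : i ≤ k := Nat.lt_succ_iff.1 (Finset.mem_range.1 hi)
  rw [mul_smul_comm, PowerSeries.coeff_smul, seriesArg, mul_pow, mul_left_comm,
    PowerSeries.coeff_X_pow_mul', if_pos hik, smul_eq_mul, mul_comm, Units.val_mul,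
    Units.val_pow_eq_pow_val]

end GroupLaw

end

section

/-! ### The Hopf algebra of a universal family -/

variable {R : Type} [Fintype R]

/-- The algebra `A` is generated freely by the coefficients of the family `x` of power series with
constant coefficient `1`. -/
structure IsUniversalFamily {A : Type} [CommRing A] [Algebra ℚ A]
    (x : R → (PowerSeries A)ˣ) : Prop where
  constantCoeff : ∀ s, PowerSeries.constantCoeff (x s).val = 1
  ext : ∀ {B : Type} [CommRing B] [Algebra ℚ B] (f g : A →ₐ[ℚ] B),
    (∀ s, unitMap (f : A →+* B) (x s) = unitMap (g : A →+* B) (x s)) → f = g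
  lift : ∀ {B : Type} [CommRing B] [Algebra ℚ B] (y : R → (PowerSeries B)ˣ),
    (∀ s, PowerSeries.constantCoeff (y s).val = 1) →
    ∃ f : A →ₐ[ℚ] B, ∀ s, unitMap (f : A →+* B) (x s) = y s

variable {A : Type} [CommRing A] [Algebra ℚ A] {x : R → (PowerSeries A)ˣ}

theorem unitMap_algHom_comp {B C : Type} [CommRing B] [CommRing C] [Algebra ℚ B] [Algebra ℚ C]
    (g : B →ₐ[ℚ] C) (f : A →ₐ[ℚ] B) (u : (PowerSeries A)ˣ) :
    unitMap ((g.comp f : A →ₐ[ℚ] C) : A →+* C) u =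
      unitMap (g : B →+* C) (unitMap (f : A →+* B) u) := by
  rw [← unitMap_comp]
  rfl

theorem unitMap_algHom_comp_seriesMul (n : R → ℤ) {B C : Type} [CommRing B] [CommRing C]
    [Algebra ℚ B] [Algebra ℚ C] (h : B →ₐ[ℚ] C) (f₁ f₂ : A →ₐ[ℚ] B) (s : R) :
    unitMap (h : B →+* C) (seriesMul n (fun s => unitMap (f₁ : A →+* B) (x s))
      (fun s => unitMap (f₂ : A →+* B) (x s)) s) =
    seriesMul n (fun s => unitMap ((h.comp f₁ : A →ₐ[ℚ] C) : A →+* C) (x s))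
      (fun s => unitMap ((h.comp f₂ : A →ₐ[ℚ] C) : A →+* C) (x s)) s := by
  rw [unitMap_seriesMul]
  simp only [unitMap_algHom_comp]

theorem unitMap_id (u : (PowerSeries A)ˣ) :
    unitMap ((AlgHom.id ℚ A : A →ₐ[ℚ] A) : A →+* A) u = u := by
  ext1
  rw [val_unitMap]
  ext i
  simp

/-- The coproduct is dual to the group law. -/
def IsSeriesComul (n : R → ℤ) (x : R → (PowerSeries A)ˣ) (Δ : A →ₐ[ℚ] A ⊗[ℚ] A) : Prop :=
  ∀ s, unitMap (Δ : A →+* A ⊗[ℚ] A) (x s) = seriesMul n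
    (fun s => unitMap ((Algebra.TensorProduct.includeLeft : A →ₐ[ℚ] A ⊗[ℚ] A) : A →+* A ⊗[ℚ] A)
      (x s))
    (fun s => unitMap ((Algebra.TensorProduct.includeRight : A →ₐ[ℚ] A ⊗[ℚ] A) : A →+* A ⊗[ℚ] A)
      (x s)) s

/-- The product of two points of the group, in terms of the coproduct. -/
theorem IsSeriesComul.unitMap_comp {n : R → ℤ} {Δ : A →ₐ[ℚ] A ⊗[ℚ] A} (hΔ : IsSeriesComul n x Δ)
    {C : Type} [CommRing C] [Algebra ℚ C] (h : A ⊗[ℚ] A →ₐ[ℚ] C) (s : R) :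
    unitMap ((h.comp Δ : A →ₐ[ℚ] C) : A →+* C) (x s) = seriesMul n
      (fun s => unitMap ((h.comp Algebra.TensorProduct.includeLeft : A →ₐ[ℚ] C) : A →+* C) (x s))
      (fun s => unitMap ((h.comp Algebra.TensorProduct.includeRight : A →ₐ[ℚ] C) : A →+* C)
        (x s)) s := by
  rw [unitMap_algHom_comp, hΔ s, unitMap_algHom_comp_seriesMul]

theorem IsUniversalFamily.exists_comul (n : R → ℤ) (hx : IsUniversalFamily x) :
    ∃ Δ, IsSeriesComul n x Δ :=
  hx.lift _ fun s => constantCoeff_seriesMul n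
    (fun s => by rw [val_unitMap, constantCoeff_map_eq, hx.constantCoeff, map_one])
    (fun s => by rw [val_unitMap, constantCoeff_map_eq, hx.constantCoeff, map_one]) s

/-- The group law makes the algebra of coordinates a Hopf algebra. -/
theorem IsUniversalFamily.isHopf {n : R → ℤ} (hx : IsUniversalFamily x) {Δ : A →ₐ[ℚ] A ⊗[ℚ] A}
    (hΔ : IsSeriesComul n x Δ) {ε : A →ₐ[ℚ] ℚ} (hε : ∀ s, unitMap (ε : A →+* ℚ) (x s) = 1) :
    IsHopf Δ ε := by
  have hone : ∀ s, unitMap (((Algebra.ofId ℚ A).comp ε : A →ₐ[ℚ] A) : A →+* A) (x s) = 1 :=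
      fun s => by
    rw [unitMap_algHom_comp, hε, map_one]
  refine ⟨fun a => ?_, fun a => ?_, fun a => ?_, ?_⟩
  · let f₁ : A →ₐ[ℚ] A ⊗[ℚ] (A ⊗[ℚ] A) :=
      ((Algebra.TensorProduct.assoc ℚ ℚ ℚ A A A).toAlgHom.comp
        (Algebra.TensorProduct.map Δ (AlgHom.id ℚ A))).comp Δ
    let f₂ : A →ₐ[ℚ] A ⊗[ℚ] (A ⊗[ℚ] A) := (Algebra.TensorProduct.map (AlgHom.id ℚ A) Δ).comp Δ
    suffices h : f₁ = f₂ from DFunLike.congr_fun h a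
    refine hx.ext f₁ f₂ fun s => ?_
    rw [hΔ.unitMap_comp, hΔ.unitMap_comp]
    have e1 : ((Algebra.TensorProduct.assoc ℚ ℚ ℚ A A A).toAlgHom.comp
        (Algebra.TensorProduct.map Δ (AlgHom.id ℚ A))).comp Algebra.TensorProduct.includeLeft =
        (Algebra.TensorProduct.map (AlgHom.id ℚ A)
          (Algebra.TensorProduct.includeLeft : A →ₐ[ℚ] A ⊗[ℚ] A)).comp Δ := by
      have h0 : (Algebra.TensorProduct.assoc ℚ ℚ ℚ A A A).toAlgHom.comp
          (Algebra.TensorProduct.includeLeft : A ⊗[ℚ] A →ₐ[ℚ] (A ⊗[ℚ] A) ⊗[ℚ] A) =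
          Algebra.TensorProduct.map (AlgHom.id ℚ A)
            (Algebra.TensorProduct.includeLeft : A →ₐ[ℚ] A ⊗[ℚ] A) := by
        ext <;> simp [Algebra.TensorProduct.one_def]
      rw [← h0]
      ext a
      simp
    have e2 : ((Algebra.TensorProduct.assoc ℚ ℚ ℚ A A A).toAlgHom.comp
        (Algebra.TensorProduct.map Δ (AlgHom.id ℚ A))).comp Algebra.TensorProduct.includeRight =
        (Algebra.TensorProduct.includeRight : A ⊗[ℚ] A →ₐ[ℚ] A ⊗[ℚ] (A ⊗[ℚ] A)).comp
          Algebra.TensorProduct.includeRight := by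
      ext a
      simp [Algebra.TensorProduct.one_def]
    have e3 : (Algebra.TensorProduct.map (AlgHom.id ℚ A) Δ).comp
        (Algebra.TensorProduct.includeLeft : A →ₐ[ℚ] A ⊗[ℚ] A) =
        (Algebra.TensorProduct.includeLeft : A →ₐ[ℚ] A ⊗[ℚ] (A ⊗[ℚ] A)) := by
      ext a
      simp
    have e4 : (Algebra.TensorProduct.map (AlgHom.id ℚ A) Δ).comp
        (Algebra.TensorProduct.includeRight : A →ₐ[ℚ] A ⊗[ℚ] A) =
        (Algebra.TensorProduct.includeRight : A ⊗[ℚ] A →ₐ[ℚ] A ⊗[ℚ] (A ⊗[ℚ] A)).comp Δ := by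
      ext a
      simp
    have e5 : (Algebra.TensorProduct.map (AlgHom.id ℚ A)
          (Algebra.TensorProduct.includeLeft : A →ₐ[ℚ] A ⊗[ℚ] A)).comp
        (Algebra.TensorProduct.includeLeft : A →ₐ[ℚ] A ⊗[ℚ] A) =
        (Algebra.TensorProduct.includeLeft : A →ₐ[ℚ] A ⊗[ℚ] (A ⊗[ℚ] A)) := by
      ext a
      simp
    have e6 : (Algebra.TensorProduct.map (AlgHom.id ℚ A)
          (Algebra.TensorProduct.includeLeft : A →ₐ[ℚ] A ⊗[ℚ] A)).comp
        (Algebra.TensorProduct.includeRight : A →ₐ[ℚ] A ⊗[ℚ] A) =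
        (Algebra.TensorProduct.includeRight : A ⊗[ℚ] A →ₐ[ℚ] A ⊗[ℚ] (A ⊗[ℚ] A)).comp
          (Algebra.TensorProduct.includeLeft : A →ₐ[ℚ] A ⊗[ℚ] A) := by
      ext a
      simp
    have key := congrFun (seriesMul_assoc n
      (fun s => unitMap ((Algebra.TensorProduct.includeLeft : A →ₐ[ℚ] A ⊗[ℚ] (A ⊗[ℚ] A)) :
        A →+* A ⊗[ℚ] (A ⊗[ℚ] A)) (x s))
      (fun s => unitMap (((Algebra.TensorProduct.includeRight :
        A ⊗[ℚ] A →ₐ[ℚ] A ⊗[ℚ] (A ⊗[ℚ] A)).comp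
          (Algebra.TensorProduct.includeLeft : A →ₐ[ℚ] A ⊗[ℚ] A) : A →ₐ[ℚ] A ⊗[ℚ] (A ⊗[ℚ] A)) :
        A →+* A ⊗[ℚ] (A ⊗[ℚ] A)) (x s))
      (fun s => unitMap (((Algebra.TensorProduct.includeRight :
        A ⊗[ℚ] A →ₐ[ℚ] A ⊗[ℚ] (A ⊗[ℚ] A)).comp
          Algebra.TensorProduct.includeRight : A →ₐ[ℚ] A ⊗[ℚ] (A ⊗[ℚ] A)) :
        A →+* A ⊗[ℚ] (A ⊗[ℚ] A)) (x s))) s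
    rw [e1, e2, e3, e4]
    convert key using 2
    · funext s
      rw [hΔ.unitMap_comp, e5, e6]
    · funext s
      rw [hΔ.unitMap_comp]
  · let f : A →ₐ[ℚ] A := ((Algebra.TensorProduct.lid ℚ A).toAlgHom.comp
      (Algebra.TensorProduct.map ε (AlgHom.id ℚ A))).comp Δ
    suffices h : f = AlgHom.id ℚ A from DFunLike.congr_fun h a
    refine hx.ext f _ fun s => ?_
    rw [hΔ.unitMap_comp, unitMap_id]
    have e1 : ((Algebra.TensorProduct.lid ℚ A).toAlgHom.comp
        (Algebra.TensorProduct.map ε (AlgHom.id ℚ A))).comp Algebra.TensorProduct.includeLeft =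
        (Algebra.ofId ℚ A).comp ε := by
      ext a
      simp [Algebra.ofId_apply, Algebra.algebraMap_eq_smul_one]
    have e2 : ((Algebra.TensorProduct.lid ℚ A).toAlgHom.comp
        (Algebra.TensorProduct.map ε (AlgHom.id ℚ A))).comp Algebra.TensorProduct.includeRight =
        AlgHom.id ℚ A := by
      ext a
      simp
    rw [e1, e2]
    convert congrFun (one_seriesMul n x) s using 2
    · funext s
      exact hone s
    · funext s
      exact unitMap_id _
  · let f : A →ₐ[ℚ] A := ((Algebra.TensorProduct.rid ℚ ℚ A).toAlgHom.comp
      (Algebra.TensorProduct.map (AlgHom.id ℚ A) ε)).comp Δ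
    suffices h : f = AlgHom.id ℚ A from DFunLike.congr_fun h a
    refine hx.ext f _ fun s => ?_
    rw [hΔ.unitMap_comp, unitMap_id]
    have e1 : ((Algebra.TensorProduct.rid ℚ ℚ A).toAlgHom.comp
        (Algebra.TensorProduct.map (AlgHom.id ℚ A) ε)).comp Algebra.TensorProduct.includeRight =
        (Algebra.ofId ℚ A).comp ε := by
      ext a
      simp [Algebra.ofId_apply, Algebra.algebraMap_eq_smul_one]
    have e2 : ((Algebra.TensorProduct.rid ℚ ℚ A).toAlgHom.comp
        (Algebra.TensorProduct.map (AlgHom.id ℚ A) ε)).comp Algebra.TensorProduct.includeLeft =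
        AlgHom.id ℚ A := by
      ext a
      simp
    rw [e1, e2]
    convert congrFun (seriesMul_one n x) s using 2
    · funext s
      exact unitMap_id _
    · funext s
      exact hone s
  · obtain ⟨S, hS⟩ := hx.lift (seriesInv n x) (constantCoeff_seriesInv n hx.constantCoeff)
    let f₁ : A →ₐ[ℚ] A := ((Algebra.TensorProduct.lmul' ℚ (S := A)).comp
      (Algebra.TensorProduct.map S (AlgHom.id ℚ A))).comp Δ
    let f₂ : A →ₐ[ℚ] A := ((Algebra.TensorProduct.lmul' ℚ (S := A)).comp
      (Algebra.TensorProduct.map (AlgHom.id ℚ A) S)).comp Δ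
    have e1 : ((Algebra.TensorProduct.lmul' ℚ (S := A)).comp
      (Algebra.TensorProduct.map S (AlgHom.id ℚ A))).comp Algebra.TensorProduct.includeLeft = S := by
      ext a
      simp
    have e2 : ((Algebra.TensorProduct.lmul' ℚ (S := A)).comp
      (Algebra.TensorProduct.map S (AlgHom.id ℚ A))).comp Algebra.TensorProduct.includeRight =
        AlgHom.id ℚ A := by
      ext a
      simp
    have e3 : ((Algebra.TensorProduct.lmul' ℚ (S := A)).comp
      (Algebra.TensorProduct.map (AlgHom.id ℚ A) S)).comp Algebra.TensorProduct.includeLeft =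
        AlgHom.id ℚ A := by
      ext a
      simp
    have e4 : ((Algebra.TensorProduct.lmul' ℚ (S := A)).comp
      (Algebra.TensorProduct.map (AlgHom.id ℚ A) S)).comp Algebra.TensorProduct.includeRight =
        S := by
      ext a
      simp
    have h1 : f₁ = (Algebra.ofId ℚ A).comp ε := hx.ext _ _ fun s => by
      rw [hΔ.unitMap_comp, e1, e2, hone, funext hS, funext fun s => unitMap_id (x s)]
      exact congrFun (seriesInv_seriesMul n x) s
    have h2 : f₂ = (Algebra.ofId ℚ A).comp ε := hx.ext _ _ fun s => by
      rw [hΔ.unitMap_comp, e3, e4, hone, funext hS, funext fun s => unitMap_id (x s)]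
      exact congrFun (seriesMul_seriesInv n x) s
    exact ⟨S.toLinearMap, fun a => ⟨DFunLike.congr_fun h1 a, DFunLike.congr_fun h2 a⟩⟩

end

section

variable {T : Theory}

/-! ### The algebra generated by the graph sums -/

theorem legSymmetry_ne_zero (r : Multiset T.Leg) : (legSymmetry r : ℚ) ≠ 0 := by
  classical
  rw [legSymmetry, Nat.cast_ne_zero]
  exact Finset.prod_ne_zero_iff.2 fun f _ => Nat.factorial_ne_zero _

/-- Every amplitude has graphs with any positive number of loops. -/
def HasGraphs (T : Theory) : Prop :=
  ∀ (r : T.amplitudes) (k : ℕ+), ∃ Γ : FeynmanGraph T, Γ.graph.residue = r ∧ Γ.graph.loops = k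

theorem HasGraphs.exists_class (hc : HasGraphs T) (p : GradIndex T) :
    ∃ q : GraphClass T, q.rep.graph.residue = p.1 ∧ q.rep.graph.loops = p.2 := by
  obtain ⟨Γ, h1, h2⟩ := hc p.1 p.2
  have h : (FeynmanGraph.setoid T).r (GraphClass.rep (Quotient.mk _ Γ)) Γ :=
    Quotient.exact (Quotient.out_eq _)
  obtain ⟨e, he⟩ := h
  exact ⟨Quotient.mk _ Γ, he.residue.symm.trans h1, he.loops.symm.trans h2⟩

/-- The polynomials in the graph sums. -/
def gradEval (T : Theory) : MvPolynomial (GradIndex T) ℚ →ₐ[ℚ] gradAlgebra T :=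
  MvPolynomial.aeval (gradGen T)

theorem gradEval_X (p : GradIndex T) : gradEval T (MvPolynomial.X p) = gradGen T p :=
  MvPolynomial.aeval_X _ _

/-- The graph sums are algebraically independent: each contains a graph that occurs in no other. -/
theorem gradEval_injective (hc : HasGraphs T) : Function.Injective (gradEval T) := by
  classical
  choose c hc1 hc2 using hc.exists_class
  have hinj : Function.Injective c := fun p p' h => by
    refine Prod.ext (Subtype.ext ?_) (PNat.eq ?_)
    · rw [← hc1, h, hc1]
    · rw [← hc2, h, hc2]
  let π : GraphAlgebra T →ₐ[ℚ] MvPolynomial (GradIndex T) ℚ := MvPolynomial.aeval fun q =>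
    if h : ∃ p, c p = q then
      ((q.rep.graph.autCard : ℚ) / legSymmetry h.choose.1.1) • MvPolynomial.X h.choose else 0
  have hπ : ∀ p, π (graphSum T p.1 p.2) = MvPolynomial.X p := by
    intro p
    have hex : ∃ p', c p' = c p := ⟨p, rfl⟩
    have hch : hex.choose = p := hinj hex.choose_spec
    rw [graphSum_eq, map_sum, Finset.sum_eq_single (c p)]
    · rw [map_smul, MvPolynomial.aeval_X, dif_pos hex, hch, smul_smul]
      have h1 := legSymmetry_ne_zero p.1.1
      have h2 : ((c p).rep.graph.autCard : ℚ) ≠ 0 := by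
        exact_mod_cast (c p).rep.graph.autCard_pos.ne'
      convert one_smul ℚ _ using 2
      field_simp
    · intro q hq hne
      rw [map_smul, MvPolynomial.aeval_X, dif_neg, smul_zero]
      rintro ⟨p', rfl⟩
      rw [mem_loopClasses, hc1, hc2] at hq
      exact hne (congrArg c (Prod.ext (Subtype.ext hq.1) (PNat.eq hq.2)))
    · intro h
      exact (h (mem_loopClasses.2 ⟨hc1 p, hc2 p⟩)).elim
  have hcomp : (π.comp (gradAlgebra T).val).comp (gradEval T) = AlgHom.id ℚ _ := by
    refine MvPolynomial.algHom_ext fun p => ?_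
    rw [AlgHom.comp_apply, gradEval_X]
    exact hπ p
  have hinv : ∀ f, π (gradEval T f).1 = f := fun f => DFunLike.congr_fun hcomp f
  intro f g h
  rw [← hinv f, h, hinv]

theorem gradEval_surjective : Function.Surjective (gradEval T) := by
  rintro ⟨a, ha⟩
  rw [gradAlgebra, Algebra.adjoin_range_eq_range_aeval] at ha
  obtain ⟨f, hf⟩ := ha
  refine ⟨f, Subtype.ext ?_⟩
  have h : (gradAlgebra T).val.comp (gradEval T) =
      MvPolynomial.aeval fun p : GradIndex T => graphSum T p.1 p.2 :=
    MvPolynomial.algHom_ext fun p => by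
      rw [AlgHom.comp_apply, gradEval_X, MvPolynomial.aeval_X]
      rfl
  exact (DFunLike.congr_fun h f).trans hf

/-- The graph sums generate a polynomial algebra. -/
def gradEquiv (hc : HasGraphs T) : MvPolynomial (GradIndex T) ℚ ≃ₐ[ℚ] gradAlgebra T :=
  AlgEquiv.ofBijective (gradEval T) ⟨gradEval_injective hc, gradEval_surjective⟩

theorem gradEquiv_X (hc : HasGraphs T) (p : GradIndex T) :
    gradEquiv hc (MvPolynomial.X p) = gradGen T p := gradEval_X p

theorem gradEquiv_symm_gradGen (hc : HasGraphs T) (p : GradIndex T) :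
    (gradEquiv hc).symm (gradGen T p) = MvPolynomial.X p := by
  rw [← gradEquiv_X hc, AlgEquiv.symm_apply_apply]

/-- The graph sums as elements of the subalgebra, with the value `0` for zero loops. -/
def gradCoeff (s : T.amplitudes) (k : ℕ) : gradAlgebra T :=
  if h : 0 < k then gradGen T (s, ⟨k, h⟩) else 0

theorem gradCoeff_pos (s : T.amplitudes) (k : ℕ+) : gradCoeff s k = gradGen T (s, k) := by
  rw [gradCoeff, dif_pos k.pos]
  rfl

theorem val_gradCoeff (s : T.amplitudes) (k : ℕ) :
    (gradCoeff s k : GraphAlgebra T) = graphSum T s k := by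
  rw [gradCoeff]
  split_ifs with h
  · rfl
  · rw [Nat.eq_zero_of_not_pos h, graphSum_zero]
    rfl

/-- The dressing of an amplitude, over the subalgebra. -/
def gradDressingSeries (s : T.amplitudes) : PowerSeries (gradAlgebra T) :=
  1 + (sign s : gradAlgebra T) • PowerSeries.mk fun k => gradCoeff s k

theorem coeff_gradDressingSeries (s : T.amplitudes) (k : ℕ) :
    PowerSeries.coeff k (gradDressingSeries s) =
      if k = 0 then 1 else (sign s : gradAlgebra T) * gradCoeff s k := by
  rw [gradDressingSeries, map_add, PowerSeries.coeff_smul, PowerSeries.coeff_mk,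
    PowerSeries.coeff_one]
  split_ifs with h
  · rw [h, gradCoeff, dif_neg (lt_irrefl 0), smul_zero, add_zero]
  · rw [zero_add, smul_eq_mul]

theorem isUnit_gradDressingSeries (s : T.amplitudes) : IsUnit (gradDressingSeries s) := by
  rw [PowerSeries.isUnit_iff_constantCoeff, ← PowerSeries.coeff_zero_eq_constantCoeff_apply,
    coeff_gradDressingSeries, if_pos rfl]
  exact isUnit_one

/-- The dressing of an amplitude, as a unit of the power series over the subalgebra. -/
def gradDressing (s : T.amplitudes) : (PowerSeries (gradAlgebra T))ˣ :=
  (isUnit_gradDressingSeries s).unit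

theorem coeff_gradDressing (s : T.amplitudes) (k : ℕ) :
    PowerSeries.coeff k (gradDressing s).val =
      if k = 0 then 1 else (sign s : gradAlgebra T) * gradCoeff s k :=
  coeff_gradDressingSeries s k

theorem coeff_gradDressing_pos (s : T.amplitudes) (k : ℕ+) :
    PowerSeries.coeff k (gradDressing s).val = (sign s : gradAlgebra T) * gradGen T (s, k) := by
  rw [coeff_gradDressing, if_neg k.ne_zero, gradCoeff_pos]

theorem coeff_dressing (s : T.amplitudes) (k : ℕ) :
    PowerSeries.coeff k (dressing s).val =
      if k = 0 then 1 else (sign s : GraphAlgebra T) * graphSum T s k :=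
  coeff_dressingSeries s k

theorem unitMap_val_gradDressing (s : T.amplitudes) :
    unitMap ((gradAlgebra T).val : gradAlgebra T →+* GraphAlgebra T) (gradDressing s) =
      dressing s := by
  ext1
  ext1 k
  rw [val_unitMap, PowerSeries.coeff_map, coeff_gradDressing, coeff_dressing]
  split_ifs
  · exact map_one _
  · rw [map_mul, map_intCast]
    exact congrArg _ (val_gradCoeff s k)

theorem isUniversalFamily_gradDressing (hc : HasGraphs T) :
    IsUniversalFamily (gradDressing (T := T)) where
  constantCoeff s := by
    rw [← PowerSeries.coeff_zero_eq_constantCoeff_apply, coeff_gradDressing, if_pos rfl]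
  ext {B} _ _ f g h := by
    have hcomp : f.comp (gradEquiv hc).toAlgHom = g.comp (gradEquiv hc).toAlgHom := by
      refine MvPolynomial.algHom_ext fun p => ?_
      have h1 := congrArg (fun u => PowerSeries.coeff (p.2 : ℕ) (Units.val u)) (h p.1)
      simp only [val_unitMap, PowerSeries.coeff_map, coeff_gradDressing_pos] at h1
      have h2 : ∀ f : gradAlgebra T →ₐ[ℚ] B,
          f (gradGen T p) = (sign p.1 : B) * f ((sign p.1 : gradAlgebra T) * gradGen T p) := by
        intro f
        rw [map_mul, map_intCast, ← mul_assoc, ← Int.cast_mul, sign_mul_self, Int.cast_one, one_mul]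
      change f (gradEquiv hc (MvPolynomial.X p)) = g (gradEquiv hc (MvPolynomial.X p))
      rw [gradEquiv_X, h2 f, h2 g]
      exact congrArg _ h1
    ext a
    obtain ⟨a, rfl⟩ := (gradEquiv hc).surjective a
    exact DFunLike.congr_fun hcomp a
  lift {B} _ _ y hy := by
    refine ⟨(MvPolynomial.aeval fun p : GradIndex T =>
      (sign p.1 : B) * PowerSeries.coeff (p.2 : ℕ) (y p.1).val).comp
        (gradEquiv hc).symm.toAlgHom, fun s => ?_⟩
    ext1
    ext1 k
    rw [val_unitMap, PowerSeries.coeff_map]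
    rcases Nat.eq_zero_or_pos k with rfl | hk
    · rw [coeff_gradDressing, if_pos rfl, map_one, PowerSeries.coeff_zero_eq_constantCoeff_apply, hy]
    · obtain ⟨k, rfl⟩ : ∃ j : ℕ+, (j : ℕ) = k := ⟨⟨k, hk⟩, rfl⟩
      rw [coeff_gradDressing_pos, map_mul, map_intCast]
      have : (gradEquiv hc).symm.toAlgHom (gradGen T (s, k)) = MvPolynomial.X (s, k) :=
        gradEquiv_symm_gradGen hc _
      rw [RingHom.coe_coe, AlgHom.comp_apply, this, MvPolynomial.aeval_X, ← mul_assoc, ← Int.cast_mul,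
        sign_mul_self, Int.cast_one, one_mul]

/-- The exponents of the dressings in the charge. -/
def chargeExponent (Q : T.amplitudes → ℤ) (s : T.amplitudes) : ℤ := sign s * Q s

theorem unitMap_comul_dressing {Q : T.amplitudes → ℤ} (hQ : HasInvariantCharge T Q)
    (s : T.amplitudes) :
    unitMap (comul T : GraphAlgebra T →+* GraphAlgebra T ⊗[ℚ] GraphAlgebra T) (dressing s) =
      seriesMul (chargeExponent Q)
        (fun s => unitMap ((Algebra.TensorProduct.includeLeft :
          GraphAlgebra T →ₐ[ℚ] GraphAlgebra T ⊗[ℚ] GraphAlgebra T) :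
            GraphAlgebra T →+* GraphAlgebra T ⊗[ℚ] GraphAlgebra T) (dressing s))
        (fun s => unitMap ((Algebra.TensorProduct.includeRight :
          GraphAlgebra T →ₐ[ℚ] GraphAlgebra T ⊗[ℚ] GraphAlgebra T) :
            GraphAlgebra T →+* GraphAlgebra T ⊗[ℚ] GraphAlgebra T) (dressing s)) s := by
  ext1
  ext1 k
  rw [val_unitMap, PowerSeries.coeff_map, coeff_seriesMul]
  have h1 : ∀ i, PowerSeries.coeff (k - i) (unitMap ((Algebra.TensorProduct.includeLeft :
          GraphAlgebra T →ₐ[ℚ] GraphAlgebra T ⊗[ℚ] GraphAlgebra T) :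
            GraphAlgebra T →+* GraphAlgebra T ⊗[ℚ] GraphAlgebra T) (dressing s) *
        seriesCharge (chargeExponent Q) (fun s => unitMap ((Algebra.TensorProduct.includeLeft :
          GraphAlgebra T →ₐ[ℚ] GraphAlgebra T ⊗[ℚ] GraphAlgebra T) :
            GraphAlgebra T →+* GraphAlgebra T ⊗[ℚ] GraphAlgebra T) (dressing s)) ^ i :
          (PowerSeries (GraphAlgebra T ⊗[ℚ] GraphAlgebra T))ˣ).val =
      PowerSeries.coeff (k - i) (dressing s * charge Q ^ i).val ⊗ₜ 1 := by
    intro i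
    rw [← map_seriesCharge, ← map_pow, ← map_mul, val_unitMap, PowerSeries.coeff_map]
    rfl
  rw [Finset.sum_congr rfl fun i _ => by rw [h1 i, val_unitMap, PowerSeries.coeff_map]]
  have h2 : ∀ i, PowerSeries.coeff (k - i) (dressing s * charge Q ^ i).val ⊗ₜ[ℚ] 1 *
      ((Algebra.TensorProduct.includeRight :
          GraphAlgebra T →ₐ[ℚ] GraphAlgebra T ⊗[ℚ] GraphAlgebra T) :
            GraphAlgebra T →+* GraphAlgebra T ⊗[ℚ] GraphAlgebra T)
        (PowerSeries.coeff i (dressing s).val) =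
      PowerSeries.coeff (k - i) (dressing s * charge Q ^ i).val ⊗ₜ
        PowerSeries.coeff i (dressing s).val := by
    intro i
    change _ * ((1 : GraphAlgebra T) ⊗ₜ[ℚ] _) = _
    rw [Algebra.TensorProduct.tmul_mul_tmul, mul_one, one_mul]
  rw [Finset.sum_congr rfl fun i _ => h2 i, Finset.sum_range_succ', pow_zero, mul_one, Nat.sub_zero,
    coeff_dressing s 0, if_pos rfl]
  have h3 : ∀ i, PowerSeries.coeff (k - (i + 1)) (dressing s * charge Q ^ (i + 1)).val ⊗ₜ[ℚ]
      PowerSeries.coeff (i + 1) (dressing s).val =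
      (sign s : GraphAlgebra T ⊗[ℚ] GraphAlgebra T) *
      (PowerSeries.coeff (k - (i + 1)) (dressing s * charge Q ^ (i + 1)).val ⊗ₜ
        graphSum T s (i + 1)) := by
    intro i
    rw [coeff_dressing, if_neg (Nat.succ_ne_zero i), ← zsmul_eq_mul, ← zsmul_eq_mul,
      TensorProduct.tmul_smul]
  rw [Finset.sum_congr rfl fun i _ => h3 i, ← Finset.mul_sum, coeff_dressing]
  split_ifs with hk
  · subst hk
    simp [Algebra.TensorProduct.one_def]
  · change comul T _ = _
    rw [map_mul, map_intCast, comul_graphSum hQ, Finset.sum_range_succ', graphSum_zero,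
      TensorProduct.tmul_zero, add_zero, mul_add, add_comm]
    congr 1
    rw [← zsmul_eq_mul, ← zsmul_eq_mul, TensorProduct.smul_tmul']

/-- The coproduct of graphs restricts to the subalgebra, where it is dual to the group law. -/
theorem exists_gradComul {Q : T.amplitudes → ℤ} (hQ : HasInvariantCharge T Q) (hc : HasGraphs T) :
    ∃ Δ : gradAlgebra T →ₐ[ℚ] gradAlgebra T ⊗[ℚ] gradAlgebra T,
      IsSeriesComul (chargeExponent Q) gradDressing Δ ∧
      ∀ a, Algebra.TensorProduct.map (gradAlgebra T).val (gradAlgebra T).val (Δ a) = comul T a := by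
  have hx := isUniversalFamily_gradDressing hc
  obtain ⟨Δ, hΔ⟩ := hx.exists_comul (chargeExponent Q)
  refine ⟨Δ, hΔ, fun a => ?_⟩
  suffices h : (Algebra.TensorProduct.map (gradAlgebra T).val (gradAlgebra T).val).comp Δ =
      (comul T).comp (gradAlgebra T).val from DFunLike.congr_fun h a
  refine hx.ext _ _ fun s => ?_
  rw [hΔ.unitMap_comp, unitMap_algHom_comp (comul T), unitMap_val_gradDressing,
    unitMap_comul_dressing hQ]
  have e1 : (Algebra.TensorProduct.map (gradAlgebra T).val (gradAlgebra T).val).comp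
      (Algebra.TensorProduct.includeLeft : gradAlgebra T →ₐ[ℚ] gradAlgebra T ⊗[ℚ] gradAlgebra T) =
      (Algebra.TensorProduct.includeLeft :
        GraphAlgebra T →ₐ[ℚ] GraphAlgebra T ⊗[ℚ] GraphAlgebra T).comp (gradAlgebra T).val := by
    ext a
    simp
  have e2 : (Algebra.TensorProduct.map (gradAlgebra T).val (gradAlgebra T).val).comp
      (Algebra.TensorProduct.includeRight : gradAlgebra T →ₐ[ℚ] gradAlgebra T ⊗[ℚ] gradAlgebra T) =
      (Algebra.TensorProduct.includeRight :
        GraphAlgebra T →ₐ[ℚ] GraphAlgebra T ⊗[ℚ] GraphAlgebra T).comp (gradAlgebra T).val := by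
    ext a
    simp
  rw [e1, e2]
  simp only [unitMap_algHom_comp, unitMap_val_gradDressing]

theorem counit_graphSum (s : Multiset T.Leg) (k : ℕ) : counit T (graphSum T s k) = 0 := by
  rw [graphSum_eq, map_sum]
  exact Finset.sum_eq_zero fun q _ => by rw [map_smul, counit, MvPolynomial.aeval_X, smul_zero]

theorem gradCounit_gradGen (p : GradIndex T) : gradCounit T (gradGen T p) = 0 :=
  counit_graphSum _ _

theorem unitMap_gradCounit (s : T.amplitudes) :
    unitMap (gradCounit T : gradAlgebra T →+* ℚ) (gradDressing s) = 1 := by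
  ext1
  ext1 k
  rw [val_unitMap, PowerSeries.coeff_map, Units.val_one, PowerSeries.coeff_one]
  rcases Nat.eq_zero_or_pos k with rfl | hk
  · rw [coeff_gradDressing, if_pos rfl, if_pos rfl, map_one]
  · obtain ⟨k, rfl⟩ : ∃ j : ℕ+, (j : ℕ) = k := ⟨⟨k, hk⟩, rfl⟩
    rw [coeff_gradDressing_pos, map_mul, if_neg hk.ne']
    change _ * gradCounit T _ = 0
    rw [gradCounit_gradGen, mul_zero]

end

section

/-! ### Pairing an enveloping algebra with a Hopf algebra -/

theorem pairTensor_tmul {A : Type} [AddCommGroup A] [Module ℚ A] (φ ψ : A →ₗ[ℚ] ℚ) (a b : A) :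
    pairTensor φ ψ (a ⊗ₜ b) = φ a * ψ b := by
  simp [pairTensor]

/-- The monomial in the family `x` with a given multiset of indices. -/
def monomial {A I : Type} [CommRing A] (x : I → A) (α : Multiset I) : A := (α.map x).prod

theorem monomial_zero {A I : Type} [CommRing A] (x : I → A) : monomial x 0 = 1 := by
  simp [monomial]

theorem monomial_cons {A I : Type} [CommRing A] (x : I → A) (p : I) (α : Multiset I) :
    monomial x (p ::ₘ α) = x p * monomial x α := by simp [monomial]

theorem monomial_add {A I : Type} [CommRing A] (x : I → A) (α β : Multiset I) :
    monomial x (α + β) = monomial x α * monomial x β := by simp [monomial]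

section Frame

attribute [local instance 100] LieRing.ofAssociativeRing

variable {A : Type} [CommRing A] [Algebra ℚ A]

/-- The coalgebra underlying a Hopf algebra. -/
@[reducible]
def IsHopf.coalgebra {Δ : A →ₐ[ℚ] A ⊗[ℚ] A} {ε : A →ₐ[ℚ] ℚ} (h : IsHopf Δ ε) :
    Coalgebra ℚ A where
  comul := Δ.toLinearMap
  counit := ε.toLinearMap
  coassoc := LinearMap.ext fun a => h.coassoc a
  rTensor_counit_comp_comul := LinearMap.ext fun a =>
    (TensorProduct.lid ℚ A).injective <| (h.counit_left a).trans (by simp)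
  lTensor_counit_comp_comul := LinearMap.ext fun a =>
    (TensorProduct.rid ℚ A).injective <| (h.counit_right a).trans (by simp)

/-- The operator `(id ⊗ φ) ∘ Δ` given by a linear functional `φ`. -/
def rightSlice (Δ : A →ₐ[ℚ] A ⊗[ℚ] A) (φ : A →ₗ[ℚ] ℚ) : A →ₗ[ℚ] A :=
  (TensorProduct.rid ℚ A).toLinearMap ∘ₗ TensorProduct.map LinearMap.id φ ∘ₗ Δ.toLinearMap

theorem apply_rightSlice (Δ : A →ₐ[ℚ] A ⊗[ℚ] A) (φ ψ : A →ₗ[ℚ] ℚ) (a : A) :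
    ψ (rightSlice Δ φ a) = pairTensor ψ φ (Δ a) := by
  rw [rightSlice, LinearMap.comp_apply, LinearMap.comp_apply, AlgHom.toLinearMap_apply]
  generalize Δ a = w
  induction w with
  | zero => simp
  | tmul a b => simp [pairTensor_tmul, mul_comm]
  | add v w hv hw => simp only [map_add, hv, hw]

/-- Functionals that satisfy the Leibniz rule along the counit give derivations. -/
theorem rightSlice_mul (Δ : A →ₐ[ℚ] A ⊗[ℚ] A) {ε : A →ₐ[ℚ] ℚ} (h : IsHopf Δ ε)
    {φ : A →ₗ[ℚ] ℚ} (hφ : ∀ a b, φ (a * b) = ε a * φ b + φ a * ε b) (a b : A) :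
    rightSlice Δ φ (a * b) = a * rightSlice Δ φ b + rightSlice Δ φ a * b := by
  have key : ∀ v w : A ⊗[ℚ] A,
      TensorProduct.rid ℚ A (TensorProduct.map LinearMap.id φ (v * w)) =
        TensorProduct.rid ℚ A (TensorProduct.map LinearMap.id ε.toLinearMap v) *
          TensorProduct.rid ℚ A (TensorProduct.map LinearMap.id φ w) +
        TensorProduct.rid ℚ A (TensorProduct.map LinearMap.id φ v) *
          TensorProduct.rid ℚ A (TensorProduct.map LinearMap.id ε.toLinearMap w) := by
    intro v w
    induction v with
    | zero => simp
    | add v v' hv hv' => simp only [add_mul, map_add, hv, hv']; ring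
    | tmul a b =>
      induction w with
      | zero => simp
      | add w w' hw hw' => simp only [mul_add, map_add, hw, hw']; ring
      | tmul c d =>
        simp only [Algebra.TensorProduct.tmul_mul_tmul, TensorProduct.map_tmul, LinearMap.id_coe,
          id_eq, hφ, TensorProduct.rid_tmul, AlgHom.toLinearMap_apply, add_smul]
        simp only [Algebra.smul_def, map_mul]
        ring
  have := key (Δ a) (Δ b)
  rw [← map_mul, h.counit_right, h.counit_right] at this
  exact this

theorem counit_rightSlice {Δ : A →ₐ[ℚ] A ⊗[ℚ] A} {ε : A →ₐ[ℚ] ℚ} (h : IsHopf Δ ε)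
    (φ : A →ₗ[ℚ] ℚ) (a : A) : ε (rightSlice Δ φ a) = φ a := by
  have h1 := congrArg φ (h.counit_left a)
  rw [← AlgHom.toLinearMap_apply, apply_rightSlice, ← h1]
  generalize Δ a = w
  induction w with
  | zero => simp
  | tmul a b => simp [pairTensor_tmul]
  | add v w hv hw => simp only [map_add, hv, hw]

variable {I L : Type} [LieRing L] [LieAlgebra ℚ L]

/-- A Lie algebra that acts on a Hopf algebra with generators `x` by functionals `D` that satisfy
the Leibniz rule along the counit, such that a spanning family `b` is dual to `x`; the bracket
corresponds to the commutator of the convolution product. -/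
structure IsPrimitiveFrame (Δ : A →ₐ[ℚ] A ⊗[ℚ] A) (ε : A →ₐ[ℚ] ℚ) (x : I → A) (b : I → L)
    (D : L →ₗ[ℚ] A →ₗ[ℚ] ℚ) : Prop where
  hopf : IsHopf Δ ε
  counit_gen : ∀ p, ε (x p) = 0
  span_monomial : Submodule.span ℚ (Set.range (monomial x)) = ⊤
  span_basis : Submodule.span ℚ (Set.range b) = ⊤
  leibniz : ∀ ℓ a c, D ℓ (a * c) = ε a * D ℓ c + D ℓ a * ε c
  dual_self : ∀ p, D (b p) (x p) = 1
  dual_ne : ∀ p q, p ≠ q → D (b p) (x q) = 0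
  lie : ∀ p q r, D ⁅b p, b q⁆ (x r) =
    D (b p) (rightSlice Δ (D (b q)) (x r)) - D (b q) (rightSlice Δ (D (b p)) (x r))

namespace IsPrimitiveFrame

variable {Δ : A →ₐ[ℚ] A ⊗[ℚ] A} {ε : A →ₐ[ℚ] ℚ} {x : I → A} {b : I → L}
  {D : L →ₗ[ℚ] A →ₗ[ℚ] ℚ}

/-- A functional satisfying the Leibniz rule along the counit vanishes when it does on
generators. -/
theorem eq_zero_of_leibniz (h : IsPrimitiveFrame Δ ε x b D) {φ : A →ₗ[ℚ] ℚ}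
    (hφ : ∀ a c, φ (a * c) = ε a * φ c + φ a * ε c) (hx : ∀ p, φ (x p) = 0) : φ = 0 := by
  have h1 : φ 1 = 0 := by
    have := hφ 1 1
    rw [mul_one, map_one ε, one_mul, mul_one] at this
    linarith
  refine LinearMap.ext_on_range h.span_monomial fun α => ?_
  induction α using Multiset.induction_on with
  | empty => rw [monomial_zero, h1, LinearMap.zero_apply]
  | cons p α ih =>
    rw [LinearMap.zero_apply] at ih ⊢
    rw [monomial_cons, hφ, ih, hx, mul_zero, zero_mul, add_zero]

/-- The derivation of the Hopf algebra given by an element of the Lie algebra. -/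
def T (_ : IsPrimitiveFrame Δ ε x b D) (ℓ : L) : A →ₗ[ℚ] A := rightSlice Δ (D ℓ)

theorem T_mul (h : IsPrimitiveFrame Δ ε x b D) (ℓ : L) (a c : A) :
    h.T ℓ (a * c) = a * h.T ℓ c + h.T ℓ a * c := rightSlice_mul Δ h.hopf (h.leibniz ℓ) a c

theorem T_one (h : IsPrimitiveFrame Δ ε x b D) (ℓ : L) : h.T ℓ 1 = 0 := by
  have := h.T_mul ℓ 1 1
  rw [mul_one, mul_one, one_mul] at this
  exact left_eq_add.1 this

theorem counit_T (h : IsPrimitiveFrame Δ ε x b D) (ℓ : L) (a : A) : ε (h.T ℓ a) = D ℓ a :=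
  counit_rightSlice h.hopf _ _

theorem lie_apply_basis (h : IsPrimitiveFrame Δ ε x b D) (p q : I) (a : A) :
    D ⁅b p, b q⁆ a = D (b p) (h.T (b q) a) - D (b q) (h.T (b p) a) := by
  have := h.eq_zero_of_leibniz (φ := D ⁅b p, b q⁆ - (D (b p) ∘ₗ h.T (b q) - D (b q) ∘ₗ h.T (b p)))
    (fun a c => by
      simp only [LinearMap.sub_apply, LinearMap.comp_apply, h.leibniz, h.T_mul, map_add,
        h.counit_T]
      ring)
    (fun r => sub_eq_zero.2 (h.lie p q r))
  exact sub_eq_zero.1 (DFunLike.congr_fun this a)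

/-- The bracket is the commutator of the convolution product. -/
theorem lie_apply (h : IsPrimitiveFrame Δ ε x b D) (ℓ m : L) (a : A) :
    D ⁅ℓ, m⁆ a = pairTensor (D ℓ) (D m) (Δ a) - pairTensor (D m) (D ℓ) (Δ a) := by
  have add_left : ∀ φ φ' ψ : A →ₗ[ℚ] ℚ, pairTensor (φ + φ') ψ = pairTensor φ ψ + pairTensor φ' ψ :=
    fun φ φ' ψ => TensorProduct.ext' fun a b => by
      simp only [pairTensor_tmul, LinearMap.add_apply, add_mul]
  have add_right : ∀ φ φ' ψ : A →ₗ[ℚ] ℚ,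
      pairTensor ψ (φ + φ') = pairTensor ψ φ + pairTensor ψ φ' :=
    fun φ φ' ψ => TensorProduct.ext' fun a b => by
      simp only [pairTensor_tmul, LinearMap.add_apply, mul_add]
  have smul_left : ∀ (c : ℚ) (φ ψ : A →ₗ[ℚ] ℚ), pairTensor (c • φ) ψ = c • pairTensor φ ψ :=
    fun c φ ψ => TensorProduct.ext' fun a b => by
      simp only [pairTensor_tmul, LinearMap.smul_apply, smul_eq_mul, mul_assoc]
  have smul_right : ∀ (c : ℚ) (φ ψ : A →ₗ[ℚ] ℚ), pairTensor ψ (c • φ) = c • pairTensor ψ φ :=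
    fun c φ ψ => TensorProduct.ext' fun a b => by
      simp only [pairTensor_tmul, LinearMap.smul_apply, smul_eq_mul, mul_left_comm]
  have zero_left : ∀ ψ : A →ₗ[ℚ] ℚ, pairTensor 0 ψ = 0 :=
    fun ψ => TensorProduct.ext' fun a b => by simp [pairTensor_tmul]
  have zero_right : ∀ ψ : A →ₗ[ℚ] ℚ, pairTensor ψ 0 = 0 :=
    fun ψ => TensorProduct.ext' fun a b => by simp [pairTensor_tmul]
  have hℓ : ℓ ∈ Submodule.span ℚ (Set.range b) := h.span_basis ▸ Submodule.mem_top
  have hm : m ∈ Submodule.span ℚ (Set.range b) := h.span_basis ▸ Submodule.mem_top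
  induction hℓ using Submodule.span_induction with
  | zero => simp [zero_left, zero_right]
  | add u v _ _ hu hv =>
    simp only [add_lie, map_add, LinearMap.add_apply, hu, hv, add_left, add_right]
    ring
  | smul c u _ hu =>
    simp only [smul_lie, map_smul, LinearMap.smul_apply, hu, smul_left, smul_right, smul_sub]
  | mem u hu =>
    obtain ⟨p, rfl⟩ := hu
    induction hm using Submodule.span_induction with
    | zero => simp [zero_left, zero_right]
    | add u v _ _ hu hv =>
      simp only [lie_add, map_add, LinearMap.add_apply, hu, hv, add_left, add_right]
      ring
    | smul c u _ hu =>
      simp only [lie_smul, map_smul, LinearMap.smul_apply, hu, smul_left, smul_right, smul_sub]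
    | mem u hu =>
      obtain ⟨q, rfl⟩ := hu
      rw [h.lie_apply_basis, T, T, apply_rightSlice, apply_rightSlice]

/-- The pairing extends `D` from the Lie algebra to its enveloping algebra, and the product of the
enveloping algebra corresponds to the convolution product. -/
structure IsExtension (_ : IsPrimitiveFrame Δ ε x b D)
    (P : UniversalEnvelopingAlgebra ℚ L →ₗ[ℚ] A →ₗ[ℚ] ℚ) : Prop where
  one_left : ∀ a, P 1 a = ε a
  mul_left : ∀ u v a, P (u * v) a = pairTensor (P u) (P v) (Δ a)
  apply_ι : ∀ ℓ, P (UniversalEnvelopingAlgebra.ι ℚ ℓ) = D ℓ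

/-- The extension exists by the universal property, applied to the convolution algebra of
functionals. -/
theorem exists_extension (h : IsPrimitiveFrame Δ ε x b D) :
    ∃ P : UniversalEnvelopingAlgebra ℚ L →ₗ[ℚ] A →ₗ[ℚ] ℚ, h.IsExtension P := by
  let _ := h.hopf.coalgebra
  have hmul : ∀ (f g : WithConv (A →ₗ[ℚ] ℚ)) (a : A),
      (f * g).ofConv a = pairTensor f.ofConv g.ofConv (Δ a) := by
    intro f g a
    rw [LinearMap.convMul_apply]
    change LinearMap.mul' ℚ ℚ (TensorProduct.map f.ofConv g.ofConv (Δ a)) = _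
    generalize Δ a = w
    induction w with
    | zero => simp
    | tmul a b => simp [pairTensor_tmul]
    | add v w hv hw => simp only [map_add, hv, hw]
  let F : L →ₗ⁅ℚ⁆ WithConv (A →ₗ[ℚ] ℚ) :=
    { toFun := fun ℓ => WithConv.toConv (D ℓ)
      map_add' := fun ℓ m => by rw [map_add]; rfl
      map_smul' := fun c ℓ => by rw [map_smul]; rfl
      map_lie' := fun {ℓ m} => by
        rw [LieRing.of_associative_ring_bracket]
        apply WithConv.ofConv_injective
        ext a
        rw [WithConv.ofConv_sub, LinearMap.sub_apply, hmul, hmul]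
        exact h.lie_apply ℓ m a }
  let G := UniversalEnvelopingAlgebra.lift ℚ F
  refine ⟨(WithConv.linearEquiv ℚ (A →ₗ[ℚ] ℚ)).toLinearMap ∘ₗ G.toLinearMap, fun a => ?_,
    fun u v a => ?_, fun ℓ => ?_⟩
  · change (G 1).ofConv a = _
    rw [map_one]
    rfl
  · change (G (u * v)).ofConv a = _
    rw [map_mul, hmul]
    rfl
  · change (G _).ofConv = _
    rw [UniversalEnvelopingAlgebra.lift_ι_apply]
    rfl

end IsPrimitiveFrame

end Frame

end

section

/-! ### Words in the enveloping algebra -/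

section Words

attribute [local instance 100] LieRing.ofAssociativeRing

variable {L : Type} [LieRing L] [LieAlgebra ℚ L]

open UniversalEnvelopingAlgebra (ι)

/-- The products `ι ℓ₁ ⋯ ι ℓₙ` span the enveloping algebra. -/
theorem envelopingAlgebra_induction {p : UniversalEnvelopingAlgebra ℚ L → Prop}
    (zero : p 0) (one : p 1) (add : ∀ u v, p u → p v → p (u + v))
    (smul : ∀ (c : ℚ) u, p u → p (c • u))
    (mul_ι : ∀ u ℓ, p u → p (u * ι ℚ ℓ)) (u : UniversalEnvelopingAlgebra ℚ L) : p u := by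
  have hgen : Algebra.adjoin ℚ (Set.range (ι ℚ (L := L))) = ⊤ := by
    let S := Algebra.adjoin ℚ (Set.range (ι ℚ (L := L)))
    let F : L →ₗ⁅ℚ⁆ S :=
      { toFun := fun ℓ => ⟨ι ℚ ℓ, Algebra.subset_adjoin ⟨ℓ, rfl⟩⟩
        map_add' := fun ℓ m => Subtype.ext (map_add _ _ _)
        map_smul' := fun c ℓ => Subtype.ext (map_smul _ _ _)
        map_lie' := fun {ℓ m} => Subtype.ext (LieHom.map_lie _ _ _) }
    have hF : S.val.comp (UniversalEnvelopingAlgebra.lift ℚ F) = AlgHom.id ℚ _ := by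
      apply UniversalEnvelopingAlgebra.hom_ext
      ext ℓ
      change ((UniversalEnvelopingAlgebra.lift ℚ F (ι ℚ ℓ) : S) : UniversalEnvelopingAlgebra ℚ L) = _
      rw [UniversalEnvelopingAlgebra.lift_ι_apply]
      rfl
    refine eq_top_iff.2 fun u _ => ?_
    have := DFunLike.congr_fun hF u
    rw [AlgHom.id_apply] at this
    rw [← this]
    exact (UniversalEnvelopingAlgebra.lift ℚ F u).2
  have hu : u ∈ Submodule.span ℚ (Submonoid.closure (Set.range (ι ℚ (L := L))) : Set _) := by
    rw [← Algebra.adjoin_eq_span, hgen]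
    trivial
  induction hu using Submodule.span_induction with
  | zero => exact zero
  | add u v _ _ hu hv => exact add u v hu hv
  | smul c u _ hu => exact smul c u hu
  | mem u hu =>
    induction hu using Submonoid.closure_induction_right with
    | one => exact one
    | mul_right u _ v hv hu =>
      obtain ⟨ℓ, rfl⟩ := hv
      exact mul_ι u ℓ hu

variable {I : Type}

/-- The product of basis elements of a Lie algebra in the enveloping algebra; the head of the list
is the last factor. -/
def word (b : I → L) : List I → UniversalEnvelopingAlgebra ℚ L
  | [] => 1
  | p :: w => word b w * ι ℚ (b p)

/-- The span of the words of length less than `n`. -/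
def shortWords (b : I → L) (n : ℕ) : Submodule ℚ (UniversalEnvelopingAlgebra ℚ L) :=
  Submodule.span ℚ (word b '' {w | w.length < n})

theorem word_mem_shortWords (b : I → L) {w : List I} {n : ℕ} (h : w.length < n) :
    word b w ∈ shortWords b n := Submodule.subset_span ⟨w, h, rfl⟩

variable {b : I → L}

theorem word_mul_ι_mem (hb : Submodule.span ℚ (Set.range b) = ⊤) (w : List I) (ℓ : L) :
    word b w * ι ℚ ℓ ∈ shortWords b (w.length + 2) := by
  have hℓ : ℓ ∈ Submodule.span ℚ (Set.range b) := hb ▸ Submodule.mem_top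
  induction hℓ using Submodule.span_induction with
  | zero => rw [map_zero, mul_zero]; exact zero_mem _
  | add u v _ _ hu hv => rw [map_add, mul_add]; exact add_mem hu hv
  | smul c u _ hu => rw [map_smul, mul_smul_comm]; exact Submodule.smul_mem _ _ hu
  | mem u hu =>
    obtain ⟨p, rfl⟩ := hu
    exact word_mem_shortWords b (w := p :: w) (by simp)

theorem mul_ι_mem_shortWords {n : ℕ} {u : UniversalEnvelopingAlgebra ℚ L}
    (hu : u ∈ shortWords b n) (p : I) : u * ι ℚ (b p) ∈ shortWords b (n + 1) := by
  induction hu using Submodule.span_induction with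
  | zero => rw [zero_mul]; exact zero_mem _
  | add u v _ _ hu hv => rw [add_mul]; exact add_mem hu hv
  | smul c u _ hu => rw [smul_mul_assoc]; exact Submodule.smul_mem _ _ hu
  | mem u hu =>
    obtain ⟨w, hw, rfl⟩ := hu
    exact word_mem_shortWords b (w := p :: w) (Nat.succ_lt_succ hw)

/-- Permuting the letters changes a word only by shorter words. -/
theorem word_sub_mem_of_perm (hb : Submodule.span ℚ (Set.range b) = ⊤) {w w' : List I}
    (h : w.Perm w') : word b w - word b w' ∈ shortWords b w.length := by
  induction h with
  | nil => rw [sub_self]; exact zero_mem _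
  | cons p h ih =>
    rw [word, word, ← sub_mul]
    exact mul_ι_mem_shortWords ih p
  | swap p q w =>
    have : word b (q :: p :: w) - word b (p :: q :: w) = word b w * ι ℚ ⁅b p, b q⁆ := by
      rw [LieHom.map_lie, LieRing.of_associative_ring_bracket]
      simp only [word, mul_assoc, mul_sub]
    rw [this]
    exact word_mul_ι_mem hb w _
  | trans h₁ h₂ ih₁ ih₂ =>
    rw [← h₁.length_eq] at ih₂
    have := add_mem ih₁ ih₂
    rwa [sub_add_sub_cancel] at this

/-- The word of a multiset, with its elements in an arbitrary order. -/
def multisetWord (b : I → L) (β : Multiset I) : UniversalEnvelopingAlgebra ℚ L := word b β.toList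

/-- The spanning half of the Poincaré–Birkhoff–Witt theorem. -/
theorem span_multisetWord (hb : Submodule.span ℚ (Set.range b) = ⊤) :
    Submodule.span ℚ (Set.range (multisetWord b)) = ⊤ := by
  have key : ∀ n, shortWords b n ≤ Submodule.span ℚ (Set.range (multisetWord b)) := by
    intro n
    induction n with
    | zero =>
      refine Submodule.span_le.2 ?_
      rintro _ ⟨w, hw, rfl⟩
      exact absurd hw (Nat.not_lt_zero _)
    | succ n ih =>
      refine Submodule.span_le.2 ?_
      rintro _ ⟨w, hw, rfl⟩
      have h1 : w.Perm (Multiset.toList (w : Multiset I)) :=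
        Multiset.coe_eq_coe.1 (Multiset.coe_toList _).symm
      have h2 : shortWords b w.length ≤ shortWords b n :=
        Submodule.span_mono (Set.image_mono fun v hv =>
          lt_of_lt_of_le hv (Nat.lt_succ_iff.1 hw))
      have h3 := ih (h2 (word_sub_mem_of_perm hb h1))
      have h4 : multisetWord b (w : Multiset I) ∈
          Submodule.span ℚ (Set.range (multisetWord b)) := Submodule.subset_span ⟨_, rfl⟩
      have := add_mem h3 h4
      rwa [multisetWord, sub_add_cancel] at this
  refine Submodule.eq_top_iff'.2 fun u => ?_
  suffices h : ∃ n, u ∈ shortWords b n from h.elim fun n hn => key n hn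
  have mono : ∀ {m n}, m ≤ n → shortWords b m ≤ shortWords b n := fun h =>
    Submodule.span_mono (Set.image_mono fun v hv => lt_of_lt_of_le hv h)
  induction u using envelopingAlgebra_induction with
  | zero => exact ⟨0, zero_mem _⟩
  | one => exact ⟨1, word_mem_shortWords b (w := []) (by simp)⟩
  | add u v hu hv =>
    obtain ⟨m, hm⟩ := hu
    obtain ⟨n, hn⟩ := hv
    exact ⟨max m n, add_mem (mono (le_max_left _ _) hm) (mono (le_max_right _ _) hn)⟩
  | smul c u hu =>
    obtain ⟨n, hn⟩ := hu
    exact ⟨n, Submodule.smul_mem _ _ hn⟩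
  | mul_ι u ℓ hu =>
    obtain ⟨n, hn⟩ := hu
    refine ⟨n + 1, ?_⟩
    induction hn using Submodule.span_induction with
    | zero => rw [zero_mul]; exact zero_mem _
    | add u v _ _ hu hv => rw [add_mul]; exact add_mem hu hv
    | smul c u _ hu => rw [smul_mul_assoc]; exact Submodule.smul_mem _ _ hu
    | mem u hu =>
      obtain ⟨w, hw, rfl⟩ := hu
      exact mono (Nat.succ_lt_succ hw) (word_mul_ι_mem hb w ℓ)

end Words

end

section

/-! ### The pairing of words and monomials -/

section Duality

attribute [local instance 100] LieRing.ofAssociativeRing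

open UniversalEnvelopingAlgebra (ι)

variable {A I L : Type} [CommRing A] [Algebra ℚ A] [LieRing L] [LieAlgebra ℚ L]
  {Δ : A →ₐ[ℚ] A ⊗[ℚ] A} {ε : A →ₐ[ℚ] ℚ} {x : I → A} {b : I → L} {D : L →ₗ[ℚ] A →ₗ[ℚ] ℚ}

namespace IsPrimitiveFrame

/-- A derivation lowers the filtration by powers of the augmentation ideal by at most one. -/
theorem T_mem_pow (h : IsPrimitiveFrame Δ ε x b D) (ℓ : L) {n : ℕ} {a : A}
    (ha : a ∈ RingHom.ker ε ^ (n + 1)) :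
    h.T ℓ a ∈ RingHom.ker ε ^ n := by
  induction n generalizing a with
  | zero => rw [pow_zero, Ideal.one_eq_top]; trivial
  | succ n ih =>
    rw [pow_succ] at ha
    induction ha using Submodule.mul_induction_on' with
    | mem_mul_mem a ha c hc =>
      rw [T_mul]
      refine add_mem (Ideal.mul_mem_right _ _ ha) ?_
      rw [pow_succ]
      exact Ideal.mul_mem_mul (ih ha) hc
    | add a _ c _ ha hc => rw [map_add]; exact add_mem ha hc

theorem gen_mem (h : IsPrimitiveFrame Δ ε x b D) (p : I) : x p ∈ RingHom.ker ε := h.counit_gen p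

theorem monomial_mem_pow (h : IsPrimitiveFrame Δ ε x b D) (α : Multiset I) :
    monomial x α ∈ RingHom.ker ε ^ α.card := by
  induction α using Multiset.induction_on with
  | empty => rw [Multiset.card_zero, pow_zero, Ideal.one_eq_top]; trivial
  | cons p α ih =>
    rw [monomial_cons, Multiset.card_cons, pow_succ']
    exact Ideal.mul_mem_mul (h.gen_mem p) ih

open Classical in
/-- To leading order in the augmentation ideal, the derivation of a basis element is the partial
derivative by the dual generator. -/
theorem T_monomial_sub_mem (h : IsPrimitiveFrame Δ ε x b D) (p : I) (α : Multiset I) :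
    h.T (b p) (monomial x α) - (α.count p : ℚ) • monomial x (α.erase p) ∈
      RingHom.ker ε ^ α.card := by
  induction α using Multiset.induction_on with
  | empty => rw [Multiset.card_zero, pow_zero, Ideal.one_eq_top]; trivial
  | cons q α ih =>
    have h1 : x q * (h.T (b p) (monomial x α) - (α.count p : ℚ) • monomial x (α.erase p)) ∈
        RingHom.ker ε ^ (α.card + 1) := by
      rw [pow_succ']
      exact Ideal.mul_mem_mul (h.gen_mem q) ih
    have h2 : (h.T (b p) (x q) - algebraMap ℚ A (D (b p) (x q))) * monomial x α ∈
        RingHom.ker ε ^ (α.card + 1) := by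
      rw [pow_succ']
      refine Ideal.mul_mem_mul ?_ (h.monomial_mem_pow α)
      rw [RingHom.mem_ker, map_sub, h.counit_T, AlgHom.commutes, Algebra.algebraMap_self_apply,
        sub_self]
    have h3 := add_mem h1 h2
    rw [Multiset.card_cons]
    convert h3 using 1
    rw [monomial_cons, T_mul]
    have h4 : ((q ::ₘ α).count p : ℚ) • monomial x ((q ::ₘ α).erase p) =
        x q * ((α.count p : ℚ) • monomial x (α.erase p)) +
          algebraMap ℚ A (D (b p) (x q)) * monomial x α := by
      by_cases hpq : p = q
      · subst hpq
        rw [Multiset.count_cons_self, Multiset.erase_cons_head, h.dual_self, map_one, one_mul]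
        by_cases hp : p ∈ α
        · rw [mul_smul_comm, ← monomial_cons, Multiset.cons_erase hp, Nat.cast_add, Nat.cast_one,
            add_smul, one_smul]
        · rw [Multiset.count_eq_zero_of_notMem hp]
          simp
      · rw [Multiset.count_cons_of_ne hpq, Multiset.erase_cons_tail _ (Ne.symm hpq),
          monomial_cons, h.dual_ne p q hpq, map_zero, zero_mul, add_zero, mul_smul_comm]
    rw [h4]
    ring

variable {h : IsPrimitiveFrame Δ ε x b D} {P : UniversalEnvelopingAlgebra ℚ L →ₗ[ℚ] A →ₗ[ℚ] ℚ}

namespace IsExtension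

theorem apply_mul_ι (hP : h.IsExtension P) (u : UniversalEnvelopingAlgebra ℚ L) (ℓ : L)
    (a : A) :
    P (u * ι ℚ ℓ) a = P u (h.T ℓ a) := by
  rw [hP.mul_left, hP.apply_ι, T, apply_rightSlice]

/-- A word of length `n` kills the powers of the augmentation ideal above the `n`-th. -/
theorem apply_word_eq_zero (hP : h.IsExtension P) {w : List I} {n : ℕ} (hw : w.length < n)
    {a : A} (ha : a ∈ RingHom.ker ε ^ n) : P (word b w) a = 0 := by
  induction w generalizing n a with
  | nil =>
    rw [word, hP.one_left]
    exact Ideal.pow_le_self (Nat.pos_iff_ne_zero.1 hw) ha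
  | cons p w ih =>
    obtain ⟨n, rfl⟩ : ∃ m, n = m + 1 := ⟨n - 1, by have : 0 < n := (Nat.zero_le _).trans_lt hw; omega⟩
    rw [word, hP.apply_mul_ι]
    exact ih (Nat.lt_of_succ_lt_succ hw) (h.T_mem_pow _ ha)

/-- In top degree, a word pairs only with the monomial of its letters. -/
theorem apply_word_monomial_ne_zero_iff (hP : h.IsExtension P) {w : List I} {α : Multiset I}
    (hw : w.length = α.card) :
    P (word b w) (monomial x α) ≠ 0 ↔ (w : Multiset I) = α := by
  classical
  induction w generalizing α with
  | nil =>
    have : α = 0 := Multiset.card_eq_zero.1 hw.symm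
    subst this
    rw [word, hP.one_left, monomial_zero, map_one]
    simp
  | cons p w ih =>
    have h1 := hP.apply_word_eq_zero (w := w) (n := α.card) (by rw [← hw]; simp)
      (h.T_monomial_sub_mem p α)
    rw [map_sub, sub_eq_zero, map_smul, smul_eq_mul] at h1
    rw [word, hP.apply_mul_ι]
    have h2 : P (word b w) (h.T (b p) (monomial x α)) =
      (α.count p : ℚ) * P (word b w) (monomial x (α.erase p)) := by
      convert h1
    rw [h2, mul_ne_zero_iff, Nat.cast_ne_zero, Multiset.count_ne_zero, ← Multiset.cons_coe]
    by_cases hp : p ∈ α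
    · rw [ih (by rw [Multiset.card_erase_of_mem hp, ← hw]; rfl)]
      constructor
      · rintro ⟨_, h3⟩
        rw [h3, Multiset.cons_erase hp]
      · intro h3
        exact ⟨hp, by rw [← h3, Multiset.erase_cons_head]⟩
    · constructor
      · exact fun h3 => (hp h3.1).elim
      · intro h3
        exact (hp (h3 ▸ Multiset.mem_cons_self p _)).elim

theorem apply_multisetWord_eq_zero (hP : h.IsExtension P) {α β : Multiset I}
    (hαβ : β.card ≤ α.card) (hne : β ≠ α) :
    P (multisetWord b β) (monomial x α) = 0 := by
  rcases hαβ.lt_or_eq with hlt | heq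
  · exact hP.apply_word_eq_zero (by rwa [Multiset.length_toList]) (h.monomial_mem_pow α)
  · by_contra h1
    have := (hP.apply_word_monomial_ne_zero_iff (by rwa [Multiset.length_toList])).1 h1
    rw [Multiset.coe_toList] at this
    exact hne this

theorem apply_multisetWord_self (hP : h.IsExtension P) (α : Multiset I) :
    P (multisetWord b α) (monomial x α) ≠ 0 :=
  (hP.apply_word_monomial_ne_zero_iff (Multiset.length_toList α)).2 (Multiset.coe_toList α)

/-- The product of the Hopf algebra is dual to the coproduct of the enveloping algebra: elements of
`L` act as derivations. -/
theorem mul_right (hP : h.IsExtension P) (u : UniversalEnvelopingAlgebra ℚ L) (a c : A) :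
    P u (a * c) = pairTensor (P.flip a) (P.flip c) (envelopingComul L u) := by
  induction u using envelopingAlgebra_induction generalizing a c with
  | zero => simp
  | one =>
    rw [map_one (envelopingComul L), Algebra.TensorProduct.one_def, pairTensor_tmul, LinearMap.flip_apply,
      LinearMap.flip_apply, hP.one_left, hP.one_left, hP.one_left, map_mul]
  | add u v hu hv => rw [map_add, map_add, map_add, LinearMap.add_apply, hu, hv]
  | smul r u hu => rw [map_smul, map_smul, map_smul, LinearMap.smul_apply, hu]
  | mul_ι u ℓ hu =>
    have h1 : envelopingComul L (ι ℚ ℓ) = ι ℚ ℓ ⊗ₜ[ℚ] 1 + 1 ⊗ₜ[ℚ] ι ℚ ℓ := by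
      rw [envelopingComul, UniversalEnvelopingAlgebra.lift_ι_apply]
      rfl
    have h2 : ∀ w : UniversalEnvelopingAlgebra ℚ L ⊗[ℚ] UniversalEnvelopingAlgebra ℚ L,
        pairTensor (P.flip a) (P.flip c) (w * (ι ℚ ℓ ⊗ₜ[ℚ] 1 + 1 ⊗ₜ[ℚ] ι ℚ ℓ)) =
          pairTensor (P.flip (h.T ℓ a)) (P.flip c) w +
            pairTensor (P.flip a) (P.flip (h.T ℓ c)) w := by
      intro w
      induction w with
      | zero => simp
      | add v w hv hw => simp only [add_mul, map_add, hv, hw]; ring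
      | tmul v w =>
        rw [mul_add, Algebra.TensorProduct.tmul_mul_tmul, Algebra.TensorProduct.tmul_mul_tmul,
          mul_one, mul_one, map_add]
        simp only [pairTensor_tmul, LinearMap.flip_apply, hP.apply_mul_ι]
    rw [hP.apply_mul_ι, h.T_mul, map_add, hu, hu, map_mul, h1, h2, add_comm]

theorem one_right (hP : h.IsExtension P) (u : UniversalEnvelopingAlgebra ℚ L) :
    P u 1 = envelopingCounit L u := by
  induction u using envelopingAlgebra_induction with
  | zero => simp
  | one => rw [hP.one_left, map_one ε, map_one (envelopingCounit L)]
  | add u v hu hv => rw [map_add, map_add, LinearMap.add_apply, hu, hv]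
  | smul r u hu => rw [map_smul, map_smul, LinearMap.smul_apply, hu]
  | mul_ι u ℓ hu =>
    rw [hP.apply_mul_ι, h.T_one, map_zero, map_mul, envelopingCounit,
      UniversalEnvelopingAlgebra.lift_ι_apply, LieHom.zero_apply, mul_zero]

/-- Distinct elements of the enveloping algebra are separated by the monomials of highest degree. -/
theorem injective (hP : h.IsExtension P) : Function.Injective P := by
  rw [← LinearMap.ker_eq_bot, LinearMap.ker_eq_bot']
  intro u hu
  have hmem : u ∈ Submodule.span ℚ (Set.range (multisetWord b)) :=
    span_multisetWord h.span_basis ▸ Submodule.mem_top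
  obtain ⟨c, rfl⟩ := Finsupp.mem_span_range_iff_exists_finsupp.1 hmem
  by_contra hne
  have hc : c.support.Nonempty := by
    rw [Finsupp.support_nonempty_iff]
    rintro rfl
    exact hne Finsupp.sum_zero_index
  obtain ⟨β, hβ, hmax⟩ := c.support.exists_max_image Multiset.card hc
  have h1 := DFunLike.congr_fun hu (monomial x β)
  rw [Finsupp.sum, map_sum, LinearMap.sum_apply, Finset.sum_eq_single β] at h1
  · rw [map_smul, LinearMap.smul_apply, LinearMap.zero_apply, smul_eq_mul] at h1
    exact mul_ne_zero (Finsupp.mem_support_iff.1 hβ) (hP.apply_multisetWord_self β) h1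
  · intro γ hγ hne'
    rw [map_smul, LinearMap.smul_apply, hP.apply_multisetWord_eq_zero (hmax γ hγ) hne', smul_zero]
  · exact fun h2 => (h2 hβ).elim

end IsExtension

end IsPrimitiveFrame

end Duality

end

section

/-! ### The graded dual -/

section GradedDual

attribute [local instance 100] LieRing.ofAssociativeRing

variable {A I L : Type} [CommRing A] [Algebra ℚ A] [LieRing L] [LieAlgebra ℚ L]
  {Δ : A →ₐ[ℚ] A ⊗[ℚ] A} {ε : A →ₐ[ℚ] ℚ} {x : I → A} {b : I → L} {D : L →ₗ[ℚ] A →ₗ[ℚ] ℚ}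

/-- The total weight of a multiset of indices. -/
def weight (wt : I → ℕ) (α : Multiset I) : ℕ := (α.map wt).sum

theorem weight_cons (wt : I → ℕ) (p : I) (α : Multiset I) :
    weight wt (p ::ₘ α) = wt p + weight wt α := by simp [weight]

theorem weight_add (wt : I → ℕ) (α β : Multiset I) :
    weight wt (α + β) = weight wt α + weight wt β := by simp [weight]

theorem card_le_weight {wt : I → ℕ} (hwt : ∀ p, 0 < wt p) (α : Multiset I) :
    α.card ≤ weight wt α := by
  induction α using Multiset.induction_on with
  | empty => simp
  | cons p α ih =>
    have := hwt p
    rw [weight_cons, Multiset.card_cons]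
    omega

theorem le_weight {wt : I → ℕ} {p : I} {α : Multiset I} (hp : p ∈ α) : wt p ≤ weight wt α := by
  obtain ⟨β, rfl⟩ := Multiset.exists_cons_of_mem hp
  rw [weight_cons]
  exact Nat.le_add_right _ _

theorem finite_weight_lt {wt : I → ℕ} (hwt : ∀ p, 0 < wt p) (hfin : ∀ N, {p | wt p < N}.Finite)
    (N : ℕ) : {α : Multiset I | weight wt α < N}.Finite := by
  classical
  refine (Multiset.finite_toSet (Multiset.powerset (N • (hfin N).toFinset.val))).subset ?_
  intro α hα
  rw [Set.mem_ofPred_eq, Multiset.mem_powerset, Multiset.le_iff_count]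
  intro p
  by_cases hp : p ∈ α
  · have h1 : p ∈ (hfin N).toFinset := (hfin N).mem_toFinset.2 ((le_weight hp).trans_lt hα)
    rw [Multiset.count_nsmul, Multiset.count_eq_one_of_mem (hfin N).toFinset.nodup h1, mul_one]
    exact (Multiset.count_le_card p α).trans ((card_le_weight hwt α).trans hα.le)
  · rw [Multiset.count_eq_zero_of_notMem hp]
    exact Nat.zero_le _

namespace IsPrimitiveFrame

/-- The Hopf algebra is graded by positive weights of the generators, with finitely many generators
in each degree, and the derivations of basis elements lower the degree by the weight. -/
structure IsGraded (h : IsPrimitiveFrame Δ ε x b D) (wt : I → ℕ) (deg : ℕ → Submodule ℚ A) :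
    Prop where
  pos : ∀ p, 0 < wt p
  finite : ∀ N, {p | wt p < N}.Finite
  monomial_mem : ∀ α, monomial x α ∈ deg (weight wt α)
  le_span : ∀ n, deg n ≤ Submodule.span ℚ (monomial x '' {α | weight wt α = n})
  T_mem : ∀ p q, h.T (b p) (x q) ∈
    Submodule.span ℚ (monomial x '' {α | weight wt α + wt p = wt q})

namespace IsGraded

variable {h : IsPrimitiveFrame Δ ε x b D} {wt : I → ℕ} {deg : ℕ → Submodule ℚ A}

theorem T_monomial_mem (hd : h.IsGraded wt deg) (p : I) (α : Multiset I) :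
    h.T (b p) (monomial x α) ∈
      Submodule.span ℚ (monomial x '' {γ | weight wt γ + wt p = weight wt α}) := by
  induction α using Multiset.induction_on with
  | empty => rw [monomial_zero, h.T_one]; exact zero_mem _
  | cons q α ih =>
    rw [monomial_cons, h.T_mul]
    refine add_mem ?_ ?_
    · generalize h.T (b p) (monomial x α) = a at ih ⊢
      induction ih using Submodule.span_induction with
      | zero => rw [mul_zero]; exact zero_mem _
      | add u v _ _ hu hv => rw [mul_add]; exact add_mem hu hv
      | smul c u _ hu => rw [mul_smul_comm]; exact Submodule.smul_mem _ _ hu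
      | mem u hu =>
        obtain ⟨γ, hγ, rfl⟩ := hu
        rw [← monomial_cons]
        refine Submodule.subset_span ⟨_, ?_, rfl⟩
        rw [Set.mem_ofPred_eq] at hγ ⊢
        rw [weight_cons, weight_cons, add_assoc, hγ]
    · have hq := hd.T_mem p q
      generalize h.T (b p) (x q) = a at hq ⊢
      induction hq using Submodule.span_induction with
      | zero => rw [zero_mul]; exact zero_mem _
      | add u v _ _ hu hv => rw [add_mul]; exact add_mem hu hv
      | smul c u _ hu => rw [smul_mul_assoc]; exact Submodule.smul_mem _ _ hu
      | mem u hu =>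
        obtain ⟨γ, hγ, rfl⟩ := hu
        rw [← monomial_add]
        refine Submodule.subset_span ⟨_, ?_, rfl⟩
        rw [Set.mem_ofPred_eq] at hγ ⊢
        rw [weight_cons, weight_add, ← hγ]
        omega

end IsGraded

namespace IsExtension

variable {h : IsPrimitiveFrame Δ ε x b D} {wt : I → ℕ} {deg : ℕ → Submodule ℚ A}
  {P : UniversalEnvelopingAlgebra ℚ L →ₗ[ℚ] A →ₗ[ℚ] ℚ}

/-- A word pairs only with the degree given by its weight. -/
theorem apply_word_of_weight_ne (hP : h.IsExtension P) (hd : h.IsGraded wt deg) {w : List I}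
    {α : Multiset I} (hne : weight wt α ≠ weight wt w) : P (word b w) (monomial x α) = 0 := by
  induction w generalizing α with
  | nil =>
    obtain ⟨p, hp⟩ : ∃ p, p ∈ α := Multiset.exists_mem_of_ne_zero (by rintro rfl; exact hne rfl)
    obtain ⟨β, rfl⟩ := Multiset.exists_cons_of_mem hp
    rw [word, hP.one_left, monomial_cons, map_mul, h.counit_gen, zero_mul]
  | cons p w ih =>
    rw [word, hP.apply_mul_ι]
    have hmem := hd.T_monomial_mem p α
    generalize h.T (b p) (monomial x α) = a at hmem ⊢
    induction hmem using Submodule.span_induction with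
    | zero => exact map_zero _
    | add u v _ _ hu hv => rw [map_add, hu, hv, add_zero]
    | smul c u _ hu => rw [map_smul, hu, smul_zero]
    | mem u hu =>
      obtain ⟨γ, hγ, rfl⟩ := hu
      refine ih fun h1 => hne ?_
      rw [Set.mem_ofPred_eq] at hγ
      rw [← Multiset.cons_coe, weight_cons, ← hγ, h1, add_comm]

/-- The functionals given by elements of the enveloping algebra vanish in high degrees. -/
theorem exists_forall_apply_eq_zero (hP : h.IsExtension P) (hd : h.IsGraded wt deg)
    (u : UniversalEnvelopingAlgebra ℚ L) : ∃ N : ℕ, ∀ n, N ≤ n → ∀ a ∈ deg n, P u a = 0 := by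
  have hmem : u ∈ Submodule.span ℚ (Set.range (multisetWord b)) :=
    span_multisetWord h.span_basis ▸ Submodule.mem_top
  induction hmem using Submodule.span_induction with
  | zero => exact ⟨0, fun n _ a _ => by rw [map_zero, LinearMap.zero_apply]⟩
  | add u v _ _ hu hv =>
    obtain ⟨M, hM⟩ := hu
    obtain ⟨N, hN⟩ := hv
    refine ⟨max M N, fun n hn a ha => ?_⟩
    rw [map_add, LinearMap.add_apply, hM n (le_of_max_le_left hn) a ha,
      hN n (le_of_max_le_right hn) a ha, add_zero]
  | smul c u _ hu =>
    obtain ⟨N, hN⟩ := hu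
    exact ⟨N, fun n hn a ha => by rw [map_smul, LinearMap.smul_apply, hN n hn a ha, smul_zero]⟩
  | mem u hu =>
    obtain ⟨β, rfl⟩ := hu
    refine ⟨weight wt β + 1, fun n hn a ha => ?_⟩
    refine LinearMap.mem_ker.1 ((hd.le_span n).trans (Submodule.span_le.2 ?_) ha)
    rintro _ ⟨γ, hγ, rfl⟩
    refine hP.apply_word_of_weight_ne hd ?_
    rw [Set.mem_ofPred_eq] at hγ
    rw [Multiset.coe_toList, hγ]
    omega

/-- Every functional that vanishes in high degrees comes from the enveloping algebra: a functional
on finitely many monomials is corrected on those with the largest number of factors first, where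
words act as a dual basis. -/
theorem exists_apply_eq (hP : h.IsExtension P) (hd : h.IsGraded wt deg) {N : ℕ} (M : ℕ)
    (φ : A →ₗ[ℚ] ℚ) (hN : ∀ α, N ≤ weight wt α → φ (monomial x α) = 0)
    (hM : ∀ α : Multiset I, M ≤ α.card → φ (monomial x α) = 0) : ∃ u, P u = φ := by
  classical
  induction M generalizing φ with
  | zero =>
    refine ⟨0, ?_⟩
    rw [map_zero]
    exact LinearMap.ext_on_range h.span_monomial fun α => by
      rw [hM α (Nat.zero_le _), LinearMap.zero_apply]
  | succ M ih =>
    let F := ((finite_weight_lt hd.pos hd.finite N).toFinset).filter fun β => β.card = M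
    let v : UniversalEnvelopingAlgebra ℚ L := ∑ β ∈ F,
      (φ (monomial x β) / P (multisetWord b β) (monomial x β)) • multisetWord b β
    have hv : ∀ a, P v a = ∑ β ∈ F, φ (monomial x β) / P (multisetWord b β) (monomial x β) *
        P (multisetWord b β) a := by
      intro a
      rw [map_sum, LinearMap.sum_apply]
      simp only [map_smul, LinearMap.smul_apply, smul_eq_mul]
    suffices h1 : ∃ u, P u = φ - P v from
      h1.elim fun u hu => ⟨u + v, by rw [map_add, hu, sub_add_cancel]⟩
    refine ih (φ - P v) (fun α hα => ?_) fun α hα => ?_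
    · rw [LinearMap.sub_apply, hN α hα, hv, zero_sub, neg_eq_zero]
      refine Finset.sum_eq_zero fun β hβ => ?_
      have hβ' := (finite_weight_lt hd.pos hd.finite N).mem_toFinset.1 (Finset.mem_filter.1 hβ).1
      rw [Set.mem_ofPred_eq] at hβ'
      rw [multisetWord, hP.apply_word_of_weight_ne hd (α := α), mul_zero]
      rw [Multiset.coe_toList]
      omega
    · have hF : ∀ β ∈ F, β ≠ α → φ (monomial x β) / P (multisetWord b β) (monomial x β) *
          P (multisetWord b β) (monomial x α) = 0 := fun β hβ hne => by
        rw [hP.apply_multisetWord_eq_zero ((Finset.mem_filter.1 hβ).2.trans_le hα) hne, mul_zero]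
      rw [LinearMap.sub_apply, hv, sub_eq_zero]
      by_cases hα' : α ∈ F
      · rw [Finset.sum_eq_single α hF fun h1 => (h1 hα').elim,
          div_mul_cancel₀ _ (hP.apply_multisetWord_self α)]
      · rw [Finset.sum_eq_zero fun β hβ => hF β hβ fun h1 => hα' (h1 ▸ hβ)]
        rcases Nat.lt_or_ge (weight wt α) N with h1 | h1
        · refine hM α (Nat.lt_of_le_of_ne hα fun h2 => hα' ?_)
          exact Finset.mem_filter.2 ⟨(finite_weight_lt hd.pos hd.finite N).mem_toFinset.2 h1, h2.symm⟩
        · exact hN α h1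

/-- The enveloping algebra is identified with the graded dual. -/
theorem isMilnorMooreDuality (hP : h.IsExtension P) (hd : h.IsGraded wt deg) :
    IsMilnorMooreDuality L Δ ε deg P where
  one_left := hP.one_left
  mul_left := hP.mul_left
  one_right := hP.one_right
  mul_right := hP.mul_right
  injective := hP.injective
  range φ := by
    constructor
    · rintro ⟨u, rfl⟩
      exact hP.exists_forall_apply_eq_zero hd u
    · rintro ⟨N, hN⟩
      have h1 : ∀ α, N ≤ weight wt α → φ (monomial x α) = 0 := fun α hα =>
        hN _ hα _ (hd.monomial_mem α)
      refine hP.exists_apply_eq hd (M := N) φ h1 fun α hα => h1 α ?_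
      exact hα.trans (card_le_weight hd.pos α)

end IsExtension

end IsPrimitiveFrame

end GradedDual

end

section

/-! ### Primitive functionals on the algebra of graph sums -/

section Units

variable {A : Type} [CommRing A] [Algebra ℚ A]

/-- A functional that satisfies the Leibniz rule along the counit turns products of power series
with trivial counit into sums. -/
def leibnizHom {ε : A →ₐ[ℚ] ℚ} {φ : A →ₗ[ℚ] ℚ} (hφ : ∀ a c, φ (a * c) = ε a * φ c + φ a * ε c)
    (j : ℕ) : (unitMap (ε : A →+* ℚ)).ker →* Multiplicative ℚ :=
  MonoidHom.mk' (fun u => Multiplicative.ofAdd (φ (PowerSeries.coeff j u.1.val))) fun u v => by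
    have h1 : ∀ (w : (unitMap (ε : A →+* ℚ)).ker) (i : ℕ),
        ε (PowerSeries.coeff i w.1.val) = PowerSeries.coeff i (1 : PowerSeries ℚ) := fun w i => by
      have := congrArg (fun f => PowerSeries.coeff i (Units.val f)) (MonoidHom.mem_ker.1 w.2)
      rw [val_unitMap, PowerSeries.coeff_map, Units.val_one] at this
      exact this
    have h2 : ∀ w : (unitMap (ε : A →+* ℚ)).ker,
        PowerSeries.coeff j ((1 : PowerSeries ℚ) *
          PowerSeries.mk fun i => φ (PowerSeries.coeff i w.1.val)) =
        φ (PowerSeries.coeff j w.1.val) := fun w => by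
      rw [one_mul, PowerSeries.coeff_mk]
    rw [← ofAdd_add]
    refine congrArg Multiplicative.ofAdd ?_
    rw [← h2 u, ← h2 v, mul_comm (1 : PowerSeries ℚ) (PowerSeries.mk fun i =>
      φ (PowerSeries.coeff i u.1.val)), Subgroup.coe_mul, Units.val_mul, PowerSeries.coeff_mul,
      PowerSeries.coeff_mul, PowerSeries.coeff_mul, map_sum, ← Finset.sum_add_distrib]
    refine Finset.sum_congr rfl fun i _ => ?_
    rw [hφ, h1, h1, PowerSeries.coeff_mk, PowerSeries.coeff_mk, add_comm]

/-- The power series with constant coefficient `1` whose coefficients lie in the corresponding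
degrees of a grading form a group. -/
def gradedUnits (G : ℕ → Submodule ℚ A) (hone : 1 ∈ G 0)
    (hmul : ∀ m n a c, a ∈ G m → c ∈ G n → a * c ∈ G (m + n)) : Subgroup (PowerSeries A)ˣ where
  carrier := {u | PowerSeries.coeff 0 u.val = 1 ∧ ∀ k, PowerSeries.coeff k u.val ∈ G k}
  one_mem' := by
    refine ⟨by simp, fun k => ?_⟩
    rw [Units.val_one, PowerSeries.coeff_one]
    split_ifs with h
    · rw [h]; exact hone
    · exact zero_mem _
  mul_mem' {u v} hu hv := by
    refine ⟨?_, fun k => ?_⟩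
    · rw [Units.val_mul, PowerSeries.coeff_mul, Finset.HasAntidiagonal.antidiagonal_zero,
        Finset.sum_singleton, hu.1, hv.1, mul_one]
    · rw [Units.val_mul, PowerSeries.coeff_mul]
      refine sum_mem fun i hi => ?_
      rw [← Finset.HasAntidiagonal.mem_antidiagonal.1 hi]
      exact hmul _ _ _ _ (hu.2 _) (hv.2 _)
  inv_mem' {u} hu := by
    have h0 : ∀ k, PowerSeries.coeff k (u⁻¹).val = PowerSeries.coeff k (1 : PowerSeries A) -
        ∑ i ∈ Finset.range k, PowerSeries.coeff (i + 1) u.val *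
          PowerSeries.coeff (k - (i + 1)) (u⁻¹).val := fun k => by
      rw [← Units.mul_inv u, PowerSeries.coeff_mul, Finset.Nat.sum_antidiagonal_eq_sum_range_succ_mk,
        Finset.sum_range_succ', hu.1, one_mul, Nat.sub_zero, add_sub_cancel_left]
    refine ⟨by rw [h0]; simp, fun k => ?_⟩
    induction k using Nat.strong_induction_on with
    | _ k ih =>
      rw [h0]
      refine sub_mem ?_ (sum_mem fun i hi => ?_)
      · rw [PowerSeries.coeff_one]
        split_ifs with h
        · rw [h]; exact hone
        · exact zero_mem _
      · have hi' := Finset.mem_range.1 hi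
        have := hmul _ _ _ _ (hu.2 (i + 1)) (ih (k - (i + 1)) (by omega))
        rwa [Nat.add_sub_cancel' (by omega : i + 1 ≤ k)] at this

theorem mem_gradedUnits {G : ℕ → Submodule ℚ A} {hone : 1 ∈ G 0}
    {hmul : ∀ m n a c, a ∈ G m → c ∈ G n → a * c ∈ G (m + n)} {u : (PowerSeries A)ˣ} :
    u ∈ gradedUnits G hone hmul ↔
      PowerSeries.coeff 0 u.val = 1 ∧ ∀ k, PowerSeries.coeff k u.val ∈ G k := Iff.rfl

variable {R : Type} [Fintype R] {n : R → ℤ} {x : R → (PowerSeries A)ˣ}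

theorem coeff_mul_seriesCharge_pow_mem {G : ℕ → Submodule ℚ A} (hone : 1 ∈ G 0)
    (hmul : ∀ m n a c, a ∈ G m → c ∈ G n → a * c ∈ G (m + n))
    (hx : ∀ s, PowerSeries.coeff 0 (x s).val = 1 ∧ ∀ k, PowerSeries.coeff k (x s).val ∈ G k)
    (r : R) (l k : ℕ) : PowerSeries.coeff k (x r * seriesCharge n x ^ l).val ∈ G k := by
  have hx' : ∀ s, x s ∈ gradedUnits G hone hmul := hx
  have : x r * seriesCharge n x ^ l ∈ gradedUnits G hone hmul :=
    mul_mem (hx' r) (pow_mem (prod_mem fun s _ => zpow_mem (hx' s) _) _)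
  exact (mem_gradedUnits.1 this).2 k

theorem leibniz_coeff_mul_seriesCharge_pow {ε : A →ₐ[ℚ] ℚ} {φ : A →ₗ[ℚ] ℚ}
    (hφ : ∀ a c, φ (a * c) = ε a * φ c + φ a * ε c) (hx : ∀ s, unitMap (ε : A →+* ℚ) (x s) = 1)
    (r : R) (l j : ℕ) :
    φ (PowerSeries.coeff j (x r * seriesCharge n x ^ l).val) =
      φ (PowerSeries.coeff j (x r).val) +
        l * ∑ s, (n s : ℚ) * φ (PowerSeries.coeff j (x s).val) := by
  let ξ : R → (unitMap (ε : A →+* ℚ)).ker := fun s => ⟨x s, MonoidHom.mem_ker.2 (hx s)⟩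
  have h1 : x r * seriesCharge n x ^ l = (ξ r * (∏ s, ξ s ^ n s) ^ l).1 := by
    simp [seriesCharge, ξ]
  have h2 : ∀ u : (unitMap (ε : A →+* ℚ)).ker,
      φ (PowerSeries.coeff j u.1.val) = Multiplicative.toAdd (leibnizHom hφ j u) := fun _ => rfl
  rw [h1, h2, map_mul, map_pow, map_prod, toAdd_mul, toAdd_pow, toAdd_prod, nsmul_eq_mul]
  simp only [map_zpow, toAdd_zpow, zsmul_eq_mul]
  rfl

/-- The operator `(id ⊗ φ) ∘ Δ` on the coefficients of the universal family. -/
theorem rightSlice_coeff {Δ : A →ₐ[ℚ] A ⊗[ℚ] A} (hΔ : IsSeriesComul n x Δ) (φ : A →ₗ[ℚ] ℚ) (r : R)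
    (m : ℕ) : rightSlice Δ φ (PowerSeries.coeff m (x r).val) =
      ∑ i ∈ Finset.range (m + 1), φ (PowerSeries.coeff i (x r).val) •
        PowerSeries.coeff (m - i) (x r * seriesCharge n x ^ i).val := by
  have h1 := congrArg (fun f => PowerSeries.coeff m (Units.val f)) (hΔ r)
  simp only [val_unitMap, PowerSeries.coeff_map, coeff_seriesMul] at h1
  rw [rightSlice, LinearMap.comp_apply, LinearMap.comp_apply]
  change (TensorProduct.rid ℚ A) (TensorProduct.map LinearMap.id φ
    ((Δ : A →+* A ⊗[ℚ] A) (PowerSeries.coeff m (x r).val))) = _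
  rw [h1, map_sum, map_sum]
  refine Finset.sum_congr rfl fun i _ => ?_
  rw [← map_seriesCharge, ← map_pow, ← map_mul, val_unitMap, PowerSeries.coeff_map]
  change (TensorProduct.rid ℚ A) (TensorProduct.map LinearMap.id φ
    ((_ ⊗ₜ[ℚ] (1 : A)) * ((1 : A) ⊗ₜ[ℚ] _))) = _
  rw [Algebra.TensorProduct.tmul_mul_tmul, mul_one, one_mul, TensorProduct.map_tmul,
    TensorProduct.rid_tmul, LinearMap.id_apply]

end Units

end

section

variable {T : Theory}

/-! ### The grading by loop number -/

theorem one_mem_gradDegree : (1 : gradAlgebra T) ∈ gradDegree T 0 :=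
  MvPolynomial.isWeightedHomogeneous_one ℚ _

theorem mul_mem_gradDegree (m n : ℕ) (a c : gradAlgebra T) (ha : a ∈ gradDegree T m)
    (hc : c ∈ gradDegree T n) : a * c ∈ gradDegree T (m + n) :=
  MvPolynomial.IsWeightedHomogeneous.mul ha hc

theorem gradGen_mem_gradDegree (p : GradIndex T) : gradGen T p ∈ gradDegree T p.2 := by
  change graphSum T p.1 p.2 ∈ MvPolynomial.weightedHomogeneousSubmodule ℚ
    (fun q : GraphClass T => q.rep.graph.loops) p.2
  rw [graphSum_eq]
  refine sum_mem fun q hq => Submodule.smul_mem _ _ ?_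
  have h1 := MvPolynomial.isWeightedHomogeneous_X ℚ (fun q : GraphClass T => q.rep.graph.loops) q
  rw [(mem_loopClasses.1 hq).2] at h1
  exact h1

/-- The loop number of a generator. -/
def loopWeight (p : GradIndex T) : ℕ := p.2

theorem monomial_mem_gradDegree (α : Multiset (GradIndex T)) :
    monomial (gradGen T) α ∈ gradDegree T (weight loopWeight α) := by
  induction α using Multiset.induction_on with
  | empty => rw [monomial_zero]; exact one_mem_gradDegree
  | cons p α ih =>
    rw [monomial_cons, weight_cons]
    exact mul_mem_gradDegree _ _ _ _ (gradGen_mem_gradDegree p) ih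

theorem span_monomial_gradGen :
    Submodule.span ℚ (Set.range (monomial (gradGen T))) = ⊤ := by
  refine Submodule.eq_top_iff'.2 fun a => ?_
  obtain ⟨f, rfl⟩ := gradEval_surjective a
  induction f using MvPolynomial.induction_on with
  | C c =>
    rw [← MvPolynomial.algebraMap_eq, AlgHom.commutes, Algebra.algebraMap_eq_smul_one]
    exact Submodule.smul_mem _ _ (Submodule.subset_span ⟨0, monomial_zero _⟩)
  | add f g hf hg => rw [map_add]; exact add_mem hf hg
  | mul_X f p hf =>
    rw [map_mul, gradEval_X, mul_comm]
    generalize gradEval T f = a at hf ⊢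
    induction hf using Submodule.span_induction with
    | zero => rw [mul_zero]; exact zero_mem _
    | add u v _ _ hu hv => rw [mul_add]; exact add_mem hu hv
    | smul c u _ hu => rw [mul_smul_comm]; exact Submodule.smul_mem _ _ hu
    | mem u hu =>
      obtain ⟨α, rfl⟩ := hu
      rw [← monomial_cons]
      exact Submodule.subset_span ⟨_, rfl⟩

/-- A homogeneous polynomial in the graph sums is a combination of monomials of the same degree. -/
theorem gradDegree_le_span (n : ℕ) : gradDegree T n ≤
    Submodule.span ℚ (monomial (gradGen T) '' {α | weight loopWeight α = n}) := by
  classical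
  let π := MvPolynomial.weightedHomogeneousComponent (R := ℚ)
    (fun q : GraphClass T => q.rep.graph.loops) n
  have key : ∀ a : gradAlgebra T, ∃ a' ∈ Submodule.span ℚ
      (monomial (gradGen T) '' {α | weight loopWeight α = n}), a'.1 = π a.1 := by
    intro a
    have ha : a ∈ Submodule.span ℚ (Set.range (monomial (gradGen T))) :=
      span_monomial_gradGen ▸ Submodule.mem_top
    induction ha using Submodule.span_induction with
    | zero => exact ⟨0, zero_mem _, (map_zero π).symm⟩
    | add u v _ _ hu hv =>
      obtain ⟨u', hu', hu⟩ := hu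
      obtain ⟨v', hv', hv⟩ := hv
      exact ⟨u' + v', add_mem hu' hv', by
        rw [Subalgebra.coe_add, Subalgebra.coe_add, map_add, hu, hv]⟩
    | smul c u _ hu =>
      obtain ⟨u', hu', hu⟩ := hu
      exact ⟨c • u', Submodule.smul_mem _ _ hu', by
        rw [Subalgebra.coe_smul, Subalgebra.coe_smul, map_smul, hu]⟩
    | mem u hu =>
      obtain ⟨α, rfl⟩ := hu
      have h1 := MvPolynomial.weightedHomogeneousComponent_of_mem (m := n)
        (monomial_mem_gradDegree α)
      by_cases h2 : weight loopWeight α = n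
      · refine ⟨_, Submodule.subset_span ⟨α, h2, rfl⟩, ?_⟩
        rw [if_pos h2.symm] at h1
        exact h1.symm
      · refine ⟨0, zero_mem _, ?_⟩
        rw [if_neg (Ne.symm h2)] at h1
        exact h1.symm
  intro a ha
  obtain ⟨a', ha', h1⟩ := key a
  have h2 : π a.1 = a.1 := MvPolynomial.weightedHomogeneousComponent_eq_self ha
  rw [h2] at h1
  rwa [← Subtype.ext h1]

/-! ### The functionals dual to the graph sums -/

/-- The functional given by the coefficient of one graph sum in a polynomial in the graph sums. -/
def gradFunctional (hc : HasGraphs T) (p : GradIndex T) : gradAlgebra T →ₗ[ℚ] ℚ :=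
  (gradCounit T).toLinearMap ∘ₗ (gradEquiv hc).toLinearMap ∘ₗ
    (MvPolynomial.pderiv p).toLinearMap ∘ₗ (gradEquiv hc).symm.toLinearMap

theorem gradFunctional_apply (hc : HasGraphs T) (p : GradIndex T) (a : gradAlgebra T) :
    gradFunctional hc p a =
      gradCounit T (gradEquiv hc (MvPolynomial.pderiv p ((gradEquiv hc).symm a))) := rfl

theorem gradFunctional_mul (hc : HasGraphs T) (p : GradIndex T) (a c : gradAlgebra T) :
    gradFunctional hc p (a * c) =
      gradCounit T a * gradFunctional hc p c + gradFunctional hc p a * gradCounit T c := by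
  simp only [gradFunctional_apply, map_mul, Derivation.leibniz, smul_eq_mul, map_add,
    AlgEquiv.apply_symm_apply]
  ring

open Classical in
theorem gradFunctional_gradGen (hc : HasGraphs T) (p q : GradIndex T) :
    gradFunctional hc p (gradGen T q) = if p = q then 1 else 0 := by
  rw [gradFunctional_apply, gradEquiv_symm_gradGen]
  split_ifs with h
  · rw [h, MvPolynomial.pderiv_X_self, map_one, map_one]
  · rw [MvPolynomial.pderiv_X_of_ne (Ne.symm h), map_zero, map_zero]

open Classical in
theorem gradFunctional_coeff (hc : HasGraphs T) (s r : T.amplitudes) (k : ℕ+) (i : ℕ) :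
    gradFunctional hc (s, k) (PowerSeries.coeff i (gradDressing r).val) =
      if s = r ∧ (k : ℕ) = i then (sign r : ℚ) else 0 := by
  rcases Nat.eq_zero_or_pos i with rfl | hi
  · rw [coeff_gradDressing, if_pos rfl, if_neg fun h => k.ne_zero h.2, gradFunctional_apply, map_one,
      MvPolynomial.pderiv_one, map_zero, map_zero]
  · obtain ⟨i, rfl⟩ : ∃ j : ℕ+, (j : ℕ) = i := ⟨⟨i, hi⟩, rfl⟩
    rw [coeff_gradDressing_pos, ← zsmul_eq_mul, map_zsmul, gradFunctional_gradGen, zsmul_eq_mul]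
    simp only [Prod.mk.injEq, PNat.coe_inj, mul_ite, mul_one, mul_zero]

theorem gradGen_eq (r : T.amplitudes) (m : ℕ+) : gradGen T (r, m) =
    (sign r : ℚ) • PowerSeries.coeff m (gradDressing r).val := by
  rw [coeff_gradDressing_pos, Int.cast_smul_eq_zsmul, zsmul_eq_mul, ← mul_assoc, ← Int.cast_mul,
    sign_mul_self, Int.cast_one, one_mul]

theorem sign_mul_self_rat (s : T.amplitudes) : (sign s : ℚ) * sign s = 1 := by
  exact_mod_cast sign_mul_self s

open Classical in
theorem rightSlice_gradGen (hc : HasGraphs T) {n : T.amplitudes → ℤ}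
    {Δ : gradAlgebra T →ₐ[ℚ] gradAlgebra T ⊗[ℚ] gradAlgebra T}
    (hΔ : IsSeriesComul n gradDressing Δ) (t r : T.amplitudes) (l m : ℕ+) :
    rightSlice Δ (gradFunctional hc (t, l)) (gradGen T (r, m)) =
      if t = r ∧ l ≤ m then
        PowerSeries.coeff ((m : ℕ) - l) (gradDressing r * seriesCharge n gradDressing ^ (l : ℕ)).val
      else 0 := by
  rw [gradGen_eq, map_smul, rightSlice_coeff hΔ]
  simp only [gradFunctional_coeff]
  split_ifs with h
  · have hlm : (l : ℕ) ≤ m := h.2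
    rw [Finset.sum_eq_single (l : ℕ), if_pos ⟨h.1, rfl⟩, smul_smul, sign_mul_self_rat, one_smul]
    · intro i _ hi
      rw [if_neg fun h1 => hi h1.2.symm, zero_smul]
    · intro h1
      exact (h1 (Finset.mem_range.2 (Nat.lt_succ_of_le hlm))).elim
  · rw [Finset.sum_eq_zero, smul_zero]
    intro i hi
    rw [if_neg, zero_smul]
    rintro ⟨h1, h2⟩
    refine h ⟨h1, ?_⟩
    have : (l : ℕ) ≤ m := by
      rw [h2]
      exact Nat.lt_succ_iff.1 (Finset.mem_range.1 hi)
    exact this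

open Classical in
/-- The convolution product of two of the functionals, on the graph sums. -/
theorem gradFunctional_rightSlice (hc : HasGraphs T) {Q : T.amplitudes → ℤ}
    {Δ : gradAlgebra T →ₐ[ℚ] gradAlgebra T ⊗[ℚ] gradAlgebra T}
    (hΔ : IsSeriesComul (chargeExponent Q) gradDressing Δ) (s t r : T.amplitudes) (k l m : ℕ+) :
    gradFunctional hc (s, k) (rightSlice Δ (gradFunctional hc (t, l)) (gradGen T (r, m))) =
      if t = r ∧ k + l = m then (if s = r then (sign s : ℚ) else 0) + (l : ℕ) * Q s else 0 := by
  rw [rightSlice_gradGen hc hΔ]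
  by_cases h : t = r ∧ l ≤ m
  · rw [if_pos h, leibniz_coeff_mul_seriesCharge_pow (gradFunctional_mul hc (s, k))
      unitMap_gradCounit]
    simp only [gradFunctional_coeff]
    have hlm : (l : ℕ) ≤ m := h.2
    have h1 : ((k : ℕ) = m - l) ↔ k + l = m := by
      rw [← PNat.coe_inj, PNat.add_coe]
      omega
    simp only [h1]
    by_cases hm : k + l = m
    · have h2 : t = r ∧ k + l = m := ⟨h.1, hm⟩
      rw [if_pos h2, Finset.sum_eq_single s]
      · have h3 : s = s ∧ k + l = m := ⟨rfl, hm⟩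
        rw [if_pos h3, chargeExponent, Int.cast_mul, mul_right_comm, sign_mul_self_rat,
          one_mul]
        by_cases hs : s = r
        · have h3 : s = r ∧ k + l = m := ⟨hs, hm⟩
          rw [if_pos h3, if_pos hs, hs]
        · have h3 : ¬(s = r ∧ k + l = m) := fun h4 => hs h4.1
          rw [if_neg h3, if_neg hs]
      · intro s' _ hs'
        rw [if_neg fun h2 => hs' h2.1.symm, mul_zero]
      · exact fun h2 => (h2 (Finset.mem_univ _)).elim
    · rw [if_neg fun h2 => hm h2.2, if_neg fun h2 => hm h2.2, zero_add]
      rw [Finset.sum_eq_zero fun s' _ => by rw [if_neg fun h2 => hm h2.2, mul_zero], mul_zero]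
  · rw [if_neg h, map_zero, if_neg]
    rintro ⟨h1, h2⟩
    refine h ⟨h1, ?_⟩
    rw [← h2]
    exact (PNat.lt_add_left l k).le

/-! ### The Lie algebra of the dual -/

theorem bracket_z (Q : T.amplitudes → ℤ) (s t : T.amplitudes) (k l : ℕ+) :
    bracket Q (z s k) (z t l) =
      -((Q t : ℚ) * (k : ℕ)) • z s (k + l) + ((Q s : ℚ) * (l : ℕ)) • z t (k + l) := by
  rw [bracket, z, Finsupp.linearCombination_single, one_smul, z, Finsupp.linearCombination_single,
    one_smul]

theorem bracket_neg (Q : T.amplitudes → ℤ) (x y : GradLie T) :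
    bracket Q x y = -bracket Q y x := by
  induction x using Finsupp.induction_linear with
  | zero => simp
  | add u v hu hv => rw [map_add, map_add, LinearMap.add_apply, hu, hv, neg_add]
  | single p c =>
    induction y using Finsupp.induction_linear with
    | zero => simp
    | add u v hu hv => rw [map_add, map_add, LinearMap.add_apply, hu, hv, neg_add]
    | single q d =>
      have h1 : ∀ (p : GradIndex T) (c : ℚ), Finsupp.single p c = c • z p.1 p.2 := fun p c => by
        rw [z, Finsupp.smul_single, smul_eq_mul, mul_one]
      rw [h1, h1]
      simp only [map_smul, LinearMap.smul_apply, bracket_z, add_comm q.2 p.2]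
      module

theorem bracket_jacobi_z (Q : T.amplitudes → ℤ) (r s t : T.amplitudes) (k l m : ℕ+) :
    bracket Q (z r k) (bracket Q (z s l) (z t m)) + bracket Q (z s l) (bracket Q (z t m) (z r k)) +
      bracket Q (z t m) (bracket Q (z r k) (z s l)) = 0 := by
  have h1 : l + (m + k) = k + (l + m) := by rw [add_comm m, add_left_comm]
  have h2 : m + (k + l) = k + (l + m) := by rw [add_left_comm, add_comm m]
  simp only [bracket_z, map_add, map_smul, h1, h2, PNat.add_coe, Nat.cast_add]
  module

theorem isLieBracket_bracket (Q : T.amplitudes → ℤ) : IsLieBracket (bracket Q) where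
  self x := self_eq_neg.1 (bracket_neg Q x x)
  jacobi x y w := by
    have h1 : ∀ (p : GradIndex T) (c : ℚ), Finsupp.single p c = c • z p.1 p.2 := fun p c => by
      rw [z, Finsupp.smul_single, smul_eq_mul, mul_one]
    induction x using Finsupp.induction_linear with
    | zero => simp
    | add u v hu hv =>
      simp only [map_add, LinearMap.add_apply]
      rw [← add_zero (0 : GradLie T)]
      nth_rw 1 [← hu]
      rw [← hv]
      abel
    | single p c =>
      induction y using Finsupp.induction_linear with
      | zero => simp
      | add u v hu hv =>
        simp only [map_add, LinearMap.add_apply]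
        rw [← add_zero (0 : GradLie T)]
        nth_rw 1 [← hu]
        rw [← hv]
        abel
      | single q d =>
        induction w using Finsupp.induction_linear with
        | zero => simp
        | add u v hu hv =>
          simp only [map_add, LinearMap.add_apply]
          rw [← add_zero (0 : GradLie T)]
          nth_rw 1 [← hu]
          rw [← hv]
          abel
        | single o e =>
          have h2 := congrArg (fun v => (c * d * e) • v)
            (bracket_jacobi_z Q p.1 q.1 o.1 p.2 q.2 o.2)
          simp only [smul_zero, smul_add] at h2
          rw [h1, h1, h1, ← h2]
          simp only [map_smul, LinearMap.smul_apply, smul_smul]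
          congr 1
          · congr 2 <;> ring
          · congr 1; ring

end

section

variable {T : Theory}

/-! ### The duality -/

/-- The functional given by an element of the Lie algebra, where the basis vectors are dual to the
graph sums. -/
def gradPairing (hc : HasGraphs T) : GradLie T →ₗ[ℚ] gradAlgebra T →ₗ[ℚ] ℚ :=
  Finsupp.linearCombination ℚ (gradFunctional hc)

theorem gradPairing_single (hc : HasGraphs T) (p : GradIndex T) :
    gradPairing hc (Finsupp.single p 1) = gradFunctional hc p := by
  rw [gradPairing, Finsupp.linearCombination_single, one_smul]

theorem gradPairing_bracket (hc : HasGraphs T) {Q : T.amplitudes → ℤ}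
    {Δ : gradAlgebra T →ₐ[ℚ] gradAlgebra T ⊗[ℚ] gradAlgebra T}
    (hΔ : IsSeriesComul (chargeExponent Q) gradDressing Δ) (p q r : GradIndex T) :
    gradPairing hc (bracket Q (Finsupp.single p 1) (Finsupp.single q 1)) (gradGen T r) =
      gradFunctional hc p (rightSlice Δ (gradFunctional hc q) (gradGen T r)) -
        gradFunctional hc q (rightSlice Δ (gradFunctional hc p) (gradGen T r)) := by
  obtain ⟨s, k⟩ := p
  obtain ⟨t, l⟩ := q
  obtain ⟨r, m⟩ := r
  classical
  have h1 := bracket_z Q s t k l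
  rw [z, z] at h1
  rw [h1, gradFunctional_rightSlice hc hΔ, gradFunctional_rightSlice hc hΔ, z, z, map_add, map_smul,
    map_smul, gradPairing_single, gradPairing_single]
  simp only [LinearMap.add_apply, LinearMap.smul_apply, gradFunctional_gradGen, smul_eq_mul,
    Prod.mk.injEq, add_comm l k]
  by_cases hm : k + l = m
  · simp only [hm, and_true]
    by_cases hs : s = r
    · by_cases ht : t = r
      · subst hs
        subst ht
        simp only [if_true]
        ring
      · simp only [hs, ht, if_true, if_false]
        ring
    · by_cases ht : t = r
      · simp only [hs, ht, if_true, if_false]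
        ring
      · simp only [hs, ht, if_false]
        ring
  · simp only [hm, and_false, if_false]
    ring

/-- The generators of the Lie algebra act on the algebra of graph sums by the dual functionals. -/
theorem isPrimitiveFrame_gradPairing (hc : HasGraphs T) {Q : T.amplitudes → ℤ}
    {Δ : gradAlgebra T →ₐ[ℚ] gradAlgebra T ⊗[ℚ] gradAlgebra T}
    (hΔ : IsSeriesComul (chargeExponent Q) gradDressing Δ) (hL : IsLieBracket (bracket Q)) :
    letI := hL.lieRing
    letI := hL.lieAlgebra
    IsPrimitiveFrame Δ (gradCounit T) (gradGen T) (fun p => (Finsupp.single p 1 : GradLie T))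
      (gradPairing hc) := by
  classical
  let _ := hL.lieRing
  let _ := hL.lieAlgebra
  exact
    { hopf := (isUniversalFamily_gradDressing hc).isHopf hΔ unitMap_gradCounit
      counit_gen := gradCounit_gradGen
      span_monomial := span_monomial_gradGen
      span_basis := by
        have := (Finsupp.basisSingleOne (R := ℚ) (ι := GradIndex T)).span_eq
        rwa [Finsupp.coe_basisSingleOne] at this
      leibniz := fun ℓ a c => by
        induction ℓ using Finsupp.induction_linear with
        | zero => simp
        | add u v hu hv => simp only [map_add, LinearMap.add_apply, hu, hv]; ring
        | single p d =>
          rw [gradPairing, Finsupp.linearCombination_single]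
          simp only [LinearMap.smul_apply, gradFunctional_mul, smul_eq_mul]
          ring
      dual_self := fun p => by rw [gradPairing_single, gradFunctional_gradGen, if_pos rfl]
      dual_ne := fun p q hpq => by rw [gradPairing_single, gradFunctional_gradGen, if_neg hpq]
      lie := fun p q r => by
        rw [gradPairing_single, gradPairing_single]
        exact gradPairing_bracket hc hΔ p q r }

theorem coeff_gradDressing_mem (s : T.amplitudes) (k : ℕ) :
    PowerSeries.coeff k (gradDressing s).val ∈ gradDegree T k := by
  rcases Nat.eq_zero_or_pos k with rfl | hk
  · rw [coeff_gradDressing, if_pos rfl]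
    exact one_mem_gradDegree
  · obtain ⟨k, rfl⟩ : ∃ j : ℕ+, (j : ℕ) = k := ⟨⟨k, hk⟩, rfl⟩
    rw [coeff_gradDressing_pos, ← zsmul_eq_mul]
    exact zsmul_mem (gradGen_mem_gradDegree (s, k)) _

theorem rightSlice_gradFunctional_mem_span (hc : HasGraphs T) {n : T.amplitudes → ℤ}
    {Δ : gradAlgebra T →ₐ[ℚ] gradAlgebra T ⊗[ℚ] gradAlgebra T}
    (hΔ : IsSeriesComul n gradDressing Δ) (p q : GradIndex T) :
    rightSlice Δ (gradFunctional hc p) (gradGen T q) ∈ Submodule.span ℚ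
      (monomial (gradGen T) '' {α | weight loopWeight α + loopWeight p = loopWeight q}) := by
  classical
  obtain ⟨t, l⟩ := p
  obtain ⟨r, m⟩ := q
  rw [rightSlice_gradGen hc hΔ]
  split_ifs with h
  · have hlm : (l : ℕ) ≤ m := h.2
    have h1 := coeff_mul_seriesCharge_pow_mem (n := n) (x := gradDressing (T := T))
      (G := gradDegree T) one_mem_gradDegree mul_mem_gradDegree
      (fun s => ⟨by rw [coeff_gradDressing, if_pos rfl], coeff_gradDressing_mem s⟩) r l ((m : ℕ) - l)
    have h2 : {α : Multiset (GradIndex T) | weight loopWeight α = (m : ℕ) - l} ⊆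
        {α | weight loopWeight α + loopWeight (t, l) = loopWeight (r, m)} := fun α hα => by
      rw [Set.mem_ofPred_eq] at hα ⊢
      rw [hα]
      exact Nat.sub_add_cancel hlm
    exact Submodule.span_mono (Set.image_mono h2) (gradDegree_le_span _ h1)
  · exact zero_mem _

theorem isGraded_gradPairing (hc : HasGraphs T) {Q : T.amplitudes → ℤ}
    {Δ : gradAlgebra T →ₐ[ℚ] gradAlgebra T ⊗[ℚ] gradAlgebra T}
    (hΔ : IsSeriesComul (chargeExponent Q) gradDressing Δ) (hL : IsLieBracket (bracket Q)) :
    letI := hL.lieRing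
    letI := hL.lieAlgebra
    (isPrimitiveFrame_gradPairing hc hΔ hL).IsGraded loopWeight (gradDegree T) := by
  classical
  let _ := hL.lieRing
  let _ := hL.lieAlgebra
  exact
    { pos := fun p => p.2.pos
      finite := fun N => by
        have h1 : {k : ℕ+ | (k : ℕ) < N}.Finite :=
          Set.Finite.preimage PNat.coe_injective.injOn (Set.finite_lt_nat N)
        exact (Set.finite_univ.prod h1).subset fun p hp => ⟨Set.mem_univ _, hp⟩
      monomial_mem := monomial_mem_gradDegree
      le_span := gradDegree_le_span
      T_mem := fun p q => by
        rw [IsPrimitiveFrame.T, gradPairing_single]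
        exact rightSlice_gradFunctional_mem_span hc hΔ p q }

end

end QFT

end

theorem theorem1 (T : Theory) (Q : T.amplitudes → ℤ) (hQ : HasInvariantCharge T Q)
    (hc : ∀ (r : T.amplitudes) (k : ℕ+), ∃ Γ : FeynmanGraph T,
      Γ.graph.residue = r ∧ Γ.graph.loops = k) :
    -- the bracket makes the span of the `z_k^s` a Lie algebra
    (∀ (s t : T.amplitudes) (k l : ℕ+), bracket Q (z s k) (z t l) =
      -((Q t : ℚ) * (k : ℕ)) • z s (k + l) + ((Q s : ℚ) * (l : ℕ)) • z t (k + l)) ∧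
    ∃ hL : IsLieBracket (bracket Q),
    -- the coproduct of graphs restricts to the algebra generated by the `c_k^r`
    ∃ Δ : gradAlgebra T →ₐ[ℚ] gradAlgebra T ⊗[ℚ] gradAlgebra T,
      (∀ a, Algebra.TensorProduct.map (gradAlgebra T).val (gradAlgebra T).val (Δ a) =
        comul T a) ∧
      IsHopf Δ (gradCounit T) ∧
      letI := hL.lieRing
      letI := hL.lieAlgebra
      ∃ P : UniversalEnvelopingAlgebra ℚ (GradLie T) →ₗ[ℚ] gradAlgebra T →ₗ[ℚ] ℚ,
        IsMilnorMooreDuality (GradLie T) Δ (gradCounit T) (gradDegree T) P ∧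
        -- the `z_k^s` are dual to the `c_k^s`
        (∀ (s t : T.amplitudes) (k j : ℕ+),
          ((s, k) = (t, j) →
            P (UniversalEnvelopingAlgebra.ι ℚ (z s k)) (gradGen T (t, j)) = 1) ∧
          ((s, k) ≠ (t, j) →
            P (UniversalEnvelopingAlgebra.ι ℚ (z s k)) (gradGen T (t, j)) = 0)) ∧
        -- the bracket matches the antisymmetrised pairing with the coproduct
        ∀ (s t r : T.amplitudes) (k l j : ℕ+),
          P (UniversalEnvelopingAlgebra.ι ℚ (bracket Q (z s k) (z t l))) (gradGen T (r, j)) =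
            pairTensor (P (UniversalEnvelopingAlgebra.ι ℚ (z s k)))
                (P (UniversalEnvelopingAlgebra.ι ℚ (z t l))) (Δ (gradGen T (r, j))) -
              pairTensor (P (UniversalEnvelopingAlgebra.ι ℚ (z t l)))
                (P (UniversalEnvelopingAlgebra.ι ℚ (z s k))) (Δ (gradGen T (r, j))) := by
  refine ⟨bracket_z Q, isLieBracket_bracket Q, ?_⟩
  obtain ⟨Δ, hΔ, hcomul⟩ := exists_gradComul hQ hc
  have hx := isUniversalFamily_gradDressing hc
  refine ⟨Δ, hcomul, hx.isHopf hΔ unitMap_gradCounit, ?_⟩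
  let _ := (isLieBracket_bracket Q).lieRing
  let _ := (isLieBracket_bracket Q).lieAlgebra
  have h := isPrimitiveFrame_gradPairing hc hΔ (isLieBracket_bracket Q)
  obtain ⟨P, hP⟩ := h.exists_extension
  refine ⟨P, hP.isMilnorMooreDuality (isGraded_gradPairing hc hΔ (isLieBracket_bracket Q)),
    fun s t k j => ⟨fun hst => ?_, fun hst => ?_⟩, fun s t r k l j => ?_⟩
  · rw [← hst, hP.apply_ι]
    exact h.dual_self (s, k)
  · rw [hP.apply_ι]
    exact h.dual_ne (s, k) (t, j) hst
  · rw [hP.apply_ι, hP.apply_ι, hP.apply_ι]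
    exact h.lie_apply (z s k) (z t l) _
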